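/- **Conventions.** Let $M$ be a closed connected smooth 3-manifold. A *handlebody of genus $g$* is a closed 3-ball with $g$ one-handles attached, i.e. the space obtained from a closed 3-ball by gluing $g$ pairs of pairwise disjoint closed discs in its boundary sphere. A *Heegaard splitting* of $M$ of genus $g$ is a decomposition $M=V\cup W$ into two handlebodies of genus $g$ which meet exactly in their common boundary, a smoothly embedded closed surface. The (ordinary) *Heegaard genus* of $M$ is the smallest genus of a Heegaard splitting of $M$. Let $g>1$, and let $G$ be a finite group of diffeomorphisms of $M$. * The $G$-action is *of type $12(g-1)$ and genus $g$* if $M$ is orientable, $G$ is orientation-preserving, $M$ has a Heegaard splitting of genus $g$ both of whose handlebodies are mapped to themselves by every element of $G$, and $|G|=12(g-1)$. * The $G$-action is *of interchanging type $24(g-1)$ and genus $g$* if $M$ is orientable and has a Heegaard splitting of genus $g$ such that every element of $G$ either preserves both handlebodies or interchanges them, some element interchanges them, the subgroup $G_0$ of the elements preserving both handlebodies is orientation-preserving, and $|G|=24(g-1)$. * The $G$-action is *of type $48(g-1)$ and genus $g$* if $M$ has a Heegaard splitting of genus $g$ such that every element of $G$ either preserves both handlebodies or interchanges them, some element interchanges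 them, either $M$ is orientable and $G_0$ contains an orientation-reversing element or $M$ is non-orientable, and $|G|=48(g-1)$. (In each case the given order is the maximal possible one for such a situation.) $M$ is said to be of one of these types if it has an action of that type. The *Euclidean Hantzsche–Wendt manifold* is the flat manifold $\mathbb R^3/\Gamma$, where $\Gamma$ is the group generated by the screw motions $(x,y,z)\mapsto(x+1,\,1-y,\,-z)$ and $(x,y,z)\mapsto(-x,\,y+1,\,1-z)$, with the metric induced by the Euclidean metric of $\mathbb R^3$. **Corollary 2.6.** (i) The 3-torus $\mathbb R^3/\mathbb Z^3$ is a 3-manifold of type $48(g-1)$ and genus $g=3$, and $3$ is also its ordinary Heegaard genus. (ii) The action of the orientation-preserving isometry group of the Euclidean Hantzsche–Wendt manifold is of interchanging type $24(g-1)$ and genus $g=3$, and this group is isomorphic to $S_4\times\mathbb Z_2$. Moreover, the Hantzsche–Wendt manifold is also of type $12(g-1)$ and genus $g=2$, for an action of the dihedral group $\mathbb D_6$ of order $12$. -/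

import Mathlib

open scoped Manifold ContDiff Topology

namespace Heegaard

noncomputable section

/-- Euclidean 3-space. -/
abbrev E3 : Type := EuclideanSpace ℝ (Fin 3)

/-- The Euclidean plane. -/
abbrev E2 : Type := EuclideanSpace ℝ (Fin 2)

/-! ### Diffeomorphisms and orientations of a smooth 3-manifold -/

/-- Self-diffeomorphisms (smooth with smooth inverse) of a 3-manifold. -/
abbrev Diffeo (M : Type*) [TopologicalSpace M] [ChartedSpace E3 M] : Type _ :=
  M ≃ₘ⟮𝓡 3, 𝓡 3⟯ M

/-- Diffeomorphisms form a group under composition, `(f * h) x = f (h x)`. -/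
instance diffeoGroup (M : Type*) [TopologicalSpace M] [ChartedSpace E3 M] :
    Group (Diffeo M) where
  mul f h := h.trans f
  one := Diffeomorph.refl (𝓡 3) M ∞
  inv f := f.symm
  mul_assoc _ _ _ := rfl
  one_mul _ := rfl
  mul_one _ := rfl
  inv_mul_cancel f := Diffeomorph.self_trans_symm f

/-- An orientation of a smooth 3-manifold `M`. The tangent space at `p` is identified with `ℝ³`
through the preferred chart at `p`; the orientation of that tangent space is recorded by the sign
`o p` relative to the standard orientation of `ℝ³`. These signs have to be locally coherent
under the coordinate changes (from the chart at `q` to the chart at `p`, at the point `q`). -/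
def IsOrientation {M : Type*} [TopologicalSpace M] [ChartedSpace E3 M] [IsManifold (𝓡 3) ∞ M]
    (o : M → ℤˣ) : Prop :=
  haveI : IsManifold (𝓡 3) 1 M := IsManifold.of_le (n := ∞) (by decide)
  ∀ p : M, ∀ᶠ q in 𝓝 p,
    0 < ((o p : ℤ) : ℝ) * ((o q : ℤ) : ℝ) * (tangentCoordChange (𝓡 3) q p q).det

/-- `M` is orientable. -/
def Orientable (M : Type*) [TopologicalSpace M] [ChartedSpace E3 M] [IsManifold (𝓡 3) ∞ M] :
    Prop :=
  ∃ o : M → ℤˣ, IsOrientation o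

/-- The determinant of the differential of `f` at `p`, taken in the preferred charts at `p` and
at `f p`. -/
def jacobian {M : Type*} [TopologicalSpace M] [ChartedSpace E3 M] (f : M → M) (p : M) : ℝ :=
  (show E3 →L[ℝ] E3 from mfderiv (𝓡 3) (𝓡 3) f p).det

/-- `f` preserves the orientations of `M` (used for connected orientable `M`, where it does not
matter which of the two orientations is taken). -/
def PreservesOrientation {M : Type*} [TopologicalSpace M] [ChartedSpace E3 M]
    [IsManifold (𝓡 3) ∞ M] (f : M → M) : Prop :=
  ∀ o : M → ℤˣ, IsOrientation o →
    ∀ p : M, 0 < ((o p : ℤ) : ℝ) * ((o (f p) : ℤ) : ℝ) * jacobian f p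

/-- `f` reverses the orientations of `M` (used for connected orientable `M`). -/
def ReversesOrientation {M : Type*} [TopologicalSpace M] [ChartedSpace E3 M]
    [IsManifold (𝓡 3) ∞ M] (f : M → M) : Prop :=
  ∀ o : M → ℤˣ, IsOrientation o →
    ∀ p : M, ((o p : ℤ) : ℝ) * ((o (f p) : ℤ) : ℝ) * jacobian f p < 0

lemma jacobian_id {M : Type*} [TopologicalSpace M] [ChartedSpace E3 M] (p : M) :
    jacobian (id : M → M) p = 1 := by
  unfold jacobian
  rw [mfderiv_id]
  exact LinearMap.det_id

lemma jacobian_comp {M : Type*} [TopologicalSpace M] [ChartedSpace E3 M]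
    (f h : Diffeo M) (p : M) :
    jacobian (f ∘ h) p = jacobian f (h p) * jacobian h p := by
  unfold jacobian
  rw [mfderiv_comp p (f.mdifferentiable (by simp) _) (h.mdifferentiable (by simp) _)]
  exact LinearMap.det_comp _ _

lemma unit_sq (u : ℤˣ) : ((u : ℤ) : ℝ) * ((u : ℤ) : ℝ) = 1 := by
  rcases Int.units_eq_one_or u with h | h <;> simp [h]

/-- The group of orientation-preserving diffeomorphisms. -/
def orientationPreserving (M : Type*) [TopologicalSpace M] [ChartedSpace E3 M]
    [IsManifold (𝓡 3) ∞ M] : Subgroup (Diffeo M) where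
  carrier := {f | PreservesOrientation f}
  one_mem' := by
    intro o _ p
    change 0 < _ * _ * jacobian (id : M → M) p
    rw [jacobian_id, mul_one]
    exact lt_of_lt_of_eq one_pos (unit_sq (o p)).symm
  mul_mem' := by
    intro f h hf hh o ho p
    have h1 := hf o ho (h p)
    have h2 := hh o ho p
    change 0 < ((o p : ℤ) : ℝ) * ((o (f (h p)) : ℤ) : ℝ) * jacobian (f ∘ h) p
    rw [jacobian_comp]
    have h3 := mul_pos h1 h2
    have h4 := unit_sq (o (h p))
    refine lt_of_lt_of_eq h3 ?_
    linear_combination (((o p : ℤ) : ℝ) * ((o (f (h p)) : ℤ) : ℝ) *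
      jacobian f (h p) * jacobian h p) * h4
  inv_mem' := by
    intro f hf o ho p
    have h1 := hf o ho (f.symm p)
    have h2 := jacobian_comp f f.symm p
    have h3 : (f ∘ f.symm : M → M) = id := funext f.apply_symm_apply
    rw [h3, jacobian_id] at h2
    rw [f.apply_symm_apply] at h1
    change 0 < ((o p : ℤ) : ℝ) * ((o (f.symm p) : ℤ) : ℝ) * jacobian f.symm p
    have h5 : 0 < jacobian f.symm p * jacobian f.symm p := by
      have : jacobian f.symm p ≠ 0 := by
        intro h0
        rw [h0, mul_zero] at h2
        exact one_ne_zero h2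
      exact mul_self_pos.mpr this
    refine lt_of_lt_of_eq (mul_pos h1 h5) ?_
    linear_combination (-((o p : ℤ) : ℝ) * ((o (f.symm p) : ℤ) : ℝ) * jacobian f.symm p) * h2

/-! ### Handlebodies and Heegaard splittings -/

/-- The unit sphere with the open discs `e i b (|z| < 1)` removed. -/
def holedSphere {g : ℕ} (e : Fin g → Bool → E2 → E3) : Set E3 :=
  Metric.sphere (0 : E3) 1 \ ⋃ (i : Fin g) (b : Bool), e i b '' Metric.ball (0 : E2) 1

/-- `V` is a handlebody of genus `g` (orientable or not) with boundary surface `S`: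
a closed 3-ball with `g` one-handles, that is, the space obtained from the closed unit ball by
choosing `2 g` pairwise disjoint closed discs `e i b` in the unit sphere and gluing, for each `i`,
the disc `e i true` to the disc `e i false` along their parametrisations. The map `q` is the
quotient map onto `V`; the boundary is the image of the sphere minus the open discs. (That
disjoint closed discs do not separate the sphere is automatic, and is recorded for convenience.) -/
def IsHandlebody {M : Type*} [TopologicalSpace M] (g : ℕ) (V S : Set M) : Prop :=
  ∃ (e : Fin g → Bool → E2 → E3) (q : E3 → M),
    (∀ i b, ContinuousOn (e i b) (Metric.closedBall 0 1)) ∧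
    (∀ i b, Set.MapsTo (e i b) (Metric.closedBall 0 1) (Metric.sphere 0 1)) ∧
    (∀ i b, ∀ z ∈ Metric.closedBall (0 : E2) 1, ∀ i' b', ∀ z' ∈ Metric.closedBall (0 : E2) 1,
      e i b z = e i' b' z' → i = i' ∧ b = b' ∧ z = z') ∧
    IsConnected (holedSphere e) ∧
    ContinuousOn q (Metric.closedBall 0 1) ∧
    (∀ x ∈ Metric.closedBall (0 : E3) 1, ∀ y ∈ Metric.closedBall (0 : E3) 1,
      q x = q y ↔
        x = y ∨ ∃ i b, ∃ z ∈ Metric.closedBall (0 : E2) 1, x = e i b z ∧ y = e i (!b) z) ∧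
    q '' Metric.closedBall 0 1 = V ∧
    q '' holedSphere e = S

/-- `M = V ∪ W` is a (smooth) Heegaard splitting of genus `g` of the closed 3-manifold `M`:
`V` and `W` are handlebodies of genus `g` which meet exactly in their common boundary, and that
surface is smoothly embedded with `V` and `W` on its two sides: near each of its points it is the
zero set of a smooth function without critical point there, `V` is where this function is `≥ 0`
and `W` is where it is `≤ 0`. -/
structure IsHeegaardSplitting {M : Type*} [TopologicalSpace M] [ChartedSpace E3 M]
    [IsManifold (𝓡 3) ∞ M] [T2Space M] [CompactSpace M] [ConnectedSpace M]
    (g : ℕ) (V W : Set M) : Prop where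
  union_eq : V ∪ W = Set.univ
  left : IsHandlebody g V (V ∩ W)
  right : IsHandlebody g W (V ∩ W)
  smooth : ∀ p ∈ V ∩ W, ∃ U : Set M, IsOpen U ∧ p ∈ U ∧ ∃ f : M → ℝ,
    ContMDiffOn (𝓡 3) 𝓘(ℝ, ℝ) ∞ f U ∧ mfderiv (𝓡 3) 𝓘(ℝ, ℝ) f p ≠ 0 ∧
    ∀ x ∈ U, (x ∈ V ↔ 0 ≤ f x) ∧ (x ∈ W ↔ f x ≤ 0)

/-- The (ordinary) Heegaard genus of `M` is `g`: the smallest genus of a Heegaard splitting. -/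
def IsHeegaardGenus (M : Type*) [TopologicalSpace M] [ChartedSpace E3 M]
    [IsManifold (𝓡 3) ∞ M] [T2Space M] [CompactSpace M] [ConnectedSpace M] (g : ℕ) : Prop :=
  IsLeast {k : ℕ | ∃ V W : Set M, IsHeegaardSplitting k V W} g

/-! ### Large group actions -/

/-- `f` maps each of the two handlebodies to itself. -/
def Preserves {M : Type*} (f : M → M) (V W : Set M) : Prop := f '' V = V ∧ f '' W = W

/-- `f` interchanges the two handlebodies. -/
def Interchanges {M : Type*} (f : M → M) (V W : Set M) : Prop := f '' V = W ∧ f '' W = V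

section Types

variable {M : Type*} [TopologicalSpace M] [ChartedSpace E3 M]
  [IsManifold (𝓡 3) ∞ M] [T2Space M] [CompactSpace M] [ConnectedSpace M]

/-- The finite group `G` of diffeomorphisms of `M` is of type `12(g-1)` and genus `g`:
`M` is orientable, `G` preserves the orientation and both handlebodies of a Heegaard splitting of
genus `g > 1`, and `G` has the maximal possible order `12(g-1)`. -/
def IsType12 (G : Subgroup (Diffeo M)) (g : ℕ) : Prop :=
  1 < g ∧ Orientable M ∧ G ≤ orientationPreserving M ∧
    (∃ V W : Set M, IsHeegaardSplitting g V W ∧ ∀ f ∈ G, Preserves f V W) ∧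
    Nat.card G = 12 * (g - 1)

/-- The finite group `G` of diffeomorphisms of `M` is of interchanging type `24(g-1)` and
genus `g`: `M` is orientable, each element of `G` preserves or interchanges the handlebodies of a
Heegaard splitting of genus `g > 1`, some element interchanges them, the subgroup `G₀` of the
elements preserving both handlebodies is orientation-preserving, and `G` has the maximal possible
order `24(g-1)`. -/
def IsInterchangingType24 (G : Subgroup (Diffeo M)) (g : ℕ) : Prop :=
  1 < g ∧ Orientable M ∧
    (∃ V W : Set M, IsHeegaardSplitting g V W ∧
      (∀ f ∈ G, Preserves f V W ∨ Interchanges f V W) ∧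
      (∃ f ∈ G, Interchanges f V W) ∧
      (∀ f ∈ G, Preserves f V W → PreservesOrientation f)) ∧
    Nat.card G = 24 * (g - 1)

/-- The finite group `G` of diffeomorphisms of `M` is of type `48(g-1)` and genus `g`:
each element of `G` preserves or interchanges the handlebodies of a Heegaard splitting of genus
`g > 1`, some element interchanges them, either `M` is orientable and the subgroup `G₀` of the
elements preserving both handlebodies is orientation-reversing (contains an orientation-reversing
element) or `M` is non-orientable, and `G` has the maximal possible order `48(g-1)`. -/
def IsType48 (G : Subgroup (Diffeo M)) (g : ℕ) : Prop :=
  1 < g ∧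
    (∃ V W : Set M, IsHeegaardSplitting g V W ∧
      (∀ f ∈ G, Preserves f V W ∨ Interchanges f V W) ∧
      (∃ f ∈ G, Interchanges f V W) ∧
      ((Orientable M ∧ ∃ f ∈ G, Preserves f V W ∧ ReversesOrientation f) ∨ ¬ Orientable M)) ∧
    Nat.card G = 48 * (g - 1)

end Types

/-! ### Closed Euclidean 3-manifolds `ℝ³ / Γ` -/

/-- The isometry group of `ℝ³` acts on `ℝ³`. -/
instance isometryAction : MulAction (E3 ≃ᵃⁱ[ℝ] E3) E3 where
  smul γ x := γ x
  one_smul _ := rfl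
  mul_smul _ _ _ := rfl

/-- `Γ` acts on `ℝ³` freely and discretely (each non-trivial element moves every point by at
least some fixed `δ > 0`) and with bounded fundamental domain. -/
class IsSpaceFormGroup (Γ : Subgroup (E3 ≃ᵃⁱ[ℝ] E3)) : Prop where
  displacement : ∃ δ : ℝ, 0 < δ ∧ ∀ γ ∈ Γ, γ ≠ 1 → ∀ x : E3, δ ≤ dist (γ x) x
  cocompact : ∃ R : ℝ, ∀ x : E3, ∃ γ ∈ Γ, ‖γ x‖ ≤ R

/-- The quotient `ℝ³ / Γ`. Its topology is the quotient topology, and its charts are local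
inverses of the projection `ℝ³ → ℝ³ / Γ`. -/
abbrev FlatManifold (Γ : Subgroup (E3 ≃ᵃⁱ[ℝ] E3)) : Type := MulAction.orbitRel.Quotient Γ E3

/-- The projection `ℝ³ → ℝ³ / Γ`. -/
def proj (Γ : Subgroup (E3 ≃ᵃⁱ[ℝ] E3)) (x : E3) : FlatManifold Γ :=
  Quotient.mk (MulAction.orbitRel Γ E3) x

section FlatManifold

variable (Γ : Subgroup (E3 ≃ᵃⁱ[ℝ] E3))

lemma proj_eq_iff {x y : E3} : proj Γ x = proj Γ y ↔ ∃ γ ∈ Γ, γ y = x := by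
  unfold proj
  rw [Quotient.eq, MulAction.orbitRel_apply]
  constructor
  · rintro ⟨γ, h⟩
    exact ⟨γ, γ.2, h⟩
  · rintro ⟨γ, hγ, h⟩
    exact ⟨⟨γ, hγ⟩, h⟩

instance : ContinuousConstSMul Γ E3 :=
  ⟨fun γ => (γ : E3 ≃ᵃⁱ[ℝ] E3).continuous⟩

variable [hΓ : IsSpaceFormGroup Γ]

lemma eq_of_dist_lt : ∃ δ : ℝ, 0 < δ ∧ ∀ γ ∈ Γ, ∀ γ' ∈ Γ, ∀ x : E3,
    dist (γ x) (γ' x) < δ → γ = γ' := by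
  obtain ⟨δ, hδ, h⟩ := hΓ.displacement
  refine ⟨δ, hδ, fun γ hγ γ' hγ' x hx => ?_⟩
  by_contra hne
  have h1 := h (γ'⁻¹ * γ) (Γ.mul_mem (Γ.inv_mem hγ') hγ)
    (fun h0 => hne (inv_mul_eq_one.mp h0).symm) x
  have h2 : dist ((γ'⁻¹ * γ) x) x = dist (γ x) (γ' x) := by
    rw [← γ'.dist_map]
    simp
  linarith

instance : IsCancelSMul Γ E3 where
  right_cancel' a b x h := by
    obtain ⟨δ, hδ, hd⟩ := eq_of_dist_lt Γ
    refine Subtype.ext (hd a a.2 b b.2 x ?_)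
    have h' : (a : E3 ≃ᵃⁱ[ℝ] E3) x = (b : E3 ≃ᵃⁱ[ℝ] E3) x := h
    rw [h', dist_self]
    exact hδ

instance : ProperlyDiscontinuousSMul Γ E3 where
  finite_disjoint_inter_image := by
    intro K L hK hL
    obtain ⟨δ, hδ, hd⟩ := eq_of_dist_lt Γ
    obtain ⟨R, hR⟩ := hK.isBounded.subset_closedBall (0 : E3)
    obtain ⟨R', hR'⟩ := hL.isBounded.subset_closedBall (0 : E3)
    have htb : TotallyBounded (Metric.closedBall (0 : E3) (R + R')) :=
      (isCompact_closedBall _ _).totallyBounded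
    obtain ⟨t, ht, hcov⟩ := Metric.totallyBounded_iff.mp htb (δ / 2) (by positivity)
    have key : ∀ γ ∈ {γ : Γ | ((γ • ·) '' K ∩ L).Nonempty},
        ∃ y ∈ t, dist ((γ : E3 ≃ᵃⁱ[ℝ] E3) 0) y < δ / 2 := by
      rintro γ ⟨_, ⟨x, hx, rfl⟩, hL'⟩
      have h1 : dist ((γ : E3 ≃ᵃⁱ[ℝ] E3) x) 0 ≤ R' := hR' hL'
      have h2 : dist x 0 ≤ R := hR hx
      have h3 : (γ : E3 ≃ᵃⁱ[ℝ] E3) 0 ∈ Metric.closedBall (0 : E3) (R + R') := by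
        rw [Metric.mem_closedBall]
        have := dist_triangle ((γ : E3 ≃ᵃⁱ[ℝ] E3) 0) ((γ : E3 ≃ᵃⁱ[ℝ] E3) x) 0
        rw [AffineIsometryEquiv.dist_map, dist_comm 0 x] at this
        linarith
      simpa using hcov h3
    choose! F hF hF' using key
    refine Set.Finite.of_finite_image (ht.subset (Set.image_subset_iff.mpr hF)) ?_
    intro γ hγ γ' hγ' hEq
    refine Subtype.ext (hd γ γ.2 γ' γ'.2 0 ?_)
    have h1 := hF' γ hγ
    have h2 := hF' γ' hγ'
    have hEq' : F γ = F γ' := hEq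
    rw [← hEq', dist_comm] at h2
    exact (dist_triangle _ _ _).trans_lt (by linarith)

instance : SecondCountableTopology (FlatManifold Γ) :=
  ContinuousConstSMul.secondCountableTopology

instance : T2Space (FlatManifold Γ) :=
  t2Space_of_properlyDiscontinuousSMul_of_t2Space

instance : ConnectedSpace (FlatManifold Γ) :=
  inferInstanceAs (ConnectedSpace (Quotient (MulAction.orbitRel Γ E3)))

instance : CompactSpace (FlatManifold Γ) := by
  obtain ⟨R, hR⟩ := hΓ.cocompact
  refine ⟨?_⟩
  have h : proj Γ '' Metric.closedBall 0 R = Set.univ := by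
    refine Set.eq_univ_of_forall fun a => ?_
    obtain ⟨x, rfl⟩ := Quotient.exists_rep a
    obtain ⟨γ, hγ, hx⟩ := hR x
    exact ⟨γ x, by simpa using hx, (proj_eq_iff Γ).mpr ⟨γ, hγ, rfl⟩⟩
  rw [← h]
  exact (isCompact_closedBall _ _).image continuous_quot_mk

lemma symm_of_mem_atlas {e : OpenPartialHomeomorph (FlatManifold Γ) E3}
    (he : e ∈ atlas E3 (FlatManifold Γ)) (x : E3) : e.symm x = proj Γ x := by
  obtain ⟨q, rfl⟩ := he
  rw [OpenPartialHomeomorph.trans_symm_eq_symm_trans_symm, OpenPartialHomeomorph.coe_trans,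
    IsLocalHomeomorph.localInverseAt_symm]
  rfl

instance : IsManifold (𝓡 3) ∞ (FlatManifold Γ) := by
  refine isManifold_of_contDiffOn (𝓡 3) ∞ _ fun e e' he he' => ?_
  intro x hx
  have hx' : x ∈ (e.symm ≫ₕ e').source := hx.1
  obtain ⟨δ, hδ, hd⟩ := eq_of_dist_lt Γ
  have hT : ∀ y ∈ (e.symm ≫ₕ e').source, ∃ γ ∈ Γ, γ y = (e.symm ≫ₕ e') y := by
    intro y hy
    rw [← proj_eq_iff, ← symm_of_mem_atlas Γ he', ← symm_of_mem_atlas Γ he]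
    rw [OpenPartialHomeomorph.trans_source] at hy
    exact e'.left_inv hy.2
  obtain ⟨γ, hγ, hγx⟩ := hT x hx'
  have hopen := (e.symm ≫ₕ e').open_source
  have hcont : ContinuousAt (e.symm ≫ₕ e') x := (e.symm ≫ₕ e').continuousAt hx'
  have hev : (e.symm ≫ₕ e') =ᶠ[𝓝 x] γ := by
    have h1 : Filter.Tendsto (fun y => dist (γ y) ((e.symm ≫ₕ e') y)) (𝓝 x)
        (𝓝 (dist (γ x) ((e.symm ≫ₕ e') x))) :=
      (γ.continuous.continuousAt).dist hcont
    rw [hγx, dist_self] at h1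
    filter_upwards [h1.eventually_lt_const hδ, hopen.mem_nhds hx'] with y hy hys
    obtain ⟨γ', hγ', h'⟩ := hT y hys
    rw [← h'] at hy
    rw [← h', hd γ hγ γ' hγ' y hy]
  have hsm : ContDiffAt ℝ ∞ γ x :=
    (ContinuousAffineMap.contDiff γ.toAffineIsometry.toContinuousAffineMap).contDiffAt
  exact (hsm.congr_of_eventuallyEq hev).contDiffWithinAt

/-- The distance of the quotient metric on `ℝ³ / Γ`: the smallest distance between points of the
two orbits. -/
def flatDist (a b : FlatManifold Γ) : ℝ :=
  sInf {r : ℝ | ∃ x y : E3, proj Γ x = a ∧ proj Γ y = b ∧ dist x y = r}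

/-- The isometry group of `ℝ³ / Γ`. -/
def isometryGroup : Subgroup (Diffeo (FlatManifold Γ)) where
  carrier := {f | ∀ a b, flatDist Γ (f a) (f b) = flatDist Γ a b}
  one_mem' _ _ := rfl
  mul_mem' := fun {f h} hf hh a b => (hf (h a) (h b)).trans (hh a b)
  inv_mem' := by
    intro f hf a b
    have h1 := hf (f.symm a) (f.symm b)
    rw [f.apply_symm_apply, f.apply_symm_apply] at h1
    exact h1.symm

/-- The orientation-preserving isometry group of `ℝ³ / Γ`. -/
def orientationPreservingIsometryGroup : Subgroup (Diffeo (FlatManifold Γ)) :=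
  isometryGroup Γ ⊓ orientationPreserving (FlatManifold Γ)

end FlatManifold

/-! ### The 3-torus -/

/-- The group of translations of `ℝ³` by integer vectors. -/
def integerTranslations : Subgroup (E3 ≃ᵃⁱ[ℝ] E3) where
  carrier := {γ | ∃ n : Fin 3 → ℤ, ∀ x : E3, ∀ i, γ x i = x i + n i}
  one_mem' := ⟨0, fun x i => by simp⟩
  mul_mem' := by
    rintro γ γ' ⟨n, hn⟩ ⟨n', hn'⟩
    refine ⟨n + n', fun x i => ?_⟩
    rw [AffineIsometryEquiv.coe_mul, Function.comp_apply, hn, hn']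
    push_cast [Pi.add_apply]
    ring
  inv_mem' := by
    rintro γ ⟨n, hn⟩
    refine ⟨-n, fun x i => ?_⟩
    have h := hn (γ⁻¹ x) i
    have h1 : γ (γ⁻¹ x) = x := γ.apply_symm_apply x
    rw [h1] at h
    push_cast [Pi.neg_apply]
    linarith

lemma abs_coord_le (x : E3) (i : Fin 3) : |x i| ≤ ‖x‖ := by
  simpa using PiLp.norm_apply_le x i

lemma norm_le_of_coord {x : E3} {r : ℝ} (hr : 0 ≤ r) (h : ∀ i, |x i| ≤ r) : ‖x‖ ≤ 3 * r := by
  rw [EuclideanSpace.norm_eq, Real.sqrt_le_left (by positivity), Fin.sum_univ_three]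
  have h2 : ∀ i, ‖x i‖ ^ 2 ≤ r ^ 2 := fun i => by
    have := h i
    rw [Real.norm_eq_abs]
    gcongr
  nlinarith [h2 0, h2 1, h2 2, sq_nonneg r]

lemma one_le_dist_of_coord {x y : E3} (i : Fin 3) (h : 1 ≤ |x i - y i|) : 1 ≤ dist x y := by
  rw [dist_eq_norm]
  exact h.trans (abs_coord_le (x - y) i)

/-- Translation of `ℝ³` by the vector `v`. -/
def translation (v : Fin 3 → ℝ) : E3 ≃ᵃⁱ[ℝ] E3 :=
  AffineIsometryEquiv.constVAdd ℝ E3 (WithLp.toLp 2 v)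

lemma translation_apply (v : Fin 3 → ℝ) (x : E3) (i : Fin 3) :
    translation v x i = v i + x i := rfl

lemma one_le_abs_intCast {n : ℤ} (h : n ≠ 0) : (1 : ℝ) ≤ |(n : ℝ)| := by
  exact_mod_cast Int.one_le_abs h

instance : IsSpaceFormGroup integerTranslations where
  displacement := by
    refine ⟨1, one_pos, ?_⟩
    rintro γ ⟨n, hn⟩ hne x
    have h : ∃ i, n i ≠ 0 := by
      by_contra! h0
      exact hne (AffineIsometryEquiv.ext fun y => by
        ext i
        simp [hn, h0])
    obtain ⟨i, hi⟩ := h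
    refine one_le_dist_of_coord i ?_
    rw [hn, add_sub_cancel_left]
    exact one_le_abs_intCast hi
  cocompact := by
    refine ⟨3 * 1, fun x => ⟨translation fun i => -(⌊x i⌋ : ℝ), ⟨fun i => -⌊x i⌋, ?_⟩,
      norm_le_of_coord zero_le_one ?_⟩⟩
    · intro y i
      rw [translation_apply]
      push_cast
      ring
    · intro i
      rw [translation_apply, abs_le]
      constructor <;> linarith [Int.floor_le (x i), Int.lt_floor_add_one (x i)]

/-- The 3-torus `ℝ³ / ℤ³`. -/
abbrev ThreeTorus : Type := FlatManifold integerTranslations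

/-! ### The Hantzsche–Wendt manifold -/

/-- The reflection `t ↦ -t` of the line if `s`, otherwise the identity. -/
def flip (s : Bool) : ℝ ≃ₗᵢ[ℝ] ℝ :=
  if s then LinearIsometryEquiv.neg ℝ else LinearIsometryEquiv.refl ℝ ℝ

/-- The isometry of `ℝ³` which changes the sign of the coordinates marked by `s` and then
translates by `v`. -/
def signedTranslation (s : Fin 3 → Bool) (v : Fin 3 → ℝ) : E3 ≃ᵃⁱ[ℝ] E3 :=
  translation v *
    (LinearIsometryEquiv.piLpCongrRight 2 fun i => flip (s i)).toAffineIsometryEquiv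

lemma signedTranslation_apply (s : Fin 3 → Bool) (v : Fin 3 → ℝ) (x : E3) (i : Fin 3) :
    signedTranslation s v x i = v i + (if s i then -x i else x i) := by
  change v i + flip (s i) (x i) = _
  unfold flip
  cases s i <;> simp

/-- The screw motion `(x, y, z) ↦ (x + 1, 1 - y, -z)`. -/
def screwA : E3 ≃ᵃⁱ[ℝ] E3 := signedTranslation ![false, true, true] ![1, 1, 0]

/-- The screw motion `(x, y, z) ↦ (-x, y + 1, 1 - z)`. -/
def screwB : E3 ≃ᵃⁱ[ℝ] E3 := signedTranslation ![true, false, true] ![0, 1, 1]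

/-- The Hantzsche–Wendt group: the torsion-free crystallographic group with holonomy group
`ℤ₂ × ℤ₂` generated by the screw motions `(x, y, z) ↦ (x + 1, 1 - y, -z)` and
`(x, y, z) ↦ (-x, y + 1, 1 - z)`; its translation lattice is the cubic lattice `2ℤ³`. -/
def hantzscheWendtGroup : Subgroup (E3 ≃ᵃⁱ[ℝ] E3) := Subgroup.closure {screwA, screwB}

/-- The shape of the elements of the Hantzsche–Wendt group: integral signed translations, where
the signs are governed by the parities of the translation parts. -/
def HWShape (γ : E3 ≃ᵃⁱ[ℝ] E3) : Prop :=
  ∃ (s : Fin 3 → ℤ) (n : Fin 3 → ℤ), (∀ (x : E3) (i : Fin 3), γ x i = s i * x i + n i) ∧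
    ((s 0 = 1 ∧ s 1 = 1 ∧ s 2 = 1 ∧ n 0 % 2 = 0 ∧ n 1 % 2 = 0 ∧ n 2 % 2 = 0) ∨
     (s 0 = 1 ∧ s 1 = -1 ∧ s 2 = -1 ∧ n 0 % 2 = 1 ∧ n 1 % 2 = 1 ∧ n 2 % 2 = 0) ∨
     (s 0 = -1 ∧ s 1 = 1 ∧ s 2 = -1 ∧ n 0 % 2 = 0 ∧ n 1 % 2 = 1 ∧ n 2 % 2 = 1) ∨
     (s 0 = -1 ∧ s 1 = -1 ∧ s 2 = 1 ∧ n 0 % 2 = 1 ∧ n 1 % 2 = 0 ∧ n 2 % 2 = 1))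

lemma HWShape.mul {γ γ' : E3 ≃ᵃⁱ[ℝ] E3} (h : HWShape γ) (h' : HWShape γ') :
    HWShape (γ * γ') := by
  obtain ⟨s, n, hn, hc⟩ := h
  obtain ⟨s', n', hn', hc'⟩ := h'
  refine ⟨fun i => s i * s' i, fun i => s i * n' i + n i, fun x i => ?_, ?_⟩
  · rw [AffineIsometryEquiv.coe_mul, Function.comp_apply, hn, hn']
    push_cast
    ring
  · rcases hc with ⟨h0, h1, h2, hc⟩ | ⟨h0, h1, h2, hc⟩ | ⟨h0, h1, h2, hc⟩ | ⟨h0, h1, h2, hc⟩ <;>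
    rcases hc' with ⟨k0, k1, k2, hc'⟩ | ⟨k0, k1, k2, hc'⟩ | ⟨k0, k1, k2, hc'⟩ |
      ⟨k0, k1, k2, hc'⟩ <;>
    norm_num [h0, h1, h2, k0, k1, k2] <;> omega

lemma HWShape.inv {γ : E3 ≃ᵃⁱ[ℝ] E3} (h : HWShape γ) : HWShape γ⁻¹ := by
  obtain ⟨s, n, hn, hc⟩ := h
  have hs : ∀ i, s i * s i = 1 := by
    intro i
    rcases hc with ⟨h0, h1, h2, -⟩ | ⟨h0, h1, h2, -⟩ | ⟨h0, h1, h2, -⟩ | ⟨h0, h1, h2, -⟩ <;>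
    fin_cases i <;> simp [h0, h1, h2]
  refine ⟨s, fun i => -(s i * n i), fun x i => ?_, ?_⟩
  · have h := hn (γ⁻¹ x) i
    have h1 : γ (γ⁻¹ x) = x := γ.apply_symm_apply x
    have h2 : (s i : ℝ) * s i = 1 := by exact_mod_cast hs i
    rw [h1] at h
    push_cast
    linear_combination (-(s i : ℝ)) * h - ((γ⁻¹ x) i) * h2
  · rcases hc with ⟨h0, h1, h2, hc⟩ | ⟨h0, h1, h2, hc⟩ | ⟨h0, h1, h2, hc⟩ | ⟨h0, h1, h2, hc⟩ <;>
    norm_num [h0, h1, h2] <;> omega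

lemma hwShape_of_mem {γ : E3 ≃ᵃⁱ[ℝ] E3} (h : γ ∈ hantzscheWendtGroup) : HWShape γ := by
  induction h using Subgroup.closure_induction with
  | mem γ hγ =>
    rcases hγ with rfl | rfl
    · refine ⟨![1, -1, -1], ![1, 1, 0], fun x i => ?_, by simp⟩
      rw [screwA, signedTranslation_apply]
      fin_cases i <;> simp [add_comm]
    · refine ⟨![-1, 1, -1], ![0, 1, 1], fun x i => ?_, by simp⟩
      rw [screwB, signedTranslation_apply]
      fin_cases i <;> simp [add_comm]
  | one => exact ⟨1, 0, fun x i => by simp, by simp⟩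
  | mul _ _ _ _ h h' => exact h.mul h'
  | inv _ _ h => exact h.inv

lemma translation_add (v w : Fin 3 → ℝ) :
    translation v * translation w = translation (v + w) := by
  ext x i
  change v i + (w i + x i) = (v i + w i) + x i
  ring

lemma translation_zpow (v : Fin 3 → ℝ) (k : ℤ) :
    translation v ^ k = translation (fun i => k * v i) := by
  have hinv : ∀ w : Fin 3 → ℝ, (translation w)⁻¹ = translation (-w) := by
    intro w
    rw [inv_eq_iff_mul_eq_one, translation_add]
    ext x i
    simp [translation_apply]
  induction k with
  | zero =>
    ext x i
    simp [translation_apply]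
  | succ k ih =>
    rw [zpow_add_one, ih, translation_add]
    congr 1
    ext i
    simp only [Pi.add_apply]
    push_cast
    ring
  | pred k ih =>
    rw [zpow_sub_one, ih, hinv, translation_add]
    congr 1
    ext i
    simp only [Pi.add_apply, Pi.neg_apply]
    push_cast
    ring

lemma evenTranslation_mem (k : Fin 3 → ℤ) :
    translation (fun i => 2 * (k i : ℝ)) ∈ hantzscheWendtGroup := by
  have hA : screwA ∈ hantzscheWendtGroup := Subgroup.subset_closure (by simp)
  have hB : screwB ∈ hantzscheWendtGroup := Subgroup.subset_closure (by simp)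
  have h0 : translation ![2, 0, 0] ∈ hantzscheWendtGroup := by
    have : translation ![2, 0, 0] = screwA * screwA := by
      ext x i
      rw [AffineIsometryEquiv.coe_mul, Function.comp_apply, screwA, signedTranslation_apply,
        signedTranslation_apply, translation_apply]
      fin_cases i <;> simp
      ring
    rw [this]
    exact mul_mem hA hA
  have h1 : translation ![0, 2, 0] ∈ hantzscheWendtGroup := by
    have : translation ![0, 2, 0] = screwB * screwB := by
      ext x i
      rw [AffineIsometryEquiv.coe_mul, Function.comp_apply, screwB, signedTranslation_apply,
        signedTranslation_apply, translation_apply]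
      fin_cases i <;> simp
      ring
    rw [this]
    exact mul_mem hB hB
  have h2 : translation ![0, 0, -2] ∈ hantzscheWendtGroup := by
    have : translation ![0, 0, -2] = (screwA * screwB) * (screwA * screwB) := by
      ext x i
      simp only [AffineIsometryEquiv.coe_mul, Function.comp_apply, screwA, screwB,
        signedTranslation_apply, translation_apply]
      fin_cases i <;> simp
      ring
    rw [this]
    exact mul_mem (mul_mem hA hB) (mul_mem hA hB)
  have h : translation (fun i => 2 * (k i : ℝ)) =
      translation ![2, 0, 0] ^ k 0 * translation ![0, 2, 0] ^ k 1 *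
        translation ![0, 0, -2] ^ (-k 2) := by
    rw [translation_zpow, translation_zpow, translation_zpow, translation_add, translation_add]
    congr 1
    ext i
    fin_cases i <;> simp [mul_comm]
  rw [h]
  exact mul_mem (mul_mem (zpow_mem h0 _) (zpow_mem h1 _)) (zpow_mem h2 _)

instance : IsSpaceFormGroup hantzscheWendtGroup where
  displacement := by
    refine ⟨1, one_pos, fun γ hγ hne x => ?_⟩
    obtain ⟨s, n, hn, hc⟩ := hwShape_of_mem hγ
    have key : ∀ i, s i = 1 → n i ≠ 0 → 1 ≤ dist (γ x) x := by
      intro i hs hi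
      refine one_le_dist_of_coord i ?_
      rw [hn, hs]
      have : ((1 : ℤ) : ℝ) * x i + n i - x i = n i := by
        push_cast
        ring
      rw [this]
      exact one_le_abs_intCast hi
    rcases hc with ⟨h0, h1, h2, hc⟩ | ⟨h0, h1, h2, hc⟩ | ⟨h0, h1, h2, hc⟩ | ⟨h0, h1, h2, hc⟩
    · by_contra hd
      have e0 : n 0 = 0 := by_contra fun h => hd (key 0 h0 h)
      have e1 : n 1 = 0 := by_contra fun h => hd (key 1 h1 h)
      have e2 : n 2 = 0 := by_contra fun h => hd (key 2 h2 h)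
      refine hne (AffineIsometryEquiv.ext fun y => ?_)
      ext i
      rw [hn]
      fin_cases i <;> simp [h0, h1, h2, e0, e1, e2]
    · exact key 0 h0 (by omega)
    · exact key 1 h1 (by omega)
    · exact key 2 h2 (by omega)
  cocompact := by
    refine ⟨3 * 2, fun x => ⟨_, evenTranslation_mem fun i => -⌊x i / 2⌋,
      norm_le_of_coord zero_le_two ?_⟩⟩
    intro i
    rw [translation_apply, abs_le]
    push_cast
    constructor <;> linarith [Int.floor_le (x i / 2), Int.lt_floor_add_one (x i / 2)]

/-- The Euclidean Hantzsche–Wendt manifold, with its flat metric coming from the cubic lattice. -/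
abbrev HantzscheWendt : Type := FlatManifold hantzscheWendtGroup

end

end Heegaard

/-!
All splittings of the theorem are zero sets of trigonometric functions on `ℝ³`. Let `Γ` be a group
of isometries with quotient a closed flat manifold, and `f` a `Γ`-invariant function without
critical zeros. If some isometry that normalizes `Γ` changes the sign of `f`, it interchanges the
two sides of the surface `{f = 0} / Γ`, so that this surface gives a Heegaard splitting as soon as
the side `{f ≥ 0} / Γ` is a handlebody (`Heegaard.isHeegaardSplitting_of_function`). The isometries
that normalize `Γ` and preserve `f` up to sign act on the splitting.

* The function `schwarzP` (the Schwarz P surface) gives a splitting of genus 3 of the 3-torus. The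
  signed permutations of the coordinates and the translation by `(1/2, 1/2, 1/2)`, which
  interchanges the sides, act on it as a group of order `96 = 48 · 2`.
* The function `schwarzD` (the Schwarz D surface) gives a splitting of genus 3 of the
  Hantzsche–Wendt manifold, which is respected by all its orientation-preserving isometries.
* The function `gyroid` gives a splitting of genus 2 of the Hantzsche–Wendt manifold, which is
  respected by a dihedral group of order 12.

That a side is a handlebody is shown by a fundamental cell (`Heegaard.HandlebodyCell`): the part
`f ≥ 0` of a polytope, a cube for the Schwarz surfaces and a tetrahedron for the gyroid. The faces
of the cell are disjoint discs, paired by elements of `Γ`, and the cell is strictly star-shaped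
about its centre, hence homeomorphic to a ball by the gauge homeomorphism, as is each face to a disc
(`Heegaard.HandlebodyCell.isHandlebody`). Star-shapedness follows from the fact that the radial
derivative of `f` is negative at the zeros of `f` in the polytope (`Heegaard.cubeDDecreasing`,
`Heegaard.cellGRadial_neg`); these trigonometric inequalities, and the verification that the
`Γ`-translates of the cell tile the region, make up a large part of the file.

The 3-torus has no splitting of smaller genus (`Heegaard.three_le_of_isHeegaardSplitting`): lifting
the ball of a handlebody `V` to `ℝ³`, each handle determines an integral vector, and with fewer than
three handles there is a non-zero integral linear form that vanishes on these vectors. It descends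
to a continuous real function on `V`, then, since the boundary surface is connected, also on the
other handlebody, and thus on the torus. But a real function on the torus that lifts to the linear
form up to integers has to agree with it up to a constant, and the form is not periodic.

Every isometry of the quotient `ℝ³ / Γ` lifts to an isometry of `ℝ³` normalizing `Γ`
(`Heegaard.exists_descend_eq`). For the Hantzsche–Wendt group the normalizer consists of the signed
permutations of the coordinates followed by translations by half-integral vectors of a suitable
parity (`Heegaard.exists_eq_halfPerm`). Those preserving the orientation permute the three summands
of the gyroid function up to signs with product one, hence act on the four sign patterns with
product one by arbitrary permutations, and change `schwarzD` by a sign, independently. The kernel of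
this action is the Hantzsche–Wendt group itself, so that the orientation-preserving isometry group
of the manifold is `S₄ × ℤ/2` (`Heegaard.exists_isometryAction`). The permutations of the patterns
that permute the entries, times the factor `ℤ/2`, form the dihedral group of order 12; they preserve
the gyroid function.
-/

namespace Heegaard

noncomputable section

/-! ### Strictly star-shaped bodies -/

section StarBody

open Metric Set Bornology
open scoped Pointwise

variable {E : Type*} [NormedAddCommGroup E] [NormedSpace ℝ E]

/-- A compact set `P` which is strictly star-shaped about `0`: it contains a neighbourhood of `0`,
and the half-open segment from `0` to a point of `P` lies in the interior of `P`. -/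
structure IsStarBody (P : Set E) : Prop where
  isCompact : IsCompact P
  zero_mem : (0 : E) ∈ interior P
  smul_mem : ∀ x ∈ P, ∀ t : ℝ, 0 ≤ t → t < 1 → t • x ∈ interior P

variable {P : Set E}

namespace IsStarBody

lemma mem_nhds (hP : IsStarBody P) : P ∈ 𝓝 (0 : E) := mem_interior_iff_mem_nhds.mp hP.zero_mem

lemma absorbent (hP : IsStarBody P) : Absorbent ℝ P := absorbent_nhds_zero hP.mem_nhds

lemma isVonNBounded (hP : IsStarBody P) : IsVonNBounded ℝ P :=
  NormedSpace.isVonNBounded_of_isBounded ℝ hP.isCompact.isBounded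

lemma gauge_lt_one_iff (hP : IsStarBody P) {x : E} : gauge P x < 1 ↔ x ∈ interior P := by
  refine ⟨fun h => ?_, fun h => interior_subset_gauge_lt_one P h⟩
  obtain ⟨b, hb0, hb1, y, hy, rfl⟩ := exists_lt_of_gauge_lt hP.absorbent h
  exact hP.smul_mem y hy b hb0.le hb1

lemma gauge_le_one_iff (hP : IsStarBody P) {x : E} : gauge P x ≤ 1 ↔ x ∈ P := by
  refine ⟨fun h => ?_, fun h => gauge_le_one_of_mem h⟩
  have hlim : Filter.Tendsto (fun t : ℝ => t • x) (𝓝[<] 1) (𝓝 x) := by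
    have : Filter.Tendsto (fun t : ℝ => t • x) (𝓝 1) (𝓝 ((1 : ℝ) • x)) :=
      (continuous_id.smul continuous_const).tendsto 1
    rw [one_smul] at this
    exact this.mono_left nhdsWithin_le_nhds
  refine hP.isCompact.isClosed.mem_of_tendsto hlim ?_
  have h0 : ∀ᶠ t : ℝ in 𝓝[<] 1, t ∈ Ioo (0 : ℝ) 1 := Ioo_mem_nhdsLT one_pos
  filter_upwards [h0] with t ht
  refine interior_subset (hP.gauge_lt_one_iff.mp ?_)
  rw [gauge_smul_of_nonneg ht.1.le, smul_eq_mul]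
  nlinarith [ht.1, ht.2, gauge_nonneg (s := P) x]

lemma continuous_gauge (hP : IsStarBody P) : Continuous (gauge P) := by
  have hscale : ∀ a : ℝ, 0 < a → ∀ x, gauge P (a⁻¹ • x) = a⁻¹ * gauge P x := fun a ha x => by
    rw [gauge_smul_of_nonneg (inv_nonneg.mpr ha.le), smul_eq_mul]
  rw [OrderTopology.continuous_iff]
  intro a
  rcases lt_trichotomy a 0 with ha | rfl | ha
  · constructor
    · convert isOpen_univ
      exact eq_univ_of_forall fun x => ha.trans_le (gauge_nonneg x)
    · convert isOpen_empty
      exact eq_empty_of_forall_notMem fun x hx =>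
        absurd (lt_trans hx ha) (not_lt.mpr (gauge_nonneg x))
  · constructor
    · convert isOpen_compl_singleton (x := (0 : E)) using 1
      ext x
      exact gauge_pos hP.absorbent hP.isVonNBounded
    · convert isOpen_empty
      exact eq_empty_of_forall_notMem fun x hx => absurd hx (not_lt.mpr (gauge_nonneg x))
  · constructor
    · have : gauge P ⁻¹' Ioi a = (fun x => a⁻¹ • x) ⁻¹' Pᶜ := by
        ext x
        rw [mem_preimage, mem_preimage, mem_compl_iff, ← hP.gauge_le_one_iff, hscale a ha, not_le,
          mem_Ioi, lt_inv_mul_iff₀ ha, mul_one]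
      rw [this]
      exact hP.isCompact.isClosed.isOpen_compl.preimage (continuous_const_smul _)
    · have : gauge P ⁻¹' Iio a = (fun x => a⁻¹ • x) ⁻¹' interior P := by
        ext x
        rw [mem_preimage, mem_preimage, ← hP.gauge_lt_one_iff, hscale a ha, mem_Iio,
          inv_mul_lt_iff₀ ha, mul_one]
      rw [this]
      exact isOpen_interior.preimage (continuous_const_smul _)

lemma continuous_gaugeRescale {Q : Set E} (hP : IsStarBody P) (hQ : IsStarBody Q) :
    Continuous (gaugeRescale P Q) := by
  refine continuous_iff_continuousAt.2 fun x => ?_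
  rcases eq_or_ne x 0 with rfl | hx
  · rw [ContinuousAt, gaugeRescale_zero]
    nth_rewrite 2 [← comap_gauge_nhds_zero hQ.isVonNBounded hQ.mem_nhds]
    simp only [Filter.tendsto_comap_iff, Function.comp_def,
      gauge_gaugeRescale _ hQ.absorbent hQ.isVonNBounded]
    exact tendsto_gauge_nhds_zero hP.mem_nhds
  · exact (hP.continuous_gauge.continuousAt.div hQ.continuous_gauge.continuousAt
      ((gauge_pos hQ.absorbent hQ.isVonNBounded).2 hx).ne').smul continuousAt_id

lemma closedBall [ProperSpace E] : IsStarBody (closedBall (0 : E) 1) where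
  isCompact := isCompact_closedBall _ _
  zero_mem := ball_subset_interior_closedBall (mem_ball_self one_pos)
  smul_mem x hx t h0 h1 := by
    refine ball_subset_interior_closedBall ?_
    rw [mem_closedBall_zero_iff] at hx
    rw [mem_ball_zero_iff, norm_smul, Real.norm_of_nonneg h0]
    nlinarith [norm_nonneg x]

/-- The radial homeomorphism takes the unit ball to a strictly star-shaped body. -/
theorem exists_homeomorph [ProperSpace E] (hP : IsStarBody P) :
    ∃ h : E ≃ₜ E, (∀ x, h x ∈ P ↔ ‖x‖ ≤ 1) ∧ (∀ x, h x ∈ interior P ↔ ‖x‖ < 1) := by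
  have hB : IsStarBody (Metric.closedBall (0 : E) 1) := closedBall
  refine ⟨{ toEquiv := gaugeRescaleEquiv _ _ hB.absorbent hB.isVonNBounded
              hP.absorbent hP.isVonNBounded
            continuous_toFun := hB.continuous_gaugeRescale hP
            continuous_invFun := hP.continuous_gaugeRescale hB }, fun x => ?_, fun x => ?_⟩
  · rw [← hP.gauge_le_one_iff]
    change gauge P (gaugeRescale _ _ x) ≤ 1 ↔ _
    rw [gauge_gaugeRescale _ hP.absorbent hP.isVonNBounded, gauge_closedBall zero_le_one, div_one]
  · rw [← hP.gauge_lt_one_iff]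
    change gauge P (gaugeRescale _ _ x) < 1 ↔ _
    rw [gauge_gaugeRescale _ hP.absorbent hP.isVonNBounded, gauge_closedBall zero_le_one, div_one]

end IsStarBody

end StarBody

/-! ### Spheres with holes -/

/-- A connected set from which one removes the "open parts" `O j` of finitely many disjoint closed
subsets `D j` stays preconnected if the rims `D j \ O j` are preconnected: a separation of the
complement would extend over the sets `D j`. -/
lemma isPreconnected_diff_iUnion {X ι : Type*} [TopologicalSpace X] [Finite ι] {S : Set X}
    (hS : IsPreconnected S) (D O : ι → Set X) (hD : ∀ j, IsClosed (D j))
    (hDS : ∀ j, D j ⊆ S) (hOD : ∀ j, O j ⊆ D j) (hrim : ∀ j, IsPreconnected (D j \ O j))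
    (hdisj : ∀ j j', ∀ x, x ∈ D j → x ∈ D j' → j = j')
    (hclosed : IsClosed (S \ ⋃ j, O j)) : IsPreconnected (S \ ⋃ j, O j) := by
  classical
  set H := S \ ⋃ j, O j with hH
  have hrimH : ∀ j, D j \ O j ⊆ H := by
    rintro j x ⟨hx, hxO⟩
    refine ⟨hDS j hx, fun hU => ?_⟩
    obtain ⟨j', hj'⟩ := Set.mem_iUnion.mp hU
    rw [hdisj j j' x hx (hOD j' hj')] at hxO
    exact hxO hj'
  rw [isPreconnected_closed_iff]
  rintro t t' ht ht' hcov ⟨a, haH, hat⟩ ⟨b, hbH, hbt'⟩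
  by_contra hne
  have hdis : ∀ x ∈ H, x ∈ t → x ∈ t' → False := fun x hx h h' => hne ⟨x, hx, h, h'⟩
  have hside : ∀ j, ¬ (D j \ O j ⊆ t) → D j \ O j ⊆ t' := by
    intro j hj x hx
    by_contra hxt'
    have hxt : x ∈ t := (hcov (hrimH j hx)).resolve_right hxt'
    obtain ⟨y, hy, hyt⟩ := Set.not_subset.mp hj
    have hyt' : y ∈ t' := (hcov (hrimH j hy)).resolve_left hyt
    obtain ⟨z, hz, hz1, hz2⟩ := isPreconnected_closed_iff.mp (hrim j) t t' ht ht'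
      ((hrimH j).trans hcov) ⟨x, hx, hxt⟩ ⟨y, hy, hyt'⟩
    exact hdis z (hrimH j hz) hz1 hz2
  -- attach each `D j` to the part of the separation that contains its rim
  set T := (H ∩ t) ∪ ⋃ j : {j // D j \ O j ⊆ t}, D j.1 with hT
  set T' := (H ∩ t') ∪ ⋃ j : {j // ¬ (D j \ O j ⊆ t)}, D j.1 with hT'
  have hTc : IsClosed T := (hclosed.inter ht).union (isClosed_iUnion_of_finite fun j => hD j.1)
  have hTc' : IsClosed T' := (hclosed.inter ht').union (isClosed_iUnion_of_finite fun j => hD j.1)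
  have hST : S ⊆ T ∪ T' := by
    intro x hx
    by_cases hxU : x ∈ ⋃ j, O j
    · obtain ⟨j, hj⟩ := Set.mem_iUnion.mp hxU
      by_cases hjt : D j \ O j ⊆ t
      · exact Or.inl (Or.inr (Set.mem_iUnion.mpr ⟨⟨j, hjt⟩, hOD j hj⟩))
      · exact Or.inr (Or.inr (Set.mem_iUnion.mpr ⟨⟨j, hjt⟩, hOD j hj⟩))
    · have hxH : x ∈ H := ⟨hx, hxU⟩
      rcases hcov hxH with h | h
      · exact Or.inl (Or.inl ⟨hxH, h⟩)
      · exact Or.inr (Or.inl ⟨hxH, h⟩)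
  obtain ⟨x, hxS, hxT, hxT'⟩ := isPreconnected_closed_iff.mp hS T T' hTc hTc' hST
    ⟨a, haH.1, Or.inl ⟨haH, hat⟩⟩ ⟨b, hbH.1, Or.inl ⟨hbH, hbt'⟩⟩
  have hnotO : ∀ y ∈ H, ∀ j, y ∉ O j := fun y hy j hj => hy.2 (Set.mem_iUnion.mpr ⟨j, hj⟩)
  rcases hxT with ⟨hxH, hxt⟩ | hxT
  · rcases hxT' with ⟨-, hxt'⟩ | hxT'
    · exact hdis x hxH hxt hxt'
    · obtain ⟨⟨j, hj⟩, hxj⟩ := Set.mem_iUnion.mp hxT'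
      exact hdis x hxH hxt (hside j hj ⟨hxj, hnotO x hxH j⟩)
  · obtain ⟨⟨j, hj⟩, hxj⟩ := Set.mem_iUnion.mp hxT
    rcases hxT' with ⟨hxH, hxt'⟩ | hxT'
    · exact hdis x hxH (hj ⟨hxj, hnotO x hxH j⟩) hxt'
    · obtain ⟨⟨j', hj'⟩, hxj'⟩ := Set.mem_iUnion.mp hxT'
      have := hdisj j j' x hxj hxj'
      subst this
      exact hj' hj

/-! ### Handlebodies from fundamental cells -/

/-- A fundamental cell exhibiting `{f ≥ 0} / Γ` as a handlebody of genus `g`. In suitable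
coordinates `κ` of `ℝ³` the cell is the part `F ≥ 0` (where `F = f ∘ κ`) of the polytope
`ℓ i b ≤ 1`; it is strictly star-shaped about the origin. The faces `(i, true)` and `(i, false)`
of the polytope are paired by an element of `Γ`, which is `τ i` in the coordinates `κ`. The
affine chart `d i` of the plane of the face `(i, true)`, with retraction `r i`, is such that the
intersection of the cell with that face is strictly star-shaped about `d i 0`. -/
structure HandlebodyCell (Γ : Subgroup (E3 ≃ᵃⁱ[ℝ] E3)) (f : E3 → ℝ) (g : ℕ) where
  /-- The coordinates. -/
  κ : E3 ≃ₜ E3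
  /-- The functionals that define the faces of the polytope. -/
  ℓ : Fin g → Bool → E3 →L[ℝ] ℝ
  /-- The face pairings in the coordinates `κ`. -/
  τ : Fin g → E3 → E3
  /-- The affine charts of the faces. -/
  d : Fin g → E2 → E3
  /-- Retractions of `ℝ³` to the charts of the faces. -/
  r : Fin g → E3 → E2
  d_cont : ∀ i, Continuous (d i)
  r_cont : ∀ i, Continuous (r i)
  r_d : ∀ i z, r i (d i z) = z
  d_r : ∀ i v, ℓ i true v = 1 → d i (r i v) = v
  ℓ_d : ∀ i z, ℓ i true (d i z) = 1
  d_smul : ∀ i z (t : ℝ), d i (t • z) = (1 - t) • d i 0 + t • d i z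
  τ_spec : ∀ i, ∃ γ ∈ Γ, ∀ v, γ (κ v) = κ (τ i v)
  bounded : ∃ R : ℝ, ∀ v, (∀ i b, ℓ i b v ≤ 1) → 0 ≤ f (κ v) → ‖v‖ ≤ R
  center : 0 < f (κ 0)
  star : ∀ v, (∀ i b, ℓ i b v ≤ 1) → 0 ≤ f (κ v) → ∀ t : ℝ, 0 ≤ t → t < 1 → 0 < f (κ (t • v))
  face_inj : ∀ v, (∀ i b, ℓ i b v ≤ 1) → 0 ≤ f (κ v) → ∀ i b i' b', ℓ i b v = 1 →
    ℓ i' b' v = 1 → i = i' ∧ b = b'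
  face_center : ∀ i, (∀ i' b', ℓ i' b' (d i 0) ≤ 1) ∧ 0 < f (κ (d i 0))
  face_star : ∀ i z, (∀ i' b', ℓ i' b' (d i z) ≤ 1) → 0 ≤ f (κ (d i z)) →
    ∀ t : ℝ, 0 ≤ t → t < 1 → 0 < f (κ (d i (t • z)))
  pair : ∀ i v, (∀ i b, ℓ i b v ≤ 1) → 0 ≤ f (κ v) → ℓ i true v = 1 →
    (∀ i' b', ℓ i' b' (τ i v) ≤ 1) ∧ ℓ i false (τ i v) = 1
  pair_surj : ∀ i w, (∀ i b, ℓ i b w ≤ 1) → 0 ≤ f (κ w) → ℓ i false w = 1 →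
    ∃ v, (∀ i b, ℓ i b v ≤ 1) ∧ ℓ i true v = 1 ∧ τ i v = w
  tiling : ∀ γ ∈ Γ, ∀ v w, (∀ i b, ℓ i b v ≤ 1) → 0 ≤ f (κ v) → (∀ i b, ℓ i b w ≤ 1) →
    0 ≤ f (κ w) → γ (κ v) = κ w →
    v = w ∨ ∃ i, (ℓ i true v = 1 ∧ w = τ i v) ∨ (ℓ i true w = 1 ∧ v = τ i w)
  cover : ∀ x, 0 ≤ f x → ∃ γ ∈ Γ, ∃ v, (∀ i b, ℓ i b v ≤ 1) ∧ κ v = γ x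

namespace HandlebodyCell

variable {Γ : Subgroup (E3 ≃ᵃⁱ[ℝ] E3)} {f : E3 → ℝ} {g : ℕ} (K : HandlebodyCell Γ f g)

/-- The cell, as a set in the coordinates. -/
def body : Set E3 := {v | (∀ i b, K.ℓ i b v ≤ 1) ∧ 0 ≤ f (K.κ v)}

lemma isOpen_strict (hf : Continuous f) :
    IsOpen {v : E3 | (∀ i b, K.ℓ i b v < 1) ∧ 0 < f (K.κ v)} := by
  refine IsOpen.inter ?_ (isOpen_lt continuous_const (hf.comp K.κ.continuous))
  have : {v : E3 | ∀ i b, K.ℓ i b v < 1} = ⋂ (i) (b), {v | K.ℓ i b v < 1} := by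
    ext v
    simp
  change IsOpen {v : E3 | ∀ i b, K.ℓ i b v < 1}
  rw [this]
  exact isOpen_iInter_of_finite fun i => isOpen_iInter_of_finite fun b =>
    isOpen_lt (K.ℓ i b).continuous continuous_const

lemma isClosed_body (hf : Continuous f) : IsClosed K.body := by
  refine IsClosed.inter ?_ (isClosed_le continuous_const (hf.comp K.κ.continuous))
  have : {v : E3 | ∀ i b, K.ℓ i b v ≤ 1} = ⋂ (i) (b), {v | K.ℓ i b v ≤ 1} := by
    ext v
    simp
  change IsClosed {v : E3 | ∀ i b, K.ℓ i b v ≤ 1}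
  rw [this]
  exact isClosed_iInter fun i => isClosed_iInter fun b =>
    isClosed_le (K.ℓ i b).continuous continuous_const

lemma isCompact_body (hf : Continuous f) : IsCompact K.body := by
  obtain ⟨R, hR⟩ := K.bounded
  exact (isCompact_closedBall (0 : E3) R).of_isClosed_subset (K.isClosed_body hf)
    fun v hv => mem_closedBall_zero_iff.mpr (hR v hv.1 hv.2)

lemma smul_strict {v : E3} (hv : v ∈ K.body) {t : ℝ} (h0 : 0 ≤ t) (h1 : t < 1) :
    (∀ i b, K.ℓ i b (t • v) < 1) ∧ 0 < f (K.κ (t • v)) := by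
  refine ⟨fun i b => ?_, K.star v hv.1 hv.2 t h0 h1⟩
  rw [map_smul, smul_eq_mul]
  nlinarith [hv.1 i b]

lemma strict_subset_body : {v : E3 | (∀ i b, K.ℓ i b v < 1) ∧ 0 < f (K.κ v)} ⊆ K.body :=
  fun _ hv => ⟨fun i b => (hv.1 i b).le, hv.2.le⟩

lemma isStarBody (hf : Continuous f) : IsStarBody K.body where
  isCompact := K.isCompact_body hf
  zero_mem := interior_maximal K.strict_subset_body
    (K.isOpen_strict hf) ⟨fun i b => by simp, K.center⟩
  smul_mem v hv t h0 h1 := interior_maximal K.strict_subset_body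
    (K.isOpen_strict hf) (K.smul_strict hv h0 h1)

lemma mem_interior_iff (hf : Continuous f) {v : E3} :
    v ∈ interior K.body ↔ (∀ i b, K.ℓ i b v < 1) ∧ 0 < f (K.κ v) := by
  constructor
  · intro hv
    have hlim : Filter.Tendsto (fun t : ℝ => t • v) (𝓝[>] 1) (𝓝 v) := by
      have : Filter.Tendsto (fun t : ℝ => t • v) (𝓝 1) (𝓝 ((1 : ℝ) • v)) :=
        (continuous_id.smul continuous_const).tendsto 1
      rw [one_smul] at this
      exact this.mono_left nhdsWithin_le_nhds
    have h1 : ∀ᶠ t : ℝ in 𝓝[>] 1, t • v ∈ K.body :=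
      (hlim.eventually (mem_interior_iff_mem_nhds.mp hv))
    obtain ⟨t, ht, ht1⟩ := (h1.and self_mem_nhdsWithin).exists
    have ht1 : (1 : ℝ) < t := ht1
    have h := K.smul_strict ht (inv_nonneg.mpr (by linarith)) (inv_lt_one_of_one_lt₀ ht1)
    rwa [smul_smul, inv_mul_cancel₀ (by linarith), one_smul] at h
  · exact fun hv => interior_maximal K.strict_subset_body
      (K.isOpen_strict hf) hv

/-- The intersection of the cell with the face `(i, true)`, in the chart `d i`. -/
def disc (i : Fin g) : Set E2 := {z | K.d i z ∈ K.body}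

lemma disc_ℓ_lt {i : Fin g} {v : E3} (hv : v ∈ K.body) (hi : K.ℓ i true v = 1) {i' : Fin g}
    {b' : Bool} (hne : ¬ (i' = i ∧ b' = true)) : K.ℓ i' b' v < 1 := by
  refine lt_of_le_of_ne (hv.1 i' b') fun h => hne ?_
  obtain ⟨h1, h2⟩ := K.face_inj v hv.1 hv.2 i true i' b' hi h
  exact ⟨h1.symm, h2.symm⟩

lemma disc_smul_strict {i : Fin g} {z : E2} (hz : z ∈ K.disc i) {t : ℝ} (h0 : 0 ≤ t)
    (h1 : t < 1) : (∀ i' b', ¬ (i' = i ∧ b' = true) → K.ℓ i' b' (K.d i (t • z)) < 1) ∧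
      0 < f (K.κ (K.d i (t • z))) := by
  refine ⟨fun i' b' hne => ?_, K.face_star i z hz.1 hz.2 t h0 h1⟩
  have h2 : K.ℓ i' b' (K.d i 0) < 1 :=
    K.disc_ℓ_lt ⟨(K.face_center i).1, (K.face_center i).2.le⟩ (K.ℓ_d i 0) hne
  rw [K.d_smul, map_add, map_smul, map_smul, smul_eq_mul, smul_eq_mul]
  nlinarith [hz.1 i' b']

lemma isOpen_disc_strict (hf : Continuous f) (i : Fin g) :
    IsOpen {z : E2 | (∀ i' b', ¬ (i' = i ∧ b' = true) → K.ℓ i' b' (K.d i z) < 1) ∧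
      0 < f (K.κ (K.d i z))} := by
  refine IsOpen.inter ?_
    (isOpen_lt continuous_const (hf.comp (K.κ.continuous.comp (K.d_cont i))))
  have : {z : E2 | ∀ i' b', ¬ (i' = i ∧ b' = true) → K.ℓ i' b' (K.d i z) < 1} =
      ⋂ (i') (b'), {z | ¬ (i' = i ∧ b' = true) → K.ℓ i' b' (K.d i z) < 1} := by
    ext v
    simp
  change IsOpen {z : E2 | ∀ i' b', ¬ (i' = i ∧ b' = true) → K.ℓ i' b' (K.d i z) < 1}
  rw [this]
  refine isOpen_iInter_of_finite fun i' => isOpen_iInter_of_finite fun b' => ?_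
  by_cases h : i' = i ∧ b' = true
  · simp [h]
  · simp only [h, not_false_eq_true, forall_const]
    exact isOpen_lt ((K.ℓ i' b').continuous.comp (K.d_cont i)) continuous_const

lemma disc_strict_subset {i : Fin g} {z : E2}
    (hz : (∀ i' b', ¬ (i' = i ∧ b' = true) → K.ℓ i' b' (K.d i z) < 1) ∧
      0 < f (K.κ (K.d i z))) : z ∈ K.disc i := by
  refine ⟨fun i' b' => ?_, hz.2.le⟩
  by_cases h : i' = i ∧ b' = true
  · rw [h.1, h.2, K.ℓ_d]
  · exact (hz.1 i' b' h).le

lemma isStarBody_disc (hf : Continuous f) (i : Fin g) : IsStarBody (K.disc i) where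
  isCompact := by
    refine ((K.isCompact_body hf).image (K.r_cont i)).of_isClosed_subset
      ((K.isClosed_body hf).preimage (K.d_cont i)) fun z hz => ⟨K.d i z, hz, K.r_d i z⟩
  zero_mem := interior_maximal (fun _ hz => K.disc_strict_subset hz) (K.isOpen_disc_strict hf i)
    ⟨fun _ _ h => K.disc_ℓ_lt ⟨(K.face_center i).1, (K.face_center i).2.le⟩ (K.ℓ_d i 0) h,
      (K.face_center i).2⟩
  smul_mem z hz t h0 h1 := interior_maximal (fun _ hz => K.disc_strict_subset hz)
    (K.isOpen_disc_strict hf i) (K.disc_smul_strict hz h0 h1)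

lemma pos_of_mem_interior_disc {i : Fin g} {z : E2} (hz : z ∈ interior (K.disc i)) :
    0 < f (K.κ (K.d i z)) := by
  have hlim : Filter.Tendsto (fun t : ℝ => t • z) (𝓝[>] 1) (𝓝 z) := by
    have : Filter.Tendsto (fun t : ℝ => t • z) (𝓝 1) (𝓝 ((1 : ℝ) • z)) :=
      (continuous_id.smul continuous_const).tendsto 1
    rw [one_smul] at this
    exact this.mono_left nhdsWithin_le_nhds
  have h1 : ∀ᶠ t : ℝ in 𝓝[>] 1, t • z ∈ K.disc i :=
    (hlim.eventually (mem_interior_iff_mem_nhds.mp hz))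
  obtain ⟨t, ht, ht1⟩ := (h1.and self_mem_nhdsWithin).exists
  have ht1 : (1 : ℝ) < t := ht1
  have h := K.disc_smul_strict ht (inv_nonneg.mpr (by linarith)) (inv_lt_one_of_one_lt₀ ht1)
  rw [smul_smul, inv_mul_cancel₀ (by linarith), one_smul] at h
  exact h.2

lemma mem_interior_disc_of_pos (hf : Continuous f) {i : Fin g} {z : E2} (hz : z ∈ K.disc i)
    (hpos : 0 < f (K.κ (K.d i z))) : z ∈ interior (K.disc i) :=
  interior_maximal (fun _ hz => K.disc_strict_subset hz) (K.isOpen_disc_strict hf i)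
    ⟨fun _ _ h => K.disc_ℓ_lt hz (K.ℓ_d i z) h, hpos⟩

/-- Parametrisations of the faces of the cell by the closed unit disc, compatible with the
face pairings. -/
lemma exists_param (hf : Continuous f) (hΓ : ∀ γ ∈ Γ, ∀ x, f (γ x) = f x) :
    ∃ φ : Fin g → Bool → E2 → E3, (∀ i b, Continuous (φ i b)) ∧
      (∀ i z, φ i false z = K.τ i (φ i true z)) ∧
      (∀ i b z, ‖z‖ ≤ 1 → φ i b z ∈ K.body ∧ K.ℓ i b (φ i b z) = 1) ∧
      (∀ i b v, v ∈ K.body → K.ℓ i b v = 1 → ∃ z, ‖z‖ ≤ 1 ∧ φ i b z = v) ∧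
      (∀ i b, Function.Injective (φ i b)) ∧
      (∀ i b z, ‖z‖ ≤ 1 → (‖z‖ < 1 ↔ 0 < f (K.κ (φ i b z)))) := by
  choose hD hD1 hD2 using fun i => (K.isStarBody_disc hf i).exists_homeomorph
  choose γ hγ hγτ using K.τ_spec
  have hτ : ∀ i v, K.τ i v = K.κ.symm (γ i (K.κ v)) := fun i v => by
    rw [hγτ, Homeomorph.symm_apply_apply]
  have hfτ : ∀ i v, f (K.κ (K.τ i v)) = f (K.κ v) := fun i v => by rw [← hγτ, hΓ _ (hγ i)]
  have hτc : ∀ i, Continuous (K.τ i) := fun i => by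
    rw [show K.τ i = fun v => K.κ.symm (γ i (K.κ v)) from funext (hτ i)]
    exact K.κ.symm.continuous.comp ((γ i).continuous.comp K.κ.continuous)
  have hτi : ∀ i, Function.Injective (K.τ i) := fun i v w h => by
    rw [hτ, hτ] at h
    exact K.κ.injective ((γ i).injective (K.κ.symm.injective h))
  have hdi : ∀ i, Function.Injective (K.d i) := fun i z z' h => by
    rw [← K.r_d i z, h, K.r_d]
  have hmem : ∀ i z, ‖z‖ ≤ 1 → K.d i (hD i z) ∈ K.body := fun i z hz => (hD1 i z).mpr hz
  -- the face `(i, true)` is parametrised by its chart, its partner by the image under the pairing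
  refine ⟨fun i b z => if b then K.d i (hD i z) else K.τ i (K.d i (hD i z)), ?_, ?_, ?_, ?_, ?_,
    ?_⟩
  · rintro i (_ | _)
    · exact (hτc i).comp ((K.d_cont i).comp (hD i).continuous)
    · exact (K.d_cont i).comp (hD i).continuous
  · intro i z
    rfl
  · rintro i (_ | _) z hz
    · have h := K.pair i _ (hmem i z hz).1 (hmem i z hz).2 (K.ℓ_d i _)
      exact ⟨⟨h.1, (hfτ i _).symm ▸ (hmem i z hz).2⟩, h.2⟩
    · exact ⟨hmem i z hz, K.ℓ_d i _⟩
  · have key : ∀ i v, v ∈ K.body → K.ℓ i true v = 1 → ∃ z, ‖z‖ ≤ 1 ∧ K.d i (hD i z) = v := by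
      intro i v hv h1
      refine ⟨(hD i).symm (K.r i v), ?_, ?_⟩
      · rw [← hD1, Homeomorph.apply_symm_apply]
        change K.d i (K.r i v) ∈ K.body
        rwa [K.d_r i v h1]
      · rw [Homeomorph.apply_symm_apply, K.d_r i v h1]
    rintro i (_ | _) v hv h1
    · obtain ⟨w, hw, hw1, rfl⟩ := K.pair_surj i v hv.1 hv.2 h1
      obtain ⟨z, hz, rfl⟩ := key i w ⟨hw, (hfτ i w) ▸ hv.2⟩ hw1
      exact ⟨z, hz, rfl⟩
    · exact key i v hv h1
  · rintro i (_ | _)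
    · exact (hτi i).comp ((hdi i).comp (hD i).injective)
    · exact (hdi i).comp (hD i).injective
  · have key : ∀ i z, ‖z‖ ≤ 1 → (‖z‖ < 1 ↔ 0 < f (K.κ (K.d i (hD i z)))) := fun i z hz =>
      ⟨fun h => K.pos_of_mem_interior_disc ((hD2 i z).mpr h),
        fun h => (hD2 i z).mp (K.mem_interior_disc_of_pos hf ((hD1 i z).mpr hz) h)⟩
    rintro i (_ | _) z hz
    · change _ ↔ 0 < f (K.κ (K.τ i _))
      rw [hfτ]
      exact key i z hz
    · exact key i z hz

/-- The region `{f ≥ 0} / Γ` is a handlebody if it has a fundamental cell. -/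
theorem isHandlebody [IsSpaceFormGroup Γ] (K : HandlebodyCell Γ f g) (hg : 0 < g)
    (hf : Continuous f) (hΓ : ∀ γ ∈ Γ, ∀ x, f (γ x) = f x) :
    IsHandlebody g (proj Γ '' {x | 0 ≤ f x}) (proj Γ '' {x | f x = 0}) := by
  -- the closed ball is mapped to the body of the cell by `h`
  obtain ⟨h, h1, h2⟩ := (K.isStarBody hf).exists_homeomorph
  obtain ⟨φ, φc, φτ, φm, φs, φi, φp⟩ := K.exists_param hf hΓ
  have hproj : Continuous (proj Γ) := continuous_quot_mk
  have hnorm : ∀ v ∈ K.body, ‖h.symm v‖ ≤ 1 := fun v hv => by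
    rw [← h1, Homeomorph.apply_symm_apply]
    exact hv
  have hnorm1 : ∀ v ∈ K.body, (¬ ((∀ i b, K.ℓ i b v < 1) ∧ 0 < f (K.κ v))) →
      ‖h.symm v‖ = 1 := fun v hv hn => by
    refine le_antisymm (hnorm v hv) (not_lt.mp fun hlt => hn ?_)
    rw [← h2, Homeomorph.apply_symm_apply] at hlt
    exact (K.mem_interior_iff hf).mp hlt
  have hface1 : ∀ i b z, ‖z‖ ≤ 1 → ‖h.symm (φ i b z)‖ = 1 := fun i b z hz =>
    hnorm1 _ (φm i b z hz).1 fun hn => absurd (φm i b z hz).2 (hn.1 i b).ne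
  -- the two faces of a pair are glued along the same parametrisation
  have hglue : ∀ i z, proj Γ (K.κ (φ i false z)) = proj Γ (K.κ (φ i true z)) := fun i z => by
    obtain ⟨γ, hγ, hs⟩ := K.τ_spec i
    rw [proj_eq_iff]
    exact ⟨γ, hγ, by rw [hs, φτ]⟩
  set e : Fin g → Bool → E2 → E3 := fun i b z => h.symm (φ i b z) with he
  have einj : ∀ i b, ∀ z ∈ Metric.closedBall (0 : E2) 1, ∀ i' b',
      ∀ z' ∈ Metric.closedBall (0 : E2) 1, e i b z = e i' b' z' → i = i' ∧ b = b' ∧ z = z' := by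
    intro i b z hz i' b' z' hz' heq
    rw [mem_closedBall_zero_iff] at hz hz'
    have heq' : φ i b z = φ i' b' z' := h.symm.injective heq
    obtain ⟨rfl, rfl⟩ := K.face_inj _ (φm i b z hz).1.1 (φm i b z hz).1.2 i b i' b'
      (φm i b z hz).2 (heq' ▸ (φm i' b' z' hz').2)
    exact ⟨rfl, rfl, φi i b heq'⟩
  have ec : ∀ i b, Continuous (e i b) := fun i b => h.symm.continuous.comp (φc i b)
  -- a point of the sphere lies in an open disc if and only if `f` is positive there
  have hhole : ∀ x : E3, x ∈ holedSphere e ↔ ‖x‖ = 1 ∧ f (K.κ (h x)) = 0 := by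
    intro x
    constructor
    · rintro ⟨hx, hxU⟩
      rw [mem_sphere_zero_iff_norm] at hx
      refine ⟨hx, ?_⟩
      have hb : h x ∈ K.body := (h1 x).mpr hx.le
      have hnot : ¬ ((∀ i b, K.ℓ i b (h x) < 1) ∧ 0 < f (K.κ (h x))) := fun hn =>
        absurd ((h2 x).mp ((K.mem_interior_iff hf).mpr hn)) (by rw [hx]; exact lt_irrefl 1)
      by_contra hne
      have hpos : 0 < f (K.κ (h x)) := lt_of_le_of_ne hb.2 (Ne.symm hne)
      have : ∃ i b, K.ℓ i b (h x) = 1 := by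
        by_contra! hall
        exact hnot ⟨fun i b => lt_of_le_of_ne (hb.1 i b) (hall i b), hpos⟩
      obtain ⟨i, b, hib⟩ := this
      obtain ⟨z, hz, hzx⟩ := φs i b _ hb hib
      refine hxU (Set.mem_iUnion₂.mpr ⟨i, b, z, ?_, ?_⟩)
      · rw [mem_ball_zero_iff]
        exact (φp i b z hz).mpr (hzx ▸ hpos)
      · simp [he, hzx]
    · rintro ⟨hx, hx0⟩
      refine ⟨mem_sphere_zero_iff_norm.mpr hx, fun hxU => ?_⟩
      obtain ⟨i, b, z, hz, rfl⟩ := Set.mem_iUnion₂.mp hxU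
      rw [mem_ball_zero_iff] at hz
      have := (φp i b z hz.le).mp hz
      simp only [he, Homeomorph.apply_symm_apply] at hx0
      linarith
  refine ⟨e, fun x => proj Γ (K.κ (h x)), fun i b => (ec i b).continuousOn, ?_, einj, ?_,
    (hproj.comp (K.κ.continuous.comp h.continuous)).continuousOn, ?_, ?_, ?_⟩
  · intro i b z hz
    exact mem_sphere_zero_iff_norm.mpr (hface1 i b z (mem_closedBall_zero_iff.mp hz))
  · constructor
    -- a rim point lies in the holed sphere; for genus zero there would be no rim
    · obtain ⟨z, hz⟩ := NormedSpace.sphere_nonempty (x := (0 : E2)) (r := 1) |>.mpr zero_le_one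
      rw [mem_sphere_zero_iff_norm] at hz
      refine ⟨e ⟨0, hg⟩ true z, (hhole _).mpr ⟨hface1 _ _ z hz.le, ?_⟩⟩
      simp only [he, Homeomorph.apply_symm_apply]
      refine le_antisymm (not_lt.mp fun hp => ?_) (φm _ _ z hz.le).1.2
      exact absurd ((φp _ _ z hz.le).mpr hp) (by rw [hz]; exact lt_irrefl 1)
    · have hS : IsPreconnected (Metric.sphere (0 : E3) 1) :=
        isPreconnected_sphere (by simp [← Module.finrank_eq_rank]) _ _
      have hC : IsPreconnected (Metric.sphere (0 : E2) 1) :=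
        isPreconnected_sphere (by simp [← Module.finrank_eq_rank]) _ _
      have hrim : ∀ p : Fin g × Bool, e p.1 p.2 '' Metric.closedBall 0 1 \
          e p.1 p.2 '' Metric.ball 0 1 = e p.1 p.2 '' Metric.sphere 0 1 := by
        rintro ⟨i, b⟩
        have hinj : Function.Injective (e i b) := h.symm.injective.comp (φi i b)
        rw [← Set.image_sdiff hinj, Metric.closedBall_sdiff_ball]
      have hU : (⋃ (i : Fin g) (b : Bool), e i b '' Metric.ball (0 : E2) 1) =
          ⋃ p : Fin g × Bool, e p.1 p.2 '' Metric.ball (0 : E2) 1 := by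
        ext x
        simp
      have hcl : IsClosed (holedSphere e) := by
        have : holedSphere e = {x | ‖x‖ = 1 ∧ f (K.κ (h x)) = 0} := Set.ext hhole
        rw [this]
        exact (isClosed_eq continuous_norm continuous_const).inter
          (isClosed_eq (hf.comp (K.κ.continuous.comp h.continuous)) continuous_const)
      unfold holedSphere at hcl ⊢
      rw [hU] at hcl ⊢
      refine isPreconnected_diff_iUnion hS
        (fun p : Fin g × Bool => e p.1 p.2 '' Metric.closedBall 0 1) _ (fun p => ?_) ?_ ?_ ?_ ?_ hcl
      · exact ((isCompact_closedBall _ _).image (ec p.1 p.2)).isClosed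
      · rintro ⟨i, b⟩ _ ⟨z, hz, rfl⟩
        exact mem_sphere_zero_iff_norm.mpr (hface1 i b z (mem_closedBall_zero_iff.mp hz))
      · exact fun p => Set.image_mono Metric.ball_subset_closedBall
      · intro p
        rw [hrim]
        exact hC.image _ (ec p.1 p.2).continuousOn
      · rintro ⟨i, b⟩ ⟨i', b'⟩ _ ⟨z, hz, rfl⟩ ⟨z', hz', heq⟩
        obtain ⟨rfl, rfl, -⟩ := einj i b z hz i' b' z' hz' heq.symm
        rfl
  · intro x hx y hy
    rw [mem_closedBall_zero_iff] at hx hy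
    have hbx : h x ∈ K.body := (h1 x).mpr hx
    have hby : h y ∈ K.body := (h1 y).mpr hy
    constructor
    · intro hq
      obtain ⟨γ, hγ, hxy⟩ := (proj_eq_iff Γ).mp hq
      rcases K.tiling γ hγ (h y) (h x) hby.1 hby.2 hbx.1 hbx.2 hxy with heq | ⟨i, hi | hi⟩
      · exact Or.inl (h.injective heq).symm
      · obtain ⟨z, hz, hzy⟩ := φs i true _ hby hi.1
        refine Or.inr ⟨i, false, z, mem_closedBall_zero_iff.mpr hz, ?_, ?_⟩
        · simp only [he]
          rw [φτ, hzy, ← hi.2, Homeomorph.symm_apply_apply]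
        · simp [he, hzy]
      · obtain ⟨z, hz, hzx⟩ := φs i true _ hbx hi.1
        refine Or.inr ⟨i, true, z, mem_closedBall_zero_iff.mpr hz, ?_, ?_⟩
        · simp [he, hzx]
        · simp only [he, Bool.not_true]
          rw [φτ, hzx, ← hi.2, Homeomorph.symm_apply_apply]
    · rintro (rfl | ⟨i, b, z, hz, rfl, rfl⟩)
      · rfl
      · simp only [he, Homeomorph.apply_symm_apply]
        cases b
        · exact hglue i z
        · exact (hglue i z).symm
  · ext p
    constructor
    · rintro ⟨x, hx, rfl⟩
      exact ⟨_, ((h1 x).mpr (mem_closedBall_zero_iff.mp hx)).2, rfl⟩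
    · rintro ⟨x, hx, rfl⟩
      obtain ⟨γ, hγ, v, hv, hvx⟩ := K.cover x hx
      refine ⟨h.symm v, mem_closedBall_zero_iff.mpr (hnorm v ⟨hv, ?_⟩), ?_⟩
      · rw [hvx, hΓ γ hγ]
        exact hx
      · simp only [Homeomorph.apply_symm_apply]
        exact (proj_eq_iff Γ).mpr ⟨γ, hγ, hvx.symm⟩
  · ext p
    constructor
    · rintro ⟨x, hx, rfl⟩
      exact ⟨_, ((hhole x).mp hx).2, rfl⟩
    · rintro ⟨x, hx, rfl⟩
      have hx : f x = 0 := hx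
      obtain ⟨γ, hγ, v, hv, hvx⟩ := K.cover x hx.ge
      have hv0 : f (K.κ v) = 0 := by rw [hvx, hΓ γ hγ, hx]
      refine ⟨h.symm v, (hhole _).mpr ⟨hnorm1 v ⟨hv, hv0.ge⟩ fun hn => ?_, ?_⟩, ?_⟩
      · exact absurd hv0 hn.2.ne'
      · rw [Homeomorph.apply_symm_apply, hv0]
      · simp only [Homeomorph.apply_symm_apply]
        exact (proj_eq_iff Γ).mpr ⟨γ, hγ, hvx.symm⟩

end HandlebodyCell

/-! ### The differential of an isometry of Euclidean space -/

/-- The linear part of an isometry of `ℝ³`. -/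
def linPart (F : E3 ≃ᵃⁱ[ℝ] E3) : E3 →L[ℝ] E3 :=
  (F.linearIsometryEquiv.toContinuousLinearEquiv : E3 →L[ℝ] E3)

lemma apply_eq_linPart (F : E3 ≃ᵃⁱ[ℝ] E3) (x : E3) : F x = linPart F x + F 0 := by
  have h := F.map_vadd 0 x
  simpa [linPart] using h

lemma hasFDerivAt_isometry (F : E3 ≃ᵃⁱ[ℝ] E3) (x : E3) : HasFDerivAt F (linPart F) x := by
  have h : (F : E3 → E3) = fun y => linPart F y + F 0 := funext (apply_eq_linPart F)
  rw [h]
  exact (linPart F).hasFDerivAt.add_const _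

lemma contDiff_isometry (F : E3 ≃ᵃⁱ[ℝ] E3) : ContDiff ℝ ∞ F := by
  have h : (F : E3 → E3) = fun y => linPart F y + F 0 := funext (apply_eq_linPart F)
  rw [h]
  exact (linPart F).contDiff.add contDiff_const

/-! ### The projection to a closed Euclidean manifold -/

section Projection

variable (Γ : Subgroup (E3 ≃ᵃⁱ[ℝ] E3))

lemma continuous_proj : Continuous (proj Γ) := continuous_quot_mk

lemma proj_surjective : Function.Surjective (proj Γ) := Quotient.mk_surjective

variable {Γ} in
lemma proj_apply_of_mem {γ : E3 ≃ᵃⁱ[ℝ] E3} (hγ : γ ∈ Γ) (x : E3) : proj Γ (γ x) = proj Γ x :=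
  (proj_eq_iff Γ).mpr ⟨γ, hγ, rfl⟩

variable [hΓ : IsSpaceFormGroup Γ]

lemma isCoveringMap_proj : IsCoveringMap (proj Γ) :=
  (isQuotientCoveringMap_quotientMk_of_properlyDiscontinuousSMul (G := Γ) (E := E3)).isCoveringMap

/-- Two continuous maps to `ℝ³` with the same projection differ by an element of `Γ`. -/
lemma exists_mem_eq_of_proj_comp {A : Type*} [TopologicalSpace A] [ConnectedSpace A]
    {F G : A → E3} (hF : Continuous F) (hG : Continuous G)
    (h : ∀ x, proj Γ (F x) = proj Γ (G x)) : ∃ γ ∈ Γ, ∀ x, F x = γ (G x) := by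
  obtain ⟨a⟩ := (inferInstance : Nonempty A)
  obtain ⟨γ, hγ, ha⟩ := (proj_eq_iff Γ).mp (h a)
  refine ⟨γ, hγ, fun x => congrFun ((isCoveringMap_proj Γ).eq_of_comp_eq hF
    (γ.continuous.comp hG) ?_ a ha.symm) x⟩
  funext y
  simp only [Function.comp_apply]
  rw [proj_apply_of_mem hγ, h]

/-- Every continuous map from `ℝ³` to `ℝ³ / Γ` lifts to `ℝ³`. -/
lemma exists_lift {q : E3 → FlatManifold Γ} (hq : Continuous q) :
    ∃ Q : E3 → E3, Continuous Q ∧ ∀ x, proj Γ (Q x) = q x := by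
  obtain ⟨y, hy⟩ := proj_surjective Γ (q 0)
  obtain ⟨Q, ⟨-, hQ⟩, -⟩ := (isCoveringMap_proj Γ).existsUnique_continuousMap_lifts
    ⟨q, hq⟩ 0 y hy
  exact ⟨Q, Q.continuous, fun x => congrFun hQ x⟩

/-- In a chart, the projection is locally an element of `Γ`. -/
lemma chart_comp_proj_eventuallyEq {e : OpenPartialHomeomorph (FlatManifold Γ) E3}
    (he : e ∈ atlas E3 (FlatManifold Γ)) {x : E3} (hx : proj Γ x ∈ e.source) :
    ∃ γ ∈ Γ, γ x ∈ e.target ∧ (fun y => e (proj Γ y)) =ᶠ[𝓝 x] γ := by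
  have h1 : proj Γ (e (proj Γ x)) = proj Γ x := by
    rw [← symm_of_mem_atlas Γ he, e.left_inv hx]
  obtain ⟨γ, hγ, hγx⟩ := (proj_eq_iff Γ).mp h1
  have ht : γ x ∈ e.target := hγx ▸ e.map_source hx
  refine ⟨γ, hγ, ht, ?_⟩
  filter_upwards [γ.continuous.continuousAt.preimage_mem_nhds (e.open_target.mem_nhds ht)]
    with y hy
  rw [← proj_apply_of_mem hγ y, ← symm_of_mem_atlas Γ he, e.right_inv hy]

lemma hasMFDerivAt_proj (x : E3) :
    ∃ γ ∈ Γ, HasMFDerivAt (𝓡 3) (𝓡 3) (proj Γ) x (linPart γ) := by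
  obtain ⟨γ, hγ, -, h⟩ := chart_comp_proj_eventuallyEq Γ (chart_mem_atlas E3 (proj Γ x))
    (mem_chart_source E3 (proj Γ x))
  refine ⟨γ, hγ, (continuous_proj Γ).continuousAt, ?_⟩
  refine HasFDerivAt.hasFDerivWithinAt ?_
  refine (hasFDerivAt_isometry γ x).congr_of_eventuallyEq ?_
  filter_upwards [h] with y hy
  rw [← hy]
  rfl

lemma contMDiff_proj : ContMDiff (𝓡 3) (𝓡 3) ∞ (proj Γ) := by
  intro x
  obtain ⟨γ, hγ, ht, h⟩ := chart_comp_proj_eventuallyEq Γ (chart_mem_atlas E3 (proj Γ x))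
    (mem_chart_source E3 (proj Γ x))
  have h1 : ContMDiffAt (𝓡 3) (𝓡 3) ∞ (chartAt E3 (proj Γ x)).symm (γ x) :=
    (contMDiffOn_chart_symm (I := 𝓡 3) (n := ∞)).contMDiffAt
      ((chartAt E3 (proj Γ x)).open_target.mem_nhds ht)
  have h2 : ContMDiffAt (𝓡 3) (𝓡 3) ∞ γ x := (contDiff_isometry γ).contMDiff.contMDiffAt
  refine (h1.comp x h2).congr_of_eventuallyEq (Filter.Eventually.of_forall fun y => ?_)
  simp only [Function.comp_apply]
  rw [symm_of_mem_atlas Γ (chart_mem_atlas E3 _), proj_apply_of_mem hγ]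

/-- A map on `ℝ³ / Γ` is smooth if its composition with the projection is smooth. -/
lemma contMDiff_of_comp_proj {H E' N : Type*} [NormedAddCommGroup E'] [NormedSpace ℝ E']
    [TopologicalSpace H] {J : ModelWithCorners ℝ E' H} [TopologicalSpace N] [ChartedSpace H N]
    {φ : FlatManifold Γ → N} (h : ContMDiff (𝓡 3) J ∞ (fun x => φ (proj Γ x))) :
    ContMDiff (𝓡 3) J ∞ φ := by
  intro p
  have h1 : ContMDiffAt (𝓡 3) (𝓡 3) ∞ (chartAt E3 p) p :=
    (contMDiffOn_chart (I := 𝓡 3) (n := ∞)).contMDiffAt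
      ((chartAt E3 p).open_source.mem_nhds (mem_chart_source E3 p))
  refine (ContMDiffAt.comp p (h.contMDiffAt (x := chartAt E3 p p)) h1).congr_of_eventuallyEq ?_
  filter_upwards [(chartAt E3 p).open_source.mem_nhds (mem_chart_source E3 p)] with q hq
  simp only [Function.comp_apply]
  rw [← symm_of_mem_atlas Γ (chart_mem_atlas E3 p), (chartAt E3 p).left_inv hq]

/-! ### Orientations of closed Euclidean manifolds -/

lemma det_tangentCoordChange (hdet : ∀ γ ∈ Γ, (linPart γ).det = 1) {p q : FlatManifold Γ}
    (hq : q ∈ (chartAt E3 p).source) :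
    haveI : IsManifold (𝓡 3) 1 (FlatManifold Γ) := IsManifold.of_le (n := ∞) (by decide)
    (tangentCoordChange (𝓡 3) q p q).det = 1 := by
  have : IsManifold (𝓡 3) 1 (FlatManifold Γ) := IsManifold.of_le (n := ∞) (by decide)
  have hpq : proj Γ (chartAt E3 q q) = q := by
    rw [← symm_of_mem_atlas Γ (chart_mem_atlas E3 q),
      (chartAt E3 q).left_inv (mem_chart_source E3 q)]
  obtain ⟨γ, hγ, -, h⟩ := chart_comp_proj_eventuallyEq Γ (chart_mem_atlas E3 p)
    (x := chartAt E3 q q) (hpq.symm ▸ hq)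
  have h1 : HasFDerivAt (extChartAt (𝓡 3) p ∘ (extChartAt (𝓡 3) q).symm) (linPart γ)
      (extChartAt (𝓡 3) q q) := by
    refine (hasFDerivAt_isometry γ (chartAt E3 q q)).congr_of_eventuallyEq ?_
    filter_upwards [h] with y hy
    rw [← hy]
    simp only [mfld_simps]
    rw [symm_of_mem_atlas Γ (chart_mem_atlas E3 q)]
  have h2 : tangentCoordChange (𝓡 3) q p q = linPart γ := by
    rw [tangentCoordChange_def, ModelWithCorners.range_eq_univ, fderivWithin_univ]
    exact h1.fderiv
  rw [h2]
  exact hdet γ hγ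

lemma isOrientation_one (hdet : ∀ γ ∈ Γ, (linPart γ).det = 1) :
    IsOrientation (fun _ : FlatManifold Γ => 1) := by
  intro p
  filter_upwards [(chartAt E3 p).open_source.mem_nhds (mem_chart_source E3 p)] with q hq
  rw [det_tangentCoordChange Γ hdet hq]
  norm_num

/-- An orientation of the connected manifold `ℝ³ / Γ` is constant if `Γ` preserves the orientation
of `ℝ³`. -/
lemma IsOrientation.eq_const (hdet : ∀ γ ∈ Γ, (linPart γ).det = 1) {o : FlatManifold Γ → ℤˣ}
    (ho : IsOrientation o) (p q : FlatManifold Γ) : o p = o q := by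
  have hloc : IsLocallyConstant o := by
    rw [IsLocallyConstant.iff_eventually_eq]
    intro p
    filter_upwards [ho p, (chartAt E3 p).open_source.mem_nhds (mem_chart_source E3 p)]
      with q hq hqs
    rw [det_tangentCoordChange Γ hdet hqs, mul_one] at hq
    rcases Int.units_eq_one_or (o p) with h | h <;>
    rcases Int.units_eq_one_or (o q) with h' | h' <;>
      rw [h, h'] at hq ⊢ <;> norm_num at hq
  exact hloc.apply_eq_of_isPreconnected isPreconnected_univ trivial trivial

variable {Γ}

lemma jacobian_eq_det (hdet : ∀ γ ∈ Γ, (linPart γ).det = 1) {F : E3 ≃ᵃⁱ[ℝ] E3}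
    {f : Diffeo (FlatManifold Γ)} (hf : ∀ x, f (proj Γ x) = proj Γ (F x)) (p : FlatManifold Γ) :
    jacobian f p = (linPart F).det := by
  obtain ⟨x, rfl⟩ := proj_surjective Γ p
  obtain ⟨γ, hγ, h1⟩ := hasMFDerivAt_proj Γ x
  obtain ⟨γ', hγ', h2⟩ := hasMFDerivAt_proj Γ (F x)
  have h3 : HasMFDerivAt (𝓡 3) (𝓡 3) F x (linPart F) := (hasFDerivAt_isometry F x).hasMFDerivAt
  have h4 : HasMFDerivAt (𝓡 3) (𝓡 3) f (proj Γ x) (mfderiv (𝓡 3) (𝓡 3) f (proj Γ x)) :=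
    (f.mdifferentiable (by simp) _).hasMFDerivAt
  have h5 := h4.comp x h1
  have h6 := h2.comp x h3
  have h7 : (f ∘ proj Γ : E3 → FlatManifold Γ) = proj Γ ∘ F := funext hf
  rw [h7] at h5
  have h8 := hasMFDerivAt_unique h5 h6
  have hcomp : ∀ A B : E3 →L[ℝ] E3, (A.comp B).det = A.det * B.det :=
    fun A B => LinearMap.det_comp _ _
  have key : ∀ A : E3 →L[ℝ] E3, A.comp (linPart γ) = (linPart γ').comp (linPart F) →
      A.det = (linPart F).det := fun A hA => by
    have h9 := congrArg ContinuousLinearMap.det hA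
    rwa [hcomp, hcomp, hdet γ hγ, hdet γ' hγ', mul_one, one_mul] at h9
  exact key _ h8

lemma preservesOrientation_iff (hdet : ∀ γ ∈ Γ, (linPart γ).det = 1) {F : E3 ≃ᵃⁱ[ℝ] E3}
    {f : Diffeo (FlatManifold Γ)} (hf : ∀ x, f (proj Γ x) = proj Γ (F x)) :
    PreservesOrientation f ↔ 0 < (linPart F).det := by
  constructor
  · intro h
    have := h _ (isOrientation_one Γ hdet) (proj Γ 0)
    rw [jacobian_eq_det hdet hf] at this
    simpa using this
  · intro h o ho p
    rw [jacobian_eq_det hdet hf, IsOrientation.eq_const Γ hdet ho p (f p), unit_sq, one_mul]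
    exact h

lemma reversesOrientation_of_det_neg (hdet : ∀ γ ∈ Γ, (linPart γ).det = 1) {F : E3 ≃ᵃⁱ[ℝ] E3}
    {f : Diffeo (FlatManifold Γ)} (hf : ∀ x, f (proj Γ x) = proj Γ (F x))
    (h : (linPart F).det < 0) : ReversesOrientation f := by
  intro o ho p
  rw [jacobian_eq_det hdet hf, IsOrientation.eq_const Γ hdet ho p (f p), unit_sq, one_mul]
  exact h

/-! ### Diffeomorphisms induced by isometries of Euclidean space -/

variable (Γ) in
/-- The isometries of `ℝ³` which normalize `Γ`, and therefore act on `ℝ³ / Γ`. -/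
abbrev normalizerGroup : Subgroup (E3 ≃ᵃⁱ[ℝ] E3) :=
  Subgroup.normalizer (Γ : Set (E3 ≃ᵃⁱ[ℝ] E3))

omit hΓ in
lemma exists_descend (F : normalizerGroup Γ) : ∃ φ : FlatManifold Γ → FlatManifold Γ,
    ∀ x, φ (proj Γ x) = proj Γ (F.1 x) := by
  refine ⟨Quotient.map (sa := MulAction.orbitRel Γ E3) (sb := MulAction.orbitRel Γ E3) F.1 ?_,
    fun x => rfl⟩
  rintro _ x ⟨γ, rfl⟩
  refine Quotient.exact (s := MulAction.orbitRel Γ E3) ?_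
  refine (proj_eq_iff Γ).mpr ⟨F.1 * γ.1 * F.1⁻¹,
    (Subgroup.mem_normalizer_iff.mp F.2 γ.1).mp γ.2, ?_⟩
  change F.1 (γ.1 (F.1⁻¹ (F.1 x))) = F.1 (γ.1 x)
  congr 2
  exact F.1.symm_apply_apply x

/-- The action on `ℝ³ / Γ` of an isometry which normalizes `Γ`. -/
def descendFun (F : normalizerGroup Γ) : FlatManifold Γ → FlatManifold Γ :=
  (exists_descend F).choose

omit hΓ in
lemma descendFun_proj (F : normalizerGroup Γ) (x : E3) :
    descendFun F (proj Γ x) = proj Γ (F.1 x) := (exists_descend F).choose_spec x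

omit hΓ in
lemma descendFun_mul (F F' : normalizerGroup Γ) (p : FlatManifold Γ) :
    descendFun (F * F') p = descendFun F (descendFun F' p) := by
  obtain ⟨x, rfl⟩ := proj_surjective Γ p
  rw [descendFun_proj, descendFun_proj, descendFun_proj]
  rfl

omit hΓ in
lemma descendFun_one (p : FlatManifold Γ) : descendFun (1 : normalizerGroup Γ) p = p := by
  obtain ⟨x, rfl⟩ := proj_surjective Γ p
  rw [descendFun_proj]
  rfl

lemma contMDiff_descendFun (F : normalizerGroup Γ) :
    ContMDiff (𝓡 3) (𝓡 3) ∞ (descendFun F) := by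
  refine contMDiff_of_comp_proj Γ ?_
  simp only [descendFun_proj]
  exact (contMDiff_proj Γ).comp (contDiff_isometry F.1).contMDiff

variable (Γ) in
/-- The action on `ℝ³ / Γ` of the normalizer of `Γ`. -/
def descend : normalizerGroup Γ →* Diffeo (FlatManifold Γ) where
  toFun F :=
    { toFun := descendFun F
      invFun := descendFun F⁻¹
      left_inv := fun p => by rw [← descendFun_mul, inv_mul_cancel, descendFun_one]
      right_inv := fun p => by rw [← descendFun_mul, mul_inv_cancel, descendFun_one]
      contMDiff_toFun := contMDiff_descendFun F
      contMDiff_invFun := contMDiff_descendFun F⁻¹ }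
  map_one' := Diffeomorph.ext fun p => descendFun_one p
  map_mul' F F' := Diffeomorph.ext fun p => descendFun_mul F F' p

lemma descend_proj (F : normalizerGroup Γ) (x : E3) :
    descend Γ F (proj Γ x) = proj Γ (F.1 x) := descendFun_proj F x

lemma descend_eq_one_iff (F : normalizerGroup Γ) : descend Γ F = 1 ↔ F.1 ∈ Γ := by
  constructor
  · intro h
    obtain ⟨γ, hγ, hF⟩ := exists_mem_eq_of_proj_comp Γ F.1.continuous continuous_id
      (fun x => by rw [← descend_proj, h]; rfl)
    rwa [show F.1 = γ from AffineIsometryEquiv.ext hF]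
  · intro h
    refine Diffeomorph.ext fun p => ?_
    obtain ⟨x, rfl⟩ := proj_surjective Γ p
    rw [descend_proj, proj_apply_of_mem h]
    rfl

omit hΓ in
lemma mem_normalizerGroup {F : E3 ≃ᵃⁱ[ℝ] E3} (h : ∀ γ ∈ Γ, F * γ * F⁻¹ ∈ Γ)
    (h' : ∀ γ ∈ Γ, F⁻¹ * γ * F ∈ Γ) : F ∈ normalizerGroup Γ := by
  refine Subgroup.mem_normalizer_iff.mpr fun γ => ⟨h γ, fun hγ => ?_⟩
  have := h' _ hγ
  simpa [mul_assoc] using this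

/-! ### Heegaard splittings as zero sets -/

lemma IsHandlebody.image {M M' : Type*} [TopologicalSpace M] [TopologicalSpace M'] {g : ℕ}
    {V S : Set M} (h : IsHandlebody g V S) {φ : M → M'} (hφ : Continuous φ)
    (hi : Function.Injective φ) : IsHandlebody g (φ '' V) (φ '' S) := by
  obtain ⟨e, q, h1, h2, h3, h4, h5, h6, h7, h8⟩ := h
  refine ⟨e, φ ∘ q, h1, h2, h3, h4, hφ.comp_continuousOn h5, fun x hx y hy => ?_, ?_, ?_⟩
  · rw [← h6 x hx y hy]
    exact hi.eq_iff
  · rw [Set.image_comp, h7]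
  · rw [Set.image_comp, h8]

variable {f : E3 → ℝ}

lemma image_descend_of_comp_eq {F : normalizerGroup Γ} {s t : Set E3}
    (h : ∀ x, F.1 x ∈ t ↔ x ∈ s) : descend Γ F '' (proj Γ '' s) = proj Γ '' t := by
  ext p
  constructor
  · rintro ⟨_, ⟨x, hx, rfl⟩, rfl⟩
    exact ⟨F.1 x, (h x).mpr hx, (descend_proj F x).symm⟩
  · rintro ⟨y, hy, rfl⟩
    have hy' : F.1 (F.1.symm y) = y := F.1.apply_symm_apply y
    refine ⟨_, ⟨F.1.symm y, (h _).mp (hy'.symm ▸ hy), rfl⟩, ?_⟩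
    rw [descend_proj, hy']

lemma preserves_descend {F : normalizerGroup Γ} (h : ∀ x, f (F.1 x) = f x) :
    Preserves (descend Γ F) (proj Γ '' {x | 0 ≤ f x}) (proj Γ '' {x | f x ≤ 0}) :=
  ⟨image_descend_of_comp_eq fun x => by simp [h], image_descend_of_comp_eq fun x => by simp [h]⟩

lemma interchanges_descend {F : normalizerGroup Γ} (h : ∀ x, f (F.1 x) = -f x) :
    Interchanges (descend Γ F) (proj Γ '' {x | 0 ≤ f x}) (proj Γ '' {x | f x ≤ 0}) :=
  ⟨image_descend_of_comp_eq fun x => by simp [h], image_descend_of_comp_eq fun x => by simp [h]⟩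

/-- A smooth `Γ`-invariant function without critical zeros defines a Heegaard splitting if one
side of its zero set is a handlebody and some isometry changes the sign of the function. -/
theorem isHeegaardSplitting_of_function {g : ℕ} (hf : ContDiff ℝ ∞ f)
    (hinv : ∀ γ ∈ Γ, ∀ x, f (γ x) = f x) (hreg : ∀ x, f x = 0 → fderiv ℝ f x ≠ 0)
    (hV : IsHandlebody g (proj Γ '' {x | 0 ≤ f x}) (proj Γ '' {x | f x = 0}))
    {F : normalizerGroup Γ} (hF : ∀ x, f (F.1 x) = -f x) :
    IsHeegaardSplitting g (proj Γ '' {x | 0 ≤ f x}) (proj Γ '' {x | f x ≤ 0}) := by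
  have hlift : ∀ x y, proj Γ x = proj Γ y → f x = f y := by
    intro x y h
    obtain ⟨γ, hγ, rfl⟩ := (proj_eq_iff Γ).mp h
    exact hinv γ hγ y
  have hmem : ∀ (s : Set ℝ) (x : E3), proj Γ x ∈ proj Γ '' {y | f y ∈ s} ↔ f x ∈ s := by
    intro s x
    refine ⟨?_, fun h => ⟨x, h, rfl⟩⟩
    rintro ⟨y, hy, hxy⟩
    rw [← hlift y x hxy]
    exact hy
  have hmemV : ∀ x, proj Γ x ∈ proj Γ '' {y | 0 ≤ f y} ↔ 0 ≤ f x := hmem (Set.Ici 0)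
  have hmemW : ∀ x, proj Γ x ∈ proj Γ '' {y | f y ≤ 0} ↔ f x ≤ 0 := hmem (Set.Iic 0)
  have hmemS : ∀ x, proj Γ x ∈ proj Γ '' {y | f y = 0} ↔ f x = 0 := hmem {0}
  have hS : proj Γ '' {x | 0 ≤ f x} ∩ proj Γ '' {x | f x ≤ 0} = proj Γ '' {x | f x = 0} := by
    ext p
    obtain ⟨x, rfl⟩ := proj_surjective Γ p
    rw [Set.mem_inter_iff, hmemV, hmemW, hmemS]
    exact ⟨fun h => le_antisymm h.2 h.1, fun h => ⟨h.ge, h.le⟩⟩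
  have hfS : descend Γ F '' (proj Γ '' {x | f x = 0}) = proj Γ '' {x | f x = 0} :=
    image_descend_of_comp_eq fun x => by simp [hF]
  refine ⟨?_, hS ▸ hV, ?_, ?_⟩
  · refine Set.eq_univ_of_forall fun p => ?_
    obtain ⟨x, rfl⟩ := proj_surjective Γ p
    rw [Set.mem_union, hmemV, hmemW]
    exact le_total _ _
  -- the side `f ≤ 0` is the image of the side `f ≥ 0` under the isometry
  · rw [hS, ← hfS, ← (interchanges_descend hF).1]
    exact hV.image (descend Γ F).continuous (descend Γ F).injective
  -- the function induced by `f` on the quotient defines the surface locally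
  · intro p hp
    obtain ⟨x, rfl⟩ := proj_surjective Γ p
    rw [hS, hmemS] at hp
    obtain ⟨φ, hφ⟩ : ∃ φ : FlatManifold Γ → ℝ, ∀ y, φ (proj Γ y) = f y :=
      ⟨Quotient.lift f fun a b hab => hlift a b (Quotient.sound hab), fun y => rfl⟩
    have hsm : ContMDiff (𝓡 3) 𝓘(ℝ, ℝ) ∞ φ := by
      refine contMDiff_of_comp_proj Γ ?_
      simp only [hφ]
      exact hf.contMDiff
    refine ⟨Set.univ, isOpen_univ, trivial, φ, hsm.contMDiffOn, fun h0 => ?_, ?_⟩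
    · obtain ⟨γ, -, h1⟩ := hasMFDerivAt_proj Γ x
      have h2 := ((hsm.mdifferentiable (by simp) (proj Γ x)).hasMFDerivAt).comp x h1
      have h3 : (φ ∘ proj Γ : E3 → ℝ) = f := funext hφ
      rw [h3, h0] at h2
      have h4 : HasFDerivAt f ((0 : E3 →L[ℝ] ℝ).comp (linPart γ)) x := h2.hasFDerivAt
      rw [ContinuousLinearMap.zero_comp] at h4
      exact hreg x hp h4.fderiv
    · intro q _
      obtain ⟨y, rfl⟩ := proj_surjective Γ q
      rw [hmemV, hmemW, hφ]
      exact ⟨Iff.rfl, Iff.rfl⟩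

end Projection

/-! ### Signed permutations of the coordinates -/

lemma continuous_toLp_of_coord {n : ℕ} {X : Type*} [TopologicalSpace X]
    {φ : X → EuclideanSpace ℝ (Fin n)} (h : ∀ i, Continuous fun x => φ x i) : Continuous φ := by
  have : φ = fun x => WithLp.toLp 2 (fun i => φ x i) := rfl
  rw [this]
  exact (PiLp.continuous_toLp 2 _).comp (continuous_pi h)

lemma continuous_coord {n : ℕ} (i : Fin n) :
    Continuous fun x : EuclideanSpace ℝ (Fin n) => x i :=
  (EuclideanSpace.proj i : EuclideanSpace ℝ (Fin n) →L[ℝ] ℝ).continuous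

lemma contDiff_coord {n : ℕ} (i : Fin n) :
    ContDiff ℝ ∞ fun x : EuclideanSpace ℝ (Fin n) => x i :=
  (EuclideanSpace.proj i : EuclideanSpace ℝ (Fin n) →L[ℝ] ℝ).contDiff

/-- The `i`-th coordinate, as a functional on `ℝ³`. -/
abbrev coordCLM (i : Fin 3) : E3 →L[ℝ] ℝ := EuclideanSpace.proj i

lemma hasFDerivAt_coord (i : Fin 3) (x : E3) :
    HasFDerivAt (fun x : E3 => x i) (coordCLM i) x := (coordCLM i).hasFDerivAt

/-- The isometry `x ↦ (ε i * x (σ i) + v i)_i` of `ℝ³`. -/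
def signedPerm (σ : Equiv.Perm (Fin 3)) (ε : Fin 3 → ℤˣ) (v : Fin 3 → ℝ) : E3 ≃ᵃⁱ[ℝ] E3 :=
  signedTranslation (fun i => decide (ε i = -1)) v *
    (LinearIsometryEquiv.piLpCongrLeft 2 ℝ ℝ σ.symm).toAffineIsometryEquiv

lemma signedPerm_apply (σ : Equiv.Perm (Fin 3)) (ε : Fin 3 → ℤˣ) (v : Fin 3 → ℝ) (x : E3)
    (i : Fin 3) : signedPerm σ ε v x i = ((ε i : ℤ) : ℝ) * x (σ i) + v i := by
  unfold signedPerm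
  rw [AffineIsometryEquiv.coe_mul, Function.comp_apply, signedTranslation_apply]
  have h : (LinearIsometryEquiv.piLpCongrLeft 2 ℝ ℝ σ.symm).toAffineIsometryEquiv x i
      = x (σ i) := rfl
  rw [h]
  rcases Int.units_eq_one_or (ε i) with h1 | h1 <;> simp [h1, add_comm]

lemma isometry_ext {F F' : E3 ≃ᵃⁱ[ℝ] E3} (h : ∀ x i, F x i = F' x i) : F = F' := by
  ext x i
  exact h x i

lemma signedPerm_mul (σ σ' : Equiv.Perm (Fin 3)) (ε ε' : Fin 3 → ℤˣ) (v v' : Fin 3 → ℝ) :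
    signedPerm σ ε v * signedPerm σ' ε' v' =
      signedPerm (σ' * σ) (fun i => ε i * ε' (σ i))
        (fun i => ((ε i : ℤ) : ℝ) * v' (σ i) + v i) := by
  refine isometry_ext fun x i => ?_
  rw [AffineIsometryEquiv.coe_mul, Function.comp_apply, signedPerm_apply, signedPerm_apply,
    signedPerm_apply, Equiv.Perm.mul_apply]
  push_cast
  ring

lemma signedPerm_inv (σ : Equiv.Perm (Fin 3)) (ε : Fin 3 → ℤˣ) (v : Fin 3 → ℝ) :
    (signedPerm σ ε v)⁻¹ = signedPerm σ⁻¹ (fun i => ε (σ⁻¹ i))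
      (fun i => -(((ε (σ⁻¹ i) : ℤˣ) : ℤ) : ℝ) * v (σ⁻¹ i)) := by
  rw [inv_eq_iff_mul_eq_one, signedPerm_mul]
  refine isometry_ext fun x i => ?_
  rw [signedPerm_apply]
  have h : ((ε i : ℤ) : ℝ) * ((ε i : ℤ) : ℝ) = 1 := unit_sq _
  have hσ : σ⁻¹ (σ i) = i := σ.symm_apply_apply i
  simp only [hσ, inv_mul_cancel, Equiv.Perm.one_apply,
    AffineIsometryEquiv.coe_one, id_eq]
  push_cast
  linear_combination (x i - v i) * h

lemma det_linPart_of_apply {F : E3 ≃ᵃⁱ[ℝ] E3} {σ : Equiv.Perm (Fin 3)} {ε : Fin 3 → ℤˣ}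
    {v : Fin 3 → ℝ} (h : ∀ x i, F x i = ((ε i : ℤ) : ℝ) * x (σ i) + v i) :
    (linPart F).det = ((Equiv.Perm.sign σ * ∏ i, ε i : ℤˣ) : ℤ) := by
  have hL : ∀ x i, linPart F x i = ((ε i : ℤ) : ℝ) * x (σ i) := fun x i => by
    have h1 := congrArg (fun y : E3 => y i) (apply_eq_linPart F x)
    simp only [PiLp.add_apply, h] at h1
    simpa using h1.symm
  set b := (EuclideanSpace.basisFun (Fin 3) ℝ).toBasis with hb
  have hM : (linPart F : E3 →ₗ[ℝ] E3) = Matrix.toLin b b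
      (Matrix.of fun i j => ((ε i : ℤ) : ℝ) * (σ.toPEquiv.toMatrix : Matrix _ _ ℝ) i j) := by
    refine b.ext fun j => ?_
    rw [Matrix.toLin_self]
    ext i
    change linPart F (b j) i = _
    rw [hL]
    simp only [hb, OrthonormalBasis.coe_toBasis, EuclideanSpace.basisFun_apply, Matrix.of_apply,
      PEquiv.toMatrix_apply, Equiv.toPEquiv_apply, Option.mem_def, Option.some.injEq]
    rw [WithLp.ofLp_sum, Finset.sum_apply]
    simp only [PiLp.smul_apply, smul_eq_mul, PiLp.single_apply]
    rw [Finset.sum_eq_single i (fun k _ hk => by simp [Ne.symm hk]) (by simp)]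
    by_cases hij : σ i = j <;> simp [hij]
  change LinearMap.det (linPart F : E3 →ₗ[ℝ] E3) = _
  rw [hM, LinearMap.det_toLin, Matrix.det_mul_column, Matrix.det_permutation]
  push_cast
  ring

lemma det_linPart_signedPerm (σ : Equiv.Perm (Fin 3)) (ε : Fin 3 → ℤˣ) (v : Fin 3 → ℝ) :
    (linPart (signedPerm σ ε v)).det = ((Equiv.Perm.sign σ * ∏ i, ε i : ℤˣ) : ℤ) :=
  det_linPart_of_apply (signedPerm_apply σ ε v)

/-! ### Monotonicity of the cosine along rays -/

lemma cos_le_cos_mul {x t : ℝ} (hx : |x| ≤ Real.pi) (h0 : 0 ≤ t) (h1 : t ≤ 1) :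
    Real.cos x ≤ Real.cos (t * x) := by
  rw [← Real.cos_abs x, ← Real.cos_abs (t * x), abs_mul, abs_of_nonneg h0]
  exact Real.cos_le_cos_of_nonneg_of_le_pi (by positivity) hx
    (mul_le_of_le_one_left (abs_nonneg x) h1)

lemma cos_lt_cos_mul {x t : ℝ} (hx : |x| ≤ Real.pi) (h0 : 0 ≤ t) (h1 : t < 1) (hx0 : x ≠ 0) :
    Real.cos x < Real.cos (t * x) := by
  rw [← Real.cos_abs x, ← Real.cos_abs (t * x), abs_mul, abs_of_nonneg h0]
  exact Real.cos_lt_cos_of_nonneg_of_le_pi (by positivity) hx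
    (mul_lt_of_lt_one_left (abs_pos.mpr hx0) h1)

lemma sum_cos_lt_sum_cos_mul {n : ℕ} {x : EuclideanSpace ℝ (Fin n)} {t : ℝ}
    (hx : ∀ i, |x i| ≤ Real.pi) (h0 : 0 ≤ t) (h1 : t < 1) (hx0 : x ≠ 0) :
    ∑ i, Real.cos (x i) < ∑ i, Real.cos (t * x i) := by
  have : ∃ i, x i ≠ 0 := by
    by_contra! h
    exact hx0 (by ext i; simp [h])
  obtain ⟨i, hi⟩ := this
  exact Finset.sum_lt_sum (fun j _ => cos_le_cos_mul (hx j) h0 h1.le)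
    ⟨i, Finset.mem_univ i, cos_lt_cos_mul (hx i) h0 h1 hi⟩

/-! ### The faces of a cube -/

/-- The chart of the face `x i = π` of the cube `[-π, π]³`. -/
def cubeFace (i : Fin 3) (z : E2) : E3 := WithLp.toLp 2 (i.insertNth Real.pi z.ofLp)

/-- The projection of `ℝ³` along the `i`-th axis. -/
def dropCoord (i : Fin 3) (v : E3) : E2 := WithLp.toLp 2 fun j => v (i.succAbove j)

lemma cubeFace_same (i : Fin 3) (z : E2) : cubeFace i z i = Real.pi :=
  Fin.insertNth_apply_same (α := fun _ => ℝ) i _ _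

lemma cubeFace_succAbove (i : Fin 3) (z : E2) (j : Fin 2) :
    cubeFace i z (i.succAbove j) = z j :=
  Fin.insertNth_apply_succAbove (α := fun _ => ℝ) i _ _ j

lemma dropCoord_apply (i : Fin 3) (v : E3) (j : Fin 2) : dropCoord i v j = v (i.succAbove j) := rfl

lemma forall_coord_iff (i : Fin 3) {p : Fin 3 → Prop} :
    (∀ k, p k) ↔ p i ∧ ∀ j : Fin 2, p (i.succAbove j) := Fin.forall_iff_succAbove i

lemma continuous_dropCoord (i : Fin 3) : Continuous (dropCoord i) :=
  continuous_toLp_of_coord fun _ => continuous_coord _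

lemma continuous_cubeFace (i : Fin 3) : Continuous (cubeFace i) := by
  refine continuous_toLp_of_coord ((forall_coord_iff i).mpr ⟨?_, fun j => ?_⟩)
  · simp only [cubeFace_same]
    exact continuous_const
  · simp only [cubeFace_succAbove]
    exact continuous_coord j

lemma dropCoord_cubeFace (i : Fin 3) (z : E2) : dropCoord i (cubeFace i z) = z := by
  ext j
  rw [dropCoord_apply, cubeFace_succAbove]

lemma cubeFace_dropCoord {i : Fin 3} {v : E3} (h : v i = Real.pi) :
    cubeFace i (dropCoord i v) = v := by
  ext k
  revert k
  exact (forall_coord_iff i).mpr ⟨by rw [cubeFace_same, h],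
    fun j => by rw [cubeFace_succAbove, dropCoord_apply]⟩

lemma cubeFace_smul (i : Fin 3) (z : E2) (t : ℝ) :
    cubeFace i (t • z) = (1 - t) • cubeFace i 0 + t • cubeFace i z := by
  ext k
  revert k
  refine (forall_coord_iff i).mpr ⟨?_, fun j => ?_⟩
  · simp only [PiLp.add_apply, PiLp.smul_apply, smul_eq_mul, cubeFace_same]
    ring
  · simp only [PiLp.add_apply, PiLp.smul_apply, smul_eq_mul, cubeFace_succAbove]
    simp

/-- The functionals whose conditions `≤ 1` define the cube `[-π, π]³`. -/
def cubeFunctional (i : Fin 3) (b : Bool) : E3 →L[ℝ] ℝ :=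
  (if b then Real.pi⁻¹ else -Real.pi⁻¹) • coordCLM i

lemma cubeFunctional_apply (i : Fin 3) (b : Bool) (v : E3) :
    cubeFunctional i b v = (if b then Real.pi⁻¹ else -Real.pi⁻¹) * v i := rfl

lemma cubeFunctional_true_eq_one {i : Fin 3} {v : E3} :
    cubeFunctional i true v = 1 ↔ v i = Real.pi := by
  rw [cubeFunctional_apply, if_pos rfl, inv_mul_eq_one₀ Real.pi_ne_zero]
  exact eq_comm

lemma cubeFunctional_false_eq_one {i : Fin 3} {v : E3} :
    cubeFunctional i false v = 1 ↔ v i = -Real.pi := by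
  rw [cubeFunctional_apply, if_neg Bool.false_ne_true, neg_mul, ← mul_neg,
    inv_mul_eq_one₀ Real.pi_ne_zero]
  constructor <;> intro h <;> linarith

lemma cubeFunctional_le_one {v : E3} :
    (∀ i b, cubeFunctional i b v ≤ 1) ↔ ∀ i, |v i| ≤ Real.pi := by
  refine forall_congr' fun i => ?_
  rw [Bool.forall_bool, cubeFunctional_apply, cubeFunctional_apply, if_pos rfl,
    if_neg Bool.false_ne_true, neg_mul, ← mul_neg, inv_mul_le_one₀ Real.pi_pos,
    inv_mul_le_one₀ Real.pi_pos, abs_le]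
  constructor <;> rintro ⟨h1, h2⟩ <;> constructor <;> linarith

lemma abs_eq_pi_of_cubeFunctional {i : Fin 3} {b : Bool} {v : E3} (h : cubeFunctional i b v = 1) :
    |v i| = Real.pi := by
  cases b
  · rw [cubeFunctional_false_eq_one.mp h, abs_neg, abs_of_pos Real.pi_pos]
  · rw [cubeFunctional_true_eq_one.mp h, abs_of_pos Real.pi_pos]

/-- Two faces of the cube have no common point in a set that misses the edges. -/
lemma cubeFunctional_inj {v : E3} (hv : ∀ i j, i ≠ j → |v i| = Real.pi → |v j| = Real.pi → False)
    {i i' : Fin 3} {b b' : Bool} (h : cubeFunctional i b v = 1) (h' : cubeFunctional i' b' v = 1) :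
    i = i' ∧ b = b' := by
  have hi : i = i' := by
    by_contra hne
    exact hv i i' hne (abs_eq_pi_of_cubeFunctional h) (abs_eq_pi_of_cubeFunctional h')
  subst hi
  refine ⟨rfl, ?_⟩
  have hpi := Real.pi_pos
  cases b <;> cases b' <;> try rfl
  · rw [cubeFunctional_false_eq_one] at h
    rw [cubeFunctional_true_eq_one] at h'
    linarith
  · rw [cubeFunctional_true_eq_one] at h
    rw [cubeFunctional_false_eq_one] at h'
    linarith

/-! ### The Schwarz P surface in the 3-torus -/

/-- The function whose zero set is a Schwarz P surface of cubic period `1`. -/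
def schwarzP (x : E3) : ℝ := ∑ i, Real.cos (2 * Real.pi * x i)

lemma contDiff_schwarzP : ContDiff ℝ ∞ schwarzP := by
  unfold schwarzP
  exact ContDiff.sum fun i _ => Real.contDiff_cos.comp (contDiff_const.mul (contDiff_coord i))

lemma schwarzP_regular (x : E3) (hx : schwarzP x = 0) : fderiv ℝ schwarzP x ≠ 0 := by
  intro h0
  have hd : HasFDerivAt schwarzP (∑ i, -Real.sin (2 * Real.pi * x i) •
      ((2 * Real.pi) • coordCLM i)) x := by
    unfold schwarzP
    exact HasFDerivAt.fun_sum fun i _ => ((hasFDerivAt_coord i x).const_mul (2 * Real.pi)).cos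
  rw [hd.fderiv] at h0
  have hsin : ∀ i, Real.sin (2 * Real.pi * x i) = 0 := by
    intro i
    have h1 := congrArg (fun L : E3 →L[ℝ] ℝ => L (EuclideanSpace.single i 1)) h0
    have h2 : Real.pi ≠ 0 := Real.pi_ne_zero
    fin_cases i <;>
      simpa [Fin.sum_univ_three, Pi.single_apply, h2] using h1
  have hcos : ∀ i, Real.cos (2 * Real.pi * x i) = 1 ∨ Real.cos (2 * Real.pi * x i) = -1 :=
    fun i => by
      have := Real.sin_sq_add_cos_sq (2 * Real.pi * x i)
      rw [hsin i] at this
      have h1 : (Real.cos (2 * Real.pi * x i) - 1) * (Real.cos (2 * Real.pi * x i) + 1) = 0 := by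
        linarith
      rcases mul_eq_zero.mp h1 with h | h
      · exact Or.inl (by linarith)
      · exact Or.inr (by linarith)
  unfold schwarzP at hx
  rw [Fin.sum_univ_three] at hx
  rcases hcos 0 with h | h <;> rcases hcos 1 with h' | h' <;> rcases hcos 2 with h'' | h'' <;>
    rw [h, h', h''] at hx <;> norm_num at hx

lemma intTranslation_mem (n : Fin 3 → ℤ) :
    translation (fun i => (n i : ℝ)) ∈ integerTranslations :=
  ⟨n, fun x i => by rw [translation_apply, add_comm]⟩

/-- The coordinates of `ℝ³` in which the cube `[-π, π]³` is a fundamental cell of `ℤ³`. -/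
def torusCoord : E3 ≃ₜ E3 := Homeomorph.smulOfNeZero (2 * Real.pi)⁻¹
  (inv_ne_zero (mul_ne_zero two_ne_zero Real.pi_ne_zero))

lemma torusCoord_apply (v : E3) (i : Fin 3) : torusCoord v i = (2 * Real.pi)⁻¹ * v i := rfl

lemma two_pi_mul_torusCoord (v : E3) (i : Fin 3) : 2 * Real.pi * torusCoord v i = v i := by
  rw [torusCoord_apply, mul_inv_cancel_left₀ (mul_ne_zero two_ne_zero Real.pi_ne_zero)]

lemma schwarzP_torusCoord (v : E3) : schwarzP (torusCoord v) = ∑ i, Real.cos (v i) := by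
  unfold schwarzP
  simp only [two_pi_mul_torusCoord]

/-- Translation by `-2π` along the `i`-th axis. -/
def cubeShift (i : Fin 3) (v : E3) : E3 :=
  WithLp.toLp 2 fun j => v j - if j = i then 2 * Real.pi else 0

lemma cubeShift_apply (i : Fin 3) (v : E3) (j : Fin 3) :
    cubeShift i v j = v j - if j = i then 2 * Real.pi else 0 := rfl

lemma schwarzP_edge {v : E3} (hv : 0 ≤ ∑ i, Real.cos (v i)) (i j : Fin 3) (hij : i ≠ j)
    (hi : |v i| = Real.pi) (hj : |v j| = Real.pi) : False := by
  have h1 : Real.cos (v i) = -1 := by rw [← Real.cos_abs, hi, Real.cos_pi]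
  have h2 : Real.cos (v j) = -1 := by rw [← Real.cos_abs, hj, Real.cos_pi]
  have h3 := fun k => Real.cos_le_one (v k)
  rw [Fin.sum_univ_three] at hv
  fin_cases i <;> fin_cases j <;> simp_all <;> linarith [h3 0, h3 1, h3 2]

/-- The cube as a fundamental cell of the region `schwarzP ≥ 0` of the 3-torus. -/
def torusCell : HandlebodyCell integerTranslations schwarzP 3 where
  κ := torusCoord
  ℓ := cubeFunctional
  τ := cubeShift
  d := cubeFace
  r := dropCoord
  d_cont := continuous_cubeFace
  r_cont := continuous_dropCoord
  r_d := dropCoord_cubeFace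
  d_r i v h := cubeFace_dropCoord (cubeFunctional_true_eq_one.mp h)
  ℓ_d i z := cubeFunctional_true_eq_one.mpr (cubeFace_same i z)
  d_smul := cubeFace_smul
  τ_spec i := by
    refine ⟨_, intTranslation_mem fun j => if j = i then -1 else 0, fun v => ?_⟩
    ext j
    rw [translation_apply, torusCoord_apply, torusCoord_apply, cubeShift_apply]
    have := Real.pi_ne_zero
    split_ifs
    · push_cast
      field_simp
      ring
    · simp
  bounded := by
    refine ⟨3 * Real.pi, fun v hv _ => ?_⟩
    exact norm_le_of_coord Real.pi_pos.le (cubeFunctional_le_one.mp hv)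
  center := by
    rw [schwarzP_torusCoord]
    simp
  star v hv hf t h0 h1 := by
    rw [schwarzP_torusCoord] at hf ⊢
    rcases eq_or_ne v 0 with rfl | hne
    · simp
    · exact hf.trans_lt (sum_cos_lt_sum_cos_mul (cubeFunctional_le_one.mp hv) h0 h1 hne)
  face_inj v hv hf i b i' b' h h' := by
    rw [schwarzP_torusCoord] at hf
    exact cubeFunctional_inj (schwarzP_edge hf) h h'
  face_center i := by
    refine ⟨cubeFunctional_le_one.mpr ((forall_coord_iff i).mpr ⟨?_, fun j => ?_⟩), ?_⟩
    · rw [cubeFace_same, abs_of_pos Real.pi_pos]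
    · rw [cubeFace_succAbove]
      simpa using Real.pi_pos.le
    · rw [schwarzP_torusCoord, Fin.sum_univ_succAbove _ i]
      simp only [cubeFace_same, cubeFace_succAbove]
      norm_num
  face_star i z hz hf t h0 h1 := by
    rw [schwarzP_torusCoord, Fin.sum_univ_succAbove _ i] at hf ⊢
    simp only [cubeFace_same, cubeFace_succAbove, Real.cos_pi] at hf ⊢
    rcases eq_or_ne z 0 with rfl | hne
    · norm_num
    · have hz' : ∀ j, |z j| ≤ Real.pi := fun j => by
        have := cubeFunctional_le_one.mp hz (i.succAbove j)
        rwa [cubeFace_succAbove] at this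
      have := sum_cos_lt_sum_cos_mul hz' h0 h1 hne
      simp only [PiLp.smul_apply, smul_eq_mul]
      linarith
  pair i v hv _ h := by
    rw [cubeFunctional_true_eq_one] at h
    rw [cubeFunctional_le_one] at hv ⊢
    have hi : cubeShift i v i = -Real.pi := by
      rw [cubeShift_apply, if_pos rfl, h]
      ring
    refine ⟨fun j => ?_, cubeFunctional_false_eq_one.mpr hi⟩
    rcases eq_or_ne j i with rfl | hj
    · rw [hi, abs_neg, abs_of_pos Real.pi_pos]
    · rw [cubeShift_apply, if_neg hj, sub_zero]
      exact hv j
  pair_surj i w hw _ h := by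
    rw [cubeFunctional_false_eq_one] at h
    rw [cubeFunctional_le_one] at hw
    set v : E3 := WithLp.toLp 2 fun j => w j + if j = i then 2 * Real.pi else 0 with hv
    have hvj : ∀ j, v j = w j + if j = i then 2 * Real.pi else 0 := fun j => rfl
    have hi : v i = Real.pi := by
      rw [hvj, if_pos rfl, h]
      ring
    refine ⟨v, cubeFunctional_le_one.mpr fun j => ?_, cubeFunctional_true_eq_one.mpr hi, ?_⟩
    · rcases eq_or_ne j i with rfl | hj
      · rw [hi, abs_of_pos Real.pi_pos]
      · rw [hvj, if_neg hj, add_zero]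
        exact hw j
    · ext j
      rw [cubeShift_apply, hvj, add_sub_cancel_right]
  tiling γ hγ v w hv hfv hw hfw h := by
    obtain ⟨n, hn⟩ := hγ
    rw [schwarzP_torusCoord] at hfv
    rw [cubeFunctional_le_one] at hv hw
    have hpi := Real.pi_pos
    have hwn : ∀ i, w i = v i + 2 * Real.pi * n i := fun i => by
      have h1 := congrArg (fun y : E3 => 2 * Real.pi * y i) h
      simp only [hn, mul_add, two_pi_mul_torusCoord] at h1
      exact h1.symm
    -- a non-zero entry of `n` forces `v` and `w` to lie on opposite faces
    have hcase : ∀ i, n i = 0 ∨ (n i = -1 ∧ v i = Real.pi) ∨ (n i = 1 ∧ w i = Real.pi) := by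
      intro i
      obtain ⟨h1, h2⟩ := abs_le.mp (hv i)
      obtain ⟨h3, h4⟩ := abs_le.mp (hw i)
      rw [hwn] at h3 h4
      have h5 : (n i : ℝ) ≤ 1 := by nlinarith
      have h6 : (-1 : ℝ) ≤ n i := by nlinarith
      have h7 : n i ≤ 1 := by exact_mod_cast h5
      have h8 : -1 ≤ n i := by exact_mod_cast h6
      obtain h9 | h9 | h9 : n i = 0 ∨ n i = -1 ∨ n i = 1 := by omega
      · exact Or.inl h9
      · refine Or.inr (Or.inl ⟨h9, ?_⟩)
        rw [h9] at h3
        push_cast at h3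
        linarith
      · refine Or.inr (Or.inr ⟨h9, ?_⟩)
        rw [h9] at h4
        push_cast at h4
        rw [hwn, h9]
        push_cast
        linarith
    have habs : ∀ i, n i ≠ 0 → |v i| = Real.pi := by
      intro i hi
      rcases hcase i with h1 | ⟨-, h1⟩ | ⟨h1, h2⟩
      · exact absurd h1 hi
      · rw [h1, abs_of_pos hpi]
      · have := hwn i
        rw [h1, h2] at this
        push_cast at this
        rw [show v i = -Real.pi by linarith, abs_neg, abs_of_pos hpi]
    by_cases hall : ∀ i, n i = 0
    · left
      ext i
      rw [hwn, hall i]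
      simp
    · push Not at hall
      obtain ⟨i, hi⟩ := hall
      have hother : ∀ j, j ≠ i → n j = 0 := fun j hj => by
        by_contra hnj
        exact schwarzP_edge hfv j i hj (habs j hnj) (habs i hi)
      right
      refine ⟨i, ?_⟩
      rcases hcase i with h1 | ⟨h1, h2⟩ | ⟨h1, h2⟩
      · exact absurd h1 hi
      · refine Or.inl ⟨cubeFunctional_true_eq_one.mpr h2, ?_⟩
        ext j
        rw [cubeShift_apply, hwn]
        rcases eq_or_ne j i with rfl | hj
        · rw [if_pos rfl, h1]
          push_cast
          ring
        · rw [if_neg hj, hother j hj]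
          simp
      · refine Or.inr ⟨cubeFunctional_true_eq_one.mpr h2, ?_⟩
        ext j
        rw [cubeShift_apply, hwn]
        rcases eq_or_ne j i with rfl | hj
        · rw [if_pos rfl, h1]
          push_cast
          ring
        · rw [if_neg hj, hother j hj]
          simp
  cover x _ := by
    refine ⟨_, intTranslation_mem fun i => -round (x i), torusCoord.symm _,
      cubeFunctional_le_one.mpr fun i => ?_, torusCoord.apply_symm_apply _⟩
    rw [← two_pi_mul_torusCoord, torusCoord.apply_symm_apply, translation_apply]
    have h := abs_sub_round (x i)
    push_cast
    rw [show -(round (x i) : ℝ) + x i = x i - round (x i) by ring, abs_mul,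
      abs_of_pos (by positivity : (0 : ℝ) < 2 * Real.pi)]
    nlinarith [Real.pi_pos]

/-! ### The large group action on the 3-torus -/

lemma det_integerTranslations : ∀ γ ∈ integerTranslations, (linPart γ).det = 1 := by
  rintro γ ⟨n, hn⟩
  rw [det_linPart_of_apply (σ := 1) (ε := 1) (v := fun i => (n i : ℝ)) fun x i => by simp [hn]]
  simp

lemma schwarzP_invariant : ∀ γ ∈ integerTranslations, ∀ x, schwarzP (γ x) = schwarzP x := by
  rintro γ ⟨n, hn⟩ x
  unfold schwarzP
  refine Finset.sum_congr rfl fun i _ => ?_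
  rw [hn, show 2 * Real.pi * (x i + n i) = 2 * Real.pi * x i + n i * (2 * Real.pi) by ring,
    Real.cos_add_int_mul_two_pi]

lemma integerTranslations_eq {γ : E3 ≃ᵃⁱ[ℝ] E3} (h : γ ∈ integerTranslations) :
    ∃ n : Fin 3 → ℤ, γ = signedPerm 1 1 fun i => (n i : ℝ) := by
  obtain ⟨n, hn⟩ := h
  exact ⟨n, isometry_ext fun x i => by rw [hn, signedPerm_apply]; simp⟩

/-- The isometry `x ↦ (ε i * x (σ i))_i`, followed by the translation by `(1/2, 1/2, 1/2)` if
`s`. -/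
def torusIsometry (σ : Equiv.Perm (Fin 3)) (ε : Fin 3 → ℤˣ) (s : Bool) : E3 ≃ᵃⁱ[ℝ] E3 :=
  signedPerm σ ε fun _ => if s then 1 / 2 else 0

lemma torusIsometry_mul (σ σ' : Equiv.Perm (Fin 3)) (ε ε' : Fin 3 → ℤˣ) (s s' : Bool) :
    ∃ γ ∈ integerTranslations, torusIsometry σ ε s * torusIsometry σ' ε' s' =
      γ * torusIsometry (σ' * σ) (fun i => ε i * ε' (σ i)) (xor s s') := by
  unfold torusIsometry
  rw [signedPerm_mul]
  have key : ∀ u : ℤˣ, ∃ n : ℤ, ((u : ℤ) : ℝ) * (if s' then 1 / 2 else 0) +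
      (if s then 1 / 2 else 0) = (if xor s s' then 1 / 2 else 0) + n := by
    intro u
    rcases Int.units_eq_one_or u with rfl | rfl <;> cases s <;> cases s'
    · exact ⟨0, by norm_num⟩
    · exact ⟨0, by norm_num⟩
    · exact ⟨0, by norm_num⟩
    · exact ⟨1, by norm_num⟩
    · exact ⟨0, by norm_num⟩
    · exact ⟨-1, by norm_num⟩
    · exact ⟨0, by norm_num⟩
    · exact ⟨0, by norm_num⟩
  choose n hn using fun i => key (ε i)
  refine ⟨_, intTranslation_mem n, isometry_ext fun x i => ?_⟩
  rw [AffineIsometryEquiv.coe_mul, Function.comp_apply, translation_apply, signedPerm_apply,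
    signedPerm_apply, hn]
  ring

lemma torusIsometry_one : torusIsometry 1 1 false = 1 :=
  isometry_ext fun x i => by rw [torusIsometry, signedPerm_apply]; simp

lemma torusIsometry_conj (σ : Equiv.Perm (Fin 3)) (ε : Fin 3 → ℤˣ) (s : Bool) :
    torusIsometry σ ε s ∈ normalizerGroup integerTranslations := by
  refine mem_normalizerGroup (fun γ hγ => ?_) (fun γ hγ => ?_)
  · obtain ⟨n, rfl⟩ := integerTranslations_eq hγ
    refine ⟨fun i => ε i * n (σ i), fun x i => ?_⟩
    unfold torusIsometry
    rw [signedPerm_inv, signedPerm_mul, signedPerm_mul, signedPerm_apply]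
    have hσ : σ⁻¹ (σ i) = i := σ.symm_apply_apply i
    simp only [mul_one, Equiv.Perm.one_apply, Pi.one_apply, hσ, inv_mul_cancel,
      Int.units_mul_self, Units.val_one, Int.cast_one, one_mul]
    push_cast
    linear_combination (-(if s = true then 1 / 2 else (0 : ℝ))) * unit_sq (ε i)
  · obtain ⟨n, rfl⟩ := integerTranslations_eq hγ
    refine ⟨fun i => ε (σ⁻¹ i) * n (σ⁻¹ i), fun x i => ?_⟩
    unfold torusIsometry
    rw [signedPerm_inv, signedPerm_mul, signedPerm_mul, signedPerm_apply]
    have hσ : σ (σ⁻¹ i) = i := σ.apply_symm_apply i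
    simp only [mul_one, Equiv.Perm.one_apply, Pi.one_apply, mul_inv_cancel,
      Int.units_mul_self, Units.val_one, Int.cast_one, one_mul]
    push_cast
    ring

/-- The action on the 3-torus of a signed permutation of the coordinates, followed by the
translation by `(1/2, 1/2, 1/2)` if the Boolean is true. -/
def torusDiffeo (a : Equiv.Perm (Fin 3) × (Fin 3 → ℤˣ) × Bool) : Diffeo ThreeTorus :=
  descend integerTranslations ⟨torusIsometry a.1 a.2.1 a.2.2, torusIsometry_conj _ _ _⟩

lemma torusDiffeo_proj (a : Equiv.Perm (Fin 3) × (Fin 3 → ℤˣ) × Bool) (x : E3) :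
    torusDiffeo a (proj integerTranslations x) =
      proj integerTranslations (torusIsometry a.1 a.2.1 a.2.2 x) := descend_proj _ x

lemma torusDiffeo_one : torusDiffeo (1, 1, false) = 1 := by
  refine Diffeomorph.ext fun p => ?_
  obtain ⟨x, rfl⟩ := proj_surjective _ p
  rw [torusDiffeo_proj, torusIsometry_one]
  rfl

lemma torusDiffeo_mul (a b : Equiv.Perm (Fin 3) × (Fin 3 → ℤˣ) × Bool) :
    torusDiffeo a * torusDiffeo b =
      torusDiffeo (b.1 * a.1, fun i => a.2.1 i * b.2.1 (a.1 i), xor a.2.2 b.2.2) := by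
  obtain ⟨γ, hγ, h⟩ := torusIsometry_mul a.1 b.1 a.2.1 b.2.1 a.2.2 b.2.2
  refine Diffeomorph.ext fun p => ?_
  obtain ⟨x, rfl⟩ := proj_surjective _ p
  change torusDiffeo a (torusDiffeo b _) = _
  rw [torusDiffeo_proj, torusDiffeo_proj, torusDiffeo_proj]
  exact (congrArg (fun F : E3 ≃ᵃⁱ[ℝ] E3 => proj integerTranslations (F x)) h).trans
    (proj_apply_of_mem hγ _)

/-- Two lifts of a diffeomorphism of the torus differ by an integral translation, so the lift
determines the linear part, and the translation part modulo `ℤ³`. -/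
lemma torusDiffeo_injective : Function.Injective torusDiffeo := by
  intro a b h
  obtain ⟨γ, ⟨n, hn⟩, hF⟩ := exists_mem_eq_of_proj_comp integerTranslations
    (torusIsometry a.1 a.2.1 a.2.2).continuous (torusIsometry b.1 b.2.1 b.2.2).continuous
    (fun x => by rw [← torusDiffeo_proj, h, torusDiffeo_proj])
  have hco : ∀ x : E3, ∀ i, ((a.2.1 i : ℤ) : ℝ) * x (a.1 i) + (if a.2.2 then 1 / 2 else 0) =
      ((b.2.1 i : ℤ) : ℝ) * x (b.1 i) + (if b.2.2 then 1 / 2 else 0) + n i := fun x i => by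
    have := congrArg (fun y : E3 => y i) (hF x)
    simp only [hn, torusIsometry, signedPerm_apply] at this
    exact this
  have h0 : ∀ i, (if a.2.2 then 1 / 2 else (0 : ℝ)) = (if b.2.2 then 1 / 2 else 0) + n i :=
    fun i => by simpa using hco 0 i
  have hlin : ∀ x : E3, ∀ i, ((a.2.1 i : ℤ) : ℝ) * x (a.1 i) = ((b.2.1 i : ℤ) : ℝ) * x (b.1 i) :=
    fun x i => by linarith [hco x i, h0 i]
  have hσ : ∀ i, a.1 i = b.1 i := fun i => by
    by_contra hne
    have := hlin (EuclideanSpace.single (a.1 i) 1) i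
    rw [PiLp.single_apply, PiLp.single_apply, if_pos rfl, if_neg (Ne.symm hne)] at this
    rcases Int.units_eq_one_or (a.2.1 i) with h1 | h1 <;> rw [h1] at this <;> norm_num at this
  have hε : ∀ i, a.2.1 i = b.2.1 i := fun i => by
    have := hlin (EuclideanSpace.single (a.1 i) 1) i
    rw [← hσ i, PiLp.single_apply, if_pos rfl, mul_one, mul_one] at this
    exact Units.ext (by exact_mod_cast this)
  have hs : a.2.2 = b.2.2 := by
    have h1 := h0 0
    cases ha : a.2.2 <;> cases hb : b.2.2 <;> try rfl
    · exfalso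
      rw [ha, hb] at h1
      have h2 : (2 * n 0 + 1 : ℝ) = 0 := by
        norm_num at h1
        linarith
      have h3 : 2 * n 0 + 1 = 0 := by exact_mod_cast h2
      omega
    · exfalso
      rw [ha, hb] at h1
      have h2 : (2 * n 0 - 1 : ℝ) = 0 := by
        norm_num at h1
        linarith
      have h3 : 2 * n 0 - 1 = 0 := by exact_mod_cast h2
      omega
  exact Prod.ext (Equiv.ext hσ) (Prod.ext (funext hε) hs)

/-- The group of order `96` generated by the signed permutations of the coordinates and the
translation by `(1/2, 1/2, 1/2)`. -/
def torusGroup : Subgroup (Diffeo ThreeTorus) where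
  carrier := Set.range torusDiffeo
  one_mem' := ⟨_, torusDiffeo_one⟩
  mul_mem' := by
    rintro _ _ ⟨a, rfl⟩ ⟨b, rfl⟩
    exact ⟨_, (torusDiffeo_mul a b).symm⟩
  inv_mem' := by
    rintro _ ⟨a, rfl⟩
    refine ⟨(a.1⁻¹, fun i => a.2.1 (a.1⁻¹ i), a.2.2), ?_⟩
    rw [eq_inv_iff_mul_eq_one, torusDiffeo_mul, ← torusDiffeo_one]
    congr 1
    simp only [mul_inv_cancel, Int.units_mul_self, Bool.xor_self]
    rfl

lemma card_torusGroup : Nat.card torusGroup = 96 := by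
  have h : Nat.card torusGroup =
      Nat.card (Equiv.Perm (Fin 3) × (Fin 3 → ℤˣ) × Bool) :=
    Nat.card_range_of_injective torusDiffeo_injective
  rw [h, Nat.card_eq_fintype_card, Fintype.card_prod, Fintype.card_prod, Fintype.card_perm,
    Fintype.card_pi]
  simp
  rfl

lemma schwarzP_torusIsometry (σ : Equiv.Perm (Fin 3)) (ε : Fin 3 → ℤˣ) (s : Bool) (x : E3) :
    schwarzP (torusIsometry σ ε s x) = if s then -schwarzP x else schwarzP x := by
  have h : ∀ i, Real.cos (2 * Real.pi * torusIsometry σ ε s x i) =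
      if s then -Real.cos (2 * Real.pi * x (σ i)) else Real.cos (2 * Real.pi * x (σ i)) := by
    intro i
    rw [torusIsometry, signedPerm_apply]
    have h1 : Real.cos (2 * Real.pi * (((ε i : ℤ) : ℝ) * x (σ i))) =
        Real.cos (2 * Real.pi * x (σ i)) := by
      rcases Int.units_eq_one_or (ε i) with h | h <;> rw [h] <;> simp
    cases s
    · simpa using h1
    · rw [if_pos rfl, if_pos rfl, mul_add, show 2 * Real.pi * (1 / 2 : ℝ) = Real.pi by ring,
        Real.cos_add_pi, h1]
  unfold schwarzP
  simp only [h]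
  cases s
  · simp only [Bool.false_eq_true, if_false]
    exact Equiv.sum_comp σ fun i => Real.cos (2 * Real.pi * x i)
  · simp only [if_true, Finset.sum_neg_distrib]
    congr 1
    exact Equiv.sum_comp σ fun i => Real.cos (2 * Real.pi * x i)

lemma isHeegaardSplitting_threeTorus :
    IsHeegaardSplitting 3 (proj integerTranslations '' {x | 0 ≤ schwarzP x})
      (proj integerTranslations '' {x | schwarzP x ≤ 0}) :=
  isHeegaardSplitting_of_function contDiff_schwarzP schwarzP_invariant schwarzP_regular
    (torusCell.isHandlebody (by norm_num) contDiff_schwarzP.continuous schwarzP_invariant)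
    (F := ⟨torusIsometry 1 1 true, torusIsometry_conj _ _ _⟩)
    (fun x => by rw [schwarzP_torusIsometry, if_pos rfl])

theorem isType48_torusGroup : IsType48 torusGroup 3 := by
  refine ⟨by norm_num, ⟨_, _, isHeegaardSplitting_threeTorus, ?_, ?_, Or.inl ⟨?_, ?_⟩⟩,
    card_torusGroup⟩
  · rintro _ ⟨⟨σ, ε, s⟩, rfl⟩
    cases s
    · exact Or.inl (preserves_descend fun x => by
        rw [schwarzP_torusIsometry]
        simp)
    · exact Or.inr (interchanges_descend fun x => by
        rw [schwarzP_torusIsometry]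
        simp)
  · exact ⟨_, ⟨(1, 1, true), rfl⟩, interchanges_descend fun x => by
      rw [schwarzP_torusIsometry]
      simp⟩
  · exact ⟨_, isOrientation_one _ det_integerTranslations⟩
  · refine ⟨_, ⟨(1, -1, false), rfl⟩, preserves_descend fun x => by
      rw [schwarzP_torusIsometry]
      simp, ?_⟩
    refine reversesOrientation_of_det_neg det_integerTranslations (torusDiffeo_proj _) ?_
    rw [torusIsometry, det_linPart_signedPerm]
    simp

/-! ### The Heegaard genus of the 3-torus -/

lemma IsPreconnected.eq_of_int_valued {X : Type*} [TopologicalSpace X] {s : Set X}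
    (hs : IsPreconnected s) {h : X → ℝ} (hc : ContinuousOn h s)
    (hi : ∀ x ∈ s, ∃ n : ℤ, h x = n) {x y : X} (hx : x ∈ s) (hy : y ∈ s) : h x = h y := by
  have hT : IsDiscrete (Set.range ((↑) : ℤ → ℝ)) :=
    ⟨Int.isClosedEmbedding_coe_real.isEmbedding.toHomeomorph.symm.isEmbedding.discreteTopology⟩
  refine hs.constant_of_mapsTo hT hc (fun z hz => ?_) hx hy
  obtain ⟨n, hn⟩ := hi z hz
  exact ⟨n, hn.symm⟩

/-- A continuous map from the closed unit ball to `ℝ³ / Γ` lifts to `ℝ³`. -/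
lemma exists_lift_closedBall (Γ : Subgroup (E3 ≃ᵃⁱ[ℝ] E3)) [IsSpaceFormGroup Γ]
    {q : E3 → FlatManifold Γ} (hq : ContinuousOn q (Metric.closedBall 0 1)) :
    ∃ Q : E3 → E3, Continuous Q ∧ ∀ x ∈ Metric.closedBall (0 : E3) 1, proj Γ (Q x) = q x := by
  -- extend the map to `ℝ³` by the radial retraction
  have hpos : ∀ x : E3, 0 < max 1 ‖x‖ := fun x => lt_max_of_lt_left one_pos
  have hρ : Continuous fun x : E3 => (max 1 ‖x‖)⁻¹ • x :=
    ((continuous_const.max continuous_norm).inv₀ fun x => (hpos x).ne').smul continuous_id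
  have hmem : ∀ x : E3, (max 1 ‖x‖)⁻¹ • x ∈ Metric.closedBall (0 : E3) 1 := fun x => by
    rw [mem_closedBall_zero_iff, norm_smul, norm_inv, Real.norm_of_nonneg (hpos x).le,
      inv_mul_le_one₀ (hpos x)]
    exact le_max_right _ _
  obtain ⟨Q, hQ, h⟩ := exists_lift Γ (hq.comp_continuous hρ hmem)
  refine ⟨Q, hQ, fun x hx => ?_⟩
  rw [h, Function.comp_apply, max_eq_left (mem_closedBall_zero_iff.mp hx), inv_one, one_smul]

/-- A function on the ball which is compatible with the identifications of the discs descends to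
the handlebody. -/
lemma exists_continuousOn_handlebody {M : Type*} [TopologicalSpace M] [T2Space M] {g : ℕ}
    {e : Fin g → Bool → E2 → E3} {q : E3 → M} (hq : ContinuousOn q (Metric.closedBall 0 1))
    (hqe : ∀ x ∈ Metric.closedBall (0 : E3) 1, ∀ y ∈ Metric.closedBall (0 : E3) 1,
      q x = q y ↔
        x = y ∨ ∃ i b, ∃ z ∈ Metric.closedBall (0 : E2) 1, x = e i b z ∧ y = e i (!b) z)
    {ψ : E3 → ℝ} (hψ : Continuous ψ)
    (hpair : ∀ i, ∀ z ∈ Metric.closedBall (0 : E2) 1, ψ (e i true z) = ψ (e i false z)) :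
    ∃ G : M → ℝ, ContinuousOn G (q '' Metric.closedBall 0 1) ∧
      ∀ x ∈ Metric.closedBall (0 : E3) 1, G (q x) = ψ x := by
  have hcompat : ∀ x ∈ Metric.closedBall (0 : E3) 1, ∀ y ∈ Metric.closedBall (0 : E3) 1,
      q x = q y → ψ x = ψ y := by
    intro x hx y hy h
    rcases (hqe x hx y hy).mp h with rfl | ⟨i, b, z, hz, rfl, rfl⟩
    · rfl
    · cases b
      · exact (hpair i z hz).symm
      · exact hpair i z hz
  have hG : ∀ p : M, ∃ c : ℝ, ∀ x ∈ Metric.closedBall (0 : E3) 1, q x = p → c = ψ x := by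
    intro p
    by_cases hp : p ∈ q '' Metric.closedBall 0 1
    · obtain ⟨x, hx, rfl⟩ := hp
      exact ⟨ψ x, fun y hy h => hcompat x hx y hy h.symm⟩
    · exact ⟨0, fun x hx h => absurd ⟨x, hx, h⟩ hp⟩
  choose G hG using hG
  have hG' : ∀ x ∈ Metric.closedBall (0 : E3) 1, G (q x) = ψ x := fun x hx => hG _ x hx rfl
  refine ⟨G, continuousOn_iff_isClosed.mpr fun t ht => ?_, hG'⟩
  refine ⟨q '' (Metric.closedBall 0 1 ∩ ψ ⁻¹' t), ?_, ?_⟩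
  · refine IsCompact.isClosed (IsCompact.image_of_continuousOn ?_ (hq.mono Set.inter_subset_left))
    exact (isCompact_closedBall _ _).inter_right (ht.preimage hψ)
  · ext p
    constructor
    · rintro ⟨hp, x, hx, rfl⟩
      rw [Set.mem_preimage, hG' x hx] at hp
      exact ⟨⟨x, ⟨hx, hp⟩, rfl⟩, ⟨x, hx, rfl⟩⟩
    · rintro ⟨⟨x, ⟨hx, hp⟩, rfl⟩, hp'⟩
      refine ⟨?_, hp'⟩
      rw [Set.mem_preimage, hG' x hx]
      exact hp

/-- The lift to `ℝ³` of the parametrisation of a handlebody in the 3-torus jumps by an integer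
vector over each handle. -/
lemma exists_jump {g : ℕ} {e : Fin g → Bool → E2 → E3} {q : E3 → ThreeTorus}
    (he : ∀ i b, ContinuousOn (e i b) (Metric.closedBall 0 1))
    (hes : ∀ i b, Set.MapsTo (e i b) (Metric.closedBall 0 1) (Metric.sphere 0 1))
    (hqe : ∀ x ∈ Metric.closedBall (0 : E3) 1, ∀ y ∈ Metric.closedBall (0 : E3) 1,
      q x = q y ↔
        x = y ∨ ∃ i b, ∃ z ∈ Metric.closedBall (0 : E2) 1, x = e i b z ∧ y = e i (!b) z)
    {Q : E3 → E3} (hQ : Continuous Q)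
    (h : ∀ x ∈ Metric.closedBall (0 : E3) 1, proj integerTranslations (Q x) = q x) (i : Fin g) :
    ∃ n : Fin 3 → ℤ, ∀ z ∈ Metric.closedBall (0 : E2) 1, ∀ j,
      Q (e i true z) j = Q (e i false z) j + n j := by
  have : ConnectedSpace (Metric.closedBall (0 : E2) 1) :=
    isConnected_iff_connectedSpace.mp
      ((convex_closedBall (0 : E2) 1).isConnected ⟨0, by simp⟩)
  have hball : ∀ b, ∀ z ∈ Metric.closedBall (0 : E2) 1, e i b z ∈ Metric.closedBall (0 : E3) 1 :=
    fun b z hz => Metric.sphere_subset_closedBall (hes i b hz)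
  obtain ⟨γ, ⟨n, hn⟩, hγ⟩ := exists_mem_eq_of_proj_comp integerTranslations
    (F := fun z : Metric.closedBall (0 : E2) 1 => Q (e i true z))
    (G := fun z => Q (e i false z)) (hQ.comp (he i true).domRestrict)
    (hQ.comp (he i false).domRestrict)
    (fun z => by
      rw [h _ (hball _ _ z.2), h _ (hball _ _ z.2)]
      exact (hqe _ (hball _ _ z.2) _ (hball _ _ z.2)).mpr
        (Or.inr ⟨i, true, z, z.2, rfl, rfl⟩))
  exact ⟨n, fun z hz j => by rw [hγ ⟨z, hz⟩, hn]⟩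

/-- A linear form with integer coefficients. -/
def integerForm (n : Fin 3 → ℤ) (x : E3) : ℝ := ∑ j, (n j : ℝ) * x j

lemma continuous_integerForm (n : Fin 3 → ℤ) : Continuous (integerForm n) :=
  continuous_finsetSum _ fun j _ => continuous_const.mul (continuous_coord j)

lemma integerForm_of_add {n m : Fin 3 → ℤ} {x y : E3} (h : ∀ j, x j = y j + m j) :
    integerForm n x = integerForm n y + (∑ j, n j * m j : ℤ) := by
  unfold integerForm
  push_cast
  rw [← Finset.sum_add_distrib]
  exact Finset.sum_congr rfl fun j _ => by rw [h]; ring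

lemma integerForm_of_proj_eq (n : Fin 3 → ℤ) {x y : E3}
    (h : proj integerTranslations x = proj integerTranslations y) :
    ∃ k : ℤ, integerForm n x = integerForm n y + k := by
  obtain ⟨γ, ⟨m, hm⟩, rfl⟩ := (proj_eq_iff _).mp h
  exact ⟨_, integerForm_of_add (hm y)⟩

/-- Fewer than three integral vectors admit a non-zero integral linear form that vanishes on
them. -/
lemma exists_ne_zero_of_lt_three {k : ℕ} (hk : k < 3) (J : Fin k → Fin 3 → ℤ) :
    ∃ n : Fin 3 → ℤ, n ≠ 0 ∧ ∀ i, ∑ j, n j * J i j = 0 := by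
  by_contra! h
  have hinj : Function.Injective (Matrix.toLin' (Matrix.of J)) := by
    rw [← LinearMap.ker_eq_bot, LinearMap.ker_eq_bot']
    intro n hn
    by_contra hne
    obtain ⟨i, hi⟩ := h n hne
    refine hi ?_
    have h1 := congrFun hn i
    rw [Matrix.toLin'_apply] at h1
    simp only [Matrix.mulVec, dotProduct, Matrix.of_apply, Pi.zero_apply] at h1
    rw [← h1]
    exact Finset.sum_congr rfl fun j _ => mul_comm _ _
  have := le_of_fin_injective ℤ _ hinj
  omega

/-- The 3-torus has no Heegaard splitting of genus less than three: otherwise some non-zero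
integral linear form on `ℝ³` would descend, modulo its jumps over the handles of `V`, to a
continuous real function on `V`; as the boundary surface is connected, it would have no jumps over
the handles of `W` either, and it would descend to the whole torus. -/
theorem three_le_of_isHeegaardSplitting {k : ℕ} {V W : Set ThreeTorus}
    (h : IsHeegaardSplitting k V W) : 3 ≤ k := by
  by_contra! hk
  obtain ⟨e, q, ec, es, einj, -, qc, qe, rfl, hqS⟩ := h.left
  obtain ⟨e', q', ec', es', einj', hconn', qc', qe', rfl, hqS'⟩ := h.right
  obtain ⟨Q, Qc, hQ⟩ := exists_lift_closedBall _ qc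
  obtain ⟨Q', Qc', hQ'⟩ := exists_lift_closedBall _ qc'
  choose J hJ using exists_jump ec es qe Qc hQ
  choose J' hJ' using exists_jump ec' es' qe' Qc' hQ'
  obtain ⟨n, hn, hnJ⟩ := exists_ne_zero_of_lt_three hk J
  obtain ⟨G, Gc, hG⟩ := exists_continuousOn_handlebody qc qe
    ((continuous_integerForm n).comp Qc) fun i z hz => by
      simp only [Function.comp_apply]
      rw [integerForm_of_add (hJ i z hz), hnJ, Int.cast_zero, add_zero]
  -- on the lift of `V`, the linear form and `G` differ by an integer-valued function
  have hGint : ∀ x, proj integerTranslations x ∈ q '' Metric.closedBall 0 1 →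
      ∃ k : ℤ, integerForm n x - G (proj integerTranslations x) = k := by
    rintro x ⟨y, hy, hxy⟩
    obtain ⟨k, hk⟩ := integerForm_of_proj_eq n ((hQ y hy).trans hxy).symm
    refine ⟨k, ?_⟩
    rw [← hxy, hG y hy, hk, Function.comp_apply]
    ring
  have hhole : ∀ x ∈ holedSphere e', q' x ∈ q '' Metric.closedBall 0 1 := fun x hx =>
    (hqS' ▸ ⟨x, hx, rfl⟩ : q' x ∈ q '' Metric.closedBall 0 1 ∩ q' '' Metric.closedBall 0 1).1
  have hball : ∀ x ∈ holedSphere e', x ∈ Metric.closedBall (0 : E3) 1 := fun x hx =>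
    Metric.sphere_subset_closedBall hx.1
  -- it is constant on the connected holed sphere that bounds `W`
  have hconst : ∀ x ∈ holedSphere e', ∀ y ∈ holedSphere e',
      integerForm n (Q' x) - G (q' x) = integerForm n (Q' y) - G (q' y) := by
    intro x hx y hy
    refine IsPreconnected.eq_of_int_valued hconn'.isPreconnected
      (h := fun x => integerForm n (Q' x) - G (q' x)) ?_ (fun x hx => ?_) hx hy
    · exact ((continuous_integerForm n).comp Qc').continuousOn.sub
        (Gc.comp (qc'.mono hball) hhole)
    · have h1 := hGint (Q' x)
      rw [hQ' x (hball x hx)] at h1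
      exact h1 (hhole x hx)
  -- a boundary point of a disc of `W` shows that there is no jump
  have hjump : ∀ i, ∑ j, n j * J' i j = 0 := by
    intro i
    set z : E2 := EuclideanSpace.single 0 1 with hz
    have hz1 : ‖z‖ = 1 := by simp [hz]
    have hzb : z ∈ Metric.closedBall (0 : E2) 1 := by simp [hz1]
    have hmem : ∀ b, e' i b z ∈ holedSphere e' := by
      intro b
      refine ⟨es' i b hzb, fun hU => ?_⟩
      obtain ⟨i', b', w, hw, hwe⟩ := Set.mem_iUnion₂.mp hU
      obtain ⟨-, -, rfl⟩ := einj' i' b' w (Metric.ball_subset_closedBall hw) i b z hzb hwe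
      rw [mem_ball_zero_iff, hz1] at hw
      exact lt_irrefl _ hw
    have h1 := hconst _ (hmem true) _ (hmem false)
    have h2 : q' (e' i true z) = q' (e' i false z) :=
      (qe' _ (hball _ (hmem _)) _ (hball _ (hmem _))).mpr (Or.inr ⟨i, true, z, hzb, rfl, rfl⟩)
    rw [h2, integerForm_of_add (hJ' i z hzb)] at h1
    have h3 : ((∑ j, n j * J' i j : ℤ) : ℝ) = 0 := by linarith
    exact_mod_cast h3
  obtain ⟨G', Gc', hG'⟩ := exists_continuousOn_handlebody qc' qe'
    ((continuous_integerForm n).comp Qc') fun i z hz => by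
      simp only [Function.comp_apply]
      rw [integerForm_of_add (hJ' i z hz), hjump, Int.cast_zero, add_zero]
  obtain ⟨x₀, hx₀⟩ := hconn'.nonempty
  set c := integerForm n (Q' x₀) - G (q' x₀) with hc
  have hGG' : ∀ p ∈ q '' Metric.closedBall 0 1 ∩ q' '' Metric.closedBall 0 1,
      G' p - c = G p := by
    intro p hp
    rw [← hqS'] at hp
    obtain ⟨x, hx, rfl⟩ := hp
    rw [hG' x (hball x hx), hc, ← hconst x hx x₀ hx₀, Function.comp_apply]
    ring
  obtain ⟨kc, hkc⟩ : ∃ k : ℤ, c = k := by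
    have h1 := hGint (Q' x₀)
    rw [hQ' x₀ (hball x₀ hx₀)] at h1
    exact h1 (hhole x₀ hx₀)
  -- glue the two functions
  classical
  obtain ⟨H, hHV, hHW⟩ : ∃ H : ThreeTorus → ℝ, (∀ p ∈ q '' Metric.closedBall 0 1, H p = G p) ∧
      ∀ p ∈ q' '' Metric.closedBall 0 1, H p = G' p - c := by
    refine ⟨fun p => if p ∈ q '' Metric.closedBall 0 1 then G p else G' p - c,
      fun p hp => if_pos hp, fun p hp => ?_⟩
    by_cases hV : p ∈ q '' Metric.closedBall 0 1
    · simp only [if_pos hV]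
      exact (hGG' p ⟨hV, hp⟩).symm
    · simp only [if_neg hV]
  have hHc : Continuous H := by
    rw [← continuousOn_univ, ← h.union_eq]
    refine ContinuousOn.union_of_isClosed (Gc.congr hHV)
      ((Gc'.sub continuousOn_const).congr hHW) ?_ ?_
    · exact ((isCompact_closedBall _ _).image_of_continuousOn qc).isClosed
    · exact ((isCompact_closedBall _ _).image_of_continuousOn qc').isClosed
  have hHint : ∀ x, ∃ k : ℤ, integerForm n x - H (proj integerTranslations x) = k := by
    intro x
    have hx : proj integerTranslations x ∈ q '' Metric.closedBall 0 1 ∪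
        q' '' Metric.closedBall 0 1 := h.union_eq ▸ Set.mem_univ _
    rcases hx with hx | hx
    · rw [hHV _ hx]
      exact hGint x hx
    · rw [hHW _ hx]
      obtain ⟨y, hy, hxy⟩ := hx
      obtain ⟨k, hk⟩ := integerForm_of_proj_eq n ((hQ' y hy).trans hxy).symm
      refine ⟨k + kc, ?_⟩
      rw [← hxy, hG' y hy, hk, Function.comp_apply, hkc]
      push_cast
      ring
  refine hn (funext fun j => ?_)
  have h1 := IsPreconnected.eq_of_int_valued isPreconnected_univ
    (h := fun x => integerForm n x - H (proj integerTranslations x))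
    ((continuous_integerForm n).sub (hHc.comp (continuous_proj _))).continuousOn
    (fun x _ => hHint x) (Set.mem_univ (EuclideanSpace.single j (1 : ℝ))) (Set.mem_univ 0)
  have h2 : proj integerTranslations (EuclideanSpace.single j (1 : ℝ)) =
      proj integerTranslations 0 := by
    refine (proj_eq_iff _).mpr ⟨_, intTranslation_mem fun i => if i = j then 1 else 0, ?_⟩
    ext i
    rw [translation_apply, PiLp.single_apply]
    simp
  simp only [h2] at h1
  have h3 : integerForm n (EuclideanSpace.single j (1 : ℝ)) = n j := by
    simp [integerForm, PiLp.single_apply]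
  have h4 : integerForm n 0 = 0 := by simp [integerForm]
  rw [h3, h4] at h1
  have h5 : (n j : ℝ) = 0 := by linarith
  exact_mod_cast h5

theorem isHeegaardGenus_threeTorus : IsHeegaardGenus ThreeTorus 3 :=
  ⟨⟨_, _, isHeegaardSplitting_threeTorus⟩, fun _ ⟨_, _, h⟩ => three_le_of_isHeegaardSplitting h⟩

/-! ### Positivity along rays -/

/-- A function that is positive at the end of a ray, or zero there, and decreases whenever it
vanishes on the ray, is positive along the ray. -/
lemma pos_of_deriv_neg_at_zeros {φ φ' : ℝ → ℝ} (hd : ∀ t, HasDerivAt φ (φ' t) t)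
    (h1 : 0 ≤ φ 1) (hneg : ∀ t, 0 < t → t ≤ 1 → φ t = 0 → φ' t < 0) {t : ℝ} (ht0 : 0 < t)
    (ht1 : t < 1) : 0 < φ t := by
  by_contra! hle
  have hle' : ∀ s ∈ Set.Icc t 1, φ s ≤ 0 := fun s hs =>
    image_le_of_deriv_right_lt_deriv_boundary (B := fun _ => 0) (B' := fun _ => 0)
      (fun x _ => (hd x).continuousAt.continuousWithinAt) (fun x _ => (hd x).hasDerivWithinAt)
      hle (fun x => hasDerivAt_const x 0)
      (fun x hx h0 => hneg x (ht0.trans_le hx.1) hx.2.le h0) hs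
  have h0 : φ 1 = 0 := le_antisymm (hle' 1 ⟨ht1.le, le_rfl⟩) h1
  have hlt := hneg 1 one_pos le_rfl h0
  have hev := (hasDerivAt_iff_tendsto_slope_left_right.mp (hd 1)).1.eventually_lt_const hlt
  have hev' : ∀ᶠ s in 𝓝[<] (1 : ℝ), t < s :=
    mem_nhdsWithin_of_mem_nhds (lt_mem_nhds ht1)
  obtain ⟨s, ⟨hs, hts⟩, hs1⟩ := ((hev.and hev').and self_mem_nhdsWithin).exists
  have hs1 : s < 1 := hs1
  rw [slope_def_field, h0, sub_zero] at hs
  have h2 := hle' s ⟨hts.le, hs1.le⟩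
  rw [div_neg_iff] at hs
  rcases hs with hs | hs <;> linarith [hs.1, hs.2]

/-! ### The Schwarz D surface: a cube as a fundamental cell -/

/-- The function that defines the Schwarz D surface, in the coordinates in which its fundamental
cell is a cube (and up to a positive factor). -/
def cubeD (a b c : ℝ) : ℝ := Real.cos a + Real.cos b + Real.cos c - Real.cos (a + b + c)

/-- The radial derivative of `cubeD`. -/
def cubeDRadial (a b c : ℝ) : ℝ :=
  -(a * Real.sin a) - b * Real.sin b - c * Real.sin c + (a + b + c) * Real.sin (a + b + c)

/-- A point of the boundary of the cube such that `cubeD` is positive on the ray to it. -/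
def CubeDExceptional (a b c : ℝ) : Prop :=
  (|a| = Real.pi ∨ |b| = Real.pi ∨ |c| = Real.pi) ∧
    ∀ t : ℝ, 0 ≤ t → t < 1 → 0 < cubeD (t * a) (t * b) (t * c)

lemma mul_cos_le_sin {w : ℝ} (h0 : 0 ≤ w) (h1 : w ≤ Real.pi) : w * Real.cos w ≤ Real.sin w := by
  rcases lt_or_ge w (Real.pi / 2) with h | h
  · have hc : 0 < Real.cos w := Real.cos_pos_of_mem_Ioo ⟨by linarith [Real.pi_pos], h⟩
    have := Real.le_tan h0 h
    rwa [Real.tan_eq_sin_div_cos, le_div_iff₀ hc] at this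
  · have hc : Real.cos w ≤ 0 := Real.cos_nonpos_of_pi_div_two_le_of_le h (by linarith)
    have hs : 0 ≤ Real.sin w := Real.sin_nonneg_of_nonneg_of_le_pi h0 h1
    nlinarith

lemma cubeD_eq (a b c : ℝ) : cubeD a b c =
    2 * (Real.cos ((a + b) / 2) * Real.cos ((a - b) / 2) +
      Real.sin ((a + b) / 2) * Real.sin ((a + b) / 2 + c)) := by
  unfold cubeD
  have h1 := Real.cos_add_cos a b
  have h2 := Real.cos_sub_cos c (a + b + c)
  rw [show (c + (a + b + c)) / 2 = (a + b) / 2 + c by ring,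
    show (c - (a + b + c)) / 2 = -((a + b) / 2) by ring, Real.sin_neg] at h2
  linear_combination h1 + h2

lemma cubeDRadial_eq (a b c : ℝ) : cubeDRadial a b c =
    2 * (-((a + b) / 2 * (Real.sin ((a + b) / 2) * Real.cos ((a - b) / 2)))
      - (a - b) / 2 * (Real.cos ((a + b) / 2) * Real.sin ((a - b) / 2))
      + (a + b) / 2 * (Real.cos ((a + b) / 2) * Real.sin ((a + b) / 2 + c))
      + ((a + b) / 2 + c) * (Real.sin ((a + b) / 2) * Real.cos ((a + b) / 2 + c))) := by
  obtain ⟨u, v, w, rfl, rfl, rfl⟩ : ∃ u v w, a = u + v ∧ b = u - v ∧ c = w - u :=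
    ⟨(a + b) / 2, (a - b) / 2, (a + b) / 2 + c, by ring, by ring, by ring⟩
  unfold cubeDRadial
  rw [show (u + v + (u - v)) / 2 = u by ring, show (u + v - (u - v)) / 2 = v by ring,
    show u + v + (u - v) + (w - u) = u + w by ring, show u + (w - u) = w by ring,
    Real.sin_add, Real.sin_sub, Real.sin_sub, Real.sin_add]
  ring

/-- The region where the two larger coordinates are non-negative with mean at least `π / 2`, and
the function `cubeD` vanishes. -/
lemma cubeDRadial_neg_of_pi_lt {a b c : ℝ} (ha : a ≤ Real.pi) (hb : b ≤ Real.pi)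
    (hc : -Real.pi ≤ c) (hca : c ≤ a) (hab : Real.pi < a + b)
    (h : cubeD a b c = 0) : cubeDRadial a b c < 0 := by
  have hpi := Real.pi_pos
  rw [cubeD_eq] at h
  rw [cubeDRadial_eq]
  set u := (a + b) / 2 with hu
  set v := (a - b) / 2 with hv
  set w := u + c with hw
  have hv1 : |v| ≤ Real.pi - u := abs_le.mpr ⟨by rw [hv, hu]; linarith, by rw [hv, hu]; linarith⟩
  have hu1 : Real.pi / 2 < u := by rw [hu]; linarith
  have hu2 : u ≤ Real.pi := by rw [hu]; linarith
  have hcosv : 0 < Real.cos v := Real.cos_pos_of_mem_Ioo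
    ⟨by linarith [(abs_le.mp hv1).1], by linarith [(abs_le.mp hv1).2]⟩
  have hcosu : Real.cos u < 0 := Real.cos_neg_of_pi_div_two_lt_of_lt hu1 (by linarith)
  have hsinu : 0 ≤ Real.sin u := Real.sin_nonneg_of_nonneg_of_le_pi (by linarith) hu2
  have hpos : 0 < Real.sin u * Real.sin w := by nlinarith [mul_neg_of_neg_of_pos hcosu hcosv]
  have hsinu' : 0 < Real.sin u := lt_of_le_of_ne hsinu fun h0 => by simp [← h0] at hpos
  have hsinw : 0 < Real.sin w := pos_of_mul_pos_right hpos hsinu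
  have hw0 : 0 ≤ w := by
    by_contra! hw0
    linarith [Real.sin_neg_of_neg_of_neg_pi_lt hw0 (by rw [hw]; linarith)]
  have hw1 : w ≤ Real.pi := by
    by_contra! hw1
    have h2 : w ≤ 2 * Real.pi := by rw [hw]; linarith
    have h3 : 0 ≤ Real.sin (w - Real.pi) :=
      Real.sin_nonneg_of_nonneg_of_le_pi (by linarith) (by linarith)
    rw [Real.sin_sub_pi] at h3
    linarith
  -- in terms of `β = π - u`, which lies between `|v|` and `π / 2`
  set β := Real.pi - u with hβ
  have hβ0 : 0 ≤ β := by rw [hβ]; linarith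
  have hβ1 : β < Real.pi / 2 := by rw [hβ]; linarith
  have hsβ : Real.sin u = Real.sin β := by rw [hβ, Real.sin_pi_sub]
  have hcβ : Real.cos u = -Real.cos β := by rw [hβ, Real.cos_pi_sub, neg_neg]
  rw [hsβ] at hsinu' h ⊢
  rw [hcβ] at hcosu h ⊢
  have hz : Real.sin β * Real.sin w = Real.cos β * Real.cos v := by linarith
  have h4 : Real.sin β * (w * Real.cos w) ≤ Real.cos β * Real.cos v := by
    rw [← hz]
    exact mul_le_mul_of_nonneg_left (mul_cos_le_sin hw0 hw1) hsinu'.le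
  have h5 : v * Real.sin v * Real.cos β ≤ β * Real.sin β * Real.cos v := by
    have e1 : Real.cos β ≤ Real.cos v := by
      rw [← Real.cos_abs v]
      exact Real.cos_le_cos_of_nonneg_of_le_pi (abs_nonneg v) (by linarith) hv1
    have e2 : v * Real.sin v ≤ β * Real.sin β := by
      have e3 : v * Real.sin v = |v| * Real.sin |v| := by
        rcases abs_cases v with ⟨h, -⟩ | ⟨h, -⟩ <;> rw [h]
        rw [Real.sin_neg, neg_mul_neg]
      rw [e3]
      have e4 : Real.sin |v| ≤ Real.sin β := Real.sin_le_sin_of_le_of_le_pi_div_two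
        (by linarith [abs_nonneg v]) hβ1.le hv1
      have e5 : 0 ≤ Real.sin |v| :=
        Real.sin_nonneg_of_nonneg_of_le_pi (abs_nonneg v) (by linarith)
      exact mul_le_mul hv1 e4 e5 hβ0
    have e6 : 0 ≤ Real.cos β := by linarith
    calc v * Real.sin v * Real.cos β ≤ β * Real.sin β * Real.cos β :=
          mul_le_mul_of_nonneg_right e2 e6
      _ ≤ β * Real.sin β * Real.cos v :=
          mul_le_mul_of_nonneg_left e1 (mul_nonneg hβ0 hsinu'.le)
  have h6 : Real.cos β ≤ Real.pi / 2 - β := by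
    rw [← Real.sin_pi_div_two_sub]
    exact Real.sin_le (by linarith)
  have h7 : β * Real.sin β ^ 2 + Real.sin β * Real.cos β < u := by
    have e1 : Real.sin β ≤ 1 := Real.sin_le_one β
    have e2 : Real.sin β ^ 2 ≤ 1 := by nlinarith
    nlinarith
  have h8 : Real.sin β * (-(u * (Real.sin β * Real.cos v)) - v * (-Real.cos β * Real.sin v) +
      u * (-Real.cos β * Real.sin w) + w * (Real.sin β * Real.cos w)) =
      -(u * Real.cos v) + Real.sin β * (v * Real.sin v * Real.cos β) +
      Real.sin β * (Real.sin β * (w * Real.cos w)) := by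
    linear_combination (-(u * Real.cos β)) * hz - u * Real.cos v * Real.sin_sq_add_cos_sq β
  have h9 : Real.sin β * (-(u * (Real.sin β * Real.cos v)) - v * (-Real.cos β * Real.sin v) +
      u * (-Real.cos β * Real.sin w) + w * (Real.sin β * Real.cos w)) < 0 := by
    rw [h8]
    have e1 := mul_le_mul_of_nonneg_left h5 hsinu'.le
    have e2 := mul_le_mul_of_nonneg_left h4 hsinu'.le
    have e3 := mul_lt_mul_of_pos_right h7 hcosv
    nlinarith
  have h10 := neg_of_mul_neg_right h9 hsinu'.le
  linarith

/-- The region where `0 ≤ a + b ≤ π` and `a + b + c ≥ 0`. -/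
lemma cubeDRadial_neg_of_le_pi {a b c : ℝ} (ha : 0 ≤ a) (hb : 0 ≤ b)
    (hca : c ≤ a) (hcb : c ≤ b) (hab : a + b ≤ Real.pi) (hs : 0 ≤ a + b + c)
    (h : cubeD a b c = 0) : cubeDRadial a b c < 0 ∨ CubeDExceptional a b c := by
  have hpi := Real.pi_pos
  rw [cubeD_eq] at h
  rw [cubeDRadial_eq]
  set u := (a + b) / 2 with hu
  set v := (a - b) / 2 with hv
  set w := u + c with hw
  have hu0 : 0 ≤ u := by rw [hu]; linarith
  have hu1 : u ≤ Real.pi / 2 := by rw [hu]; linarith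
  have hv1 : |v| ≤ u := abs_le.mpr ⟨by rw [hv, hu]; linarith, by rw [hv, hu]; linarith⟩
  have hcosv : 0 ≤ Real.cos v := Real.cos_nonneg_of_mem_Icc
    ⟨by linarith [(abs_le.mp hv1).1], by linarith [(abs_le.mp hv1).2]⟩
  have hcosu : 0 ≤ Real.cos u := Real.cos_nonneg_of_mem_Icc ⟨by linarith, hu1⟩
  have hsinu : 0 ≤ Real.sin u := Real.sin_nonneg_of_nonneg_of_le_pi hu0 (by linarith)
  have hvsin : 0 ≤ v * Real.sin v := by
    rcases le_total 0 v with h0 | h0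
    · exact mul_nonneg h0 (Real.sin_nonneg_of_nonneg_of_le_pi h0
        (by linarith [(abs_le.mp hv1).2]))
    · exact mul_nonneg_of_nonpos_of_nonpos h0 (Real.sin_nonpos_of_nonpos_of_neg_pi_le h0
        (by linarith [(abs_le.mp hv1).1]))
  rcases lt_or_ge w 0 with hw0 | hw0
  · left
    have hw1 : -u ≤ w := by rw [hw, hu]; linarith
    have hu0' : 0 < u := by linarith
    have hsinw : Real.sin w < 0 := Real.sin_neg_of_neg_of_neg_pi_lt hw0 (by linarith)
    have hcosw : 0 ≤ Real.cos w := Real.cos_nonneg_of_mem_Icc ⟨by linarith, by linarith⟩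
    have hsinu' : 0 < Real.sin u := Real.sin_pos_of_pos_of_lt_pi hu0' (by linarith)
    have hcosu' : 0 < Real.cos u := by
      refine lt_of_le_of_ne hcosu fun h0 => ?_
      rw [← h0] at h
      nlinarith [mul_neg_of_pos_of_neg hsinu' hsinw]
    have e1 : 0 ≤ u * (Real.sin u * Real.cos v) := by positivity
    have e2 : 0 ≤ v * Real.sin v * Real.cos u := mul_nonneg hvsin hcosu
    have e3 : u * (Real.cos u * Real.sin w) < 0 :=
      mul_neg_of_pos_of_neg hu0' (mul_neg_of_pos_of_neg hcosu' hsinw)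
    have e4 : w * (Real.sin u * Real.cos w) ≤ 0 :=
      mul_nonpos_of_nonpos_of_nonneg hw0.le (mul_nonneg hsinu hcosw)
    nlinarith
  -- both summands of the equation are non-negative, hence zero, which forces `u = π / 2`
  · have hw1 : w ≤ Real.pi := by rw [hw, hu]; linarith
    have hsinw : 0 ≤ Real.sin w := Real.sin_nonneg_of_nonneg_of_le_pi hw0 hw1
    have e1 := mul_nonneg hcosu hcosv
    have e2 := mul_nonneg hsinu hsinw
    have e3 : Real.cos u * Real.cos v = 0 := by linarith
    have e4 : Real.sin u * Real.sin w = 0 := by linarith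
    have hu2 : u = Real.pi / 2 := by
      refine le_antisymm hu1 (not_lt.mp fun hlt => ?_)
      have e5 : 0 < Real.cos u := Real.cos_pos_of_mem_Ioo ⟨by linarith, hlt⟩
      have e6 : 0 < Real.cos v := Real.cos_pos_of_mem_Ioo
        ⟨by linarith [(abs_le.mp hv1).1], by linarith [(abs_le.mp hv1).2]⟩
      exact (mul_pos e5 e6).ne' e3
    rw [hu2, Real.sin_pi_div_two, one_mul] at e4
    rw [hu2, Real.sin_pi_div_two, Real.cos_pi_div_two, e4]
    rcases eq_or_ne w 0 with hw2 | hw2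
    · rw [hw2]
      by_cases hv2 : |v| = Real.pi / 2
      · -- the points `(π, 0, -π/2)` and `(0, π, -π/2)`
        right
        have hc2 : c = -(Real.pi / 2) := by linarith [hw.symm.trans hw2]
        have hcos : ∀ t : ℝ, 0 ≤ t → t < 1 → 0 < 1 + Real.cos (t * Real.pi) := fun t h0 h1 => by
          have h3 := Real.cos_lt_cos_of_nonneg_of_le_pi (x := t * Real.pi) (by positivity) le_rfl
            (by nlinarith)
          rw [Real.cos_pi] at h3
          linarith
        rcases abs_cases v with ⟨h1, -⟩ | ⟨h1, -⟩
        · have ha2 : a = Real.pi := by linarith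
          have hb2 : b = 0 := by linarith
          refine ⟨Or.inl (by rw [ha2, abs_of_pos hpi]), fun t h0 h1 => ?_⟩
          have e5 := hcos t h0 h1
          unfold cubeD
          rw [ha2, hb2, hc2, show t * Real.pi + t * 0 + t * -(Real.pi / 2) = t * (Real.pi / 2) by
            ring, mul_neg, Real.cos_neg, mul_zero, Real.cos_zero]
          linarith
        · have ha2 : b = Real.pi := by linarith
          have hb2 : a = 0 := by linarith
          refine ⟨Or.inr (Or.inl (by rw [ha2, abs_of_pos hpi])), fun t h0 h1 => ?_⟩
          have e5 := hcos t h0 h1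
          unfold cubeD
          rw [ha2, hb2, hc2, show t * 0 + t * Real.pi + t * -(Real.pi / 2) = t * (Real.pi / 2) by
            ring, mul_neg, Real.cos_neg, mul_zero, Real.cos_zero]
          linarith
      · left
        have hv3 : |v| < Real.pi / 2 := lt_of_le_of_ne (by linarith) hv2
        have e6 : 0 < Real.cos v := Real.cos_pos_of_mem_Ioo (abs_lt.mp hv3)
        nlinarith
    · left
      have hw3 : w = Real.pi := by
        refine le_antisymm hw1 (not_lt.mp fun hlt => ?_)
        exact (Real.sin_pos_of_pos_of_lt_pi (lt_of_le_of_ne hw0 (Ne.symm hw2)) hlt).ne' e4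
      rw [hw3, Real.cos_pi]
      nlinarith

/-- The constant `1 + π / 4` is the one for which the derivative vanishes at `π / 4`. -/
lemma antitoneOn_mul_sin_add_cos :
    AntitoneOn (fun x => x * Real.sin x + (1 + Real.pi / 4) * Real.cos x)
      (Set.Icc (Real.pi / 4) Real.pi) := by
  have hpi := Real.pi_pos
  have hder : ∀ x : ℝ, HasDerivAt
      (fun x => x * Real.sin x + (1 + Real.pi / 4) * Real.cos x)
      ((1 * Real.sin x + x * Real.cos x) + (1 + Real.pi / 4) * -Real.sin x) x := fun x =>
    ((hasDerivAt_id x).mul (Real.hasDerivAt_sin x)).add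
      ((Real.hasDerivAt_cos x).const_mul _)
  refine antitoneOn_of_deriv_nonpos (convex_Icc _ _)
    (fun x _ => (hder x).continuousAt.continuousWithinAt)
    (fun x _ => (hder x).differentiableAt.differentiableWithinAt) fun x hx => ?_
  rw [interior_Icc] at hx
  rw [(hder x).deriv]
  rcases le_total x (Real.pi / 2) with h5 | h5
  · -- `tan x ≥ 1 + 2 (x - π/4)`
    have hy0 : 0 ≤ x - Real.pi / 4 := by linarith [hx.1]
    have g1 : Real.sin x = Real.sqrt 2 / 2 *
        (Real.cos (x - Real.pi / 4) + Real.sin (x - Real.pi / 4)) := by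
      conv_lhs => rw [show x = (x - Real.pi / 4) + Real.pi / 4 by ring]
      rw [Real.sin_add, Real.cos_pi_div_four, Real.sin_pi_div_four]
      ring
    have g2 : Real.cos x = Real.sqrt 2 / 2 *
        (Real.cos (x - Real.pi / 4) - Real.sin (x - Real.pi / 4)) := by
      conv_lhs => rw [show x = (x - Real.pi / 4) + Real.pi / 4 by ring]
      rw [Real.cos_add, Real.cos_pi_div_four, Real.sin_pi_div_four]
      ring
    have g3 := mul_cos_le_sin hy0 (by linarith)
    set y := x - Real.pi / 4 with hy
    have g4 : x = y + Real.pi / 4 := by rw [hy]; ring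
    have g5 : 0 ≤ Real.sin y := Real.sin_nonneg_of_nonneg_of_le_pi hy0 (by linarith)
    have g6 : 0 < Real.sqrt 2 := by positivity
    have g7 : y * Real.cos y - y * Real.sin y - Real.pi / 4 * (2 * Real.sin y) ≤ 0 := by
      have : 3 < Real.pi := Real.pi_gt_three
      nlinarith [mul_nonneg hy0 g5]
    rw [g1, g2, g4]
    nlinarith
  · have g1 : Real.cos x ≤ 0 :=
      Real.cos_nonpos_of_pi_div_two_le_of_le h5 (by linarith [hx.2])
    have g2 : 0 ≤ Real.sin x :=
      Real.sin_nonneg_of_nonneg_of_le_pi (by linarith) hx.2.le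
    nlinarith [hx.1]

lemma one_sub_cos_lt_mul_sin {a : ℝ} (ha : 0 < a) (e4 : a ≤ Real.pi / 3) :
    (1 + Real.pi / 4) * (1 - Real.cos a) < a * Real.sin a := by
  have hpi := Real.pi_pos
  have g1 : 1 - Real.cos a = 2 * Real.sin (a / 2) ^ 2 := by
    rw [Real.sin_sq_eq_half_sub, mul_div_cancel₀ a two_ne_zero]
    ring
  have g2 : Real.sin a = 2 * Real.sin (a / 2) * Real.cos (a / 2) := by
    rw [← Real.sin_two_mul, mul_div_cancel₀ a two_ne_zero]
  have g3 : 0 < Real.sin (a / 2) :=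
    Real.sin_pos_of_pos_of_lt_pi (by linarith) (by linarith)
  have hpi2 : Real.pi < 3.15 := Real.pi_lt_d2
  set y := a / 2 with hy
  have hy0 : 0 < y := by rw [hy]; linarith
  have hy1 : y ≤ 0.525 := by rw [hy]; linarith
  have g5 : 1 - y ^ 2 / 2 ≤ Real.cos y := Real.one_sub_sq_div_two_le_cos
  have g7 : Real.sin y ≤ y - y ^ 3 / 6 + y ^ 5 / 100 := by
    have := (abs_le.mp (Real.sin_bound (x := y)
      (by rw [abs_of_pos hy0]; linarith))).2
    rw [abs_of_pos hy0] at this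
    linarith
  have g6 : (1 + Real.pi / 4) * Real.sin y < 2 * y * Real.cos y := by
    have k1 : (1 + Real.pi / 4) * Real.sin y ≤ 1.7875 * Real.sin y :=
      mul_le_mul_of_nonneg_right (by linarith) g3.le
    have k2 : 2 * y * (1 - y ^ 2 / 2) ≤ 2 * y * Real.cos y :=
      mul_le_mul_of_nonneg_left g5 (by linarith)
    have k3 : y ^ 2 ≤ 0.525 ^ 2 := by gcongr
    have k4 : y ^ 4 ≤ 0.525 ^ 4 := by gcongr
    have k5 : 0 < y * (0.2125 - 0.70209 * y ^ 2 - 0.017875 * y ^ 4) :=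
      mul_pos hy0 (by norm_num at k3 k4 ⊢; linarith)
    have k6 : 0 < y ^ 3 := by positivity
    linarith
  rw [g1, g2, show a = 2 * y by rw [hy]; ring]
  linarith [mul_lt_mul_of_pos_left g6 g3]

/-- The region where `a, b > 0` and `a + b + c < 0`. -/
lemma cubeDRadial_neg_of_sum_neg {a b c : ℝ} (ha : 0 < a) (hab : a ≤ b)
    (hc : -Real.pi ≤ c) (hs : a + b + c < 0) (h : cubeD a b c = 0) : cubeDRadial a b c < 0 := by
  have hpi := Real.pi_pos
  unfold cubeD at h
  unfold cubeDRadial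
  obtain ⟨s, hs'⟩ : ∃ s, s = -(a + b + c) := ⟨_, rfl⟩
  obtain ⟨d, hd⟩ : ∃ d, d = Real.pi + c := ⟨_, rfl⟩
  have hsum : d + a + b + s = Real.pi := by linarith
  have h1 : Real.cos (a + b + c) = Real.cos s := by rw [hs', Real.cos_neg]
  have h2 : (a + b + c) * Real.sin (a + b + c) = s * Real.sin s := by
    rw [hs', Real.sin_neg, neg_mul_neg]
  have h3 : Real.cos c = -Real.cos d := by rw [hd, add_comm, Real.cos_add_pi, neg_neg]
  have h4 : c * Real.sin c = (Real.pi - d) * Real.sin d := by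
    rw [hd, add_comm Real.pi, Real.sin_add_pi]
    ring
  rw [h1, h3] at h
  rw [h2, h4]
  have hs0 : 0 < s := by linarith
  have hd0 : 0 ≤ d := by linarith
  have hsa : 0 < Real.sin a := Real.sin_pos_of_pos_of_lt_pi ha (by linarith)
  have hsb : 0 < Real.sin b := Real.sin_pos_of_pos_of_lt_pi (by linarith) (by linarith)
  have hss : 0 < Real.sin s := Real.sin_pos_of_pos_of_lt_pi hs0 (by linarith)
  have hsd : 0 ≤ (Real.pi - d) * Real.sin d :=
    mul_nonneg (by linarith) (Real.sin_nonneg_of_nonneg_of_le_pi hd0 (by linarith))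
  have hsa' : 0 < a * Real.sin a := mul_pos ha hsa
  rcases le_or_gt s b with hsb' | hsb'
  · -- `b` lies between `s` and `π - s`
    have e1 : Real.sin s ≤ Real.sin b := by
      rcases le_total b (Real.pi / 2) with h5 | h5
      · exact Real.sin_le_sin_of_le_of_le_pi_div_two (by linarith) h5 hsb'
      · rw [← Real.sin_pi_sub b]
        exact Real.sin_le_sin_of_le_of_le_pi_div_two (by linarith) (by linarith) (by linarith)
    have e2 := mul_le_mul hsb' e1 hss.le (by linarith)
    linarith
  · -- now `d < a ≤ b < s`, and `cos d + cos s = cos a + cos b`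
    have e1 : Real.cos s < Real.cos b :=
      Real.cos_lt_cos_of_nonneg_of_le_pi (by linarith) (by linarith) hsb'
    have e2 : d < a := by
      by_contra! hle
      linarith [Real.cos_le_cos_of_nonneg_of_le_pi ha.le (by linarith) hle]
    have e3 : Real.pi / 2 ≤ a + b := by
      have f1 := Real.cos_add_cos a b
      have f2 := Real.cos_add_cos s d
      by_contra! hlt
      have f3 : Real.cos ((s + d) / 2) < Real.cos ((a + b) / 2) :=
        Real.cos_lt_cos_of_nonneg_of_le_pi (by linarith) (by linarith) (by linarith)
      have f4 : Real.cos ((s - d) / 2) ≤ Real.cos ((a - b) / 2) := by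
        rw [← Real.cos_abs ((a - b) / 2), abs_of_nonpos (by linarith)]
        exact Real.cos_le_cos_of_nonneg_of_le_pi (by linarith) (by linarith) (by linarith)
      have f5 : 0 < Real.cos ((s - d) / 2) :=
        Real.cos_pos_of_mem_Ioo ⟨by linarith, by linarith⟩
      have f6 : 0 < Real.cos ((a + b) / 2) :=
        Real.cos_pos_of_mem_Ioo ⟨by linarith, by linarith⟩
      nlinarith
    have e4 : a ≤ Real.pi / 3 := by linarith
    -- `x sin x + (1 + π/4) cos x` decreases for `x ≥ π/4`
    have e5 : s * Real.sin s - b * Real.sin b ≤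
        (1 + Real.pi / 4) * (Real.cos b - Real.cos s) := by
      have := antitoneOn_mul_sin_add_cos (a := b) (b := s) ⟨by linarith, by linarith⟩
        ⟨by linarith, by linarith⟩
        hsb'.le
      simp only at this
      linarith
    have e6 : Real.cos b - Real.cos s ≤ 1 - Real.cos a := by
      linarith [Real.cos_le_one d]
    -- `(1 + π/4) tan (a/2) < a`
    have e7 := one_sub_cos_lt_mul_sin ha e4
    have e8 := mul_le_mul_of_nonneg_left e6 (by linarith : 0 ≤ 1 + Real.pi / 4)
    linarith [mul_pos (ha.trans_le hab) hsb]

lemma cubeD_swap₁₂ (a b c : ℝ) : cubeD b a c = cubeD a b c := by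
  unfold cubeD
  rw [add_comm b a]
  ring

lemma cubeD_swap₂₃ (a b c : ℝ) : cubeD a c b = cubeD a b c := by
  unfold cubeD
  rw [add_right_comm a c b]
  ring

lemma cubeD_neg (a b c : ℝ) : cubeD (-a) (-b) (-c) = cubeD a b c := by
  unfold cubeD
  rw [show -a + -b + -c = -(a + b + c) by ring]
  simp only [Real.cos_neg]

/-- At a zero of `cubeD`, the radial derivative is negative, or the zero lies on the boundary of
the cube and the ray to it meets no other zero. -/
def CubeDDecreasing (a b c : ℝ) : Prop :=
  cubeD a b c = 0 → cubeDRadial a b c < 0 ∨ CubeDExceptional a b c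

lemma CubeDDecreasing.swap₁₂ {a b c : ℝ} (h : CubeDDecreasing a b c) : CubeDDecreasing b a c := by
  unfold CubeDDecreasing CubeDExceptional cubeDRadial at *
  intro h0
  rw [cubeD_swap₁₂] at h0
  refine (h h0).imp (fun h1 => ?_) fun ⟨h1, h2⟩ => ⟨by tauto, fun t => ?_⟩
  · rw [add_comm b a]
    linarith
  · rw [cubeD_swap₁₂]
    exact h2 t

lemma CubeDDecreasing.swap₂₃ {a b c : ℝ} (h : CubeDDecreasing a b c) : CubeDDecreasing a c b := by
  unfold CubeDDecreasing CubeDExceptional cubeDRadial at *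
  intro h0
  rw [cubeD_swap₂₃] at h0
  refine (h h0).imp (fun h1 => ?_) fun ⟨h1, h2⟩ => ⟨by tauto, fun t => ?_⟩
  · rw [add_right_comm a c b]
    linarith
  · rw [cubeD_swap₂₃]
    exact h2 t

lemma CubeDDecreasing.neg {a b c : ℝ} (h : CubeDDecreasing a b c) :
    CubeDDecreasing (-a) (-b) (-c) := by
  unfold CubeDDecreasing CubeDExceptional cubeDRadial at *
  intro h0
  rw [cubeD_neg] at h0
  refine (h h0).imp (fun h1 => ?_) fun ⟨h1, h2⟩ => ⟨by simpa only [abs_neg] using h1, fun t => ?_⟩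
  · rw [show -a + -b + -c = -(a + b + c) by ring]
    simpa only [Real.sin_neg, neg_mul_neg] using h1
  · rw [mul_neg, mul_neg, mul_neg, cubeD_neg]
    exact h2 t

/-- By the symmetries of `cubeD` (permutations of the coordinates and a common change of sign) one
may assume `c ≤ b ≤ a` and `0 ≤ b`; the sizes of `a + b` and of `a + b + c` then select one of the
three estimates for the radial derivative. -/
lemma cubeDDecreasing (a b c : ℝ) (ha : |a| ≤ Real.pi) (hb : |b| ≤ Real.pi) (hc : |c| ≤ Real.pi) :
    CubeDDecreasing a b c := by
  -- ordered coordinates of which two are non-negative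
  have core : ∀ a b c : ℝ, a ≤ Real.pi → -Real.pi ≤ c → c ≤ b → b ≤ a →
      (0 < b ∨ 0 ≤ b ∧ 0 ≤ a + b + c) → CubeDDecreasing a b c := by
    intro a b c h1 h2 h3 h4 h5
    have hb0 : 0 ≤ b := h5.elim le_of_lt And.left
    rcases lt_or_ge Real.pi (a + b) with h6 | h6
    · exact fun h0 => Or.inl
        (cubeDRadial_neg_of_pi_lt h1 (h4.trans h1) h2 (h3.trans h4) h6 h0)
    rcases le_or_gt 0 (a + b + c) with h7 | h7
    · exact cubeDRadial_neg_of_le_pi (hb0.trans h4) hb0 (h3.trans h4) h3 h6 h7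
    · have hb1 : 0 < b := h5.elim id fun h => absurd h.2 (not_le.mpr h7)
      refine CubeDDecreasing.swap₁₂ fun h0 => Or.inl
        (cubeDRadial_neg_of_sum_neg hb1 h4 h2 (by linarith) h0)
  have sorted : ∀ a b c : ℝ, |a| ≤ Real.pi → |c| ≤ Real.pi → c ≤ b → b ≤ a →
      CubeDDecreasing a b c := by
    intro a b c h1 h2 h3 h4
    rw [abs_le] at h1 h2
    by_cases h5 : 0 < b ∨ 0 ≤ b ∧ 0 ≤ a + b + c
    · exact core a b c h1.2 h2.1 h3 h4 h5
    · have h6 := (core (-c) (-b) (-a) (by linarith) (by linarith) (by linarith) (by linarith) (by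
        push Not at h5
        rcases h5.1.lt_or_eq with h | h
        · exact Or.inl (by linarith)
        · exact Or.inr ⟨by linarith, by linarith [h5.2 h.ge]⟩)).neg
      rw [neg_neg, neg_neg, neg_neg] at h6
      exact h6.swap₂₃.swap₁₂.swap₂₃
  rcases le_total a b with h1 | h1 <;> rcases le_total b c with h2 | h2 <;>
    rcases le_total a c with h3 | h3
  · exact (sorted c b a hc ha h1 h2).swap₂₃.swap₁₂.swap₂₃
  · exact (sorted c b a hc ha h1 h2).swap₂₃.swap₁₂.swap₂₃
  · exact (sorted b c a hb ha h3 h2).swap₂₃.swap₁₂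
  · exact (sorted b a c hb hc h3 h1).swap₁₂
  · exact (sorted c a b hc hb h1 h3).swap₁₂.swap₂₃
  · exact (sorted a c b ha hb h2 h3).swap₂₃
  · exact sorted a b c ha hc h2 h1
  · exact sorted a b c ha hc h2 h1

/-- The part `cubeD ≥ 0` of the cube is star-shaped. -/
lemma cubeD_mul_pos {a b c t : ℝ} (ha : |a| ≤ Real.pi) (hb : |b| ≤ Real.pi) (hc : |c| ≤ Real.pi)
    (h : 0 ≤ cubeD a b c) (h0 : 0 ≤ t) (h1 : t < 1) : 0 < cubeD (t * a) (t * b) (t * c) := by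
  rcases h0.eq_or_lt with rfl | h0
  · norm_num [cubeD]
  by_cases hex : CubeDExceptional a b c
  · exact hex.2 t h0.le h1
  have hsmall : ∀ s x : ℝ, 0 < s → s ≤ 1 → |x| ≤ Real.pi → |s * x| ≤ Real.pi := by
    intro s x hs hs1 hx
    rw [abs_mul, abs_of_pos hs]
    nlinarith [abs_nonneg x]
  have hrad : ∀ s : ℝ, 0 < s → s ≤ 1 → cubeD (s * a) (s * b) (s * c) = 0 →
      cubeDRadial (s * a) (s * b) (s * c) < 0 := by
    intro s hs hs1 hz
    rcases cubeDDecreasing _ _ _ (hsmall s a hs hs1 ha) (hsmall s b hs hs1 hb)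
      (hsmall s c hs hs1 hc) hz with h2 | h2
    · exact h2
    · exfalso
      rcases hs1.eq_or_lt with rfl | hs1
      · rw [one_mul, one_mul, one_mul] at h2
        exact hex h2
      · have hlt : ∀ x : ℝ, |x| ≤ Real.pi → |s * x| ≠ Real.pi := by
          intro x hx
          rw [abs_mul, abs_of_pos hs]
          nlinarith [abs_nonneg x, Real.pi_pos]
        rcases h2.1 with h3 | h3 | h3
        · exact hlt a ha h3
        · exact hlt b hb h3
        · exact hlt c hc h3
  -- a differentiable function that agrees with `cubeD` on the ray
  set φ' : ℝ → ℝ := fun s => -(a * Real.sin (s * a)) - b * Real.sin (s * b) - c * Real.sin (s * c)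
    + (a + b + c) * Real.sin (s * a + s * b + s * c) with hφ'
  have hrel : ∀ s, s * φ' s = cubeDRadial (s * a) (s * b) (s * c) := fun s => by
    rw [hφ', cubeDRadial]
    ring
  refine pos_of_deriv_neg_at_zeros (φ := fun s => cubeD (s * a) (s * b) (s * c)) (φ' := φ')
    (fun s => ?_) (by simpa using h) (fun s hs hs1 hz => ?_) h0 h1
  · have h : ∀ k : ℝ, HasDerivAt (fun s : ℝ => Real.cos (s * k)) (-Real.sin (s * k) * (1 * k)) s :=
      fun k => ((hasDerivAt_id s).mul_const k).cos
    have h2 := (((h a).add (h b)).add (h c)).sub (h (a + b + c))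
    have h3 : (fun s => cubeD (s * a) (s * b) (s * c)) =
        (((fun s => Real.cos (s * a)) + fun s => Real.cos (s * b)) + fun s => Real.cos (s * c)) -
          fun s => Real.cos (s * (a + b + c)) := by
      funext s
      simp only [Pi.add_apply, Pi.sub_apply, cubeD, mul_add]
    rw [h3]
    refine h2.congr_deriv ?_
    rw [hφ', show s * (a + b + c) = s * a + s * b + s * c by ring]
    ring
  · have h2 := hrad s hs hs1 hz
    rw [← hrel] at h2
    exact neg_of_mul_neg_right h2 hs.le

lemma cubeD_edge {a b c : ℝ} (ha : |a| = Real.pi) (hb : |b| = Real.pi) : cubeD a b c = -2 := by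
  have h1 : ∀ x : ℝ, |x| = Real.pi → Real.cos x = -1 := fun x hx => by
    rw [← Real.cos_abs, hx, Real.cos_pi]
  have h2 : ∀ x : ℝ, |x| = Real.pi → Real.sin x = 0 := fun x hx => by
    rcases abs_eq Real.pi_pos.le |>.mp hx with rfl | rfl <;> simp
  unfold cubeD
  rw [Real.cos_add, Real.cos_add, Real.sin_add, h1 a ha, h1 b hb, h2 a ha, h2 b hb]
  ring

lemma cubeD_face {a b c : ℝ} (ha : |a| = Real.pi) :
    cubeD a b c = 2 * (Real.cos ((b + c) / 2) *
      (Real.cos ((b - c) / 2) + Real.cos ((b + c) / 2))) - 2 := by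
  have h1 : Real.cos a = -1 := by rw [← Real.cos_abs, ha, Real.cos_pi]
  have h2 : Real.sin a = 0 := by
    rcases abs_eq Real.pi_pos.le |>.mp ha with rfl | rfl <;> simp
  have h3 := Real.cos_add_cos b c
  have h4 : Real.cos (b + c) = 2 * Real.cos ((b + c) / 2) ^ 2 - 1 := by
    rw [← Real.cos_two_mul, mul_div_cancel₀ _ two_ne_zero]
  unfold cubeD
  rw [add_assoc a b c, Real.cos_add, h1, h2, h4]
  linear_combination h3

lemma abs_add_le_of_cubeD_face {a b c : ℝ} (ha : |a| = Real.pi) (hb : |b| ≤ Real.pi)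
    (hc : |c| ≤ Real.pi) (h : 0 ≤ cubeD a b c) : |b + c| ≤ Real.pi := by
  rw [cubeD_face ha] at h
  rw [abs_le] at hb hc
  by_contra! hlt
  have hpi := Real.pi_pos
  have h2 : Real.cos ((b + c) / 2) ≤ 0 := by
    rw [← Real.cos_abs, abs_div, abs_two]
    have : |b + c| ≤ 2 * Real.pi := abs_le.mpr ⟨by linarith, by linarith⟩
    exact Real.cos_nonpos_of_pi_div_two_le_of_le (by linarith) (by linarith)
  have h3 : -Real.cos ((b + c) / 2) ≤ Real.cos ((b - c) / 2) := by
    rw [← Real.cos_abs ((b + c) / 2), ← Real.cos_abs ((b - c) / 2), ← Real.cos_pi_sub]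
    refine Real.cos_le_cos_of_nonneg_of_le_pi (abs_nonneg _)
      (by linarith [abs_nonneg ((b + c) / 2)]) ?_
    have h4 : |(b - c) / 2| + |(b + c) / 2| ≤ Real.pi := by
      rcases abs_cases ((b - c) / 2) with ⟨h, -⟩ | ⟨h, -⟩ <;>
      rcases abs_cases ((b + c) / 2) with ⟨h', -⟩ | ⟨h', -⟩ <;> rw [h, h'] <;> linarith
    linarith
  nlinarith

/-- The intersection of the part `cubeD ≥ 0` of the cube with a face is star-shaped. -/
lemma cubeD_face_mul_pos {b c t : ℝ} (hb : |b| ≤ Real.pi)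
    (hc : |c| ≤ Real.pi) (h : 0 ≤ cubeD Real.pi b c) (h0 : 0 ≤ t) (h1 : t < 1) :
    0 < cubeD Real.pi (t * b) (t * c) := by
  have hpi := Real.pi_pos
  have ha : |Real.pi| = Real.pi := abs_of_pos hpi
  have hbc := abs_add_le_of_cubeD_face ha hb hc h
  rw [cubeD_face ha] at h ⊢
  obtain ⟨m, hm⟩ : ∃ m, m = (b + c) / 2 := ⟨_, rfl⟩
  obtain ⟨n, hn⟩ : ∃ n, n = (b - c) / 2 := ⟨_, rfl⟩
  have hm1 : |m| ≤ Real.pi / 2 := by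
    rw [hm, abs_div, abs_two]
    linarith
  have hn1 : |n| ≤ Real.pi := by
    rw [abs_le] at hb hc ⊢
    constructor <;> rw [hn] <;> linarith
  rw [← hm, ← hn] at h
  rw [show (t * b + t * c) / 2 = t * m by rw [hm]; ring,
    show (t * b - t * c) / 2 = t * n by rw [hn]; ring]
  have e1 : 0 ≤ Real.cos m := Real.cos_nonneg_of_mem_Icc (abs_le.mp hm1)
  have e2 : 0 < Real.cos n + Real.cos m := by
    by_contra! hle
    nlinarith
  have e3 : 0 < Real.cos m := lt_of_le_of_ne e1 fun h' => by
    rw [← h'] at h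
    linarith
  have hm2 : |m| ≤ Real.pi := by linarith
  have e4 := cos_le_cos_mul hm2 h0 h1.le
  have e5 := cos_le_cos_mul hn1 h0 h1.le
  by_cases hm0 : m = 0
  · by_cases hn0 : n = 0
    · rw [hm0, hn0, mul_zero, Real.cos_zero]
      norm_num
    · have e6 := cos_lt_cos_mul hn1 h0 h1 hn0
      nlinarith
  · have e6 := cos_lt_cos_mul hm2 h0 h1 hm0
    nlinarith

/-! ### The elements of the Hantzsche–Wendt group -/

lemma mem_hantzscheWendtGroup_iff {γ : E3 ≃ᵃⁱ[ℝ] E3} :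
    γ ∈ hantzscheWendtGroup ↔ HWShape γ := by
  refine ⟨hwShape_of_mem, ?_⟩
  rintro ⟨s, n, hn, hc⟩
  have hA : screwA ∈ hantzscheWendtGroup := Subgroup.subset_closure (by simp)
  have hB : screwB ∈ hantzscheWendtGroup := Subgroup.subset_closure (by simp)
  have key : ∀ (δ : E3 ≃ᵃⁱ[ℝ] E3) (k : Fin 3 → ℤ), δ ∈ hantzscheWendtGroup →
      (∀ x i, γ x i = 2 * (k i : ℝ) + δ x i) → γ ∈ hantzscheWendtGroup := by
    intro δ k hδ h
    rw [show γ = translation (fun i => 2 * (k i : ℝ)) * δ from isometry_ext fun x i => by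
      rw [h, AffineIsometryEquiv.coe_mul, Function.comp_apply, translation_apply]]
    exact mul_mem (evenTranslation_mem k) hδ
  have hhalf : ∀ m r : ℤ, m % 2 = r → (m : ℝ) = 2 * ((m / 2 : ℤ) : ℝ) + r := by
    intro m r hr
    have := Int.mul_ediv_add_emod m 2
    rw [hr] at this
    exact_mod_cast this.symm
  rcases hc with ⟨h0, h1, h2, k0, k1, k2⟩ | ⟨h0, h1, h2, k0, k1, k2⟩ | ⟨h0, h1, h2, k0, k1, k2⟩ |
    ⟨h0, h1, h2, k0, k1, k2⟩
  · refine key 1 (fun i => n i / 2) (one_mem _) fun x i => ?_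
    rw [hn]
    fin_cases i <;> simp only [Fin.zero_eta, Fin.mk_one, Fin.reduceFinMk, h0, h1, h2]
    · rw [hhalf _ _ k0]; simp; ring
    · rw [hhalf _ _ k1]; simp; ring
    · rw [hhalf _ _ k2]; simp; ring
  · refine key screwA (fun i => n i / 2) hA fun x i => ?_
    rw [hn, screwA, signedTranslation_apply]
    fin_cases i <;> simp only [Fin.zero_eta, Fin.mk_one, Fin.reduceFinMk, h0, h1, h2]
    · rw [hhalf _ _ k0]; simp; ring
    · rw [hhalf _ _ k1]; simp; ring
    · rw [hhalf _ _ k2]; simp; ring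
  · refine key screwB (fun i => n i / 2) hB fun x i => ?_
    rw [hn, screwB, signedTranslation_apply]
    fin_cases i <;> simp only [Fin.zero_eta, Fin.mk_one, Fin.reduceFinMk, h0, h1, h2]
    · rw [hhalf _ _ k0]; simp; ring
    · rw [hhalf _ _ k1]; simp; ring
    · rw [hhalf _ _ k2]; simp; ring
  · refine key (screwA * screwB) (fun i => if i = 2 then n i / 2 + 1 else n i / 2)
      (mul_mem hA hB) fun x i => ?_
    rw [hn, AffineIsometryEquiv.coe_mul, Function.comp_apply, screwA, screwB,
      signedTranslation_apply, signedTranslation_apply]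
    fin_cases i <;> simp only [Fin.zero_eta, Fin.mk_one, Fin.reduceFinMk, h0, h1, h2]
    · rw [hhalf _ _ k0]; simp; ring
    · rw [hhalf _ _ k1]; simp; ring
    · rw [hhalf _ _ k2]; simp; ring

/-- A screw motion in the Hantzsche–Wendt group, along the axis `i + 2`. -/
def IsScrew (γ : E3 ≃ᵃⁱ[ℝ] E3) (i : Fin 3) (n : Fin 3 → ℤ) : Prop :=
  (∀ x, γ x i = -x i + n i ∧ γ x (i + 1) = -x (i + 1) + n (i + 1) ∧
    γ x (i + 2) = x (i + 2) + n (i + 2)) ∧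
  n i % 2 = 1 ∧ n (i + 1) % 2 = 0 ∧ n (i + 2) % 2 = 1

lemma IsScrew.mem {γ : E3 ≃ᵃⁱ[ℝ] E3} {i : Fin 3} {n : Fin 3 → ℤ} (h : IsScrew γ i n) :
    γ ∈ hantzscheWendtGroup := by
  obtain ⟨hx, h0, h1, h2⟩ := h
  rw [mem_hantzscheWendtGroup_iff]
  refine ⟨fun j => if j = i + 2 then 1 else -1, n, fun x j => ?_, ?_⟩
  · have := hx x
    fin_cases i <;> fin_cases j <;> simp_all
  · fin_cases i <;> simp_all

lemma hantzscheWendtGroup_cases {γ : E3 ≃ᵃⁱ[ℝ] E3} (h : γ ∈ hantzscheWendtGroup) :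
    (∃ n : Fin 3 → ℤ, ∀ x j, γ x j = x j + 2 * n j) ∨ ∃ i n, IsScrew γ i n := by
  obtain ⟨s, n, hn, hc⟩ := hwShape_of_mem h
  rcases hc with ⟨h0, h1, h2, k0, k1, k2⟩ | ⟨h0, h1, h2, k0, k1, k2⟩ | ⟨h0, h1, h2, k0, k1, k2⟩ |
    ⟨h0, h1, h2, k0, k1, k2⟩
  · refine Or.inl ⟨fun j => n j / 2, fun x j => ?_⟩
    have hj : s j = 1 ∧ n j = 2 * (n j / 2) := by
      fin_cases j <;> simp_all <;> omega
    rw [hn, hj.1]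
    have : (n j : ℝ) = 2 * ((n j / 2 : ℤ) : ℝ) := by exact_mod_cast hj.2
    rw [this]
    push_cast
    ring
  · exact Or.inr ⟨1, n, fun x => by simp [hn, h0, h1, h2, show (1 : Fin 3) + 1 = 2 from rfl,
      show (1 : Fin 3) + 2 = 0 from rfl], k1, k2, k0⟩
  · exact Or.inr ⟨2, n, fun x => by simp [hn, h0, h1, h2, show (2 : Fin 3) + 1 = 0 from rfl,
      show (2 : Fin 3) + 2 = 1 from rfl], k2, k0, k1⟩
  · exact Or.inr ⟨0, n, fun x => by simp [hn, h0, h1, h2], k0, k1, k2⟩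

lemma det_hantzscheWendtGroup : ∀ γ ∈ hantzscheWendtGroup, (linPart γ).det = 1 := by
  intro γ hγ
  obtain ⟨s, n, hn, hc⟩ := hwShape_of_mem hγ
  have hs : ∀ i, ∃ u : ℤˣ, (u : ℤ) = s i := by
    intro i
    have : s i = 1 ∨ s i = -1 := by
      rcases hc with ⟨h0, h1, h2, -⟩ | ⟨h0, h1, h2, -⟩ | ⟨h0, h1, h2, -⟩ | ⟨h0, h1, h2, -⟩ <;>
      fin_cases i <;> simp [h0, h1, h2]
    rcases this with h | h
    · exact ⟨1, by simp [h]⟩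
    · exact ⟨-1, by simp [h]⟩
  choose u hu using hs
  rw [det_linPart_of_apply (σ := 1) (ε := u) (v := fun i => (n i : ℝ)) fun x i => by
    rw [hn, ← hu]
    rfl]
  rw [Equiv.Perm.sign_one, one_mul, Fin.prod_univ_three]
  push_cast
  rw [hu, hu, hu]
  rcases hc with ⟨h0, h1, h2, -⟩ | ⟨h0, h1, h2, -⟩ | ⟨h0, h1, h2, -⟩ | ⟨h0, h1, h2, -⟩ <;>
    rw [h0, h1, h2] <;> norm_num

/-! ### The Schwarz D surface in the Hantzsche–Wendt manifold -/

lemma fin_three_rotate (i : Fin 3) : i + 1 + 1 = i + 2 ∧ i + 1 + 2 = i ∧ i + 2 + 1 = i ∧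
    i + 2 + 2 = i + 1 ∧ i + 1 ≠ i ∧ i + 2 ≠ i ∧ i + 1 ≠ i + 2 := by
  revert i
  decide

lemma forall_rotate_iff (i : Fin 3) {p : Fin 3 → Prop} :
    (∀ j, p j) ↔ p i ∧ p (i + 1) ∧ p (i + 2) := by
  have h : ∀ i j : Fin 3, j = i ∨ j = i + 1 ∨ j = i + 2 := by decide
  refine ⟨fun h => ⟨h _, h _, h _⟩, fun ⟨h0, h1, h2⟩ j => ?_⟩
  rcases h i j with rfl | rfl | rfl
  exacts [h0, h1, h2]

/-- The function whose zero set is a Schwarz D surface. -/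
def schwarzD (x : E3) : ℝ :=
  Real.cos (Real.pi * x 0) * Real.cos (Real.pi * x 1) * Real.cos (Real.pi * x 2) +
    Real.sin (Real.pi * x 0) * Real.sin (Real.pi * x 1) * Real.sin (Real.pi * x 2)

lemma schwarzD_rotate (x : E3) (i : Fin 3) : schwarzD x =
    Real.cos (Real.pi * x i) * Real.cos (Real.pi * x (i + 1)) * Real.cos (Real.pi * x (i + 2)) +
    Real.sin (Real.pi * x i) * Real.sin (Real.pi * x (i + 1)) * Real.sin (Real.pi * x (i + 2)) := by
  unfold schwarzD
  fin_cases i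
  · rfl
  · change _ = Real.cos (Real.pi * x 1) * Real.cos (Real.pi * x 2) * Real.cos (Real.pi * x 0) +
      Real.sin (Real.pi * x 1) * Real.sin (Real.pi * x 2) * Real.sin (Real.pi * x 0)
    ring
  · change _ = Real.cos (Real.pi * x 2) * Real.cos (Real.pi * x 0) * Real.cos (Real.pi * x 1) +
      Real.sin (Real.pi * x 2) * Real.sin (Real.pi * x 0) * Real.sin (Real.pi * x 1)
    ring

lemma contDiff_schwarzD : ContDiff ℝ ∞ schwarzD := by
  have hc : ∀ i : Fin 3, ContDiff ℝ ∞ fun x : E3 => Real.cos (Real.pi * x i) := fun i =>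
    Real.contDiff_cos.comp (contDiff_const.mul (contDiff_coord i))
  have hs : ∀ i : Fin 3, ContDiff ℝ ∞ fun x : E3 => Real.sin (Real.pi * x i) := fun i =>
    Real.contDiff_sin.comp (contDiff_const.mul (contDiff_coord i))
  exact (((hc 0).mul (hc 1)).mul (hc 2)).add (((hs 0).mul (hs 1)).mul (hs 2))

lemma cos_pi_add_intCast (y : ℝ) (m : ℤ) :
    Real.cos (Real.pi * (y + m)) = (-1) ^ m * Real.cos (Real.pi * y) := by
  rw [mul_add, mul_comm Real.pi (m : ℝ), Real.cos_add_int_mul_pi]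

lemma sin_pi_add_intCast (y : ℝ) (m : ℤ) :
    Real.sin (Real.pi * (y + m)) = (-1) ^ m * Real.sin (Real.pi * y) := by
  rw [mul_add, mul_comm Real.pi (m : ℝ), Real.sin_add_int_mul_pi]

lemma schwarzD_invariant : ∀ γ ∈ hantzscheWendtGroup, ∀ x, schwarzD (γ x) = schwarzD x := by
  intro γ hγ x
  rcases hantzscheWendtGroup_cases hγ with ⟨n, hn⟩ | ⟨i, n, hn, k0, k1, k2⟩
  · have h : ∀ j, Real.pi * (x j + 2 * n j) = Real.pi * x j + n j * (2 * Real.pi) := fun j => by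
      ring
    simp only [schwarzD, hn, h, Real.cos_add_int_mul_two_pi, Real.sin_add_int_mul_two_pi]
  · obtain ⟨h0, h1, h2⟩ := hn x
    rw [schwarzD_rotate x i, schwarzD_rotate (γ x) i, h0, h1, h2]
    simp only [cos_pi_add_intCast, sin_pi_add_intCast,
      Odd.neg_one_zpow (Int.odd_iff.mpr k0), Even.neg_one_zpow (Int.even_iff.mpr k1),
      Odd.neg_one_zpow (Int.odd_iff.mpr k2), mul_neg, Real.cos_neg, Real.sin_neg]
    ring

/-- The coordinates of `ℝ³` in which the fundamental cell of the region `schwarzD ≥ 0` lies in the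
cube `[-π, π]³`; the origin is the midpoint of an edge of the diamond network in that region. -/
def diamondCoord : E3 ≃ₜ E3 where
  toFun v := WithLp.toLp 2 fun j => 1 / 4 - (v (j + 1) + v (j + 2)) / (2 * Real.pi)
  invFun x := WithLp.toLp 2 fun j => Real.pi * (x j - x (j + 1) - x (j + 2) + 1 / 4)
  left_inv v := by
    ext j
    obtain ⟨h1, h2, h3, h4, -⟩ := fin_three_rotate j
    have := Real.pi_ne_zero
    simp only [h1, h2, h3, h4]
    field_simp
    ring
  right_inv x := by
    ext j
    obtain ⟨h1, h2, h3, h4, -⟩ := fin_three_rotate j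
    have := Real.pi_ne_zero
    simp only [h1, h2, h3, h4]
    field_simp
    ring
  continuous_toFun := continuous_toLp_of_coord fun j =>
    continuous_const.sub (((continuous_coord _).add (continuous_coord _)).div_const _)
  continuous_invFun := continuous_toLp_of_coord fun j => by
    have h := ((continuous_coord j).sub (continuous_coord (j + 1))).sub (continuous_coord (j + 2))
    exact continuous_const.mul (h.add continuous_const)

lemma diamondCoord_apply (v : E3) (j : Fin 3) :
    diamondCoord v j = 1 / 4 - (v (j + 1) + v (j + 2)) / (2 * Real.pi) := rfl

lemma diamondCoord_symm_apply (x : E3) (j : Fin 3) :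
    diamondCoord.symm x j = Real.pi * (x j - x (j + 1) - x (j + 2) + 1 / 4) := rfl

lemma schwarzD_diamondCoord (v : E3) (i : Fin 3) : schwarzD (diamondCoord v) =
    Real.sqrt 2 / 4 * cubeD (v i) (v (i + 1)) (v (i + 2)) := by
  obtain ⟨h1, h2, h3, h4, -⟩ := fin_three_rotate i
  rw [schwarzD_rotate _ i]
  simp only [diamondCoord_apply, h1, h2, h3, h4]
  obtain ⟨p, q, r, hp, hq, hr⟩ : ∃ p q r, v i = q + r - p ∧ v (i + 1) = r + p - q ∧
      v (i + 2) = p + q - r :=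
    ⟨(v (i + 1) + v (i + 2)) / 2, (v i + v (i + 2)) / 2, (v i + v (i + 1)) / 2,
      by ring, by ring, by ring⟩
  have hangle : ∀ y z w : ℝ, y + z = 2 * w →
      Real.pi * (1 / 4 - (y + z) / (2 * Real.pi)) = Real.pi / 4 - w := fun y z w h => by
    have := Real.pi_ne_zero
    rw [h]
    field_simp
  rw [hangle _ _ p (by rw [hq, hr]; ring), hangle _ _ q (by rw [hp, hr]; ring),
    hangle _ _ r (by rw [hp, hq]; ring), hp, hq, hr, cubeD,
    show q + r - p + (r + p - q) + (p + q - r) = p + q + r by ring]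
  have hsq : Real.sqrt 2 ^ 2 = 2 := Real.sq_sqrt (by norm_num)
  simp only [Real.cos_sub, Real.sin_sub, Real.cos_add, Real.sin_add, Real.cos_pi_div_four,
    Real.sin_pi_div_four]
  linear_combination ((Real.sqrt 2 / 4) * (Real.cos p * Real.cos q * Real.cos r +
    Real.cos p * Real.sin q * Real.sin r + Real.sin p * Real.cos q * Real.sin r +
    Real.sin p * Real.sin q * Real.cos r)) * hsq

lemma schwarzD_diamondCoord_nonneg {v : E3} (i : Fin 3) : 0 ≤ schwarzD (diamondCoord v) ↔
    0 ≤ cubeD (v i) (v (i + 1)) (v (i + 2)) := by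
  rw [schwarzD_diamondCoord v i]
  exact mul_nonneg_iff_of_pos_left (by positivity)

lemma schwarzD_diamondCoord_pos {v : E3} (i : Fin 3) : 0 < schwarzD (diamondCoord v) ↔
    0 < cubeD (v i) (v (i + 1)) (v (i + 2)) := by
  rw [schwarzD_diamondCoord v i]
  exact mul_pos_iff_of_pos_left (by positivity)

lemma schwarzD_edge {v : E3} (hv : 0 ≤ schwarzD (diamondCoord v)) (i j : Fin 3) (hij : i ≠ j)
    (hi : |v i| = Real.pi) (hj : |v j| = Real.pi) : False := by
  rw [schwarzD_diamondCoord_nonneg i] at hv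
  have h : ∀ i j : Fin 3, i ≠ j → j = i + 1 ∨ j = i + 2 := by decide
  replace h := h i j hij
  rcases h with rfl | rfl
  · rw [cubeD_edge hi hj] at hv
    norm_num at hv
  · rw [← cubeD_swap₂₃, cubeD_edge hi hj] at hv
    norm_num at hv

lemma schwarzD_face {v : E3} (hv : 0 ≤ schwarzD (diamondCoord v)) (hcube : ∀ i, |v i| ≤ Real.pi)
    {i : Fin 3} (hi : |v i| = Real.pi) : |v (i + 1) + v (i + 2)| ≤ Real.pi :=
  abs_add_le_of_cubeD_face hi (hcube _) (hcube _) ((schwarzD_diamondCoord_nonneg i).mp hv)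

lemma cubeFace_eq (i : Fin 3) (z : E2) :
    cubeD (cubeFace i z i) (cubeFace i z (i + 1)) (cubeFace i z (i + 2)) =
      cubeD Real.pi (z 0) (z 1) := by
  have h0 := cubeFace_succAbove i z 0
  have h1 := cubeFace_succAbove i z 1
  rw [cubeFace_same]
  fin_cases i
  · exact congrArg₂ _ h0 h1
  · refine (congrArg₂ _ h1 h0).trans (cubeD_swap₂₃ _ _ _)
  · exact congrArg₂ _ h0 h1

/-- The functionals that define the faces of the cube; the face `v i = π` is paired with the face
`v (i + 1) = -π`. -/
def diamondFunctional (i : Fin 3) (b : Bool) : E3 →L[ℝ] ℝ :=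
  cubeFunctional (if b then i else i + 1) b

lemma diamondFunctional_true_eq_one {i : Fin 3} {v : E3} :
    diamondFunctional i true v = 1 ↔ v i = Real.pi := cubeFunctional_true_eq_one

lemma diamondFunctional_false_eq_one {i : Fin 3} {v : E3} :
    diamondFunctional i false v = 1 ↔ v (i + 1) = -Real.pi := cubeFunctional_false_eq_one

lemma diamondFunctional_le_one {v : E3} :
    (∀ i b, diamondFunctional i b v ≤ 1) ↔ ∀ i, |v i| ≤ Real.pi := by
  rw [← cubeFunctional_le_one]
  constructor
  · rintro h i (_ | _)
    · have := h (i + 2) false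
      rwa [diamondFunctional, if_neg Bool.false_ne_true, (fin_three_rotate i).2.2.1] at this
    · exact h i true
  · exact fun h i b => h _ b

/-- The screw motion that pairs the face `v i = π` with the face `v (i + 1) = -π`. -/
def diamondScrew (i : Fin 3) : E3 ≃ᵃⁱ[ℝ] E3 :=
  signedTranslation (fun j => decide (j ≠ i + 2)) fun j => if j = i + 1 then 0 else 1

lemma diamondScrew_apply (i : Fin 3) (x : E3) : diamondScrew i x i = -x i + 1 ∧
    diamondScrew i x (i + 1) = -x (i + 1) ∧ diamondScrew i x (i + 2) = x (i + 2) + 1 := by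
  obtain ⟨-, -, -, -, h5, h6, h7⟩ := fin_three_rotate i
  simp only [diamondScrew, signedTranslation_apply]
  simp [h6.symm, h5.symm, h7, h7.symm, add_comm]

lemma diamondScrew_mem (i : Fin 3) : diamondScrew i ∈ hantzscheWendtGroup := by
  obtain ⟨-, -, -, -, h5, h6, h7⟩ := fin_three_rotate i
  refine IsScrew.mem (i := i) (n := fun j => if j = i + 1 then 0 else 1) ⟨fun x => ?_, ?_⟩
  · obtain ⟨h0, h1, h2⟩ := diamondScrew_apply i x
    rw [h0, h1, h2]
    simp [h5.symm, h7.symm]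
  · simp [h5.symm, h7.symm]

/-- The face pairing in the coordinates of the cube. -/
def diamondPairing (i : Fin 3) (v : E3) : E3 :=
  WithLp.toLp 2 fun j => if j = i then v (i + 1) else if j = i + 1 then v i - 2 * Real.pi
    else Real.pi - (v i + v (i + 1) + v (i + 2))

lemma diamondPairing_apply (i : Fin 3) (v : E3) : diamondPairing i v i = v (i + 1) ∧
    diamondPairing i v (i + 1) = v i - 2 * Real.pi ∧
    diamondPairing i v (i + 2) = Real.pi - (v i + v (i + 1) + v (i + 2)) := by
  obtain ⟨-, -, -, -, h5, h6, h7⟩ := fin_three_rotate i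
  unfold diamondPairing
  simp [h5, h6, h7.symm]

lemma diamondCoord_diamondPairing (i : Fin 3) (v : E3) :
    diamondScrew i (diamondCoord v) = diamondCoord (diamondPairing i v) := by
  obtain ⟨h1, h2, h3, h4, -⟩ := fin_three_rotate i
  obtain ⟨k0, k1, k2⟩ := diamondScrew_apply i (diamondCoord v)
  obtain ⟨p0, p1, p2⟩ := diamondPairing_apply i v
  have hpi := Real.pi_ne_zero
  ext j
  revert j
  refine (forall_rotate_iff i).mpr ⟨?_, ?_, ?_⟩
  · rw [k0, diamondCoord_apply, diamondCoord_apply, p1, p2]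
    field_simp
    ring
  · rw [k1, diamondCoord_apply, diamondCoord_apply, h1, h2, p2, p0]
    field_simp
    ring
  · rw [k2, diamondCoord_apply, diamondCoord_apply, h3, h4, p0, p1]
    field_simp
    ring

lemma isometry_diamondCoord_screw {γ : E3 ≃ᵃⁱ[ℝ] E3} {i : Fin 3} {n : Fin 3 → ℤ}
    (h : IsScrew γ i n) {v w : E3} (hvw : γ (diamondCoord v) = diamondCoord w) :
    ∃ k₀ k₁ k₂ : ℤ, (k₀ - k₂) % 2 = 0 ∧ (k₀ - k₁) % 2 = 1 ∧
      w i = v (i + 1) + 2 * Real.pi * k₀ ∧ w (i + 1) = v i + 2 * Real.pi * k₁ ∧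
      w (i + 2) = Real.pi - (v i + v (i + 1) + v (i + 2)) + 2 * Real.pi * k₂ := by
  obtain ⟨hn, e0, e1, e2⟩ := h
  obtain ⟨h1, h2, h3, h4, -⟩ := fin_three_rotate i
  obtain ⟨k0, k1, k2⟩ := hn (diamondCoord v)
  have hw : w = diamondCoord.symm (γ (diamondCoord v)) := by
    rw [hvw, Homeomorph.symm_apply_apply]
  have hpi := Real.pi_ne_zero
  obtain ⟨a, ha⟩ : ∃ a, n i - n (i + 1) - n (i + 2) = 2 * a := ⟨(n i - n (i + 1) - n (i + 2)) / 2,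
    by omega⟩
  obtain ⟨b, hb⟩ : ∃ b, -n i + n (i + 1) - n (i + 2) = 2 * b :=
    ⟨(-n i + n (i + 1) - n (i + 2)) / 2, by omega⟩
  obtain ⟨c, hc⟩ : ∃ c, -n i - n (i + 1) + n (i + 2) = 2 * c :=
    ⟨(-n i - n (i + 1) + n (i + 2)) / 2, by omega⟩
  have ha' : (n i - n (i + 1) - n (i + 2) : ℝ) = 2 * a := by exact_mod_cast ha
  have hb' : (-n i + n (i + 1) - n (i + 2) : ℝ) = 2 * b := by exact_mod_cast hb
  have hc' : (-n i - n (i + 1) + n (i + 2) : ℝ) = 2 * c := by exact_mod_cast hc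
  refine ⟨a, b, c, by omega, by omega, ?_, ?_, ?_⟩
  · rw [hw, diamondCoord_symm_apply, k0, k1, k2, mul_assoc, mul_left_comm, ← ha']
    simp only [diamondCoord_apply, h1, h2, h3, h4]
    field_simp
    ring
  · rw [hw, diamondCoord_symm_apply, h1, h2, k0, k1, k2, mul_assoc, mul_left_comm, ← hb']
    simp only [diamondCoord_apply, h1, h2, h3, h4]
    field_simp
    ring
  · rw [hw, diamondCoord_symm_apply, h3, h4, k0, k1, k2, mul_assoc, mul_left_comm, ← hc']
    simp only [diamondCoord_apply, h1, h2, h3, h4]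
    field_simp
    ring

/-- An integer `k` such that `x + 2πk` and `x` lie in `[-π, π]` is `0` or `±1`; in the latter
cases `x` is an endpoint. -/
lemma shift_cases {x y : ℝ} {k : ℤ} (hx : |x| ≤ Real.pi) (hy : |y| ≤ Real.pi)
    (h : y = x + 2 * Real.pi * k) : k = 0 ∨ (k = 1 ∧ x = -Real.pi ∧ y = Real.pi) ∨
      (k = -1 ∧ x = Real.pi ∧ y = -Real.pi) := by
  have hpi := Real.pi_pos
  obtain ⟨h1, h2⟩ := abs_le.mp hx
  obtain ⟨h3, h4⟩ := abs_le.mp hy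
  rw [h] at h3 h4
  have h5 : (k : ℝ) ≤ 1 := by nlinarith
  have h6 : (-1 : ℝ) ≤ k := by nlinarith
  have h7 : k ≤ 1 := by exact_mod_cast h5
  have h8 : -1 ≤ k := by exact_mod_cast h6
  obtain h9 | h9 | h9 : k = 0 ∨ k = -1 ∨ k = 1 := by omega
  · exact Or.inl h9
  · rw [h9] at h3 h4 h
    push_cast at h3 h4 h
    exact Or.inr (Or.inr ⟨h9, by linarith, by linarith⟩)
  · rw [h9] at h3 h4 h
    push_cast at h3 h4 h
    exact Or.inr (Or.inl ⟨h9, by linarith, by linarith⟩)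

lemma abs_eq_pi_of_eq {x : ℝ} (h : x = Real.pi ∨ x = -Real.pi) : |x| = Real.pi :=
  (abs_eq Real.pi_pos.le).mpr h

/-- A screw motion maps a point of the cell to the cell only if it is a face pairing or the inverse
of one. -/
lemma diamond_tiling_screw {γ : E3 ≃ᵃⁱ[ℝ] E3} {i : Fin 3} {n : Fin 3 → ℤ}
    (h : IsScrew γ i n) {v w : E3} (hv : ∀ i, |v i| ≤ Real.pi)
    (hfv : 0 ≤ schwarzD (diamondCoord v)) (hw : ∀ i, |w i| ≤ Real.pi)
    (hfw : 0 ≤ schwarzD (diamondCoord w)) (hvw : γ (diamondCoord v) = diamondCoord w) :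
    (v i = Real.pi ∧ w = diamondPairing i v) ∨ (w i = Real.pi ∧ v = diamondPairing i w) := by
  have hpi := Real.pi_pos
  obtain ⟨h1, h2, h3, h4, h5, h6, h7⟩ := fin_three_rotate i
  obtain ⟨k₀, k₁, k₂, e1, e2, w0, w1, w2⟩ := isometry_diamondCoord_screw h hvw
  have hnotw : ∀ {a b : Fin 3}, a ≠ b → |w a| = Real.pi → |w b| = Real.pi → False :=
    fun {a b} => schwarzD_edge hfw a b
  have hcast : ∀ {k m : ℤ}, k = m → (k : ℝ) = m := fun h => by rw [h]
  have hk₂ : ∀ r : ℝ, |r| ≤ Real.pi → ∀ m : ℤ, m % 2 = 0 → w (i + 2) = r + 2 * Real.pi * m →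
      m = 0 := by
    intro r hr m hm hwm
    rcases shift_cases hr (hw _) hwm with h | ⟨h, -⟩ | ⟨h, -⟩ <;> omega
  rcases shift_cases (hv _) (hw _) w0 with h0 | ⟨h0, f1, f2⟩ | ⟨h0, f1, f2⟩ <;>
    rcases shift_cases (hv _) (hw _) w1 with h0' | ⟨h0', f1', f2'⟩ | ⟨h0', f1', f2'⟩ <;>
    try omega
  · -- `v i = -π`
    exfalso
    have hf := abs_le.mp (schwarzD_face hfv hv (abs_eq_pi_of_eq (Or.inr f1')))
    obtain ⟨g1, g2⟩ := abs_le.mp (hw (i + 2))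
    have hm : |v (i + 1) + v (i + 2)| ≤ Real.pi := abs_le.mpr hf
    have hk : k₂ = -2 ∨ k₂ = 0 ∨ (1 : ℝ) ≤ k₂ ∨ (k₂ : ℝ) ≤ -3 := by
      have : k₂ = -2 ∨ k₂ = 0 ∨ 1 ≤ k₂ ∨ k₂ ≤ -3 := by omega
      exact_mod_cast this
    rcases hk with hk | hk | hk | hk
    · rw [hk] at w2
      push_cast at w2
      exact hnotw h7 (abs_eq_pi_of_eq (Or.inl f2'))
        (abs_eq_pi_of_eq (Or.inr (by linarith)))
    · rw [hk] at w2
      push_cast at w2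
      exact hnotw h7 (abs_eq_pi_of_eq (Or.inl f2'))
        (abs_eq_pi_of_eq (Or.inl (by linarith)))
    · nlinarith
    · nlinarith
  · -- `v i = π`, the face pairing
    left
    refine ⟨f1', ?_⟩
    have hf := schwarzD_face hfv hv (abs_eq_pi_of_eq (Or.inl f1'))
    have hk := hk₂ (-(v (i + 1) + v (i + 2))) (by rwa [abs_neg]) k₂ (by omega)
      (by rw [w2, f1']; ring)
    obtain ⟨p0, p1, p2⟩ := diamondPairing_apply i v
    ext j
    revert j
    refine (forall_rotate_iff i).mpr ⟨?_, ?_, ?_⟩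
    · rw [p0, w0, h0]
      simp
    · rw [p1, w1, h0']
      push_cast
      ring
    · rw [p2, w2, hk]
      simp
  · -- `v (i + 1) = -π`, the inverse of the face pairing
    right
    refine ⟨f2, ?_⟩
    have hf := schwarzD_face hfv hv (abs_eq_pi_of_eq (Or.inr f1))
    rw [h1, h2] at hf
    have hk := hk₂ (-(v (i + 2) + v i)) (by rwa [abs_neg]) (k₂ + 1) (by omega)
      (by rw [w2, f1]; push_cast; ring)
    have hk' : (k₂ : ℝ) = -1 := by
      have : k₂ = -1 := by omega
      rw [this]
      norm_num
    obtain ⟨p0, p1, p2⟩ := diamondPairing_apply i w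
    ext j
    revert j
    refine (forall_rotate_iff i).mpr ⟨?_, ?_, ?_⟩
    · rw [p0, w1, h0']
      simp
    · rw [p1, f1, f2]
      ring
    · rw [p2, w2, w0, w1, h0, h0', hk', f1]
      push_cast
      ring
  · -- `v (i + 1) = π`
    exfalso
    have hf := abs_le.mp (schwarzD_face hfv hv (abs_eq_pi_of_eq (Or.inl f1)))
    rw [h1, h2] at hf
    obtain ⟨g1, g2⟩ := abs_le.mp (hw (i + 2))
    have hk : k₂ = -1 ∨ k₂ = 1 ∨ (2 : ℝ) ≤ k₂ ∨ (k₂ : ℝ) ≤ -2 := by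
      have : k₂ = -1 ∨ k₂ = 1 ∨ 2 ≤ k₂ ∨ k₂ ≤ -2 := by omega
      exact_mod_cast this
    rcases hk with hk | hk | hk | hk
    · rw [hk] at w2
      push_cast at w2
      exact hnotw h6.symm (abs_eq_pi_of_eq (Or.inr f2))
        (abs_eq_pi_of_eq (Or.inr (by linarith)))
    · rw [hk] at w2
      push_cast at w2
      exact hnotw h6.symm (abs_eq_pi_of_eq (Or.inr f2))
        (abs_eq_pi_of_eq (Or.inl (by linarith)))
    · nlinarith
    · nlinarith

lemma diamond_tiling_translation {γ : E3 ≃ᵃⁱ[ℝ] E3} {n : Fin 3 → ℤ}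
    (hn : ∀ x j, γ x j = x j + 2 * n j) {v w : E3} (hv : ∀ i, |v i| ≤ Real.pi)
    (hfv : 0 ≤ schwarzD (diamondCoord v)) (hw : ∀ i, |w i| ≤ Real.pi)
    (hvw : γ (diamondCoord v) = diamondCoord w) : v = w := by
  have hw' : w = diamondCoord.symm (γ (diamondCoord v)) := by
    rw [hvw, Homeomorph.symm_apply_apply]
  have hj : ∀ j, w j = v j + 2 * Real.pi * ((n j - n (j + 1) - n (j + 2) : ℤ) : ℝ) := by
    intro j
    have hpi := Real.pi_ne_zero
    obtain ⟨h1, h2, h3, h4, -⟩ := fin_three_rotate j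
    rw [hw', diamondCoord_symm_apply, hn, hn, hn]
    simp only [diamondCoord_apply, h1, h2, h3, h4]
    push_cast
    field_simp
    ring
  have hzero : ∀ j, n j - n (j + 1) - n (j + 2) = 0 := by
    by_contra! hne
    -- the three integers have the same parity, so they are all odd
    have hodd : ∀ j, n j - n (j + 1) - n (j + 2) ≠ 0 := by
      have hcase : ∀ j, n j - n (j + 1) - n (j + 2) = 0 ∨ n j - n (j + 1) - n (j + 2) = 1 ∨
          n j - n (j + 1) - n (j + 2) = -1 := fun j => by
        rcases shift_cases (hv j) (hw j) (hj j) with h | ⟨h, -⟩ | ⟨h, -⟩ <;> omega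
      obtain ⟨i, hi⟩ := hne
      obtain ⟨h1, h2, h3, h4, -⟩ := fin_three_rotate i
      refine (forall_rotate_iff i).mpr ⟨hi, ?_, ?_⟩
      · have c0 := hcase i
        have c1 := hcase (i + 1)
        rw [h1, h2] at c1 ⊢
        omega
      · have c0 := hcase i
        have c1 := hcase (i + 2)
        rw [h3, h4] at c1 ⊢
        omega
    have habs : ∀ j, |v j| = Real.pi := fun j => by
      rcases shift_cases (hv j) (hw j) (hj j) with h | ⟨-, h, -⟩ | ⟨-, h, -⟩
      · exact absurd h (hodd j)
      · exact abs_eq_pi_of_eq (Or.inr h)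
      · exact abs_eq_pi_of_eq (Or.inl h)
    exact schwarzD_edge hfv 0 1 (by decide) (habs 0) (habs 1)
  ext j
  rw [hj, hzero]
  simp

/-- Every orbit has a point closest to the origin. -/
lemma exists_norm_le (Γ : Subgroup (E3 ≃ᵃⁱ[ℝ] E3)) [IsSpaceFormGroup Γ] (x : E3) :
    ∃ γ ∈ Γ, ∀ δ ∈ Γ, ‖γ x‖ ≤ ‖δ x‖ := by
  have hfin : {γ : Γ | ((γ • ·) '' {x} ∩ Metric.closedBall (0 : E3) ‖x‖).Nonempty}.Finite :=
    ProperlyDiscontinuousSMul.finite_disjoint_inter_image isCompact_singleton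
      (isCompact_closedBall _ _)
  have hmem : ∀ γ : Γ, ((γ • ·) '' {x} ∩ Metric.closedBall (0 : E3) ‖x‖).Nonempty ↔
      ‖γ.1 x‖ ≤ ‖x‖ := by
    intro γ
    rw [Set.image_singleton, Set.singleton_inter_nonempty, mem_closedBall_zero_iff]
    rfl
  simp only [hmem] at hfin
  obtain ⟨γ, hγ, hmin⟩ := Set.exists_min_image _ (fun γ : Γ => ‖γ.1 x‖) hfin ⟨1, le_refl ‖x‖⟩
  refine ⟨γ.1, γ.2, fun δ hδ => ?_⟩
  rcases le_total ‖δ x‖ ‖x‖ with h | h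
  · exact hmin ⟨δ, hδ⟩ h
  · exact le_trans hγ h

/-- Each point has a translate by the Hantzsche–Wendt group in the rhombic dodecahedron
`|y i| + |y j| ≤ 1`: an orbit point closest to the origin. -/
lemma exists_mem_rhombicDodecahedron (x : E3) : ∃ γ ∈ hantzscheWendtGroup, ∀ i : Fin 3,
    |γ x i| + |γ x (i + 2)| ≤ 1 := by
  obtain ⟨γ, hγ, hmin⟩ := exists_norm_le hantzscheWendtGroup x
  have hmin' : ∀ δ ∈ hantzscheWendtGroup, ‖γ x‖ ≤ ‖δ (γ x)‖ := fun δ hδ =>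
    hmin (δ * γ) (mul_mem hδ hγ)
  refine ⟨γ, hγ, fun i => ?_⟩
  set y := γ x with hy
  obtain ⟨h1, h2, h3, h4, h5, h6, h7⟩ := fin_three_rotate i
  have key : ∀ s t : ℤ, s % 2 = 1 → t % 2 = 1 → s ^ 2 = 1 → t ^ 2 = 1 →
      0 ≤ 2 - 2 * (s : ℝ) * y i + 2 * (t : ℝ) * y (i + 2) := by
    intro s t hs ht hs2 ht2
    set δ : E3 ≃ᵃⁱ[ℝ] E3 := signedTranslation (fun j => decide (j ≠ i + 2))
      fun j => if j = i then s else if j = i + 2 then t else 0 with hδ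
    have hδa : ∀ x, δ x i = -x i + s ∧ δ x (i + 1) = -x (i + 1) ∧
        δ x (i + 2) = x (i + 2) + t := by
      intro x
      simp only [hδ, signedTranslation_apply]
      simp [h5, h6, h6.symm, h7, add_comm]
    have hm : δ ∈ hantzscheWendtGroup := by
      refine IsScrew.mem (i := i) (n := fun j => if j = i then s else if j = i + 2 then t else 0)
        ⟨fun x => ?_, ?_⟩
      · obtain ⟨k0, k1, k2⟩ := hδa x
        rw [k0, k1, k2]
        simp [h5, h6, h7]
      · simp [h5, h6, h7, hs, ht]
    have hle := hmin' δ hm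
    have hsum : ∀ z : E3, ‖z‖ ^ 2 = z i ^ 2 + z (i + 1) ^ 2 + z (i + 2) ^ 2 := by
      intro z
      rw [EuclideanSpace.real_norm_sq_eq, Fin.sum_univ_three]
      fin_cases i
      · rfl
      · change _ = z 1 ^ 2 + z 2 ^ 2 + z 0 ^ 2
        ring
      · change _ = z 2 ^ 2 + z 0 ^ 2 + z 1 ^ 2
        ring
    have hle2 : ‖y‖ ^ 2 ≤ ‖δ y‖ ^ 2 := by gcongr
    obtain ⟨k0, k1, k2⟩ := hδa y
    rw [hsum, hsum, k0, k1, k2] at hle2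
    have hs2' : (s : ℝ) ^ 2 = 1 := by exact_mod_cast hs2
    have ht2' : (t : ℝ) ^ 2 = 1 := by exact_mod_cast ht2
    nlinarith
  have a1 := key 1 1 rfl rfl rfl rfl
  have a2 := key 1 (-1) rfl rfl rfl rfl
  have a3 := key (-1) 1 rfl rfl rfl rfl
  have a4 := key (-1) (-1) rfl rfl rfl rfl
  push_cast at a1 a2 a3 a4
  rcases abs_cases (y i) with ⟨h, -⟩ | ⟨h, -⟩ <;>
    rcases abs_cases (y (i + 2)) with ⟨h', -⟩ | ⟨h', -⟩ <;> rw [h, h'] <;> linarith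

/-! ### A fundamental cell of the Schwarz D region -/

/-- `schwarzD` is negative near the vertices `(-1/2, 1/2, 1/2)` and the like, where three faces of
the rhombic dodecahedron meet. -/
lemma prod_cos_lt_prod_sin {p q r : ℝ} (h : 5 / 4 < p + q + r) (hpq : p + q ≤ 1) (hpr : p + r ≤ 1)
    (hqr : q + r ≤ 1) : Real.cos (Real.pi * p) * Real.cos (Real.pi * q) * Real.cos (Real.pi * r) <
      Real.sin (Real.pi * p) * Real.sin (Real.pi * q) * Real.sin (Real.pi * r) := by
  have hpi := Real.pi_pos
  have hs : ∀ x : ℝ, 1 / 4 < x → x < 3 / 4 → 0 < Real.sin (Real.pi * x) := fun x h1 h2 =>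
    Real.sin_pos_of_pos_of_lt_pi (by nlinarith) (by nlinarith)
  have hsp := hs p (by linarith) (by linarith)
  have hsq := hs q (by linarith) (by linarith)
  have hsr := hs r (by linarith) (by linarith)
  have hpos := mul_pos (mul_pos hsp hsq) hsr
  have hc : ∀ x : ℝ, 1 / 4 < x → x ≤ 1 / 2 → 0 ≤ Real.cos (Real.pi * x) := fun x h1 h2 =>
    Real.cos_nonneg_of_mem_Icc ⟨by nlinarith, by nlinarith⟩
  have hc' : ∀ x : ℝ, 1 / 2 ≤ x → x < 3 / 4 → Real.cos (Real.pi * x) ≤ 0 := fun x h1 h2 =>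
    Real.cos_nonpos_of_pi_div_two_le_of_le (by nlinarith) (by nlinarith)
  rcases lt_or_ge (1 / 2) p with hp | hp
  · exact lt_of_le_of_lt (mul_nonpos_of_nonpos_of_nonneg (mul_nonpos_of_nonpos_of_nonneg
      (hc' p hp.le (by linarith)) (hc q (by linarith) (by linarith)))
      (hc r (by linarith) (by linarith))) hpos
  rcases lt_or_ge (1 / 2) q with hq | hq
  · exact lt_of_le_of_lt (mul_nonpos_of_nonpos_of_nonneg (mul_nonpos_of_nonneg_of_nonpos
      (hc p (by linarith) hp) (hc' q hq.le (by linarith)))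
      (hc r (by linarith) (by linarith))) hpos
  rcases lt_or_ge (1 / 2) r with hr | hr
  · exact lt_of_le_of_lt (mul_nonpos_of_nonneg_of_nonpos (mul_nonneg
      (hc p (by linarith) hp) (hc q (by linarith) hq)) (hc' r hr.le (by linarith))) hpos
  · have hcs : ∀ x y : ℝ, x ≤ 1 / 2 → 1 / 4 < y → y ≤ 1 / 2 → 1 / 2 - y < x →
        Real.cos (Real.pi * x) < Real.sin (Real.pi * y) := by
      intro x y hx hy hy' hxy
      rw [← Real.cos_pi_div_two_sub]
      exact Real.cos_lt_cos_of_nonneg_of_le_pi (by nlinarith) (by nlinarith) (by nlinarith)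
    have h1 := hcs p q hp (by linarith) hq (by linarith)
    have h2 := hcs q p hq (by linarith) hp (by linarith)
    have h3 := hcs r r hr (by linarith) hr (by linarith)
    have cp := hc p (by linarith) hp
    have cq := hc q (by linarith) hq
    have cr := hc r (by linarith) hr
    calc _ ≤ Real.sin (Real.pi * q) * Real.sin (Real.pi * p) * Real.cos (Real.pi * r) := by
          gcongr
      _ < Real.sin (Real.pi * q) * Real.sin (Real.pi * p) * Real.sin (Real.pi * r) :=
          mul_lt_mul_of_pos_left h3 (mul_pos hsq hsp)
      _ = _ := by ring

/-- `schwarzD` is negative near the vertices `(1, 0, 0)` and the like, where four faces of the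
rhombic dodecahedron meet. -/
lemma schwarzD_neg_near_octahedron {p q r : ℝ} (hp : 3 / 4 < p) (hpq : |p| + |q| ≤ 1)
    (hpr : |p| + |r| ≤ 1) :
    Real.cos (Real.pi * p) * Real.cos (Real.pi * q) * Real.cos (Real.pi * r) +
      Real.sin (Real.pi * p) * Real.sin (Real.pi * q) * Real.sin (Real.pi * r) < 0 := by
  have hpi := Real.pi_pos
  rw [abs_of_pos (by linarith)] at hpq hpr
  have hbound : ∀ x : ℝ, |x| ≤ 1 - p → |Real.sin (Real.pi * x)| < Real.cos (Real.pi * x) := by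
    intro x hx
    have h1 : |Real.sin (Real.pi * x)| = Real.sin (Real.pi * |x|) := by
      have h2 : 0 ≤ Real.sin (Real.pi * |x|) := Real.sin_nonneg_of_nonneg_of_le_pi
        (by positivity) (by nlinarith [abs_nonneg x])
      rcases abs_cases x with ⟨h, -⟩ | ⟨h, -⟩ <;> rw [h] at h2 ⊢
      · exact abs_of_nonneg h2
      · rw [mul_neg, Real.sin_neg] at h2 ⊢
        exact abs_of_nonpos (by linarith)
    have h2 : Real.cos (Real.pi * x) = Real.sin (Real.pi / 2 - Real.pi * |x|) := by
      rw [Real.sin_pi_div_two_sub]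
      rcases abs_cases x with ⟨h, -⟩ | ⟨h, -⟩ <;> rw [h]
      rw [mul_neg, Real.cos_neg]
    rw [h1, h2]
    exact Real.sin_lt_sin_of_lt_of_le_pi_div_two (by nlinarith [abs_nonneg x])
      (by nlinarith [abs_nonneg x]) (by nlinarith)
  have h1 := hbound q (by linarith)
  have h2 := hbound r (by linarith)
  have h3 := hbound (1 - p) (le_of_eq (abs_of_nonneg (by linarith [abs_nonneg q])))
  rw [mul_sub, mul_one, Real.sin_pi_sub, Real.cos_pi_sub] at h3
  have h4 : |Real.sin (Real.pi * p) * Real.sin (Real.pi * q) * Real.sin (Real.pi * r)| <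
      -Real.cos (Real.pi * p) * Real.cos (Real.pi * q) * Real.cos (Real.pi * r) := by
    rw [abs_mul, abs_mul]
    have c1 := (abs_nonneg _).trans_lt h1
    have c2 := (abs_nonneg _).trans_lt h2
    have c3 := (abs_nonneg _).trans_lt h3
    calc _ ≤ |Real.sin (Real.pi * p)| * |Real.sin (Real.pi * q)| * Real.cos (Real.pi * r) := by
          gcongr
      _ ≤ |Real.sin (Real.pi * p)| * Real.cos (Real.pi * q) * Real.cos (Real.pi * r) := by
          gcongr
      _ < _ := by gcongr
  have h5 := (abs_lt.mp h4).2
  linarith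

/-- A point of the dodecahedron in the region beyond the midplane of the edge in the direction
`(1, 1, 1)` belongs to the cube about the midpoint of this edge. -/
lemma abs_le_of_beyond_midplane {p q r : ℝ} (hpq : |p| + |q| ≤ 1) (hpr : |p| + |r| ≤ 1)
    (hqr : |q| + |r| ≤ 1) (h : 3 / 4 < p + q + r)
    (hf : 0 ≤ Real.cos (Real.pi * p) * Real.cos (Real.pi * q) * Real.cos (Real.pi * r) +
      Real.sin (Real.pi * p) * Real.sin (Real.pi * q) * Real.sin (Real.pi * r)) :
    |Real.pi * (p - q - r + 1 / 4)| ≤ Real.pi := by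
  have hpi := Real.pi_pos
  have h1 : p - q - r ≤ 3 / 4 := by
    by_contra! hlt
    exact absurd hf (not_le.mpr (schwarzD_neg_near_octahedron (by linarith) hpq hpr))
  have h2 : -1 ≤ p - q - r + 1 / 4 := by
    linarith [le_abs_self q, le_abs_self r]
  rw [abs_le]
  constructor <;> nlinarith

/-- The orbit of a point with `schwarzD ≥ 0` meets the cell: a point of the dodecahedron outside the
cube has one coordinate greater than `π`, and the screw motion of that face carries it into the
cube. -/
lemma diamond_cover (x : E3) (hx : 0 ≤ schwarzD x) : ∃ γ ∈ hantzscheWendtGroup, ∃ v,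
    (∀ i, |v i| ≤ Real.pi) ∧ diamondCoord v = γ x := by
  have hpi := Real.pi_pos
  obtain ⟨γ, hγ, hy⟩ := exists_mem_rhombicDodecahedron x
  rw [← schwarzD_invariant γ hγ x] at hx
  set y := γ x with hyd
  have hpair : ∀ i : Fin 3, |y i| + |y (i + 1)| ≤ 1 ∧ |y i| + |y (i + 2)| ≤ 1 ∧
      |y (i + 1)| + |y (i + 2)| ≤ 1 := by
    intro i
    obtain ⟨h1, h2, h3, h4, -⟩ := fin_three_rotate i
    have k0 := hy i
    have k1 := hy (i + 1)
    have k2 := hy (i + 2)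
    rw [h2] at k1
    rw [h4] at k2
    exact ⟨by linarith, by linarith, by linarith⟩
  set v := diamondCoord.symm y with hv
  have hva : ∀ i, v i = Real.pi * (y i - y (i + 1) - y (i + 2) + 1 / 4) :=
    diamondCoord_symm_apply y
  by_cases hup : ∃ i, Real.pi < v i
  · obtain ⟨i, hi⟩ := hup
    obtain ⟨h1, h2, h3, h4, -⟩ := fin_three_rotate i
    obtain ⟨a1, a2, a3⟩ := hpair i
    rw [hva] at hi
    have hi' : 3 / 4 < y i - y (i + 1) - y (i + 2) := by nlinarith
    have hf := hx
    rw [schwarzD_rotate y i] at hf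
    refine ⟨diamondScrew i * γ, mul_mem (diamondScrew_mem i) hγ, diamondPairing i v, ?_, ?_⟩
    · obtain ⟨p0, p1, p2⟩ := diamondPairing_apply i v
      refine (forall_rotate_iff i).mpr ⟨?_, ?_, ?_⟩
      · rw [p0, hva, h1, h2]
        have := abs_le_of_beyond_midplane (p := -y (i + 2)) (q := y i) (r := -y (i + 1))
          (by rw [abs_neg]; linarith) (by rw [abs_neg, abs_neg]; linarith)
          (by rw [abs_neg]; linarith) (by linarith) (by
            simp only [mul_neg, Real.cos_neg, Real.sin_neg]
            linarith)
        rwa [show -y (i + 2) - y i - -y (i + 1) + 1 / 4 =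
          y (i + 1) - y (i + 2) - y i + 1 / 4 by ring] at this
      · rw [p1, hva, abs_le]
        have b1 := neg_abs_le (y (i + 1))
        have b2 := neg_abs_le (y (i + 2))
        have b3 := le_abs_self (y i)
        constructor <;> nlinarith
      · rw [p2, hva, hva, hva, h1, h2, h3, h4]
        have := abs_le_of_beyond_midplane (p := y i) (q := -y (i + 1)) (r := -y (i + 2))
          (by rw [abs_neg]; linarith) (by rw [abs_neg]; linarith)
          (by rw [abs_neg, abs_neg]; linarith) (by linarith) (by
            simp only [mul_neg, Real.cos_neg, Real.sin_neg]
            linarith)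
        convert this using 2
        ring
    · rw [← diamondCoord_diamondPairing, hv, Homeomorph.apply_symm_apply]
      rfl
  · push Not at hup
    refine ⟨γ, hγ, v, fun i => ?_, Homeomorph.apply_symm_apply _ _⟩
    obtain ⟨a1, a2, a3⟩ := hpair i
    have hf := hx
    rw [schwarzD_rotate y i] at hf
    by_cases hs : 3 / 4 < y i + y (i + 1) + y (i + 2)
    · rw [hva]
      exact abs_le_of_beyond_midplane a1 a2 a3 hs hf
    · refine abs_le.mpr ⟨?_, hup i⟩
      rw [hva]
      by_contra! hlt
      have hlt' : y i - y (i + 1) - y (i + 2) < -(5 / 4) := by nlinarith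
      have h5 := prod_cos_lt_prod_sin (p := -y i) (q := y (i + 1)) (r := y (i + 2))
        (by linarith) (by linarith [neg_le_abs (y i), le_abs_self (y (i + 1))])
        (by linarith [neg_le_abs (y i), le_abs_self (y (i + 2))])
        (by linarith [le_abs_self (y (i + 1)), le_abs_self (y (i + 2))])
      simp only [mul_neg, Real.cos_neg, Real.sin_neg] at h5
      linarith

/-- The fundamental cell of the region `schwarzD ≥ 0` of the Hantzsche–Wendt manifold. -/
def diamondCell : HandlebodyCell hantzscheWendtGroup schwarzD 3 where
  κ := diamondCoord
  ℓ := diamondFunctional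
  τ := diamondPairing
  d := cubeFace
  r := dropCoord
  d_cont := continuous_cubeFace
  r_cont := continuous_dropCoord
  r_d := dropCoord_cubeFace
  d_r i v h := cubeFace_dropCoord (diamondFunctional_true_eq_one.mp h)
  ℓ_d i z := diamondFunctional_true_eq_one.mpr (cubeFace_same i z)
  d_smul := cubeFace_smul
  τ_spec i := ⟨_, diamondScrew_mem i, diamondCoord_diamondPairing i⟩
  bounded := ⟨_, fun v hv _ => norm_le_of_coord Real.pi_pos.le (diamondFunctional_le_one.mp hv)⟩
  center := by
    rw [schwarzD_diamondCoord_pos 0]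
    norm_num [cubeD]
  star v hv hf t h0 h1 := by
    rw [diamondFunctional_le_one] at hv
    rw [schwarzD_diamondCoord_nonneg 0] at hf
    rw [schwarzD_diamondCoord_pos 0]
    exact cubeD_mul_pos (hv _) (hv _) (hv _) hf h0 h1
  face_inj v hv hf i b i' b' h h' := by
    obtain ⟨h1, rfl⟩ := cubeFunctional_inj (schwarzD_edge hf) h h'
    cases b
    · exact ⟨add_right_cancel (b := 1) h1, rfl⟩
    · exact ⟨h1, rfl⟩
  face_center i := by
    refine ⟨diamondFunctional_le_one.mpr ((forall_coord_iff i).mpr ⟨?_, fun j => ?_⟩), ?_⟩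
    · rw [cubeFace_same, abs_of_pos Real.pi_pos]
    · rw [cubeFace_succAbove]
      simpa using Real.pi_pos.le
    · rw [schwarzD_diamondCoord_pos i, cubeFace_eq]
      norm_num [cubeD]
  face_star i z hz hf t h0 h1 := by
    rw [schwarzD_diamondCoord_nonneg i, cubeFace_eq] at hf
    rw [schwarzD_diamondCoord_pos i, cubeFace_eq]
    have hz' : ∀ j, |z j| ≤ Real.pi := fun j => by
      have := diamondFunctional_le_one.mp hz (i.succAbove j)
      rwa [cubeFace_succAbove] at this
    exact cubeD_face_mul_pos (hz' 0) (hz' 1) hf h0 h1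
  pair i v hv hf h := by
    rw [diamondFunctional_true_eq_one] at h
    rw [diamondFunctional_le_one] at hv ⊢
    have hpi := Real.pi_pos
    obtain ⟨p0, p1, p2⟩ := diamondPairing_apply i v
    have hi : diamondPairing i v (i + 1) = -Real.pi := by
      rw [p1, h]
      ring
    refine ⟨(forall_rotate_iff i).mpr ⟨p0 ▸ hv _, ?_, ?_⟩, diamondFunctional_false_eq_one.mpr hi⟩
    · rw [hi, abs_neg, abs_of_pos hpi]
    · rw [p2, h, show Real.pi - (Real.pi + v (i + 1) + v (i + 2)) = -(v (i + 1) + v (i + 2)) by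
        ring, abs_neg]
      exact schwarzD_face hf hv (abs_eq_pi_of_eq (Or.inl h))
  pair_surj i w hw hf h := by
    rw [diamondFunctional_false_eq_one] at h
    rw [diamondFunctional_le_one] at hw
    have hpi := Real.pi_pos
    obtain ⟨h1, h2, h3, h4, h5, h6, h7⟩ := fin_three_rotate i
    set v : E3 := WithLp.toLp 2 fun j => if j = i then Real.pi else if j = i + 1 then w i else
      -(w i + w (i + 2)) with hv
    have v0 : v i = Real.pi := by simp [hv]
    have v1 : v (i + 1) = w i := by simp [hv, h5]
    have v2 : v (i + 2) = -(w i + w (i + 2)) := by simp [hv, h6, h7.symm]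
    refine ⟨v, diamondFunctional_le_one.mpr ((forall_rotate_iff i).mpr ⟨?_, ?_, ?_⟩),
      diamondFunctional_true_eq_one.mpr v0, ?_⟩
    · rw [v0, abs_of_pos hpi]
    · rw [v1]
      exact hw i
    · have := schwarzD_face hf hw (abs_eq_pi_of_eq (Or.inr h))
      rw [h1, h2] at this
      rwa [v2, abs_neg, add_comm (w i)]
    · obtain ⟨p0, p1, p2⟩ := diamondPairing_apply i v
      ext j
      revert j
      refine (forall_rotate_iff i).mpr ⟨?_, ?_, ?_⟩
      · rw [p0, v1]
      · rw [p1, v0, h]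
        ring
      · rw [p2, v0, v1, v2]
        ring
  tiling γ hγ v w hv hfv hw hfw h := by
    rw [diamondFunctional_le_one] at hv hw
    rcases hantzscheWendtGroup_cases hγ with ⟨n, hn⟩ | ⟨i, n, hn⟩
    · exact Or.inl (diamond_tiling_translation hn hv hfv hw h)
    · refine Or.inr ⟨i, (diamond_tiling_screw hn hv hfv hw hfw h).imp ?_ ?_⟩
      · exact fun ⟨h1, h2⟩ => ⟨diamondFunctional_true_eq_one.mpr h1, h2⟩
      · exact fun ⟨h1, h2⟩ => ⟨diamondFunctional_true_eq_one.mpr h1, h2⟩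
  cover x hx := by
    obtain ⟨γ, hγ, v, hv, h⟩ := diamond_cover x hx
    exact ⟨γ, hγ, v, diamondFunctional_le_one.mpr hv, h⟩

/-- At a critical zero all products of two of the cosines and all products of two of the sines
would vanish, so that some sine and cosine of the same angle would vanish. -/
lemma schwarzD_regular (x : E3) (hx : schwarzD x = 0) : fderiv ℝ schwarzD x ≠ 0 := by
  intro h0
  have hc : ∀ i : Fin 3, HasFDerivAt (fun x : E3 => Real.cos (Real.pi * x i))
      (-Real.sin (Real.pi * x i) • (Real.pi • coordCLM i)) x := fun i =>
    ((hasFDerivAt_coord i x).const_mul Real.pi).cos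
  have hs : ∀ i : Fin 3, HasFDerivAt (fun x : E3 => Real.sin (Real.pi * x i))
      (Real.cos (Real.pi * x i) • (Real.pi • coordCLM i)) x := fun i =>
    ((hasFDerivAt_coord i x).const_mul Real.pi).sin
  have hd := (((hc 0).mul (hc 1)).mul (hc 2)).add (((hs 0).mul (hs 1)).mul (hs 2))
  have hd' : HasFDerivAt schwarzD _ x := hd
  rw [hd'.fderiv] at h0
  have hpi := Real.pi_ne_zero
  have e := fun i : Fin 3 =>
    congrArg (fun L : E3 →L[ℝ] ℝ => L (EuclideanSpace.single i 1)) h0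
  have e0 := e 0
  have e1 := e 1
  have e2 := e 2
  unfold schwarzD at hx
  simp at e0 e1 e2
  clear hd hd' hc hs h0 e
  have p0 := Real.sin_sq_add_cos_sq (Real.pi * x 0)
  have p1 := Real.sin_sq_add_cos_sq (Real.pi * x 1)
  have p2 := Real.sin_sq_add_cos_sq (Real.pi * x 2)
  generalize Real.cos (Real.pi * x 0) = c0 at *
  generalize Real.cos (Real.pi * x 1) = c1 at *
  generalize Real.cos (Real.pi * x 2) = c2 at *
  generalize Real.sin (Real.pi * x 0) = s0 at *
  generalize Real.sin (Real.pi * x 1) = s1 at *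
  generalize Real.sin (Real.pi * x 2) = s2 at *
  have f0 : s0 * c1 * c2 = c0 * s1 * s2 :=
    mul_right_cancel₀ hpi (by linear_combination -e0)
  have f1 : c0 * s1 * c2 = s0 * c1 * s2 :=
    mul_right_cancel₀ hpi (by linear_combination -e1)
  have f2 : c0 * c1 * s2 = s0 * s1 * c2 :=
    mul_right_cancel₀ hpi (by linear_combination -e2)
  have c12 : c1 * c2 = 0 := by linear_combination (-c1 * c2) * p0 + c0 * hx + s0 * f0
  have s12 : s1 * s2 = 0 := by linear_combination (-s1 * s2) * p0 + s0 * hx - c0 * f0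
  have c02 : c0 * c2 = 0 := by linear_combination (-c0 * c2) * p1 + c1 * hx + s1 * f1
  have s02 : s0 * s2 = 0 := by linear_combination (-s0 * s2) * p1 + s1 * hx - c1 * f1
  have c01 : c0 * c1 = 0 := by linear_combination (-c0 * c1) * p2 + c2 * hx + s2 * f2
  have s01 : s0 * s1 = 0 := by linear_combination (-s0 * s1) * p2 + s2 * hx - c2 * f2
  rcases mul_eq_zero.mp c12 with h | h
  · have : s1 ≠ 0 := fun h' => by norm_num [h, h'] at p1
    have h2 := (mul_eq_zero.mp s12).resolve_left this
    have h3 := (mul_eq_zero.mp s01).resolve_right this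
    rcases mul_eq_zero.mp c02 with h4 | h4
    · norm_num [h3, h4] at p0
    · norm_num [h2, h4] at p2
  · have : s2 ≠ 0 := fun h' => by norm_num [h, h'] at p2
    have h2 := (mul_eq_zero.mp s12).resolve_right this
    have h3 := (mul_eq_zero.mp s02).resolve_right this
    rcases mul_eq_zero.mp c01 with h4 | h4
    · norm_num [h3, h4] at p0
    · norm_num [h2, h4] at p1

/-! ### The gyroid: a fundamental cell is star-shaped -/

/-- The function that defines the gyroid, in angular coordinates `(x, y, z)` centred at the midpoint
of an edge of the network in its positive region, with `p = z + π / 4`. -/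
def cellG (x y p : ℝ) : ℝ :=
  Real.cos y * Real.cos p + Real.cos x * Real.sin p - Real.sin x * Real.sin y

/-- The derivative of `cellG` along the rays from the centre. -/
def cellGRadial (x y p : ℝ) : ℝ :=
  -(x * (Real.sin x * Real.sin p + Real.cos x * Real.sin y)) -
    y * (Real.sin y * Real.cos p + Real.sin x * Real.cos y) +
    (p - Real.pi / 4) * (Real.cos x * Real.cos p - Real.cos y * Real.sin p)

lemma sqrt_two_div_two_bounds : (0.707 : ℝ) ≤ Real.sqrt 2 / 2 ∧ Real.sqrt 2 / 2 ≤ 0.7072 := by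
  have h : Real.sqrt 2 ^ 2 = 2 := Real.sq_sqrt (by norm_num)
  have h0 : 0 ≤ Real.sqrt 2 := Real.sqrt_nonneg 2
  constructor <;> nlinarith

lemma sqrt_two_div_two_le_sin {p : ℝ} (h : Real.pi / 4 ≤ p) (h' : p ≤ Real.pi / 2) :
    Real.sqrt 2 / 2 ≤ Real.sin p := by
  rw [← Real.sin_pi_div_four]
  exact Real.sin_le_sin_of_le_of_le_pi_div_two (by linarith [Real.pi_pos]) h' h

lemma cos_le_sin_of_pi_div_four_le {p : ℝ} (h : Real.pi / 4 ≤ p) (h' : p ≤ Real.pi / 2) :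
    Real.cos p ≤ Real.sin p := by
  rw [← Real.sin_pi_div_two_sub]
  exact Real.sin_le_sin_of_le_of_le_pi_div_two (by linarith [Real.pi_pos]) h' (by linarith)

lemma one_le_cos_add_sin {x : ℝ} (h : 0 ≤ x) (h' : x ≤ Real.pi / 2) :
    1 ≤ Real.cos x + Real.sin x := by
  have hc : 0 ≤ Real.cos x := Real.cos_nonneg_of_mem_Icc ⟨by linarith [Real.pi_pos], h'⟩
  have hs : 0 ≤ Real.sin x := Real.sin_nonneg_of_nonneg_of_le_pi h (by linarith [Real.pi_pos])
  nlinarith [Real.sin_sq_add_cos_sq x]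

lemma cos_le_pi_div_two_sub {x : ℝ} (h : x ≤ Real.pi / 2) : Real.cos x ≤ Real.pi / 2 - x := by
  rw [← Real.sin_pi_div_two_sub]
  exact Real.sin_le (by linarith)

/-- Monotonicity of sine and cosine for two acute angles with sum at most `π / 2`, one of them
given by its supplement. -/
lemma sin_le_sin_neg_cos_le_cos {y p : ℝ} (hy : 0 ≤ y) (hp : Real.pi / 2 ≤ p)
    (h : y + p ≤ Real.pi) : Real.sin y ≤ Real.sin p ∧ -Real.cos p ≤ Real.cos y := by
  rw [← Real.sin_pi_sub p, ← Real.cos_pi_sub p]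
  exact ⟨Real.sin_le_sin_of_le_of_le_pi_div_two (by linarith) (by linarith) (by linarith),
    Real.cos_le_cos_of_nonneg_of_le_pi hy (by linarith) (by linarith)⟩

/-- Acute angles `x`, `y` and `p`. -/
lemma cellGRadial_neg_acute_of_le {x y p : ℝ} (hx : 0 ≤ x) (hx2 : x ≤ Real.pi / 2) (hy : 0 ≤ y)
    (hy' : y ≤ Real.pi / 2) (hp : Real.pi / 4 ≤ p) (hp' : p ≤ Real.pi / 2)
    (h : cellG x y p = 0) : cellGRadial x y p < 0 := by
  have hpi := Real.pi_pos
  unfold cellG at h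
  unfold cellGRadial
  have hcy : 0 ≤ Real.cos y := Real.cos_nonneg_of_mem_Icc ⟨by linarith, hy'⟩
  have hcp : 0 ≤ Real.cos p := Real.cos_nonneg_of_mem_Icc ⟨by linarith, hp'⟩
  have hsx : 0 ≤ Real.sin x := Real.sin_nonneg_of_nonneg_of_le_pi hx (by linarith)
  have hsy : 0 ≤ Real.sin y := Real.sin_nonneg_of_nonneg_of_le_pi hy (by linarith)
  have hsp : 0.707 ≤ Real.sin p :=
    sqrt_two_div_two_bounds.1.trans (sqrt_two_div_two_le_sin hp hp')
  have hsc := cos_le_sin_of_pi_div_four_le hp hp'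
  have e1 : 0 ≤ y * (Real.sin y * Real.cos p + Real.sin x * Real.cos y) := by positivity
  have e2 : 0 ≤ (p - Real.pi / 4) * (Real.cos y * Real.sin p) :=
    mul_nonneg (by linarith) (by positivity)
  have hcx : 0 ≤ Real.cos x := Real.cos_nonneg_of_mem_Icc ⟨by linarith, hx2⟩
  have hcc : 0 ≤ Real.cos y * Real.cos p := mul_nonneg hcy hcp
  have hx0 : 0 < x := by
    refine lt_of_le_of_ne hx fun h0 => ?_
    rw [← h0, Real.cos_zero, Real.sin_zero] at h
    linarith
  have hsx0 : 0 < Real.sin x := Real.sin_pos_of_pos_of_lt_pi hx0 (by linarith)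
  have e3 : Real.cos x * Real.cos p ≤ Real.sin x * Real.sin y := by
    have := mul_le_mul_of_nonneg_left hsc hcx
    linarith
  have e4 : (p - Real.pi / 4) * (Real.cos x * Real.cos p) ≤
      0.7875 * (Real.sin x * Real.sin y) :=
    mul_le_mul (by linarith [Real.pi_lt_d2]) e3 (by positivity) (by norm_num)
  have e5 : 0.707 * (x * Real.sin x) ≤ x * (Real.sin x * Real.sin p) := by
    have := mul_le_mul_of_nonneg_left hsp (mul_pos hx0 hsx0).le
    linarith
  have hsy1 := Real.sin_le_one y
  have e6 : 0.7875 * (Real.sin x * Real.sin y) <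
      0.707 * (x * Real.sin x) + x * (Real.cos x * Real.sin y) := by
    rcases le_or_gt 1.12 x with h1 | h1
    · have h2 : 0 ≤ x * (Real.cos x * Real.sin y) := by positivity
      have h3 := mul_le_mul_of_nonneg_right h1 hsx
      have h4 := mul_le_mul_of_nonneg_left hsy1 hsx
      linarith
    · have h3 : Real.sin x ≤ x := Real.sin_le hx
      have h4 : 1 - x ^ 2 / 2 ≤ Real.cos x := Real.one_sub_sq_div_two_le_cos
      have h8 : 0.7875 - 0.707 * x < 1 - x ^ 2 / 2 := by nlinarith
      have h9 : 0 < 1 - x ^ 2 / 2 := by nlinarith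
      have h6 : (0.7875 - 0.707 * x) * Real.sin x < x * Real.cos x := by
        have g1 : (0.7875 - 0.707 * x) * Real.sin x < (1 - x ^ 2 / 2) * Real.sin x :=
          mul_lt_mul_of_pos_right h8 hsx0
        have g2 : (1 - x ^ 2 / 2) * Real.sin x ≤ Real.cos x * x :=
          mul_le_mul h4 h3 hsx hcx
        linarith
      have g3 : 0 < 0.707 * (x * Real.sin x) := by positivity
      rcases hsy.eq_or_lt with h2 | h2
      · rw [← h2]
        linarith
      · have g4 := mul_lt_mul_of_pos_right h6 h2
        have g5 := mul_le_mul_of_nonneg_left hsy1 (mul_pos hx0 hsx0).le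
        linarith
  linarith

/-- An obtuse angle `x`, acute angles `y` and `p`. -/
lemma cellGRadial_neg_acute_of_gt {x y p : ℝ} (hx' : x ≤ p + Real.pi / 2)
    (hx2 : Real.pi / 2 < x) (hy : 0 ≤ y)
    (hy' : y ≤ Real.pi / 2) (hp : Real.pi / 4 ≤ p) (hp' : p ≤ Real.pi / 2)
    (h : cellG x y p = 0) : cellGRadial x y p < 0 := by
  have hx : 0 ≤ x := by linarith [Real.pi_pos]
  have hpi := Real.pi_pos
  unfold cellG at h
  unfold cellGRadial
  have hcy : 0 ≤ Real.cos y := Real.cos_nonneg_of_mem_Icc ⟨by linarith, hy'⟩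
  have hcp : 0 ≤ Real.cos p := Real.cos_nonneg_of_mem_Icc ⟨by linarith, hp'⟩
  have hsx : 0 ≤ Real.sin x := Real.sin_nonneg_of_nonneg_of_le_pi hx (by linarith)
  have hsy : 0 ≤ Real.sin y := Real.sin_nonneg_of_nonneg_of_le_pi hy (by linarith)
  have hsp : 0.707 ≤ Real.sin p :=
    sqrt_two_div_two_bounds.1.trans (sqrt_two_div_two_le_sin hp hp')
  have hsc := cos_le_sin_of_pi_div_four_le hp hp'
  have e1 : 0 ≤ y * (Real.sin y * Real.cos p + Real.sin x * Real.cos y) := by positivity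
  have e2 : 0 ≤ (p - Real.pi / 4) * (Real.cos y * Real.sin p) :=
    mul_nonneg (by linarith) (by positivity)
  have hcx : Real.cos x ≤ 0 := Real.cos_nonpos_of_pi_div_two_le_of_le hx2.le (by linarith)
  have e3 : 0 < Real.sin x * Real.sin p + Real.cos x * Real.sin y := by
    by_contra! hle
    have hx1 : Real.sin x ^ 2 + Real.cos x ^ 2 = 1 := Real.sin_sq_add_cos_sq x
    have hsp0 : 0 < Real.sin p := by linarith
    have f1 : Real.sin p ≤ -Real.cos x * (Real.cos y * Real.cos p) := by
      have g1 : -Real.cos x * (Real.cos y * Real.cos p) =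
          Real.sin x * (-Real.cos x * Real.sin y) + Real.cos x ^ 2 * Real.sin p := by
        linear_combination (-Real.cos x) * h
      have g2 : Real.sin x * (Real.sin x * Real.sin p) ≤
          Real.sin x * (-Real.cos x * Real.sin y) :=
        mul_le_mul_of_nonneg_left (by linarith) hsx
      have g3 : Real.sin p = Real.sin x ^ 2 * Real.sin p + Real.cos x ^ 2 * Real.sin p := by
        rw [← add_mul, hx1, one_mul]
      linarith
    have f2 : -Real.cos x ≤ 1 := by linarith [Real.neg_one_le_cos x]
    have f3 : -Real.cos x * (Real.cos y * Real.cos p) ≤ Real.cos y * Real.cos p :=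
      mul_le_of_le_one_left (mul_nonneg hcy hcp) f2
    have f4 : Real.cos y * Real.cos p ≤ Real.cos p :=
      mul_le_of_le_one_left hcp (Real.cos_le_one y)
    have f5 : 0 < Real.cos p := by linarith
    have f6 : Real.cos y = 1 := by
      have : Real.cos y * Real.cos p = 1 * Real.cos p := by linarith
      exact mul_right_cancel₀ f5.ne' this
    have f7 : Real.sin y = 0 := by
      have := Real.sin_sq_add_cos_sq y
      rw [f6] at this
      have h2 : Real.sin y ^ 2 = 0 := by linarith
      exact pow_eq_zero_iff (two_ne_zero) |>.mp h2
    have f9 : -Real.cos x = 1 := by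
      have : -Real.cos x * (Real.cos y * Real.cos p) = 1 * (Real.cos y * Real.cos p) := by
        linarith
      refine mul_right_cancel₀ ?_ this
      rw [f6, one_mul]
      exact f5.ne'
    have f8 : Real.sin x = 0 := by
      have h2 : Real.sin x ^ 2 = 0 := by
        rw [← neg_sq (Real.cos x), f9] at hx1
        linarith
      exact pow_eq_zero_iff (two_ne_zero) |>.mp h2
    have hxpi : x = Real.pi := by
      refine le_antisymm (by linarith) (not_lt.mp fun hlt => ?_)
      linarith [Real.sin_pos_of_pos_of_lt_pi (by linarith : 0 < x) hlt]
    have : p = Real.pi / 2 := by linarith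
    rw [this, Real.cos_pi_div_two] at f5
    exact lt_irrefl _ f5
  have e4 : (p - Real.pi / 4) * (Real.cos x * Real.cos p) ≤ 0 :=
    mul_nonpos_of_nonneg_of_nonpos (by linarith) (mul_nonpos_of_nonpos_of_nonneg hcx hcp)
  have e5 := mul_pos (by linarith : 0 < x) e3
  linarith

/-- An obtuse angle `y`, and `x ≥ 0`. -/
lemma cellGRadial_neg_obtuse {x y p : ℝ} (hx : 0 ≤ x) (hx' : x ≤ p + Real.pi / 2)
    (hy : Real.pi / 2 < y) (hp : Real.pi / 4 ≤ p) (hyp : y + p ≤ Real.pi)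
    (h : cellG x y p = 0) : cellGRadial x y p < 0 := by
  have hpi := Real.pi_pos
  have hpi1 := Real.pi_gt_d2
  have hpi2 := Real.pi_lt_d2
  unfold cellG at h
  unfold cellGRadial
  have hp' : p ≤ Real.pi / 2 := by linarith
  have hcp : 0 < Real.cos p := Real.cos_pos_of_mem_Ioo ⟨by linarith, by linarith⟩
  have hsx : 0 ≤ Real.sin x := Real.sin_nonneg_of_nonneg_of_le_pi hx (by linarith)
  have hsp : 0.707 ≤ Real.sin p :=
    sqrt_two_div_two_bounds.1.trans (sqrt_two_div_two_le_sin hp hp')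
  have hsp1 := Real.sin_le_one p
  obtain ⟨hspC, hS⟩ := sin_le_sin_neg_cos_le_cos (by linarith : 0 ≤ p) hy.le (by linarith)
  have hS0 : 0 ≤ -Real.cos y := by
    linarith [Real.cos_nonpos_of_pi_div_two_le_of_le hy.le (by linarith)]
  have hC1 := Real.sin_le_one y
  have hp2 := Real.sin_sq_add_cos_sq p
  have hy2 := Real.sin_sq_add_cos_sq y
  set S := -Real.cos y with hSdef
  set C := Real.sin y with hCdef
  have hcy : Real.cos y = -S := by rw [hSdef, neg_neg]
  rw [hcy] at h hy2 ⊢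
  have hC0 : 0 < C := by linarith
  have hcx : 0 ≤ Real.cos x := by
    by_contra! hlt
    nlinarith [mul_nonneg hS0 hcp.le, mul_nonneg hsx hC0.le]
  have hx2 : x ≤ Real.pi / 2 := by
    by_contra! hlt
    linarith [Real.cos_neg_of_pi_div_two_lt_of_lt hlt (by linarith)]
  have hcx1 := Real.cos_le_one x
  -- `C (C cos p - S sin x) = cos p - S cos x sin p`
  have e1 : Real.cos p * (1 - Real.sin p) ≤ C * Real.cos p - Real.sin x * S := by
    have f1 : C * (C * Real.cos p - Real.sin x * S) = Real.cos p - S * Real.cos x * Real.sin p := by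
      linear_combination S * h + Real.cos p * hy2
    have f2 : S * Real.cos x * Real.sin p ≤ Real.cos p * Real.sin p := by
      have := mul_le_mul hS hcx1 hcx hcp.le
      rw [mul_one] at this
      exact mul_le_mul_of_nonneg_right this (by linarith)
    have f3 : 0 ≤ Real.cos p * (1 - Real.sin p) := mul_nonneg hcp.le (by linarith)
    have f4 : C * (Real.cos p * (1 - Real.sin p)) ≤ 1 * (Real.cos p * (1 - Real.sin p)) :=
      mul_le_mul_of_nonneg_right hC1 f3
    refine le_of_mul_le_mul_left ?_ hC0
    linarith
  have hy0 : Real.pi / 2 * (Real.cos p * (1 - Real.sin p)) ≤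
      y * (C * Real.cos p - Real.sin x * S) :=
    mul_le_mul hy.le e1 (mul_nonneg hcp.le (by linarith)) (by linarith)
  have hz0 : 0 ≤ p - Real.pi / 4 := by linarith
  have e2 : (p - Real.pi / 4) * (Real.cos x * Real.cos p + S * Real.sin p) ≤
      (p - Real.pi / 4) * (Real.cos p * (1 + Real.sin p)) := by
    refine mul_le_mul_of_nonneg_left ?_ hz0
    linarith [mul_le_mul_of_nonneg_right hcx1 hcp.le,
      mul_le_mul_of_nonneg_right hS (by linarith : 0 ≤ Real.sin p)]
  have e3 : x * (Real.sin p * (Real.sin x + Real.cos x)) ≤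
      x * (Real.sin x * Real.sin p + Real.cos x * C) := by
    refine mul_le_mul_of_nonneg_left ?_ hx
    linarith [mul_le_mul_of_nonneg_left hspC hcx]
  suffices hsuff : (p - Real.pi / 4) * (Real.cos p * (1 + Real.sin p)) <
      x * (Real.sin p * (Real.sin x + Real.cos x)) +
        Real.pi / 2 * (Real.cos p * (1 - Real.sin p)) by
    linarith
  rcases le_or_gt 0.38 x with h1 | h1
  · have f1 : (p - Real.pi / 4) * Real.cos p ≤ 0.1551 := by
      have g1 := mul_le_mul_of_nonneg_left (cos_le_pi_div_two_sub hp') hz0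
      have g2 : Real.pi ^ 2 ≤ 3.15 ^ 2 := pow_le_pow_left₀ hpi.le hpi2.le 2
      have g3 := sq_nonneg (p - 3 * Real.pi / 8)
      linarith
    have f2 : (p - Real.pi / 4) * (Real.cos p * (1 + Real.sin p)) ≤ 0.3102 := by
      have g1 : (p - Real.pi / 4) * Real.cos p * (1 + Real.sin p) ≤ 0.1551 * 2 :=
        mul_le_mul f1 (by linarith) (by linarith) (by norm_num)
      linarith
    have f3 : 0 ≤ Real.pi / 2 * (Real.cos p * (1 - Real.sin p)) :=
      mul_nonneg (by linarith) (mul_nonneg hcp.le (by linarith))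
    have f4 : 0.44 ≤ x * (Real.sin x + Real.cos x) := by
      rcases le_or_gt x 0.5 with h2 | h2
      · have g1 : x - x ^ 3 / 6 < Real.sin x := Real.sin_gt_sub_cube (by linarith)
        have g2 : 1 - x ^ 2 / 2 ≤ Real.cos x := Real.one_sub_sq_div_two_le_cos
        have g3 : x ^ 2 ≤ 0.5 ^ 2 := pow_le_pow_left₀ hx h2 2
        have g4 : x ^ 3 ≤ 0.5 ^ 3 := pow_le_pow_left₀ hx h2 3
        have g5 : 1.2 ≤ Real.sin x + Real.cos x := by linarith
        have g6 : 0.38 * 1.2 ≤ x * (Real.sin x + Real.cos x) :=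
          mul_le_mul h1 g5 (by norm_num) hx
        linarith
      · have g6 : 0.5 * 1 ≤ x * (Real.sin x + Real.cos x) :=
          mul_le_mul h2.le (by linarith [one_le_cos_add_sin hx hx2]) (by norm_num) hx
        linarith
    have f5 : 0.707 * 0.44 ≤ Real.sin p * (x * (Real.sin x + Real.cos x)) :=
      mul_le_mul hsp f4 (by norm_num) (by linarith)
    linarith
  · have f1 : Real.sin x ≤ x := Real.sin_le hx
    have f2 : 1 - x ^ 2 / 2 ≤ Real.cos x := Real.one_sub_sq_div_two_le_cos
    have f3 : 0.9278 ≤ Real.cos x := by nlinarith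
    have f4 : Real.sin p < 0.8 := by
      by_contra! hle
      have g1 := mul_le_mul_of_nonneg_right hS hcp.le
      have g2 := mul_le_mul (by linarith : Real.sin x ≤ 0.38) hC1 hC0.le (by norm_num)
      have g3 := mul_le_mul f3 hle (by norm_num) hcx
      have g4 := mul_le_mul hle hle (by norm_num) (by linarith : 0 ≤ Real.sin p)
      linarith
    have f5 : p - Real.pi / 4 < 0.145 := by
      by_contra! hle
      have g1 : Real.sin (Real.pi / 4 + 0.145) ≤ Real.sin p :=
        Real.sin_le_sin_of_le_of_le_pi_div_two (by linarith) hp' (by linarith)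
      rw [Real.sin_add, Real.cos_pi_div_four, Real.sin_pi_div_four] at g1
      have g2 : (0.145 : ℝ) - 0.145 ^ 3 / 6 < Real.sin 0.145 :=
        Real.sin_gt_sub_cube (by norm_num)
      have g3 : 1 - (0.145 : ℝ) ^ 2 / 2 ≤ Real.cos 0.145 := Real.one_sub_sq_div_two_le_cos
      have g4 := sqrt_two_div_two_bounds.1
      norm_num at g2 g3
      have g5 : 0.707 * (0.9892 + 0.1444) ≤ Real.sqrt 2 / 2 * (Real.cos 0.145 + Real.sin 0.145) :=
        mul_le_mul g4 (by norm_num; linarith) (by norm_num) (by linarith)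
      norm_num at g1 g5
      linarith
    have f6 : 0 ≤ x * (Real.sin p * (Real.sin x + Real.cos x)) :=
      mul_nonneg hx (mul_nonneg (by linarith) (by linarith))
    have f7 : (p - Real.pi / 4) * (1 + Real.sin p) < Real.pi / 2 * (1 - Real.sin p) := by
      have g1 : (p - Real.pi / 4) * (1 + Real.sin p) ≤ 0.145 * 1.8 :=
        mul_le_mul f5.le (by linarith) (by linarith) (by norm_num)
      have g2 : 1.57 * 0.2 ≤ Real.pi / 2 * (1 - Real.sin p) :=
        mul_le_mul (by linarith) (by linarith) (by norm_num) (by linarith)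
      linarith
    linarith [mul_lt_mul_of_pos_right f7 hcp]

/-- An obtuse angle `p`, and `x ≥ 0`. -/
lemma cellGRadial_neg_high {x y p : ℝ} (hx : 0 ≤ x) (hx' : x ≤ p + Real.pi / 2)
    (hy : 0 ≤ y) (hp : Real.pi / 2 < p) (hyp : y + p ≤ Real.pi)
    (h : cellG x y p = 0) : cellGRadial x y p < 0 := by
  have hpi := Real.pi_pos
  unfold cellG at h
  unfold cellGRadial
  obtain ⟨hsW, hZc⟩ := sin_le_sin_neg_cos_le_cos hy hp.le hyp
  have hZ0 : 0 < -Real.cos p := by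
    linarith [Real.cos_neg_of_pi_div_two_lt_of_lt hp (by linarith)]
  have hW0 : 0 ≤ Real.sin p := Real.sin_nonneg_of_nonneg_of_le_pi (by linarith) (by linarith)
  have hsy : 0 ≤ Real.sin y := Real.sin_nonneg_of_nonneg_of_le_pi hy (by linarith)
  have hp2 := Real.sin_sq_add_cos_sq p
  have hxpi : x ≤ Real.pi := by
    by_contra! hlt
    have f1 : Real.sin (x - Real.pi) ≤ Real.sin (p - Real.pi / 2) :=
      Real.sin_le_sin_of_le_of_le_pi_div_two (by linarith) (by linarith) (by linarith)
    have f2 : Real.cos (p - Real.pi / 2) ≤ Real.cos (x - Real.pi) :=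
      Real.cos_le_cos_of_nonneg_of_le_pi (by linarith) (by linarith) (by linarith)
    rw [Real.sin_sub_pi, Real.sin_sub_pi_div_two] at f1
    rw [Real.cos_sub_pi, Real.cos_sub_pi_div_two] at f2
    have f3 : -Real.sin x * Real.sin y ≤ -Real.cos p * Real.sin p :=
      mul_le_mul f1 hsW hsy hZ0.le
    have f4 := mul_le_mul_of_nonneg_right hZc hZ0.le
    have f5 := mul_le_mul_of_nonneg_right f2 hW0
    have f6 := sq_nonneg (Real.cos p + Real.sin p)
    linarith
  have hsx : 0 ≤ Real.sin x := Real.sin_nonneg_of_nonneg_of_le_pi hx hxpi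
  set Z := -Real.cos p with hZ
  have hcp : Real.cos p = -Z := by rw [hZ, neg_neg]
  rw [hcp] at h hp2 ⊢
  have hcy : 0 < Real.cos y := by linarith
  have hcyZ : 0 < Real.cos y * Z := mul_pos hcy hZ0
  have hcxW : 0 < Real.cos x * Real.sin p := by nlinarith [mul_nonneg hsx hsy]
  have hcx : 0 < Real.cos x := pos_of_mul_pos_left hcxW hW0
  have hW : 0 < Real.sin p := pos_of_mul_pos_right hcxW hcx.le
  have hx2 : x < Real.pi / 2 := by
    by_contra! hle
    linarith [Real.cos_nonpos_of_pi_div_two_le_of_le hle (by linarith)]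
  have e1 : 0 ≤ x * (Real.cos x * Real.sin y) := by positivity
  have e2 : 0 ≤ y * (Real.sin x * Real.cos y) := by positivity
  suffices hsuff : y * (Real.sin y * Z) < x * (Real.sin x * Real.sin p) +
      (p - Real.pi / 4) * (Real.cos x * Z) + (p - Real.pi / 4) * (Real.cos y * Real.sin p) by
    nlinarith
  have hcxZ : 0 < Real.cos x * Z := mul_pos hcx hZ0
  have e3 : 0 ≤ x * (Real.sin x * Real.sin p) := by positivity
  rcases le_or_gt y (p - Real.pi / 4) with h1 | h1
  · have f1 : Real.sin y * Z ≤ Real.cos y * Real.sin p := by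
      have := mul_le_mul hsW hZc hZ0.le hW0
      linarith
    have f2 := mul_le_mul h1 f1 (by positivity) (by linarith)
    have f3 := mul_pos (by linarith : 0 < p - Real.pi / 4) hcxZ
    linarith
  · have hWZ : Z ≤ Real.sin p := by
      have := cos_le_sin_of_pi_div_four_le (p := Real.pi - p) (by linarith) (by linarith)
      rwa [Real.cos_pi_sub, Real.sin_pi_sub] at this
    have f1 : y * (Real.sin y * Z) ≤ y * (Real.sin p * Z) :=
      mul_le_mul_of_nonneg_left (mul_le_mul_of_nonneg_right hsW hZ0.le) hy
    have f2 : (p - Real.pi / 4) * (Z * Real.sin p) ≤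
        (p - Real.pi / 4) * (Real.cos y * Real.sin p) :=
      mul_le_mul_of_nonneg_left (mul_le_mul_of_nonneg_right hZc hW0) (by linarith)
    have f3 : 0 < Real.sin p * Z := mul_pos hW hZ0
    have f4 : (y - (p - Real.pi / 4)) * (Real.sin p * Z) < Real.pi / 4 * (Real.sin p * Z) :=
      mul_lt_mul_of_pos_right (by linarith) f3
    have f5 : Real.pi / 4 * (Real.sin p * Z) ≤ Real.pi / 4 * Z := by
      refine mul_le_mul_of_nonneg_left ?_ (by linarith)
      exact mul_le_of_le_one_left hZ0.le (Real.sin_le_one p)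
    have f6 : Real.pi / 4 * (Real.cos x * Z) ≤ (p - Real.pi / 4) * (Real.cos x * Z) :=
      mul_le_mul_of_nonneg_right (by linarith) hcxZ.le
    have f7 : 1 - Real.cos x ≤ x * Real.sin x := by
      have g1 := Real.sin_sq_add_cos_sq x
      have g2 := mul_le_mul_of_nonneg_right (Real.sin_le hx : Real.sin x ≤ x) hsx
      have g3 := mul_nonneg hcx.le (sub_nonneg.mpr (Real.cos_le_one x))
      linarith
    have f8 : Real.pi / 4 * ((1 - Real.cos x) * Z) ≤ x * (Real.sin x * Real.sin p) := by
      have g1 : (1 - Real.cos x) * Z ≤ x * Real.sin x * Real.sin p :=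
        mul_le_mul f7 hWZ hZ0.le (by positivity)
      have g2 : 0 ≤ (1 - Real.cos x) * Z :=
        mul_nonneg (by linarith [Real.cos_le_one x]) hZ0.le
      have g3 := mul_le_mul_of_nonneg_right (by linarith [Real.pi_le_four] : Real.pi / 4 ≤ 1) g2
      linarith
    linarith

/-- Angles `y` and `p` at most `π / 2`, and `x = -s ≤ 0`. -/
lemma cellGRadial_neg_acute' {s y p : ℝ} (hs : 0 ≤ s) (hs' : s ≤ p + Real.pi / 2) (hy : 0 ≤ y)
    (hy' : y ≤ Real.pi / 2) (hp : Real.pi / 4 ≤ p) (hp' : p ≤ Real.pi / 2)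
    (h : cellG (-s) y p = 0) : cellGRadial (-s) y p < 0 := by
  have hpi := Real.pi_pos
  have hpi1 := Real.pi_gt_d2
  unfold cellG at h
  unfold cellGRadial
  rw [Real.cos_neg, Real.sin_neg] at h ⊢
  have hcy : 0 ≤ Real.cos y := Real.cos_nonneg_of_mem_Icc ⟨by linarith, hy'⟩
  have hcp : 0 ≤ Real.cos p := Real.cos_nonneg_of_mem_Icc ⟨by linarith, hp'⟩
  have hss : 0 ≤ Real.sin s := Real.sin_nonneg_of_nonneg_of_le_pi hs (by linarith)
  have hsy : 0 ≤ Real.sin y := Real.sin_nonneg_of_nonneg_of_le_pi hy (by linarith)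
  have hsp : 0.707 ≤ Real.sin p :=
    sqrt_two_div_two_bounds.1.trans (sqrt_two_div_two_le_sin hp hp')
  have hcs : Real.cos s ≤ 0 := by
    by_contra! hlt
    nlinarith [mul_nonneg hcy hcp, mul_nonneg hss hsy]
  have hs2 : Real.pi / 2 ≤ s := by
    by_contra! hlt
    linarith [Real.cos_pos_of_mem_Ioo (x := s) ⟨by linarith, hlt⟩]
  have hss0 : 0 < Real.sin s := by
    refine lt_of_le_of_ne hss fun h0 => ?_
    have hspi : s = Real.pi := by
      refine le_antisymm (by linarith) (not_lt.mp fun hlt => ?_)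
      linarith [Real.sin_pos_of_pos_of_lt_pi (by linarith) hlt]
    have : p = Real.pi / 2 := by linarith
    rw [hspi, this, Real.cos_pi_div_two, Real.sin_pi_div_two, Real.cos_pi, Real.sin_pi] at h
    linarith
  have e1 : y * Real.cos y ≤ 1 := (mul_cos_le_sin hy (by linarith)).trans (Real.sin_le_one y)
  have e2 : 1 < s * Real.sin p := by nlinarith
  have e3 : 0 < (s * Real.sin p - y * Real.cos y) * Real.sin s := mul_pos (by linarith) hss0
  have e4 : 0 ≤ s * (-Real.cos s * Real.sin y) :=
    mul_nonneg hs (mul_nonneg (by linarith) hsy)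
  have e5 : 0 ≤ y * (Real.sin y * Real.cos p) := by positivity
  have e6 : 0 ≤ (p - Real.pi / 4) * (-Real.cos s * Real.cos p + Real.cos y * Real.sin p) :=
    mul_nonneg (by linarith) (add_nonneg (mul_nonneg (by linarith) hcp)
      (mul_nonneg hcy (by linarith)))
  linarith

/-- An obtuse angle `y`, and `x = -s ≤ 0`. -/
lemma cellGRadial_neg_obtuse' {s y p : ℝ} (hs : 0 ≤ s) (hs' : s ≤ p + Real.pi / 2)
    (hy : Real.pi / 2 < y) (hp : Real.pi / 4 ≤ p) (hyp : y + p ≤ Real.pi)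
    (h : cellG (-s) y p = 0) : cellGRadial (-s) y p < 0 := by
  have hpi := Real.pi_pos
  unfold cellG at h
  unfold cellGRadial
  rw [Real.cos_neg, Real.sin_neg] at h ⊢
  have hp' : p ≤ Real.pi / 2 := by linarith
  have hcp : 0 < Real.cos p := Real.cos_pos_of_mem_Ioo ⟨by linarith, by linarith⟩
  have hss : 0 ≤ Real.sin s := Real.sin_nonneg_of_nonneg_of_le_pi hs (by linarith)
  have hsp : 0.707 ≤ Real.sin p :=
    sqrt_two_div_two_bounds.1.trans (sqrt_two_div_two_le_sin hp hp')
  obtain ⟨hspC, hS⟩ := sin_le_sin_neg_cos_le_cos (by linarith : 0 ≤ p) hy.le (by linarith)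
  have hS0 : 0 ≤ -Real.cos y := by
    linarith [Real.cos_nonpos_of_pi_div_two_le_of_le hy.le (by linarith)]
  have hp2 := Real.sin_sq_add_cos_sq p
  have hcs : Real.cos s ≤ 0 := by
    by_contra! hlt
    have hs2 : s ≤ Real.pi / 2 := by
      by_contra! hlt'
      linarith [Real.cos_nonpos_of_pi_div_two_le_of_le hlt'.le (by linarith)]
    have f1 := one_le_cos_add_sin hs hs2
    have f2 : -Real.cos y * Real.cos p ≤ Real.cos p * Real.cos p :=
      mul_le_mul_of_nonneg_right hS hcp.le
    have f3 : Real.sin s * Real.sin p ≤ Real.sin s * Real.sin y :=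
      mul_le_mul_of_nonneg_left hspC hss
    nlinarith
  have hs2 : Real.pi / 2 ≤ s := by
    by_contra! hlt
    linarith [Real.cos_pos_of_mem_Ioo (x := s) ⟨by linarith, hlt⟩]
  have hss0 : 0 < Real.sin s := Real.sin_pos_of_pos_of_lt_pi (by linarith) (by linarith)
  have e1 : 0 < s * (Real.sin s * Real.sin p) :=
    mul_pos (by linarith) (mul_pos hss0 (by linarith))
  have e2 : 0 ≤ s * (-Real.cos s * Real.sin y) :=
    mul_nonneg hs (mul_nonneg (by linarith) (by linarith))
  have e3 : 0 ≤ y * (Real.sin s * -Real.cos y) :=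
    mul_nonneg (by linarith) (mul_nonneg hss hS0)
  have e4 : 0 ≤ (p - Real.pi / 4) * (-Real.cos s * Real.cos p) :=
    mul_nonneg (by linarith) (mul_nonneg (by linarith) hcp.le)
  have e5 : (p - Real.pi / 4) * (-Real.cos y * Real.sin p) ≤ y * (Real.sin y * Real.cos p) := by
    refine mul_le_mul (by linarith) ?_ (mul_nonneg hS0 (by linarith)) (by linarith)
    have := mul_le_mul hS hspC (by linarith) hcp.le
    linarith
  linarith

lemma mul_cos_le_pi_div_four_mul_sin {x : ℝ} (h : Real.pi / 4 ≤ x) (h' : x ≤ Real.pi / 2) :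
    x * Real.cos x ≤ Real.pi / 4 * Real.sin x := by
  have hpi := Real.pi_pos
  have hanti := antitoneOn_mul_sin_add_cos
  have hder : HasDerivAt (fun x => x * Real.sin x + (1 + Real.pi / 4) * Real.cos x)
      ((1 * Real.sin x + x * Real.cos x) + (1 + Real.pi / 4) * -Real.sin x) x :=
    ((hasDerivAt_id x).mul (Real.hasDerivAt_sin x)).add ((Real.hasDerivAt_cos x).const_mul _)
  have := (hder.hasDerivWithinAt (s := Set.Icc (Real.pi / 4) Real.pi)).derivWithin
    (uniqueDiffOn_Icc (by linarith) x ⟨h, by linarith⟩)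
  have h2 := hanti.derivWithin_nonpos (x := x)
  rw [this] at h2
  linarith

lemma mul_cos_lt_of_le_pi_div_four {y : ℝ} (hy : 0 ≤ y) (hy' : y ≤ Real.pi / 4) :
    y * Real.cos y < 0.57 := by
  have hpi2 := Real.pi_lt_d2
  have h := (abs_le.mp (Real.cos_bound (x := y) (by rw [abs_of_nonneg hy]; linarith))).2
  rw [abs_of_nonneg hy] at h
  have h1 : y ≤ 0.7875 := by linarith
  have h2 : y ^ 4 ≤ 0.6202 * y ^ 2 := by
    have g1 : y ^ 2 ≤ 0.7875 ^ 2 := pow_le_pow_left₀ hy h1 2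
    have g2 := mul_le_mul_of_nonneg_right g1 (sq_nonneg y)
    linarith [sq_nonneg y]
  have h3 : Real.cos y ≤ 1 - 0.46 * y ^ 2 := by linarith [sq_nonneg y]
  have h4 : y * Real.cos y ≤ y * (1 - 0.46 * y ^ 2) := mul_le_mul_of_nonneg_left h3 hy
  nlinarith [sq_nonneg (y - 0.7875), mul_nonneg hy (sq_nonneg (y - 0.7875))]

set_option maxHeartbeats 1000000 in
/-- An obtuse angle `p`, and `x = -s ≤ 0`. -/
lemma cellGRadial_neg_high' {s y p : ℝ} (hs : 0 ≤ s) (hs' : s ≤ p + Real.pi / 2)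
    (hy : 0 ≤ y) (hp : Real.pi / 2 < p) (hyp : y + p ≤ Real.pi)
    (h : cellG (-s) y p = 0) : cellGRadial (-s) y p < 0 := by
  have hpi := Real.pi_pos
  have hpi1 := Real.pi_gt_d2
  have hpi2 := Real.pi_lt_d2
  unfold cellG at h
  unfold cellGRadial
  rw [Real.cos_neg, Real.sin_neg] at h ⊢
  obtain ⟨hsW, hZc⟩ := sin_le_sin_neg_cos_le_cos hy hp.le hyp
  have hZ0 : 0 < -Real.cos p := by
    linarith [Real.cos_neg_of_pi_div_two_lt_of_lt hp (by linarith)]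
  have hW0 : 0 ≤ Real.sin p := Real.sin_nonneg_of_nonneg_of_le_pi (by linarith) (by linarith)
  have hsy : 0 ≤ Real.sin y := Real.sin_nonneg_of_nonneg_of_le_pi hy (by linarith)
  have hp2 := Real.sin_sq_add_cos_sq p
  have hs2 := Real.sin_sq_add_cos_sq s
  set Z := -Real.cos p with hZ
  have hcp : Real.cos p = -Z := by rw [hZ, neg_neg]
  rw [hcp] at h hp2 ⊢
  have hcy : 0 < Real.cos y := by linarith
  have hcyZ : 0 < Real.cos y * Z := mul_pos hcy hZ0
  have hspi : s ≤ Real.pi := by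
    by_contra! hlt
    have f1 : Real.sin s ≤ 0 := by
      have := Real.sin_nonneg_of_nonneg_of_le_pi (x := s - Real.pi) (by linarith) (by linarith)
      rw [Real.sin_sub_pi] at this
      linarith
    have f2 : Real.cos s ≤ 0 :=
      Real.cos_nonpos_of_pi_div_two_le_of_le (by linarith) (by linarith)
    nlinarith [mul_nonneg (neg_nonneg.mpr f1) hsy, mul_nonneg (neg_nonneg.mpr f2) hW0]
  have hss : 0 ≤ Real.sin s := Real.sin_nonneg_of_nonneg_of_le_pi hs hspi
  have hW : 0 < Real.sin p := by
    refine lt_of_le_of_ne hW0 fun h0 => ?_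
    rw [← h0] at h hsW
    nlinarith
  have hsyc : y * Real.cos y ≤ Real.sin y := mul_cos_le_sin hy (by linarith)
  rcases le_or_gt (Real.cos s) 0 with hcs | hcs
  · have hs3 : Real.pi / 2 ≤ s := by
      by_contra! hlt
      linarith [Real.cos_pos_of_mem_Ioo (x := s) ⟨by linarith, hlt⟩]
    set m := -Real.cos s with hm
    have hcs' : Real.cos s = -m := by rw [hm, neg_neg]
    rw [hcs'] at h hs2 ⊢
    have hm0 : 0 ≤ m := by linarith
    have hssy : 0 < Real.sin s * Real.sin y := by linarith [mul_nonneg hm0 hW0]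
    have hss0 : 0 < Real.sin s := pos_of_mul_pos_left hssy hsy
    have hsy0 : 0 < Real.sin y := pos_of_mul_pos_right hssy hss
    have e1 : m * Real.sin p ≤ Real.sin p * Real.sin p := by
      have f1 : Real.sin s * Real.sin y ≤ Real.sin p := by
        exact (mul_le_of_le_one_left hsy (Real.sin_le_one s)).trans hsW
      have f2 : Z * Z ≤ Real.cos y * Z := mul_le_mul_of_nonneg_right hZc hZ0.le
      nlinarith [Real.sin_le_one p]
    have hmW : m ≤ Real.sin p := le_of_mul_le_mul_right e1 hW
    have hms : m ≤ Real.sin s := by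
      refine le_of_mul_le_mul_right ?_ hW
      have := mul_le_mul_of_nonneg_left hsW hss
      linarith
    have e2 : 0 ≤ (p - Real.pi / 4) * (Real.cos y * Real.sin p - m * Z) := by
      refine mul_nonneg (by linarith) ?_
      linarith [mul_le_mul hZc hmW hm0 hcy.le]
    have e3 : y * (Real.sin y * Z) ≤ Real.sin y * (y * Real.cos y) := by
      linarith [mul_le_mul_of_nonneg_left hZc (mul_nonneg hy hsy)]
    have e4 : 0 ≤ s * (m * Real.sin y) := by positivity
    have e5 : s * (Real.sin s * Real.sin y) ≤ s * (Real.sin s * Real.sin p) :=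
      mul_le_mul_of_nonneg_left (mul_le_mul_of_nonneg_left hsW hss) hs
    -- `σ = s - π / 2` is at most `π / 4`
    have hσ : s - Real.pi / 2 ≤ Real.pi / 4 := by
      by_contra! hlt
      have f1 : Real.sin (Real.pi / 4) < Real.sin (s - Real.pi / 2) :=
        Real.sin_lt_sin_of_lt_of_le_pi_div_two (by linarith) (by linarith) hlt
      have f2 : Real.cos (s - Real.pi / 2) < Real.cos (Real.pi / 4) :=
        Real.cos_lt_cos_of_nonneg_of_le_pi (by linarith) (by linarith) hlt
      rw [Real.sin_sub_pi_div_two, Real.sin_pi_div_four] at f1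
      rw [Real.cos_sub_pi_div_two, Real.cos_pi_div_four] at f2
      linarith
    have hsin : 1 - (s - Real.pi / 2) ^ 2 / 2 ≤ Real.sin s := by
      rw [← Real.cos_sub_pi_div_two]
      exact Real.one_sub_sq_div_two_le_cos
    set σ := s - Real.pi / 2 with hσd
    have hσ0 : 0 ≤ σ := by linarith
    have hconc : ∀ c : ℝ, 0 ≤ c → c ≤ 0.8 → c ≤ (c + σ) * Real.sin s := by
      intro c hc hc'
      have f1 : (c + σ) * (1 - σ ^ 2 / 2) ≤ (c + σ) * Real.sin s :=
        mul_le_mul_of_nonneg_left hsin (by linarith)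
      have f2 : σ ≤ 0.79 := by linarith
      have f3 : 0 ≤ σ * (1 - c * σ / 2 - σ ^ 2 / 2) := mul_nonneg hσ0 (by nlinarith)
      linarith
    have e6 : Real.sin y * (y * Real.cos y) + (y * Real.cos y) * Real.sin s <
        s * (Real.sin s * Real.sin y) := by
      rcases le_or_gt y (Real.pi / 4) with h1 | h1
      · have f1 := mul_cos_lt_of_le_pi_div_four hy h1
        have f2 := hconc (Real.pi / 2 - 1) (by linarith) (by linarith)
        have f3 : y * Real.cos y + Real.sin s < s * Real.sin s := by
          have g1 : s * Real.sin s = (Real.pi / 2 - 1 + σ) * Real.sin s + Real.sin s := by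
            rw [hσd]
            ring
          linarith
        linarith [mul_lt_mul_of_pos_left f3 hsy0, mul_le_mul_of_nonneg_right hsyc hss]
      · have f1 := mul_cos_le_pi_div_four_mul_sin h1.le (by linarith)
        have f2 := hconc (Real.pi / 4) (by linarith) (by linarith)
        have f3 : y * Real.cos y ≤ 0.63 := by
          have g1 := mul_le_mul_of_nonneg_left (cos_le_pi_div_two_sub (x := y) (by linarith)) hy
          have g2 : Real.pi ^ 2 ≤ 3.15 ^ 2 := pow_le_pow_left₀ hpi.le hpi2.le 2
          linarith [sq_nonneg (y - Real.pi / 4)]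
        have f4 : y * Real.cos y + Real.pi / 4 * Real.sin s < s * Real.sin s := by
          have g1 : s * Real.sin s =
              (Real.pi / 4 + σ) * Real.sin s + Real.pi / 4 * Real.sin s := by
            rw [hσd]
            ring
          linarith
        linarith [mul_lt_mul_of_pos_left f4 hsy0, mul_le_mul_of_nonneg_right f1 hss]
    have e7 : y * Real.cos y * Real.sin s = y * (Real.sin s * Real.cos y) := by ring
    linarith
  · have hs3 : s ≤ Real.pi / 2 := by
      by_contra! hlt
      linarith [Real.cos_nonpos_of_pi_div_two_le_of_le hlt.le (by linarith)]
    have e1 : Real.sin y ≤ Real.cos y * Z := by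
      have f1 := one_le_cos_add_sin hs hs3
      have f2 := mul_le_mul_of_nonneg_left hsW hcs.le
      have f3 := mul_le_mul_of_nonneg_left f1 hsy
      linarith
    have e2 : Real.sin y ≤ Z := e1.trans (mul_le_of_le_one_left hZ0.le (Real.cos_le_one y))
    have e3 : y ≤ p - Real.pi / 2 := by
      by_contra! hlt
      have := Real.sin_lt_sin_of_lt_of_le_pi_div_two
        (by linarith : -(Real.pi / 2) ≤ p - Real.pi / 2)
        (by linarith : y ≤ Real.pi / 2) hlt
      rw [Real.sin_sub_pi_div_two] at this
      linarith
    have hcy1 : 0.707 ≤ Real.cos y := by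
      refine sqrt_two_div_two_bounds.1.trans ?_
      rw [← Real.cos_pi_div_four]
      exact Real.cos_le_cos_of_nonneg_of_le_pi hy (by linarith) (by linarith)
    have e4 : y * (Real.sin y * Z) ≤ y * (Real.cos y * Real.sin p) := by
      refine mul_le_mul_of_nonneg_left ?_ hy
      have := mul_le_mul hsW hZc hZ0.le hW0
      linarith
    have e5 : 0.55 * Real.sin p ≤ (p - Real.pi / 4 - y) * (Real.cos y * Real.sin p) := by
      have f1 : 0.78 * 0.707 ≤ (p - Real.pi / 4 - y) * Real.cos y :=
        mul_le_mul (by linarith) hcy1 (by norm_num) (by linarith)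
      have f2 := mul_le_mul_of_nonneg_right f1 hW0
      linarith
    have e6 : y * (Real.sin s * Real.cos y) ≤ Real.sin s * Real.sin p := by
      linarith [mul_le_mul_of_nonneg_left (hsyc.trans hsW) hss]
    have e7 : s * (Real.cos s * Real.sin y) - (p - Real.pi / 4) * (Real.cos s * Z) ≤
        0.16 * Real.sin p := by
      have f0 : 0 ≤ Real.cos s * Real.sin y := mul_nonneg hcs.le hsy
      have f1 : (p - Real.pi / 4) * (Real.cos s * Real.sin y) ≤
          (p - Real.pi / 4) * (Real.cos s * Z) :=
        mul_le_mul_of_nonneg_left (mul_le_mul_of_nonneg_left e2 hcs.le) (by linarith)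
      rcases le_or_gt s (Real.pi / 4) with h1 | h1
      · have f2 : s * (Real.cos s * Real.sin y) ≤ (p - Real.pi / 4) * (Real.cos s * Real.sin y) :=
          mul_le_mul_of_nonneg_right (by linarith) f0
        linarith
      · have f2 : (Real.pi / 4) * (Real.cos s * Real.sin y) ≤
            (p - Real.pi / 4) * (Real.cos s * Real.sin y) :=
          mul_le_mul_of_nonneg_right (by linarith) f0
        have f3 : (s - Real.pi / 4) * Real.cos s ≤ 0.16 := by
          have g1 := mul_le_mul_of_nonneg_left (cos_le_pi_div_two_sub hs3)
            (by linarith : 0 ≤ s - Real.pi / 4)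
          have g2 : Real.pi ^ 2 ≤ 3.15 ^ 2 := pow_le_pow_left₀ hpi.le hpi2.le 2
          linarith [sq_nonneg (s - 3 * Real.pi / 8)]
        have f4 : (s - Real.pi / 4) * Real.cos s * Real.sin y ≤ 0.16 * Real.sin p :=
          mul_le_mul f3 hsW hsy (by norm_num)
        linarith
    have e8 : (1 - s) * Real.sin s ≤ 0.25 := by
      rcases le_or_gt s 1 with h1 | h1
      · have : Real.sin s ≤ s := Real.sin_le hs
        have h2 := mul_le_mul_of_nonneg_left this (by linarith : 0 ≤ 1 - s)
        linarith [sq_nonneg (s - 1 / 2)]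
      · have := mul_nonneg (by linarith : 0 ≤ s - 1) hss
        linarith
    have e9 := mul_le_mul_of_nonneg_right e8 hW0
    linarith

/-- At a zero of `cellG` in the fundamental polytope, the radial derivative is negative. -/
lemma cellGRadial_neg {x y z : ℝ} (hy : |y| + z ≤ 3 * Real.pi / 4) (hx : |x| - z ≤ 3 * Real.pi / 4)
    (h : cellG x y (z + Real.pi / 4) = 0) : cellGRadial x y (z + Real.pi / 4) < 0 := by
  have core : ∀ x y z : ℝ, 0 ≤ y → 0 ≤ z → y + z ≤ 3 * Real.pi / 4 → |x| - z ≤ 3 * Real.pi / 4 →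
      cellG x y (z + Real.pi / 4) = 0 → cellGRadial x y (z + Real.pi / 4) < 0 := by
    intro x y z hy hz hyz hxz h
    have hyp : y + (z + Real.pi / 4) ≤ Real.pi := by linarith
    have hp : Real.pi / 4 ≤ z + Real.pi / 4 := by linarith
    rcases le_total 0 x with hx | hx
    · rw [abs_of_nonneg hx] at hxz
      have hxp : x ≤ z + Real.pi / 4 + Real.pi / 2 := by linarith
      rcases lt_or_ge (Real.pi / 2) y with h1 | h1
      · exact cellGRadial_neg_obtuse hx hxp h1 hp hyp h
      rcases lt_or_ge (Real.pi / 2) (z + Real.pi / 4) with h2 | h2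
      · exact cellGRadial_neg_high hx hxp hy h2 hyp h
      · rcases le_or_gt x (Real.pi / 2) with h3 | h3
        · exact cellGRadial_neg_acute_of_le hx h3 hy h1 hp h2 h
        · exact cellGRadial_neg_acute_of_gt hxp h3 hy h1 hp h2 h
    · obtain ⟨s, rfl⟩ : ∃ s, x = -s := ⟨-x, by ring⟩
      rw [abs_of_nonpos hx, neg_neg] at hxz
      have hs : 0 ≤ s := by linarith
      have hxp : s ≤ z + Real.pi / 4 + Real.pi / 2 := by linarith
      rcases lt_or_ge (Real.pi / 2) y with h1 | h1
      · exact cellGRadial_neg_obtuse' hs hxp h1 hp hyp h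
      rcases lt_or_ge (Real.pi / 2) (z + Real.pi / 4) with h2 | h2
      · exact cellGRadial_neg_high' hs hxp hy h2 hyp h
      · exact cellGRadial_neg_acute' hs hxp hy h1 hp h2 h
  -- the symmetry `(x, y, z) ↦ (-x, -y, z)`
  have upper : ∀ x y z : ℝ, 0 ≤ z → |y| + z ≤ 3 * Real.pi / 4 → |x| - z ≤ 3 * Real.pi / 4 →
      cellG x y (z + Real.pi / 4) = 0 → cellGRadial x y (z + Real.pi / 4) < 0 := by
    intro x y z hz hyz hxz h
    rcases le_total 0 y with hy | hy
    · exact core x y z hy hz (by rwa [abs_of_nonneg hy] at hyz) hxz h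
    · have h1 := core (-x) (-y) z (by linarith) hz (by rwa [abs_of_nonpos hy] at hyz)
        (by rwa [abs_neg]) (by
          rw [← h, cellG, cellG]
          simp)
      have h2 : cellGRadial (-x) (-y) (z + Real.pi / 4) = cellGRadial x y (z + Real.pi / 4) := by
        simp only [cellGRadial, Real.cos_neg, Real.sin_neg]
        ring
      rwa [h2] at h1
  -- the symmetry `(x, y, z) ↦ (y, x, -z)`
  rcases le_total 0 z with hz | hz
  · exact upper x y z hz hy hx h
  · have e1 : Real.cos (-z + Real.pi / 4) = Real.sin (z + Real.pi / 4) := by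
      rw [← Real.cos_pi_div_two_sub]
      congr 1
      ring
    have e2 : Real.sin (-z + Real.pi / 4) = Real.cos (z + Real.pi / 4) := by
      rw [← Real.sin_pi_div_two_sub]
      congr 1
      ring
    have h1 := upper y x (-z) (by linarith) (by linarith) (by linarith) (by
      rw [← h, cellG, cellG, e1, e2]
      ring)
    have h2 : cellGRadial y x (-z + Real.pi / 4) = cellGRadial x y (z + Real.pi / 4) := by
      simp only [cellGRadial, e1, e2]
      ring
    rwa [h2] at h1

/-! ### The gyroid: faces of the cell and their overlaps -/

/-- The polytope that contains the fundamental cell of the gyroid region, in angular coordinates. -/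
def InGyroidPolytope (x y z : ℝ) : Prop :=
  |y| + z ≤ 3 * Real.pi / 4 ∧ |x| - z ≤ 3 * Real.pi / 4

lemma InGyroidPolytope.swap {x y z : ℝ} (h : InGyroidPolytope x y z) :
    InGyroidPolytope y x (-z) :=
  ⟨by linarith [h.2], by linarith [h.1]⟩

lemma cellG_swap (x y z : ℝ) : cellG y x (-z + Real.pi / 4) = cellG x y (z + Real.pi / 4) := by
  have e1 : Real.cos (-z + Real.pi / 4) = Real.sin (z + Real.pi / 4) := by
    rw [← Real.cos_pi_div_two_sub]
    congr 1
    ring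
  have e2 : Real.sin (-z + Real.pi / 4) = Real.cos (z + Real.pi / 4) := by
    rw [← Real.sin_pi_div_two_sub]
    congr 1
    ring
  rw [cellG, cellG, e1, e2]
  ring

lemma cellG_neg_neg (x y p : ℝ) : cellG (-x) (-y) p = cellG x y p := by
  simp [cellG]

/-- The part `cellG ≥ 0` of the polytope is star-shaped. -/
lemma cellG_mul_pos {x y z t : ℝ} (h : InGyroidPolytope x y z)
    (hf : 0 ≤ cellG x y (z + Real.pi / 4)) (h0 : 0 ≤ t) (h1 : t < 1) :
    0 < cellG (t * x) (t * y) (t * z + Real.pi / 4) := by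
  rcases h0.eq_or_lt with rfl | h0
  · rw [zero_mul, zero_mul, zero_mul, zero_add, cellG]
    simp
  have hd : ∀ t : ℝ, HasDerivAt (fun t : ℝ => cellG (t * x) (t * y) (t * z + Real.pi / 4))
      (-(x * (Real.sin (t * x) * Real.sin (t * z + Real.pi / 4) +
          Real.cos (t * x) * Real.sin (t * y))) -
        y * (Real.sin (t * y) * Real.cos (t * z + Real.pi / 4) +
          Real.sin (t * x) * Real.cos (t * y)) +
        z * (Real.cos (t * x) * Real.cos (t * z + Real.pi / 4) -
          Real.cos (t * y) * Real.sin (t * z + Real.pi / 4))) t := by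
    intro t
    have dx : HasDerivAt (fun t : ℝ => t * x) x t := by simpa using (hasDerivAt_id t).mul_const x
    have dy : HasDerivAt (fun t : ℝ => t * y) y t := by simpa using (hasDerivAt_id t).mul_const y
    have dz : HasDerivAt (fun t : ℝ => t * z + Real.pi / 4) z t := by
      simpa using ((hasDerivAt_id t).mul_const z).add_const (Real.pi / 4)
    have := ((dy.cos.mul dz.cos).add (dx.cos.mul dz.sin)).sub (dx.sin.mul dy.sin)
    refine HasDerivAt.congr_deriv this ?_
    ring
  refine pos_of_deriv_neg_at_zeros hd (by simpa using hf) (fun s hs hs1 hz => ?_) h0 h1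
  have hr : cellGRadial (s * x) (s * y) (s * z + Real.pi / 4) < 0 := by
    refine cellGRadial_neg ?_ ?_ hz
    · rw [abs_mul, abs_of_pos hs]
      nlinarith [h.1, Real.pi_pos]
    · rw [abs_mul, abs_of_pos hs]
      nlinarith [h.2, Real.pi_pos]
  unfold cellGRadial at hr
  refine neg_of_mul_neg_right (a := s) ?_ hs.le
  linarith

/-- The cell has no points on the edges between faces that meet `y ≠ 0` and `x ≠ 0`. -/
lemma cellG_edge_neg {x y z : ℝ} (hy : |y| + z = 3 * Real.pi / 4)
    (hx : |x| - z = 3 * Real.pi / 4) : cellG x y (z + Real.pi / 4) < 0 := by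
  set p := z + Real.pi / 4 with hp
  have hy' : |y| = Real.pi - p := by linarith
  have hx' : |x| = p + Real.pi / 2 := by linarith
  have cy : Real.cos y = -Real.cos p := by rw [← Real.cos_abs, hy', Real.cos_pi_sub]
  have cx : Real.cos x = -Real.sin p := by rw [← Real.cos_abs, hx', Real.cos_add_pi_div_two]
  have hsx : Real.sin x = Real.cos p ∨ Real.sin x = -Real.cos p := by
    rcases abs_choice x with h | h
    · rw [← h, hx', Real.sin_add_pi_div_two]
      exact Or.inl rfl
    · rw [show x = -|x| by rw [h, neg_neg], hx', Real.sin_neg, Real.sin_add_pi_div_two]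
      exact Or.inr rfl
  have hsy : Real.sin y = Real.sin p ∨ Real.sin y = -Real.sin p := by
    rcases abs_choice y with h | h
    · rw [← h, hy', Real.sin_pi_sub]
      exact Or.inl rfl
    · rw [show y = -|y| by rw [h, neg_neg], hy', Real.sin_neg, Real.sin_pi_sub]
      exact Or.inr rfl
  have h1 := Real.sin_sq_add_cos_sq p
  have h2 := sq_nonneg (Real.sin p - Real.cos p)
  have h3 := sq_nonneg (Real.sin p + Real.cos p)
  rw [cellG, cy, cx]
  rcases hsx with h | h <;> rcases hsy with h' | h' <;> rw [h, h'] <;> linarith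

/-- The region is away from the neighbourhoods of the edges of the polytope with `x = ± π`. -/
lemma cellG_sliver_neg {x y p : ℝ} (hp : Real.pi / 2 ≤ p) (hx : |(|x| - Real.pi)| ≤ p - Real.pi / 2)
    (hy : |y| ≤ Real.pi - p) : cellG x y p < 0 := by
  have hpi := Real.pi_pos
  have hy0 := abs_nonneg y
  have cx : Real.cos x = -Real.cos (|(|x| - Real.pi)|) := by
    rw [Real.cos_abs, Real.cos_sub_pi, neg_neg, Real.cos_abs]
  have sx : |Real.sin x| = Real.sin (|(|x| - Real.pi)|) := by
    rw [← Real.abs_sin_eq_sin_abs_of_abs_le_pi (by linarith), Real.sin_sub_pi, abs_neg]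
    rcases abs_choice x with h | h <;> rw [h]
    rw [Real.sin_neg, abs_neg]
  have sy : |Real.sin y| = Real.sin (|y|) :=
    Real.abs_sin_eq_sin_abs_of_abs_le_pi (by linarith)
  obtain ⟨g1, g2⟩ := sin_le_sin_neg_cos_le_cos hy0 hp (by linarith)
  rw [Real.cos_abs] at g2
  set u := |(|x| - Real.pi)| with hu
  have hu0 : 0 ≤ u := abs_nonneg _
  have g3 : Real.sin u ≤ -Real.cos p := by
    rw [← Real.sin_sub_pi_div_two]
    exact Real.sin_le_sin_of_le_of_le_pi_div_two (by linarith) (by linarith) hx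
  have g4 : Real.sin p ≤ Real.cos u := by
    rw [← Real.cos_sub_pi_div_two]
    exact Real.cos_le_cos_of_nonneg_of_le_pi hu0 (by linarith) hx
  have hW : 0 ≤ Real.sin p := Real.sin_nonneg_of_nonneg_of_le_pi (by linarith) (by linarith)
  have hZ : 0 ≤ -Real.cos p := by
    linarith [Real.cos_nonpos_of_pi_div_two_le_of_le hp (by linarith)]
  have h1 : -(Real.sin x * Real.sin y) ≤ -Real.cos p * Real.sin p := by
    refine (neg_le_abs _).trans ?_
    rw [abs_mul, sx, sy]
    exact mul_le_mul g3 g1 (sy ▸ abs_nonneg _) hZ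
  have h2 := mul_le_mul_of_nonneg_right g4 hW
  have h3 := mul_le_mul_of_nonneg_right g2 hZ
  have h4 := Real.sin_sq_add_cos_sq p
  have h5 := sq_nonneg (Real.sin p + Real.cos p)
  rw [cellG, cx]
  linarith

/-- In the charts of the faces the gyroid function is `√2 cos η cos ξ - sin² η`; this is its sign
near the corners `(± π / 2, ± π / 2)`. -/
lemma sqrt_two_mul_sin_mul_sin_lt {h k : ℝ} (hh : 0 ≤ h) (hk : 0 ≤ k) (hhk : h + k ≤ Real.pi / 4) :
    Real.sqrt 2 * (Real.sin h * Real.sin k) < Real.cos h ^ 2 := by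
  have hpi := Real.pi_pos
  have hpi2 := Real.pi_lt_d2
  have h1 : Real.sin h * Real.sin k ≤ h * k :=
    mul_le_mul (Real.sin_le hh) (Real.sin_le hk)
      (Real.sin_nonneg_of_nonneg_of_le_pi hk (by linarith)) hh
  have h2 : h * k ≤ 0.16 := by nlinarith [sq_nonneg (h - k)]
  have h3 : Real.sqrt 2 * (Real.sin h * Real.sin k) ≤ 1.4144 * 0.16 := by
    have hs : 0 ≤ Real.sin h * Real.sin k :=
      mul_nonneg (Real.sin_nonneg_of_nonneg_of_le_pi hh (by linarith))
        (Real.sin_nonneg_of_nonneg_of_le_pi hk (by linarith))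
    exact mul_le_mul (by linarith [sqrt_two_div_two_bounds.2]) (h1.trans h2) hs (by norm_num)
  have h4 : 0.707 ≤ Real.cos h := by
    refine sqrt_two_div_two_bounds.1.trans ?_
    rw [← Real.cos_pi_div_four]
    exact Real.cos_le_cos_of_nonneg_of_le_pi hh (by linarith) (by linarith)
  have h5 := mul_le_mul h4 h4 (by norm_num) (by linarith)
  linarith

/-- The gyroid function on the plane of a face. -/
lemma cellG_face (ξ η : ℝ) :
    cellG (-(Real.pi / 4) + ξ) (Real.pi / 2 + η) (Real.pi / 4 - η + Real.pi / 4) =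
      Real.sqrt 2 * (Real.cos η * Real.cos ξ) - Real.sin η ^ 2 := by
  have e1 : Real.pi / 4 - η + Real.pi / 4 = Real.pi / 2 - η := by ring
  rw [cellG, e1, Real.cos_pi_div_two_sub, Real.sin_pi_div_two_sub, add_comm (Real.pi / 2) η,
    Real.sin_add_pi_div_two, Real.cos_add_pi_div_two, Real.cos_add, Real.sin_add, Real.cos_neg,
    Real.sin_neg, Real.cos_pi_div_four, Real.sin_pi_div_four]
  ring

/-- The part of the region on a face lies in a square and avoids two corners of it. -/
lemma abs_le_of_cellG_face {ξ η : ℝ}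
    (hK : InGyroidPolytope (-(Real.pi / 4) + ξ) (Real.pi / 2 + η) (Real.pi / 4 - η))
    (hf : 0 ≤ Real.sqrt 2 * (Real.cos η * Real.cos ξ) - Real.sin η ^ 2) :
    |ξ| ≤ Real.pi / 2 ∧ |η| < Real.pi / 2 ∧ -(3 * Real.pi / 4) ≤ ξ + η := by
  have hpi := Real.pi_pos
  have h2 : 0 < Real.sqrt 2 := by positivity
  obtain ⟨hy, hx⟩ := hK
  have hη : -(Real.pi / 2) ≤ η := by linarith [neg_le_abs (Real.pi / 2 + η)]
  have hx1 := le_abs_self (-(Real.pi / 4) + ξ)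
  have hx2 := neg_le_abs (-(Real.pi / 4) + ξ)
  have hη1 : η < Real.pi / 2 := by
    by_contra! hlt
    have hc : Real.cos η ≤ 0 := Real.cos_nonpos_of_pi_div_two_le_of_le hlt (by linarith)
    rcases le_or_gt ξ (Real.pi / 2) with h | h
    · have hξ : 0 ≤ Real.cos ξ := Real.cos_nonneg_of_mem_Icc ⟨by linarith, h⟩
      have g1 : Real.sqrt 2 * (Real.cos η * Real.cos ξ) ≤ 0 :=
        mul_nonpos_of_nonneg_of_nonpos h2.le (mul_nonpos_of_nonpos_of_nonneg hc hξ)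
      have g2 : Real.sin η ^ 2 = 0 := le_antisymm (by linarith) (sq_nonneg _)
      have g3 : Real.sin η = 0 := pow_eq_zero_iff two_ne_zero |>.mp g2
      have g4 : η = Real.pi := by
        refine le_antisymm (by linarith [abs_nonneg (-(Real.pi / 4) + ξ)])
          (not_lt.mp fun hlt' => ?_)
        linarith [Real.sin_pos_of_pos_of_lt_pi (by linarith : 0 < η) hlt']
      have g5 : ξ = Real.pi / 4 := by linarith
      rw [g2, g4, g5, Real.cos_pi, Real.cos_pi_div_four] at hf
      nlinarith
    · have := sqrt_two_mul_sin_mul_sin_lt (h := η - Real.pi / 2) (k := ξ - Real.pi / 2)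
        (by linarith) (by linarith) (by linarith)
      rw [Real.sin_sub_pi_div_two, Real.sin_sub_pi_div_two, Real.cos_sub_pi_div_two] at this
      linarith
  have hη2 : -(Real.pi / 2) < η := by
    refine lt_of_le_of_ne hη fun h => ?_
    rw [← h, Real.cos_neg, Real.cos_pi_div_two, Real.sin_neg, Real.sin_pi_div_two] at hf
    linarith
  have hc : 0 < Real.cos η := Real.cos_pos_of_mem_Ioo ⟨hη2, hη1⟩
  have hξ : 0 ≤ Real.cos ξ := by
    by_contra! hlt
    have := mul_neg_of_pos_of_neg h2 (mul_neg_of_pos_of_neg hc hlt)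
    linarith [sq_nonneg (Real.sin η)]
  have hξ1 : -(Real.pi / 2) ≤ ξ := by
    by_contra! hlt
    have := Real.cos_neg_of_pi_div_two_lt_of_lt (x := -ξ) (by linarith) (by linarith)
    rw [Real.cos_neg] at this
    linarith
  have hξ2 : ξ ≤ Real.pi / 2 := by
    by_contra! hlt
    have h3 : 3 * Real.pi / 2 ≤ ξ := by
      by_contra! hlt'
      linarith [Real.cos_neg_of_pi_div_two_lt_of_lt hlt (by linarith)]
    have := sqrt_two_mul_sin_mul_sin_lt (h := η + Real.pi / 2) (k := ξ - Real.pi - Real.pi / 2)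
      (by linarith) (by linarith) (by linarith)
    rw [Real.sin_sub_pi_div_two, Real.cos_sub_pi, Real.sin_add_pi_div_two, neg_neg,
      Real.cos_add_pi_div_two, neg_sq] at this
    linarith
  refine ⟨abs_le.mpr ⟨hξ1, hξ2⟩, abs_lt.mpr ⟨hη2, hη1⟩, ?_⟩
  by_contra! hlt
  have := sqrt_two_mul_sin_mul_sin_lt (h := η + Real.pi / 2) (k := ξ + Real.pi / 2)
    (by linarith) (by linarith) (by linarith)
  rw [Real.sin_add_pi_div_two, Real.sin_add_pi_div_two, Real.cos_add_pi_div_two, neg_sq] at this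
  linarith

lemma face_mul_pos {ξ η t : ℝ} (hξ : |ξ| ≤ Real.pi / 2) (hη : |η| < Real.pi / 2)
    (hf : 0 ≤ Real.sqrt 2 * (Real.cos η * Real.cos ξ) - Real.sin η ^ 2) (h0 : 0 ≤ t) (h1 : t < 1) :
    0 < Real.sqrt 2 * (Real.cos (t * η) * Real.cos (t * ξ)) - Real.sin (t * η) ^ 2 := by
  have hpi := Real.pi_pos
  have h2 : 0 < Real.sqrt 2 := by positivity
  have c1 : Real.cos ξ ≤ Real.cos (t * ξ) := cos_le_cos_mul (by linarith) h0 h1.le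
  have c0 : 0 ≤ Real.cos ξ := Real.cos_nonneg_of_mem_Icc (abs_le.mp hξ)
  have d0 : 0 < Real.cos η := Real.cos_pos_of_mem_Ioo (abs_lt.mp hη)
  rcases eq_or_ne η 0 with rfl | hne
  · rw [mul_zero, Real.cos_zero, Real.sin_zero]
    have : 0 < Real.cos (t * ξ) := by
      refine Real.cos_pos_of_mem_Ioo (abs_lt.mp ?_)
      rw [abs_mul, abs_of_nonneg h0]
      nlinarith [abs_nonneg ξ]
    have := mul_pos h2 this
    linarith
  · have d1 : Real.cos η < Real.cos (t * η) := cos_lt_cos_mul (by linarith) h0 h1 hne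
    have e1 : Real.sqrt 2 * (Real.cos η * Real.cos ξ) ≤
        Real.sqrt 2 * (Real.cos (t * η) * Real.cos (t * ξ)) :=
      mul_le_mul_of_nonneg_left (mul_le_mul d1.le c1 c0 (by linarith)) h2.le
    have e2 := Real.sin_sq_add_cos_sq η
    have e3 := Real.sin_sq_add_cos_sq (t * η)
    have e4 : Real.cos η ^ 2 < Real.cos (t * η) ^ 2 := pow_lt_pow_left₀ d1 d0.le two_ne_zero
    linarith

/-- The face pairing maps the part of the region on the face `y + z = 3π/4` to the polytope. -/
lemma InGyroidPolytope.pair {x y z : ℝ} (hK : InGyroidPolytope x y z)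
    (hf : 0 ≤ cellG x y (z + Real.pi / 4)) (h : y + z = 3 * Real.pi / 4) :
    InGyroidPolytope (-x) (y - Real.pi) (Real.pi / 2 - z) := by
  have hpi := Real.pi_pos
  obtain ⟨ξ, rfl⟩ : ∃ ξ, x = -(Real.pi / 4) + ξ := ⟨x + Real.pi / 4, by ring⟩
  obtain ⟨η, rfl⟩ : ∃ η, y = Real.pi / 2 + η := ⟨y - Real.pi / 2, by ring⟩
  obtain rfl : z = Real.pi / 4 - η := by linarith
  have hf' := hf
  rw [cellG_face] at hf'
  obtain ⟨h1, h2, h3⟩ := abs_le_of_cellG_face hK hf'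
  rw [abs_le] at h1
  rw [abs_lt] at h2
  constructor
  · rw [abs_of_nonpos (by linarith)]
    linarith
  · rw [abs_neg]
    have : |-(Real.pi / 4) + ξ| ≤ Real.pi + η := abs_le.mpr ⟨by linarith, by linarith⟩
    linarith

/-! ### The gyroid: the identifications -/

/-- The function whose zero set is a gyroid. -/
def gyroid (x : E3) : ℝ :=
  Real.sin (Real.pi * x 0) * Real.cos (Real.pi * x 1) +
    Real.sin (Real.pi * x 1) * Real.cos (Real.pi * x 2) +
    Real.sin (Real.pi * x 2) * Real.cos (Real.pi * x 0)

lemma contDiff_gyroid : ContDiff ℝ ∞ gyroid := by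
  have hc : ∀ i : Fin 3, ContDiff ℝ ∞ fun x : E3 => Real.cos (Real.pi * x i) := fun i =>
    Real.contDiff_cos.comp (contDiff_const.mul (contDiff_coord i))
  have hs : ∀ i : Fin 3, ContDiff ℝ ∞ fun x : E3 => Real.sin (Real.pi * x i) := fun i =>
    Real.contDiff_sin.comp (contDiff_const.mul (contDiff_coord i))
  exact (((hs 0).mul (hc 1)).add ((hs 1).mul (hc 2))).add ((hs 2).mul (hc 0))

lemma gyroid_rotate (x : E3) (i : Fin 3) : gyroid x =
    Real.sin (Real.pi * x i) * Real.cos (Real.pi * x (i + 1)) +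
    Real.sin (Real.pi * x (i + 1)) * Real.cos (Real.pi * x (i + 2)) +
    Real.sin (Real.pi * x (i + 2)) * Real.cos (Real.pi * x i) := by
  unfold gyroid
  fin_cases i
  · rfl
  · change _ = Real.sin (Real.pi * x 1) * Real.cos (Real.pi * x 2) +
      Real.sin (Real.pi * x 2) * Real.cos (Real.pi * x 0) +
      Real.sin (Real.pi * x 0) * Real.cos (Real.pi * x 1)
    ring
  · change _ = Real.sin (Real.pi * x 2) * Real.cos (Real.pi * x 0) +
      Real.sin (Real.pi * x 0) * Real.cos (Real.pi * x 1) +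
      Real.sin (Real.pi * x 1) * Real.cos (Real.pi * x 2)
    ring

lemma gyroid_invariant : ∀ γ ∈ hantzscheWendtGroup, ∀ x, gyroid (γ x) = gyroid x := by
  intro γ hγ x
  rcases hantzscheWendtGroup_cases hγ with ⟨n, hn⟩ | ⟨i, n, hn, k0, k1, k2⟩
  · have h : ∀ j, Real.pi * (x j + 2 * n j) = Real.pi * x j + n j * (2 * Real.pi) := fun j => by
      ring
    simp only [gyroid, hn, h, Real.cos_add_int_mul_two_pi, Real.sin_add_int_mul_two_pi]
  · obtain ⟨h0, h1, h2⟩ := hn x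
    rw [gyroid_rotate x i, gyroid_rotate (γ x) i, h0, h1, h2]
    simp only [cos_pi_add_intCast, sin_pi_add_intCast,
      Odd.neg_one_zpow (Int.odd_iff.mpr k0), Even.neg_one_zpow (Int.even_iff.mpr k1),
      Odd.neg_one_zpow (Int.odd_iff.mpr k2), mul_neg, Real.cos_neg, Real.sin_neg]
    ring

/-- At a critical zero the equations combine to `sᵢ (1 + sⱼ²) = 0` for the sines, so all sines
vanish; but then the product of two cosines is not zero, contrary to the vanishing of the
gradient. -/
lemma gyroid_regular (x : E3) (hx : gyroid x = 0) : fderiv ℝ gyroid x ≠ 0 := by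
  intro h0
  have hc : ∀ i : Fin 3, HasFDerivAt (fun x : E3 => Real.cos (Real.pi * x i))
      (-Real.sin (Real.pi * x i) • (Real.pi • coordCLM i)) x := fun i =>
    ((hasFDerivAt_coord i x).const_mul Real.pi).cos
  have hs : ∀ i : Fin 3, HasFDerivAt (fun x : E3 => Real.sin (Real.pi * x i))
      (Real.cos (Real.pi * x i) • (Real.pi • coordCLM i)) x := fun i =>
    ((hasFDerivAt_coord i x).const_mul Real.pi).sin
  have hd := (((hs 0).mul (hc 1)).add ((hs 1).mul (hc 2))).add ((hs 2).mul (hc 0))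
  have hd' : HasFDerivAt gyroid _ x := hd
  rw [hd'.fderiv] at h0
  have hpi := Real.pi_ne_zero
  have e := fun i : Fin 3 =>
    congrArg (fun L : E3 →L[ℝ] ℝ => L (EuclideanSpace.single i 1)) h0
  have e0 := e 0
  have e1 := e 1
  have e2 := e 2
  unfold gyroid at hx
  simp at e0 e1 e2
  clear hd hd' hc hs h0 e
  have p0 := Real.sin_sq_add_cos_sq (Real.pi * x 0)
  have p1 := Real.sin_sq_add_cos_sq (Real.pi * x 1)
  have p2 := Real.sin_sq_add_cos_sq (Real.pi * x 2)
  generalize Real.cos (Real.pi * x 0) = c0 at *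
  generalize Real.cos (Real.pi * x 1) = c1 at *
  generalize Real.cos (Real.pi * x 2) = c2 at *
  generalize Real.sin (Real.pi * x 0) = s0 at *
  generalize Real.sin (Real.pi * x 1) = s1 at *
  generalize Real.sin (Real.pi * x 2) = s2 at *
  have f0 : c0 * c1 = s2 * s0 :=
    mul_right_cancel₀ hpi (by linear_combination e0)
  have f1 : c1 * c2 = s0 * s1 :=
    mul_right_cancel₀ hpi (by linear_combination e1)
  have f2 : c2 * c0 = s1 * s2 :=
    mul_right_cancel₀ hpi (by linear_combination e2)
  have g2 : s2 * (1 + s1 ^ 2) = 0 := by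
    linear_combination c0 * hx - s2 * p0 - s0 * f0 - s1 * f2
  have g0 : s0 * (1 + s2 ^ 2) = 0 := by
    linear_combination c1 * hx - s0 * p1 - s1 * f1 - s2 * f0
  have g1 : s1 * (1 + s0 ^ 2) = 0 := by
    linear_combination c2 * hx - s1 * p2 - s2 * f2 - s0 * f1
  have z0 := (mul_eq_zero.mp g0).resolve_right (by positivity)
  have z1 := (mul_eq_zero.mp g1).resolve_right (by positivity)
  rw [z0] at p0 f0
  rw [z1] at p1
  have h3 : (c0 * c1) ^ 2 = 0 := by rw [f0]; ring
  have h4 : (c0 * c1) ^ 2 = 1 := by linear_combination c1 ^ 2 * p0 + p1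
  linarith

/-- The coordinates of `ℝ³` for the fundamental cell of the region `gyroid ≥ 0`; the origin is the
midpoint of an edge of the network in that region. -/
def gyroidCoord : E3 ≃ₜ E3 where
  toFun v := WithLp.toLp 2 fun j => ![0, 1 / 2, 1 / 4] j + v j / Real.pi
  invFun x := WithLp.toLp 2 fun j => Real.pi * (x j - ![0, 1 / 2, 1 / 4] j)
  left_inv v := by
    ext j
    have := Real.pi_ne_zero
    change Real.pi * ((_ + v j / Real.pi) - _) = v j
    rw [add_sub_cancel_left]
    field_simp
  right_inv x := by
    ext j
    have := Real.pi_ne_zero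
    change _ + (Real.pi * (x j - _)) / Real.pi = x j
    rw [mul_div_cancel_left₀ _ this]
    ring
  continuous_toFun := continuous_toLp_of_coord fun j =>
    continuous_const.add ((continuous_coord _).div_const _)
  continuous_invFun := continuous_toLp_of_coord fun j =>
    continuous_const.mul ((continuous_coord _).sub continuous_const)

lemma pi_mul_gyroidCoord (v : E3) : Real.pi * gyroidCoord v 0 = v 0 ∧
    Real.pi * gyroidCoord v 1 = v 1 + Real.pi / 2 ∧
    Real.pi * gyroidCoord v 2 = v 2 + Real.pi / 4 := by
  have h : ∀ j, gyroidCoord v j = ![0, 1 / 2, 1 / 4] j + v j / Real.pi := fun j => rfl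
  have := Real.pi_ne_zero
  refine ⟨?_, ?_, ?_⟩ <;> rw [h]
  · change Real.pi * (0 + v 0 / Real.pi) = _
    field_simp
    ring
  · change Real.pi * (1 / 2 + v 1 / Real.pi) = _
    field_simp
    ring
  · change Real.pi * (1 / 4 + v 2 / Real.pi) = _
    field_simp
    ring

/-- The gyroid function in the coordinates of the cell. -/
def gyroidF (v : E3) : ℝ := cellG (v 0) (v 1) (v 2 + Real.pi / 4)

lemma gyroid_gyroidCoord (v : E3) : gyroid (gyroidCoord v) = gyroidF v := by
  obtain ⟨h0, h1, h2⟩ := pi_mul_gyroidCoord v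
  rw [gyroid, gyroidF, cellG, h0, h1, h2, Real.cos_add_pi_div_two, Real.sin_add_pi_div_two]
  ring

/-- Equivalence of points under the Hantzsche–Wendt group, in the coordinates of the cell. -/
def GyroidRel (v w : E3) : Prop :=
  ∃ a b c : ℤ,
    (w 0 = v 0 + Real.pi * (2 * a) ∧ w 1 = v 1 + Real.pi * (2 * b) ∧
      w 2 = v 2 + Real.pi * (2 * c)) ∨
    (w 0 = v 0 + Real.pi * (2 * a + 1) ∧ w 1 = -v 1 + Real.pi * (2 * b) ∧
      w 2 = -v 2 + Real.pi * (2 * c) - Real.pi / 2) ∨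
    (w 0 = -v 0 + Real.pi * (2 * a) ∧ w 1 = v 1 + Real.pi * (2 * b + 1) ∧
      w 2 = -v 2 + Real.pi * (2 * c) + Real.pi / 2) ∨
    (w 0 = -v 0 + Real.pi * (2 * a + 1) ∧ w 1 = -v 1 + Real.pi * (2 * b + 1) ∧
      w 2 = v 2 + Real.pi * (2 * c + 1))

lemma signedTranslation_apply_intCast (s : Fin 3 → Bool) (n : Fin 3 → ℤ) (x : E3) (i : Fin 3) :
    signedTranslation s (fun i => n i) x i = ((if s i then -1 else 1 : ℤ) : ℝ) * x i + n i := by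
  rw [signedTranslation_apply]
  split_ifs <;> push_cast <;> ring

lemma signedTranslation_gyroidCoord (s : Fin 3 → Bool) (n : Fin 3 → ℤ) {v w : E3}
    (h : ∀ i, Real.pi * gyroidCoord w i =
      (if s i then -(Real.pi * gyroidCoord v i) else Real.pi * gyroidCoord v i) + Real.pi * n i) :
    signedTranslation s (fun i => n i) (gyroidCoord v) = gyroidCoord w := by
  ext i
  rw [signedTranslation_apply]
  refine mul_left_cancel₀ Real.pi_ne_zero ?_
  rw [h]
  split_ifs <;> ring

/-- The four alternatives are the classes of the Hantzsche–Wendt group modulo its translations. -/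
lemma gyroidRel_iff {v w : E3} :
    GyroidRel v w ↔ ∃ γ ∈ hantzscheWendtGroup, γ (gyroidCoord v) = gyroidCoord w := by
  have hpi := Real.pi_ne_zero
  obtain ⟨p0, p1, p2⟩ := pi_mul_gyroidCoord v
  obtain ⟨q0, q1, q2⟩ := pi_mul_gyroidCoord w
  constructor
  · have mem : ∀ (s : Fin 3 → Bool) (n : Fin 3 → ℤ), HWShape (signedTranslation s fun i => n i) →
        (∀ i, Real.pi * gyroidCoord w i =
          (if s i then -(Real.pi * gyroidCoord v i) else Real.pi * gyroidCoord v i) +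
            Real.pi * n i) →
        ∃ γ ∈ hantzscheWendtGroup, γ (gyroidCoord v) = gyroidCoord w :=
      fun s n hs h =>
        ⟨_, mem_hantzscheWendtGroup_iff.mpr hs, signedTranslation_gyroidCoord s n h⟩
    rintro ⟨a, b, c, ⟨h0, h1, h2⟩ | ⟨h0, h1, h2⟩ | ⟨h0, h1, h2⟩ | ⟨h0, h1, h2⟩⟩
    · refine mem ![false, false, false] ![2 * a, 2 * b, 2 * c]
        ⟨_, _, signedTranslation_apply_intCast _ _, Or.inl (by simp)⟩ fun i => ?_
      fin_cases i <;> simp [p0, p1, p2, q0, q1, q2, h0, h1, h2] <;> ring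
    · refine mem ![false, true, true] ![2 * a + 1, 2 * b + 1, 2 * c]
        ⟨_, _, signedTranslation_apply_intCast _ _, Or.inr (Or.inl (by simp))⟩ fun i => ?_
      fin_cases i <;> simp [p0, p1, p2, q0, q1, q2, h0, h1, h2] <;> ring
    · refine mem ![true, false, true] ![2 * a, 2 * b + 1, 2 * c + 1]
        ⟨_, _, signedTranslation_apply_intCast _ _, Or.inr (Or.inr (Or.inl (by simp)))⟩ fun i => ?_
      fin_cases i <;> simp [p0, p1, p2, q0, q1, q2, h0, h1, h2] <;> ring
    · refine mem ![true, true, false] ![2 * a + 1, 2 * b + 2, 2 * c + 1]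
        ⟨_, _, signedTranslation_apply_intCast _ _, Or.inr (Or.inr (Or.inr (by simp)))⟩ fun i => ?_
      fin_cases i <;> simp [p0, p1, p2, q0, q1, q2, h0, h1, h2] <;> ring
  · rintro ⟨γ, hγ, h⟩
    obtain ⟨s, n, hn, hc⟩ := hwShape_of_mem hγ
    have h0 := hn (gyroidCoord v) 0
    have h1 := hn (gyroidCoord v) 1
    have h2 := hn (gyroidCoord v) 2
    rw [h] at h0 h1 h2
    replace h0 := congrArg (Real.pi * ·) h0
    replace h1 := congrArg (Real.pi * ·) h1
    replace h2 := congrArg (Real.pi * ·) h2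
    simp only [mul_add, mul_left_comm Real.pi _ (gyroidCoord v _), p0, p1, p2, q0, q1, q2]
      at h0 h1 h2
    have hs : ∀ i, s i = 1 ∨ s i = -1 := by
      intro i
      rcases hc with ⟨k0, k1, k2, -⟩ | ⟨k0, k1, k2, -⟩ | ⟨k0, k1, k2, -⟩ | ⟨k0, k1, k2, -⟩ <;>
        fin_cases i <;> simp [k0, k1, k2]
    rcases hc with ⟨k0, k1, k2, m0, m1, m2⟩ | ⟨k0, k1, k2, m0, m1, m2⟩ |
      ⟨k0, k1, k2, m0, m1, m2⟩ | ⟨k0, k1, k2, m0, m1, m2⟩ <;> rw [k0] at h0 <;> rw [k1] at h1 <;>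
      rw [k2] at h2
    · obtain ⟨a, ha⟩ : ∃ a, n 0 = 2 * a := ⟨n 0 / 2, by omega⟩
      obtain ⟨b, hb⟩ : ∃ b, n 1 = 2 * b := ⟨n 1 / 2, by omega⟩
      obtain ⟨c, hc⟩ : ∃ c, n 2 = 2 * c := ⟨n 2 / 2, by omega⟩
      rw [ha] at h0
      rw [hb] at h1
      rw [hc] at h2
      push_cast at h0 h1 h2
      exact ⟨a, b, c, Or.inl ⟨by linarith, by linarith, by linarith⟩⟩
    · obtain ⟨a, ha⟩ : ∃ a, n 0 = 2 * a + 1 := ⟨n 0 / 2, by omega⟩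
      obtain ⟨b, hb⟩ : ∃ b, n 1 = 2 * b + 1 := ⟨n 1 / 2, by omega⟩
      obtain ⟨c, hc⟩ : ∃ c, n 2 = 2 * c := ⟨n 2 / 2, by omega⟩
      rw [ha] at h0
      rw [hb] at h1
      rw [hc] at h2
      push_cast at h0 h1 h2
      exact ⟨a, b, c, Or.inr (Or.inl ⟨by linarith, by linarith, by linarith⟩)⟩
    · obtain ⟨a, ha⟩ : ∃ a, n 0 = 2 * a := ⟨n 0 / 2, by omega⟩
      obtain ⟨b, hb⟩ : ∃ b, n 1 = 2 * b + 1 := ⟨n 1 / 2, by omega⟩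
      obtain ⟨c, hc⟩ : ∃ c, n 2 = 2 * c + 1 := ⟨n 2 / 2, by omega⟩
      rw [ha] at h0
      rw [hb] at h1
      rw [hc] at h2
      push_cast at h0 h1 h2
      exact ⟨a, b, c, Or.inr (Or.inr (Or.inl ⟨by linarith, by linarith, by linarith⟩))⟩
    · obtain ⟨a, ha⟩ : ∃ a, n 0 = 2 * a + 1 := ⟨n 0 / 2, by omega⟩
      obtain ⟨b, hb⟩ : ∃ b, n 1 = 2 * b + 2 := ⟨n 1 / 2 - 1, by omega⟩
      obtain ⟨c, hc⟩ : ∃ c, n 2 = 2 * c + 1 := ⟨n 2 / 2, by omega⟩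
      rw [ha] at h0
      rw [hb] at h1
      rw [hc] at h2
      push_cast at h0 h1 h2
      exact ⟨a, b, c, Or.inr (Or.inr (Or.inr ⟨by linarith, by linarith, by linarith⟩))⟩

/-- The polytope, as a condition on points of `ℝ³`. -/
def gyroidPolytope : Set E3 := {v | InGyroidPolytope (v 0) (v 1) (v 2)}

/-- The symmetry of the cell that carries the faces with `y ≠ 0` to the faces of index `i`. -/
def gyroidSwap (i : Fin 2) (v : E3) : E3 :=
  if i = 0 then v else WithLp.toLp 2 ![v 1, v 0, -v 2]

lemma gyroidSwap_zero (v : E3) : gyroidSwap 0 v = v := rfl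

lemma gyroidSwap_one (v : E3) : gyroidSwap 1 v = WithLp.toLp 2 ![v 1, v 0, -v 2] := rfl

lemma gyroidSwap_swap (i : Fin 2) (v : E3) : gyroidSwap i (gyroidSwap i v) = v := by
  fin_cases i
  · rfl
  · ext j
    fin_cases j <;> simp [gyroidSwap]

lemma continuous_gyroidSwap (i : Fin 2) : Continuous (gyroidSwap i) := by
  fin_cases i
  · exact continuous_id
  · refine continuous_toLp_of_coord fun j => ?_
    fin_cases j
    · exact continuous_coord 1
    · exact continuous_coord 0
    · exact (continuous_coord 2).neg

lemma gyroidSwap_smul_add (i : Fin 2) (a b : ℝ) (v w : E3) :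
    gyroidSwap i (a • v + b • w) = a • gyroidSwap i v + b • gyroidSwap i w := by
  fin_cases i
  · rfl
  · ext j
    fin_cases j <;> simp [gyroidSwap]
    ring

lemma gyroidSwap_mem_iff (i : Fin 2) {v : E3} :
    gyroidSwap i v ∈ gyroidPolytope ↔ v ∈ gyroidPolytope := by
  have key : ∀ v, v ∈ gyroidPolytope → gyroidSwap i v ∈ gyroidPolytope := by
    intro v hv
    fin_cases i
    · exact hv
    · exact InGyroidPolytope.swap hv
  exact ⟨fun h => gyroidSwap_swap i v ▸ key _ h, key v⟩

lemma gyroidF_swap (i : Fin 2) (v : E3) : gyroidF (gyroidSwap i v) = gyroidF v := by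
  fin_cases i
  · rfl
  · exact cellG_swap _ _ _

lemma GyroidRel.swap {v w : E3} (h : GyroidRel v w) (i : Fin 2) :
    GyroidRel (gyroidSwap i v) (gyroidSwap i w) := by
  fin_cases i
  · exact h
  · obtain ⟨a, b, c, ⟨h0, h1, h2⟩ | ⟨h0, h1, h2⟩ | ⟨h0, h1, h2⟩ | ⟨h0, h1, h2⟩⟩ := h
    · refine ⟨b, a, -c, Or.inl ⟨h1, h0, ?_⟩⟩
      change -w 2 = -v 2 + _
      push_cast
      linarith
    · refine ⟨b, a, -c, Or.inr (Or.inr (Or.inl ⟨h1, h0, ?_⟩))⟩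
      change -w 2 = - -v 2 + _ + _
      push_cast
      linarith
    · refine ⟨b, a, -c, Or.inr (Or.inl ⟨h1, h0, ?_⟩)⟩
      change -w 2 = - -v 2 + _ - _
      push_cast
      linarith
    · refine ⟨b, a, -c - 1, Or.inr (Or.inr (Or.inr ⟨h1, h0, ?_⟩))⟩
      change -w 2 = -v 2 + _
      push_cast
      linarith

lemma gyroidPolytope_bounds {v : E3} (hv : v ∈ gyroidPolytope) :
    |v 0| ≤ 3 * Real.pi / 2 ∧ |v 1| ≤ 3 * Real.pi / 2 ∧ |v 2| ≤ 3 * Real.pi / 4 := by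
  obtain ⟨h1, h2⟩ := hv
  have a0 := abs_nonneg (v 0)
  have a1 := abs_nonneg (v 1)
  have h3 : |v 2| ≤ 3 * Real.pi / 4 := abs_le.mpr ⟨by linarith, by linarith⟩
  have h4 := abs_le.mp h3
  exact ⟨by linarith, by linarith, h3⟩

/-- The pairing of the faces `y + z = 3π/4` and `-y + z = 3π/4`. -/
def gyroidPairing (v : E3) : E3 := WithLp.toLp 2 ![-v 0, v 1 - Real.pi, Real.pi / 2 - v 2]

lemma gyroidPairing_eq {v w : E3} (h0 : w 0 = -v 0) (h1 : w 1 = v 1 - Real.pi)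
    (h2 : w 2 = Real.pi / 2 - v 2) : w = gyroidPairing v := by
  ext i
  fin_cases i
  exacts [h0, h1, h2]

/-- Two points of the cell do not differ by a lattice vector with non-zero first coordinate. -/
lemma gyroid_translation_zero {v w : E3} (hv : v ∈ gyroidPolytope) (hw : w ∈ gyroidPolytope)
    (hfv : 0 ≤ gyroidF v) {a : ℤ} (h0 : w 0 = v 0 + Real.pi * (2 * a)) (h2 : w 2 = v 2) :
    a = 0 := by
  have hpi := Real.pi_pos
  by_contra hne
  have ha : 1 ≤ |(a : ℝ)| := one_le_abs_intCast hne
  have h3 : 2 * Real.pi ≤ |v 0| + |w 0| := by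
    have h4 := abs_sub (w 0) (v 0)
    rw [h0, add_sub_cancel_left, abs_mul, abs_mul, abs_of_pos hpi, abs_two, ← h0] at h4
    nlinarith
  obtain ⟨hv1, hv2⟩ := hv
  obtain ⟨hw1, hw2⟩ := hw
  rw [h2] at hw2
  refine absurd hfv (not_le.mpr (cellG_sliver_neg ?_ (abs_le.mpr ⟨?_, ?_⟩) ?_)) <;> linarith

/-- Two points of the cell do not differ by a non-zero lattice vector. -/
lemma gyroid_tiling_translation {v w : E3} (hv : v ∈ gyroidPolytope) (hw : w ∈ gyroidPolytope)
    (hfv : 0 ≤ gyroidF v) {a b c : ℤ} (h0 : w 0 = v 0 + Real.pi * (2 * a))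
    (h1 : w 1 = v 1 + Real.pi * (2 * b)) (h2 : w 2 = v 2 + Real.pi * (2 * c)) : v = w := by
  have hpi := Real.pi_pos
  obtain ⟨-, -, b1⟩ := gyroidPolytope_bounds hv
  obtain ⟨-, -, b2⟩ := gyroidPolytope_bounds hw
  rw [abs_le] at b1 b2
  have hc : c = 0 := by
    have c1 : (c : ℝ) < 1 := by nlinarith
    have c2 : (-1 : ℝ) < c := by nlinarith
    have c1' : c < 1 := by exact_mod_cast c1
    have c2' : -1 < c := by exact_mod_cast c2
    omega
  rw [hc, Int.cast_zero, mul_zero, mul_zero, add_zero] at h2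
  have ha := gyroid_translation_zero hv hw hfv h0 h2
  have hb : b = 0 := by
    refine gyroid_translation_zero (v := gyroidSwap 1 v) (w := gyroidSwap 1 w)
      ((gyroidSwap_mem_iff 1).mpr hv) ((gyroidSwap_mem_iff 1).mpr hw) ?_ h1 ?_
    · rwa [gyroidF_swap]
    · change -w 2 = -v 2
      rw [h2]
  rw [ha, Int.cast_zero, mul_zero, mul_zero, add_zero] at h0
  rw [hb, Int.cast_zero, mul_zero, mul_zero, add_zero] at h1
  ext i
  fin_cases i
  exacts [h0.symm, h1.symm, h2.symm]

lemma gyroid_tiling_half_turn_aux {v w : E3} (hv : v ∈ gyroidPolytope) (hw : w ∈ gyroidPolytope)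
    (hfw : 0 ≤ gyroidF w) {a : ℤ} (h0 : w 0 = -v 0 + Real.pi * (2 * a + 1))
    (h2 : w 2 = v 2 + Real.pi) : False := by
  have hpi := Real.pi_pos
  obtain ⟨hv1, hv2⟩ := hv
  obtain ⟨hw1, hw2⟩ := hw
  have a1 := abs_nonneg (w 1)
  have hx : |v 0| ≤ Real.pi / 2 := by linarith
  have hx' : |w 0| ≤ 3 * Real.pi / 2 := by linarith
  have hlr := abs_le.mp hx
  have hlr' := abs_le.mp hx'
  have ha : a = 0 ∨ a = -1 := by
    have c1 : (a : ℝ) < 1 := by nlinarith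
    have c2 : (-2 : ℝ) < a := by nlinarith
    have c1' : a < 1 := by exact_mod_cast c1
    have c2' : -2 < a := by exact_mod_cast c2
    omega
  refine absurd hfw (not_le.mpr (cellG_sliver_neg ?_ ?_ ?_)) <;> try linarith [abs_nonneg (v 0)]
  have h3 : |(|w 0| - Real.pi)| = |v 0| := by
    rcases ha with rfl | rfl
    · have h4 : w 0 = Real.pi - v 0 := by
        rw [h0]
        push_cast
        ring
      rw [h4, abs_of_nonneg (a := Real.pi - v 0) (by linarith),
        show Real.pi - v 0 - Real.pi = -v 0 by ring, abs_neg]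
    · have h4 : w 0 = -(Real.pi + v 0) := by
        rw [h0]
        push_cast
        ring
      rw [h4, abs_neg, abs_of_nonneg (a := Real.pi + v 0) (by linarith), add_sub_cancel_left]
  linarith

/-- No two points of the cell are related by a screw motion along the third axis. -/
lemma gyroid_tiling_half_turn {v w : E3} (hv : v ∈ gyroidPolytope) (hw : w ∈ gyroidPolytope)
    (hfv : 0 ≤ gyroidF v) (hfw : 0 ≤ gyroidF w) {a c : ℤ}
    (h0 : w 0 = -v 0 + Real.pi * (2 * a + 1)) (h2 : w 2 = v 2 + Real.pi * (2 * c + 1)) : False := by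
  have hpi := Real.pi_pos
  obtain ⟨-, -, b1⟩ := gyroidPolytope_bounds hv
  obtain ⟨-, -, b2⟩ := gyroidPolytope_bounds hw
  rw [abs_le] at b1 b2
  have hc : c = 0 ∨ c = -1 := by
    have c1 : (c : ℝ) < 1 := by nlinarith
    have c2 : (-2 : ℝ) < c := by nlinarith
    have c1' : c < 1 := by exact_mod_cast c1
    have c2' : -2 < c := by exact_mod_cast c2
    omega
  rcases hc with rfl | rfl
  · refine gyroid_tiling_half_turn_aux hv hw hfw h0 ?_
    rw [h2]
    push_cast
    ring
  · refine gyroid_tiling_half_turn_aux (a := a) hw hv hfv ?_ ?_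
    · rw [h0]
      ring
    · rw [h2]
      push_cast
      ring

/-- If a screw motion along the second axis relates two points of the cell, then these lie on the
faces with `y ≠ 0` and are identified by the pairing of these faces. -/
lemma gyroid_tiling_screw {v w : E3} (hv : v ∈ gyroidPolytope) (hw : w ∈ gyroidPolytope)
    (hfv : 0 ≤ gyroidF v) {a b c : ℤ}
    (h0 : w 0 = -v 0 + Real.pi * (2 * a)) (h1 : w 1 = v 1 + Real.pi * (2 * b + 1))
    (h2 : w 2 = -v 2 + Real.pi * (2 * c) + Real.pi / 2) :
    (v 1 + v 2 = 3 * Real.pi / 4 ∧ w = gyroidPairing v) ∨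
      (w 1 + w 2 = 3 * Real.pi / 4 ∧ v = gyroidPairing w) := by
  have hpi := Real.pi_pos
  obtain ⟨-, -, b1⟩ := gyroidPolytope_bounds hv
  obtain ⟨-, -, b2⟩ := gyroidPolytope_bounds hw
  rw [abs_le] at b1 b2
  obtain ⟨hv1, hv2⟩ := hv
  obtain ⟨hw1, hw2⟩ := hw
  have hc : c = 0 ∨ c = -1 := by
    have c1 : (c : ℝ) < 1 := by nlinarith
    have c2 : (-2 : ℝ) < c := by nlinarith
    have c1' : c < 1 := by exact_mod_cast c1
    have c2' : -2 < c := by exact_mod_cast c2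
    omega
  rcases hc with rfl | rfl
  · have h2' : v 2 + w 2 = Real.pi / 2 := by
      rw [h2]
      push_cast
      ring
    have hb : b = 0 ∨ b = -1 := by
      have h3 := abs_sub (w 1) (v 1)
      have h4 : |Real.pi * (2 * (b : ℝ) + 1)| ≤ Real.pi := by
        rw [h1, add_sub_cancel_left, ← h1] at h3
        linarith
      rw [abs_le] at h4
      have c1 : (b : ℝ) < 1 := by nlinarith
      have c2 : (-2 : ℝ) < b := by nlinarith
      have c1' : b < 1 := by exact_mod_cast c1
      have c2' : -2 < b := by exact_mod_cast c2
      omega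
    have hface : |v 1| + v 2 = 3 * Real.pi / 4 := by
      rcases hb with rfl | rfl <;> push_cast at h1 <;>
        linarith [neg_le_abs (v 1), le_abs_self (w 1), le_abs_self (v 1), neg_le_abs (w 1)]
    have ha : a = 0 := by
      by_contra hne
      have ha : 1 ≤ |(a : ℝ)| := one_le_abs_intCast hne
      have h3 : 2 * Real.pi ≤ |v 0| + |w 0| := by
        have h4 := abs_add_le (w 0) (v 0)
        rw [show w 0 + v 0 = Real.pi * (2 * a) by linarith, abs_mul, abs_mul, abs_of_pos hpi,
          abs_two] at h4
        nlinarith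
      exact absurd hfv (not_le.mpr (cellG_edge_neg hface (by linarith)))
    rw [ha, Int.cast_zero, mul_zero, mul_zero, add_zero] at h0
    rcases hb with rfl | rfl <;> push_cast at h1
    · right
      refine ⟨?_, gyroidPairing_eq (by linarith) (by linarith) (by linarith)⟩
      linarith [neg_le_abs (v 1), le_abs_self (w 1), le_abs_self (v 1), neg_le_abs (w 1)]
    · left
      refine ⟨?_, gyroidPairing_eq (by linarith) (by linarith) (by linarith)⟩
      linarith [neg_le_abs (v 1), le_abs_self (w 1), le_abs_self (v 1), neg_le_abs (w 1)]
  · exfalso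
    have h3 : v 2 = -(3 * Real.pi / 4) := by
      push_cast at h2
      linarith
    have h4 : v 0 = 0 := abs_nonpos_iff.mp (by linarith)
    have h5 : gyroidF v = -1 := by
      rw [gyroidF, cellG, h3, h4, show -(3 * Real.pi / 4) + Real.pi / 4 = -(Real.pi / 2) by ring]
      simp
    linarith

/-- Two points of the cell that are equivalent under the group agree, or are identified by a face
pairing. -/
lemma gyroid_tiling {v w : E3} (hv : v ∈ gyroidPolytope) (hw : w ∈ gyroidPolytope)
    (hfv : 0 ≤ gyroidF v) (hfw : 0 ≤ gyroidF w) (h : GyroidRel v w) :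
    v = w ∨ ∃ i, let v' := gyroidSwap i v; let w' := gyroidSwap i w;
      (v' 1 + v' 2 = 3 * Real.pi / 4 ∧ w' = gyroidPairing v') ∨
      (w' 1 + w' 2 = 3 * Real.pi / 4 ∧ v' = gyroidPairing w') := by
  have h' := h
  obtain ⟨a, b, c, ⟨h0, h1, h2⟩ | ⟨h0, h1, h2⟩ | ⟨h0, h1, h2⟩ | ⟨h0, h1, h2⟩⟩ := h'
  · exact Or.inl (gyroid_tiling_translation hv hw hfv h0 h1 h2)
  · refine Or.inr ⟨1, gyroid_tiling_screw (a := b) (b := a) (c := -c)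
      ((gyroidSwap_mem_iff 1).mpr hv) ((gyroidSwap_mem_iff 1).mpr hw)
      (by rwa [gyroidF_swap]) h1 h0 ?_⟩
    change -w 2 = - -v 2 + _ + _
    push_cast
    linarith
  · exact Or.inr ⟨0, gyroid_tiling_screw hv hw hfv h0 h1 h2⟩
  · exact (gyroid_tiling_half_turn hv hw hfv hfw h0 h2).elim

lemma exists_abs_add_two_pi_le (x : ℝ) : ∃ a : ℤ, |x + Real.pi * (2 * a)| ≤ Real.pi := by
  have hpi := Real.pi_pos
  refine ⟨-round (x / (2 * Real.pi)), ?_⟩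
  have h := abs_le.mp (abs_sub_round (x / (2 * Real.pi)))
  have hx : x = 2 * Real.pi * (x / (2 * Real.pi)) := by field_simp
  set r := x / (2 * Real.pi)
  push_cast
  rw [hx, abs_le]
  constructor <;> nlinarith

/-- Translations and, if need be, a screw motion along the third axis carry every point to a box. -/
lemma exists_gyroidRel_bounded (v : E3) : ∃ w, GyroidRel v w ∧ |w 0| ≤ Real.pi ∧
    |w 1| ≤ Real.pi ∧ |w 2| ≤ Real.pi / 2 := by
  have hpi := Real.pi_pos
  obtain ⟨c, hc⟩ : ∃ c : ℤ, |v 2 + Real.pi * c| ≤ Real.pi / 2 := by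
    obtain ⟨c, hc⟩ := exists_abs_add_two_pi_le (2 * v 2)
    refine ⟨c, ?_⟩
    rw [abs_le] at hc ⊢
    constructor <;> linarith
  obtain ⟨k, rfl | rfl⟩ := Int.even_or_odd' c
  · obtain ⟨a, ha⟩ := exists_abs_add_two_pi_le (v 0)
    obtain ⟨b, hb⟩ := exists_abs_add_two_pi_le (v 1)
    refine ⟨WithLp.toLp 2 ![_, _, _], ⟨a, b, k, Or.inl ⟨rfl, rfl, rfl⟩⟩, ha, hb, ?_⟩
    push_cast at hc
    exact hc
  · obtain ⟨a, ha⟩ := exists_abs_add_two_pi_le (-v 0 + Real.pi)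
    obtain ⟨b, hb⟩ := exists_abs_add_two_pi_le (-v 1 + Real.pi)
    refine ⟨WithLp.toLp 2 ![_, _, _], ⟨a, b, k, Or.inr (Or.inr (Or.inr ⟨rfl, rfl, rfl⟩))⟩,
      ?_, ?_, ?_⟩
    · convert ha using 2
      change -v 0 + Real.pi * (2 * a + 1) = _
      ring
    · convert hb using 2
      change -v 1 + Real.pi * (2 * b + 1) = _
      ring
    · push_cast at hc
      exact hc

lemma exists_abs_sub_pi (x : ℝ) (hx : |x| ≤ Real.pi) : ∃ b : ℤ, |x + Real.pi * (2 * b + 1)| =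
    Real.pi - |x| := by
  rcases le_total 0 x with h | h
  · rw [abs_of_nonneg h] at hx ⊢
    refine ⟨-1, ?_⟩
    push_cast
    rw [abs_of_nonpos (by linarith)]
    ring
  · rw [abs_of_nonpos h] at hx ⊢
    refine ⟨0, ?_⟩
    push_cast
    rw [abs_of_nonneg (by linarith)]
    ring

/-- A point of the box above the faces with `y ≠ 0` is moved into the polytope by a screw motion
that carries one of these faces to the other, or, if it would then leave through a face with
`x ≠ 0`, by a screw motion along the third axis. -/
lemma gyroid_cover_aux {u : E3} (h0 : |u 0| ≤ Real.pi) (h1 : |u 1| ≤ Real.pi)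
    (h2 : |u 2| ≤ Real.pi / 2) (h : 3 * Real.pi / 4 < |u 1| + u 2) :
    ∃ w ∈ gyroidPolytope, GyroidRel u w := by
  have hpi := Real.pi_pos
  rw [abs_le] at h2
  obtain ⟨b, hb⟩ := exists_abs_sub_pi (u 1) h1
  rcases le_or_gt (|u 0| + u 2) (5 * Real.pi / 4) with h3 | h3
  · refine ⟨WithLp.toLp 2 ![-u 0, u 1 + Real.pi * (2 * b + 1), -u 2 + Real.pi / 2], ⟨?_, ?_⟩,
      0, b, 0, Or.inr (Or.inr (Or.inl ⟨?_, rfl, ?_⟩))⟩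
    · change |u 1 + Real.pi * (2 * b + 1)| + (-u 2 + Real.pi / 2) ≤ _
      linarith
    · change |-u 0| - (-u 2 + Real.pi / 2) ≤ _
      rw [abs_neg]
      linarith
    · change -u 0 = _
      simp
    · change -u 2 + Real.pi / 2 = _
      simp
  · obtain ⟨a, ha⟩ := exists_abs_sub_pi (-u 0) (by rwa [abs_neg])
    obtain ⟨b, hb⟩ := exists_abs_sub_pi (-u 1) (by rwa [abs_neg])
    rw [abs_neg] at ha hb
    refine ⟨WithLp.toLp 2 ![-u 0 + Real.pi * (2 * a + 1), -u 1 + Real.pi * (2 * b + 1),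
      u 2 - Real.pi], ⟨?_, ?_⟩, a, b, -1, Or.inr (Or.inr (Or.inr ⟨rfl, rfl, ?_⟩))⟩
    · change |-u 1 + Real.pi * (2 * b + 1)| + (u 2 - Real.pi) ≤ _
      linarith
    · change |-u 0 + Real.pi * (2 * a + 1)| - (u 2 - Real.pi) ≤ _
      linarith
    · change u 2 - Real.pi = _
      push_cast
      ring

lemma gyroid_cover (v : E3) : ∃ w ∈ gyroidPolytope, ∃ γ ∈ hantzscheWendtGroup,
    γ (gyroidCoord v) = gyroidCoord w := by
  obtain ⟨u, hu, h0, h1, h2⟩ := exists_gyroidRel_bounded v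
  have key : ∃ w ∈ gyroidPolytope, GyroidRel u w := by
    rcases lt_or_ge (3 * Real.pi / 4) (|u 1| + u 2) with h3 | h3
    · exact gyroid_cover_aux h0 h1 h2 h3
    rcases lt_or_ge (3 * Real.pi / 4) (|u 0| - u 2) with h4 | h4
    · obtain ⟨w, hw, hr⟩ := gyroid_cover_aux (u := gyroidSwap 1 u) h1 h0
        ((abs_neg (u 2)).trans_le h2) h4
      refine ⟨gyroidSwap 1 w, (gyroidSwap_mem_iff 1).mpr hw, ?_⟩
      have := hr.swap 1
      rwa [gyroidSwap_swap] at this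
    · exact ⟨u, ⟨h3, h4⟩, 0, 0, 0, Or.inl (by simp)⟩
  obtain ⟨w, hw, hr⟩ := key
  obtain ⟨γ, hγ, e⟩ := gyroidRel_iff.mp hu
  obtain ⟨γ', hγ', e'⟩ := gyroidRel_iff.mp hr
  refine ⟨w, hw, γ' * γ, mul_mem hγ' hγ, ?_⟩
  rw [← e', ← e]
  rfl

/-! ### A fundamental cell of the gyroid region -/

/-- The functionals that define the faces of the cell. -/
def gyroidFunctional (i : Fin 2) (b : Bool) : E3 →L[ℝ] ℝ :=
  (4 / (3 * Real.pi)) • ((if b then (1 : ℝ) else -1) • coordCLM (if i = 0 then 1 else 0) +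
    (if i = 0 then (1 : ℝ) else -1) • coordCLM 2)

lemma gyroidFunctional_swap (i : Fin 2) (b : Bool) (v : E3) :
    gyroidFunctional i b v = gyroidFunctional 0 b (gyroidSwap i v) := by
  fin_cases i
  · rfl
  · cases b <;> simp [gyroidFunctional, gyroidSwap]

lemma gyroidFunctional_zero (b : Bool) (v : E3) : gyroidFunctional 0 b v =
    (4 / (3 * Real.pi)) * ((if b then (1 : ℝ) else -1) * v 1 + v 2) := by
  cases b <;> simp [gyroidFunctional] <;> ring

lemma gyroidFunctional_true_eq_one {i : Fin 2} {v : E3} : gyroidFunctional i true v = 1 ↔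
    gyroidSwap i v 1 + gyroidSwap i v 2 = 3 * Real.pi / 4 := by
  have := Real.pi_ne_zero
  rw [gyroidFunctional_swap, gyroidFunctional_zero, if_pos rfl, one_mul, div_mul_eq_mul_div,
    div_eq_one_iff_eq (by positivity)]
  constructor <;> intro h <;> linarith

lemma gyroidFunctional_false_eq_one {i : Fin 2} {v : E3} : gyroidFunctional i false v = 1 ↔
    -gyroidSwap i v 1 + gyroidSwap i v 2 = 3 * Real.pi / 4 := by
  have := Real.pi_ne_zero
  rw [gyroidFunctional_swap, gyroidFunctional_zero, if_neg Bool.false_ne_true, neg_one_mul,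
    div_mul_eq_mul_div, div_eq_one_iff_eq (by positivity)]
  constructor <;> intro h <;> linarith

lemma gyroidFunctional_le_one {v : E3} :
    (∀ i b, gyroidFunctional i b v ≤ 1) ↔ v ∈ gyroidPolytope := by
  have hpi := Real.pi_pos
  have key : ∀ v : E3, (∀ b, gyroidFunctional 0 b v ≤ 1) ↔ |v 1| + v 2 ≤ 3 * Real.pi / 4 := by
    intro v
    rw [Bool.forall_bool, gyroidFunctional_zero, gyroidFunctional_zero, if_pos rfl,
      if_neg Bool.false_ne_true, div_mul_eq_mul_div, div_mul_eq_mul_div,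
      div_le_one (by positivity), div_le_one (by positivity)]
    constructor
    · rintro ⟨h1, h2⟩
      rcases abs_cases (v 1) with ⟨h, -⟩ | ⟨h, -⟩ <;> rw [h] <;> linarith
    · intro h
      constructor <;> linarith [le_abs_self (v 1), neg_abs_le (v 1)]
  rw [Fin.forall_fin_two, key]
  have h1 : (∀ b, gyroidFunctional 1 b v ≤ 1) ↔ |v 0| - v 2 ≤ 3 * Real.pi / 4 := by
    simp only [gyroidFunctional_swap 1]
    exact key (gyroidSwap 1 v)
  rw [h1]
  rfl

/-- The affine charts of the faces of the cell. -/
def gyroidFace (i : Fin 2) (z : E2) : E3 :=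
  gyroidSwap i (WithLp.toLp 2
    ![-(Real.pi / 4) + z 0, Real.pi / 2 + z 1, Real.pi / 4 - z 1])

/-- Retractions to the faces of the cell. -/
def gyroidRetract (i : Fin 2) (v : E3) : E2 :=
  WithLp.toLp 2 ![gyroidSwap i v 0 + Real.pi / 4, gyroidSwap i v 1 - Real.pi / 2]

lemma gyroidSwap_face (i : Fin 2) (z : E2) : gyroidSwap i (gyroidFace i z) = WithLp.toLp 2
    ![-(Real.pi / 4) + z 0, Real.pi / 2 + z 1, Real.pi / 4 - z 1] := gyroidSwap_swap _ _

lemma gyroidF_face (i : Fin 2) (z : E2) : gyroidF (gyroidFace i z) =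
    Real.sqrt 2 * (Real.cos (z 1) * Real.cos (z 0)) - Real.sin (z 1) ^ 2 := by
  rw [← gyroidF_swap i, gyroidSwap_face]
  exact cellG_face _ _

lemma gyroid_face_bounds {i : Fin 2} {z : E2} (h : gyroidFace i z ∈ gyroidPolytope)
    (hf : 0 ≤ Real.sqrt 2 * (Real.cos (z 1) * Real.cos (z 0)) - Real.sin (z 1) ^ 2) :
    |z 0| ≤ Real.pi / 2 ∧ |z 1| < Real.pi / 2 := by
  rw [← gyroidSwap_mem_iff i, gyroidSwap_face] at h
  have := abs_le_of_cellG_face h hf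
  exact ⟨this.1, this.2.1⟩

lemma gyroidPairing_mem {v : E3} (hv : v ∈ gyroidPolytope) (hf : 0 ≤ gyroidF v)
    (h : v 1 + v 2 = 3 * Real.pi / 4) : gyroidPairing v ∈ gyroidPolytope :=
  InGyroidPolytope.pair hv hf h

/-- The face pairings are restrictions of elements of the Hantzsche–Wendt group. -/
lemma exists_mem_gyroidPairing (i : Fin 2) : ∃ γ ∈ hantzscheWendtGroup, ∀ v,
    γ (gyroidCoord v) = gyroidCoord (gyroidSwap i (gyroidPairing (gyroidSwap i v))) := by
  fin_cases i
  · refine ⟨signedTranslation ![true, false, true] fun i => (![0, -1, 1] i : ℤ),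
      mem_hantzscheWendtGroup_iff.mpr ⟨_, _, signedTranslation_apply_intCast _ _,
        Or.inr (Or.inr (Or.inl (by simp)))⟩, fun v => ?_⟩
    refine signedTranslation_gyroidCoord _ _ fun i => ?_
    obtain ⟨p0, p1, p2⟩ := pi_mul_gyroidCoord v
    obtain ⟨q0, q1, q2⟩ := pi_mul_gyroidCoord (gyroidPairing v)
    fin_cases i <;> simp [gyroidSwap_zero, p0, p1, p2, q0, q1, q2] <;> simp [gyroidPairing] <;> ring
  · refine ⟨signedTranslation ![false, true, true] fun i => (![-1, 1, 0] i : ℤ),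
      mem_hantzscheWendtGroup_iff.mpr ⟨_, _, signedTranslation_apply_intCast _ _,
        Or.inr (Or.inl (by simp))⟩, fun v => ?_⟩
    refine signedTranslation_gyroidCoord _ _ fun i => ?_
    obtain ⟨p0, p1, p2⟩ := pi_mul_gyroidCoord v
    obtain ⟨q0, q1, q2⟩ := pi_mul_gyroidCoord (gyroidSwap 1 (gyroidPairing (gyroidSwap 1 v)))
    fin_cases i <;> simp [p0, p1, p2, q0, q1, q2] <;>
      simp [gyroidPairing, gyroidSwap_one] <;> ring

lemma gyroid_edge_absurd {v : E3} (hf : 0 ≤ gyroidF v) (h0 : |v 1| + v 2 = 3 * Real.pi / 4)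
    (h1 : |v 0| - v 2 = 3 * Real.pi / 4) : False :=
  absurd hf (not_le.mpr (cellG_edge_neg h0 h1))

lemma gyroidFunctional_face_abs {i : Fin 2} {b : Bool} {v : E3} (hv : v ∈ gyroidPolytope)
    (h : gyroidFunctional i b v = 1) :
    |gyroidSwap i v 1| + gyroidSwap i v 2 = 3 * Real.pi / 4 := by
  have hv' := ((gyroidSwap_mem_iff i).mpr hv).1
  refine le_antisymm hv' ?_
  cases b
  · rw [gyroidFunctional_false_eq_one] at h
    linarith [neg_le_abs (gyroidSwap i v 1)]
  · rw [gyroidFunctional_true_eq_one] at h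
    linarith [le_abs_self (gyroidSwap i v 1)]

/-- A point of the cell lies on at most one face. -/
lemma gyroidFunctional_inj {v : E3} (hv : v ∈ gyroidPolytope) (hf : 0 ≤ gyroidF v) {i i' : Fin 2}
    {b b' : Bool} (h : gyroidFunctional i b v = 1) (h' : gyroidFunctional i' b' v = 1) :
    i = i' ∧ b = b' := by
  have e : ∀ b b' : Bool, gyroidFunctional 0 b v = 1 → gyroidFunctional 1 b' v = 1 → False := by
    intro b b' h h'
    refine gyroid_edge_absurd hf (gyroidFunctional_face_abs hv h) ?_
    exact gyroidFunctional_face_abs hv h'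
  have tf : ∀ i, gyroidFunctional i true v = 1 → gyroidFunctional i false v = 1 → False := by
    intro i h h'
    rw [gyroidFunctional_true_eq_one] at h
    rw [gyroidFunctional_false_eq_one] at h'
    rw [← gyroidF_swap i, gyroidF, cellG, show gyroidSwap i v 1 = 0 by linarith,
      show gyroidSwap i v 2 + Real.pi / 4 = Real.pi by linarith] at hf
    norm_num at hf
  have hi : i = i' := by
    fin_cases i <;> fin_cases i'
    · rfl
    · exact (e _ _ h h').elim
    · exact (e _ _ h' h).elim
    · rfl
  subst hi
  refine ⟨rfl, ?_⟩
  cases b <;> cases b'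
  · rfl
  · exact (tf _ h' h).elim
  · exact (tf _ h h').elim
  · rfl

/-- The fundamental cell of the region `gyroid ≥ 0` of the Hantzsche–Wendt manifold. -/
def gyroidCell : HandlebodyCell hantzscheWendtGroup gyroid 2 where
  κ := gyroidCoord
  ℓ := gyroidFunctional
  τ i v := gyroidSwap i (gyroidPairing (gyroidSwap i v))
  d := gyroidFace
  r := gyroidRetract
  d_cont i := by
    refine (continuous_gyroidSwap i).comp (continuous_toLp_of_coord fun j => ?_)
    fin_cases j
    · exact continuous_const.add (continuous_coord 0)
    · exact continuous_const.add (continuous_coord 1)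
    · exact continuous_const.sub (continuous_coord 1)
  r_cont i := by
    refine continuous_toLp_of_coord fun j => ?_
    fin_cases j
    · exact ((continuous_coord 0).comp (continuous_gyroidSwap i)).add continuous_const
    · exact ((continuous_coord 1).comp (continuous_gyroidSwap i)).sub continuous_const
  r_d i z := by
    rw [gyroidRetract, gyroidSwap_face]
    ext j
    fin_cases j <;> simp
  d_r i v h := by
    rw [gyroidFunctional_true_eq_one] at h
    rw [← gyroidSwap_swap i v, gyroidFace]
    congr 1
    ext j
    fin_cases j
    · simp [gyroidRetract, gyroidSwap_swap]
    · simp [gyroidRetract, gyroidSwap_swap]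
    · change Real.pi / 4 - (gyroidSwap i (gyroidSwap i (gyroidSwap i v)) 1 - Real.pi / 2) = _
      rw [gyroidSwap_swap]
      change _ = gyroidSwap i v 2
      linarith
  ℓ_d i z := by
    rw [gyroidFunctional_true_eq_one, gyroidSwap_face]
    change (Real.pi / 2 + z 1) + (Real.pi / 4 - z 1) = _
    ring
  d_smul i z t := by
    unfold gyroidFace
    rw [← gyroidSwap_smul_add]
    congr 1
    ext j
    fin_cases j <;> simp <;> ring
  τ_spec := exists_mem_gyroidPairing
  bounded := ⟨3 * (3 * Real.pi / 2), fun v hv _ => by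
    have hpi := Real.pi_pos
    obtain ⟨h0, h1, h2⟩ := gyroidPolytope_bounds (gyroidFunctional_le_one.mp hv)
    refine norm_le_of_coord (by positivity) fun j => ?_
    fin_cases j
    · exact h0
    · exact h1
    · exact h2.trans (by linarith)⟩
  center := by
    rw [gyroid_gyroidCoord]
    simp [gyroidF, cellG]
  star v hv hf t h0 h1 := by
    rw [gyroidFunctional_le_one] at hv
    rw [gyroid_gyroidCoord] at hf ⊢
    exact cellG_mul_pos hv hf h0 h1
  face_inj v hv hf i b i' b' h h' := by
    rw [gyroidFunctional_le_one] at hv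
    rw [gyroid_gyroidCoord] at hf
    exact gyroidFunctional_inj hv hf h h'
  face_center i := by
    have hpi := Real.pi_pos
    rw [gyroid_gyroidCoord, gyroidF_face]
    refine ⟨gyroidFunctional_le_one.mpr ?_, by simp⟩
    rw [← gyroidSwap_mem_iff i, gyroidSwap_face]
    constructor
    · change |Real.pi / 2 + (0 : ℝ)| + (Real.pi / 4 - 0) ≤ _
      rw [abs_of_pos (by linarith)]
      linarith
    · change |-(Real.pi / 4) + (0 : ℝ)| - (Real.pi / 4 - 0) ≤ _
      rw [abs_of_neg (by linarith)]
      linarith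
  face_star i z hz hf t h0 h1 := by
    rw [gyroidFunctional_le_one] at hz
    rw [gyroid_gyroidCoord, gyroidF_face] at hf ⊢
    obtain ⟨b0, b1⟩ := gyroid_face_bounds hz hf
    exact face_mul_pos b0 b1 hf h0 h1
  pair i v hv hf h := by
    rw [gyroidFunctional_le_one] at hv ⊢
    rw [gyroid_gyroidCoord, ← gyroidF_swap i] at hf
    rw [gyroidFunctional_true_eq_one] at h
    rw [gyroidSwap_mem_iff, gyroidFunctional_false_eq_one, gyroidSwap_swap]
    refine ⟨gyroidPairing_mem ((gyroidSwap_mem_iff i).mpr hv) hf h, ?_⟩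
    change -(gyroidSwap i v 1 - Real.pi) + (Real.pi / 2 - gyroidSwap i v 2) = _
    linarith
  pair_surj i w hw hf h := by
    rw [gyroidFunctional_le_one] at hw
    rw [gyroid_gyroidCoord, ← gyroidF_swap i] at hf
    rw [gyroidFunctional_false_eq_one] at h
    rw [← gyroidSwap_mem_iff i] at hw
    -- conjugation with the symmetry `(x, y, z) ↦ (-x, -y, z)` carries the pairing to its inverse
    have hpair := InGyroidPolytope.pair (x := -gyroidSwap i w 0) (y := -gyroidSwap i w 1)
      (z := gyroidSwap i w 2) (by
        rw [InGyroidPolytope, abs_neg, abs_neg]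
        exact hw) (by rwa [cellG_neg_neg]) h
    set u : E3 := WithLp.toLp 2 ![-gyroidSwap i w 0, gyroidSwap i w 1 + Real.pi,
      Real.pi / 2 - gyroidSwap i w 2] with hu
    have humem : u ∈ gyroidPolytope := by
      obtain ⟨h1, h2⟩ := hpair
      refine ⟨?_, ?_⟩
      · change |gyroidSwap i w 1 + Real.pi| + (Real.pi / 2 - gyroidSwap i w 2) ≤ _
        rw [← abs_neg, neg_add']
        exact h1
      · change |-gyroidSwap i w 0| - (Real.pi / 2 - gyroidSwap i w 2) ≤ _
        rw [← abs_neg]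
        exact h2
    refine ⟨gyroidSwap i u, ?_, ?_, ?_⟩
    · rw [gyroidFunctional_le_one, gyroidSwap_mem_iff]
      exact humem
    · rw [gyroidFunctional_true_eq_one, gyroidSwap_swap]
      change gyroidSwap i w 1 + Real.pi + (Real.pi / 2 - gyroidSwap i w 2) = _
      linarith
    · have : gyroidPairing u = gyroidSwap i w := by
        ext j
        fin_cases j <;> simp [gyroidPairing, hu]
      rw [gyroidSwap_swap, this, gyroidSwap_swap]
  tiling γ hγ v w hv hfv hw hfw h := by
    rw [gyroidFunctional_le_one] at hv hw
    rw [gyroid_gyroidCoord] at hfv hfw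
    refine (gyroid_tiling hv hw hfv hfw (gyroidRel_iff.mpr ⟨γ, hγ, h⟩)).imp_right ?_
    rintro ⟨i, h | h⟩
    · refine ⟨i, Or.inl ⟨gyroidFunctional_true_eq_one.mpr h.1, ?_⟩⟩
      rw [← h.2, gyroidSwap_swap]
    · refine ⟨i, Or.inr ⟨gyroidFunctional_true_eq_one.mpr h.1, ?_⟩⟩
      rw [← h.2, gyroidSwap_swap]
  cover x _ := by
    obtain ⟨w, hw, γ, hγ, h⟩ := gyroid_cover (gyroidCoord.symm x)
    rw [Homeomorph.apply_symm_apply] at h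
    exact ⟨γ, hγ, w, gyroidFunctional_le_one.mpr hw, h.symm⟩

/-! ### Isometries of flat manifolds -/

section Isometries

variable {Γ : Subgroup (E3 ≃ᵃⁱ[ℝ] E3)} [hΓ : IsSpaceFormGroup Γ]

omit hΓ in
lemma flatDist_proj_le (x y : E3) : flatDist Γ (proj Γ x) (proj Γ y) ≤ dist x y := by
  refine csInf_le ⟨0, ?_⟩ ⟨x, y, rfl, rfl, rfl⟩
  rintro _ ⟨x, y, -, -, rfl⟩
  exact dist_nonneg

variable (Γ) in
/-- At small distances the projection is an isometry. -/
lemma exists_flatDist_proj_eq : ∃ δ : ℝ, 0 < δ ∧ ∀ x y : E3, dist x y ≤ δ →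
    flatDist Γ (proj Γ x) (proj Γ y) = dist x y := by
  obtain ⟨δ, hδ, hd⟩ := hΓ.displacement
  refine ⟨δ / 2, by positivity, fun x y hxy => le_antisymm (flatDist_proj_le x y) ?_⟩
  refine le_csInf ⟨_, x, y, rfl, rfl, rfl⟩ ?_
  rintro _ ⟨x', y', hx, hy, rfl⟩
  obtain ⟨γ, hγ, rfl⟩ := (proj_eq_iff Γ).mp hx
  obtain ⟨γ', hγ', rfl⟩ := (proj_eq_iff Γ).mp hy
  have h1 : dist (γ x) (γ' y) = dist x ((γ⁻¹ * γ') y) := by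
    rw [← γ.dist_map x]
    congr 1
    exact (γ.apply_symm_apply _).symm
  rw [h1]
  by_cases h : γ⁻¹ * γ' = 1
  · rw [h]
    exact le_rfl
  · have h2 := hd _ (Γ.mul_mem (Γ.inv_mem hγ) hγ') h y
    have h3 := dist_triangle ((γ⁻¹ * γ') y) x y
    rw [dist_comm _ x] at h3
    linarith

/-- A continuous lift of an isometry of `ℝ³ / Γ` does not increase distances. -/
lemma dist_lift_le {f : FlatManifold Γ → FlatManifold Γ}
    (hf : ∀ a b, flatDist Γ (f a) (f b) = flatDist Γ a b) {F : E3 → E3} (hF : Continuous F)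
    (hFf : ∀ x, proj Γ (F x) = f (proj Γ x)) (x y : E3) : dist (F x) (F y) ≤ dist x y := by
  obtain ⟨δ, hδ, hd⟩ := exists_flatDist_proj_eq Γ
  have hflat : ∀ x y, flatDist Γ (proj Γ (F x)) (proj Γ (F y)) =
      flatDist Γ (proj Γ x) (proj Γ y) := fun x y => by rw [hFf, hFf, hf]
  -- at small distances: otherwise an intermediate point would violate `hflat`
  have hlocal : ∀ x y, dist x y < δ → dist (F x) (F y) ≤ dist x y := by
    intro x y hxy
    by_contra! hlt
    set ρ : ℝ → ℝ := fun s => dist (F x) (F (AffineMap.lineMap x y s)) with hρ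
    have hcont : Continuous ρ :=
      continuous_const.dist (hF.comp AffineMap.lineMap_continuous)
    obtain ⟨c, hc1, hc2⟩ := exists_between (lt_min hxy hlt)
    obtain ⟨s, ⟨hs0, hs1⟩, hs⟩ : c ∈ ρ '' Set.Icc 0 1 := by
      refine intermediate_value_Icc zero_le_one hcont.continuousOn ⟨?_, ?_⟩
      · simp only [hρ, AffineMap.lineMap_apply_zero, dist_self]
        exact dist_nonneg.trans hc1.le
      · simp only [hρ, AffineMap.lineMap_apply_one]
        exact (hc2.trans_le (min_le_right _ _)).le
    have h1 : c = flatDist Γ (proj Γ x) (proj Γ (AffineMap.lineMap x y s)) := by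
      rw [← hflat, hd _ _ (hs.trans_le (hc2.trans_le (min_le_left _ _)).le)]
      exact hs.symm
    have h2 : dist x (AffineMap.lineMap x y s) ≤ dist x y := by
      rw [dist_left_lineMap, Real.norm_eq_abs, abs_of_nonneg hs0]
      exact mul_le_of_le_one_left dist_nonneg hs1
    have h3 := flatDist_proj_le (Γ := Γ) x (AffineMap.lineMap x y s)
    linarith
  obtain ⟨n, hn⟩ := exists_nat_gt (dist x y / δ)
  have hn0 : (0 : ℝ) < n := (div_nonneg dist_nonneg hδ.le).trans_lt hn
  set p : ℕ → E3 := fun k => AffineMap.lineMap x y ((k : ℝ) / n) with hp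
  have hstep : ∀ k, dist (p k) (p (k + 1)) = dist x y / n := by
    intro k
    rw [hp, dist_lineMap_lineMap, Real.dist_eq, ← sub_div]
    push_cast
    rw [show (k : ℝ) - (k + 1) = -1 by ring, abs_div, abs_neg, abs_one, abs_of_pos hn0,
      one_div_mul_eq_div]
  have hsum := dist_le_range_sum_dist (fun k => F (p k)) n
  have h0 : p 0 = x := by simp [hp]
  have h1 : p n = y := by simp [hp, div_self hn0.ne']
  rw [h0, h1] at hsum
  refine hsum.trans ?_
  calc ∑ k ∈ Finset.range n, dist (F (p k)) (F (p (k + 1)))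
      ≤ ∑ k ∈ Finset.range n, dist x y / n := Finset.sum_le_sum fun k _ => by
        rw [← hstep k]
        refine hlocal _ _ ?_
        rw [hstep, div_lt_iff₀ hn0, mul_comm, ← div_lt_iff₀ hδ]
        exact hn
    _ = dist x y := by
        rw [Finset.sum_const, Finset.card_range, nsmul_eq_mul, mul_div_cancel₀ _ hn0.ne']

/-- The isometries of `ℝ³ / Γ` are induced by the normalizer of `Γ`. -/
lemma exists_descend_eq {f : Diffeo (FlatManifold Γ)} (hf : f ∈ isometryGroup Γ) :
    ∃ F : normalizerGroup Γ, descend Γ F = f := by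
  obtain ⟨F, hF, hFf⟩ := exists_lift Γ (f.continuous.comp (continuous_proj Γ))
  obtain ⟨G, hG, hGf⟩ := exists_lift Γ (f⁻¹.continuous.comp (continuous_proj Γ))
  simp only [Function.comp_apply] at hFf hGf
  have hff : ∀ p, f⁻¹ (f p) = p := f.symm_apply_apply
  have hff' : ∀ p, f (f⁻¹ p) = p := f.apply_symm_apply
  obtain ⟨γ, hγ, h1⟩ := exists_mem_eq_of_proj_comp Γ (hG.comp hF) continuous_id
    fun x => by rw [Function.comp_apply, hGf, hFf, hff, id]
  obtain ⟨γ', hγ', h2⟩ := exists_mem_eq_of_proj_comp Γ (hF.comp hG) continuous_id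
    fun x => by rw [Function.comp_apply, hFf, hGf, hff', id]
  simp only [Function.comp_apply, id] at h1 h2
  have hiso : Isometry F := by
    refine Isometry.of_dist_eq fun x y => le_antisymm (dist_lift_le hf hF hFf x y) ?_
    have := dist_lift_le ((isometryGroup Γ).inv_mem hf) hG hGf (F x) (F y)
    rwa [h1, h1, γ.dist_map] at this
  have hsurj : Function.Surjective F := fun y =>
    ⟨G (γ'.symm y), by rw [h2, γ'.apply_symm_apply]⟩
  set F' : E3 ≃ᵃⁱ[ℝ] E3 := (IsometryEquiv.mk (Equiv.ofBijective F ⟨hiso.injective, hsurj⟩)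
    hiso).toRealAffineIsometryEquiv with hF'
  have hFF' : ∀ x, F' x = F x := fun x => by
    rw [hF', IsometryEquiv.coeFn_toRealAffineIsometryEquiv]
    rfl
  have hFp : ∀ x, proj Γ (F' x) = f (proj Γ x) := fun x => by rw [hFF', hFf]
  have hFp' : ∀ x, proj Γ (F'⁻¹ x) = f⁻¹ (proj Γ x) := fun x => by
    have h3 : F' (F'⁻¹ x) = x := F'.apply_symm_apply x
    conv_rhs => rw [← h3, hFp, hff]
  have hconj : ∀ (H H' : E3 ≃ᵃⁱ[ℝ] E3) (h : FlatManifold Γ → FlatManifold Γ), H * H' = 1 →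
      (∀ x, proj Γ (H x) = h (proj Γ x)) → ∀ α ∈ Γ, H * α * H' ∈ Γ := by
    intro H H' h hHH' hp α hα
    obtain ⟨β, hβ, h3⟩ := exists_mem_eq_of_proj_comp Γ (F := H * α) (G := H)
      (H * α).continuous H.continuous fun x => by
        rw [AffineIsometryEquiv.coe_mul, Function.comp_apply, hp, hp, proj_apply_of_mem hα]
    have h4 : H * α = β * H := AffineIsometryEquiv.ext h3
    rw [h4, mul_assoc, hHH', mul_one]
    exact hβ
  refine ⟨⟨F', mem_normalizerGroup (hconj F' F'⁻¹ f (mul_inv_cancel _) hFp)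
    (hconj F'⁻¹ F' ⇑(f⁻¹) (inv_mul_cancel _) hFp')⟩, Diffeomorph.ext fun p => ?_⟩
  obtain ⟨x, rfl⟩ := proj_surjective Γ p
  rw [descend_proj, hFp]

lemma descend_mem_isometryGroup (F : normalizerGroup Γ) : descend Γ F ∈ isometryGroup Γ := by
  have hle : ∀ (F : normalizerGroup Γ) a b,
      flatDist Γ (descend Γ F a) (descend Γ F b) ≤ flatDist Γ a b := by
    intro F a b
    obtain ⟨x, rfl⟩ := proj_surjective Γ a
    obtain ⟨y, rfl⟩ := proj_surjective Γ b
    refine le_csInf ⟨_, x, y, rfl, rfl, rfl⟩ ?_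
    rintro _ ⟨x', y', hx, hy, rfl⟩
    rw [← hx, ← hy, descend_proj, descend_proj, ← F.1.dist_map x' y']
    exact flatDist_proj_le _ _
  intro a b
  refine le_antisymm (hle F a b) ?_
  have h := hle F⁻¹ (descend Γ F a) (descend Γ F b)
  have h1 : ∀ p, descend Γ F⁻¹ (descend Γ F p) = p := fun p => by
    rw [map_inv]
    exact (descend Γ F).symm_apply_apply p
  rwa [h1, h1] at h

/-- The elements of the normalizer of `Γ` that induce orientation-preserving isometries. -/
def positiveNormalizer (Γ : Subgroup (E3 ≃ᵃⁱ[ℝ] E3)) [IsSpaceFormGroup Γ] :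
    Subgroup (normalizerGroup Γ) :=
  (orientationPreservingIsometryGroup Γ).comap (descend Γ)

lemma mem_positiveNormalizer (hdet : ∀ γ ∈ Γ, (linPart γ).det = 1) {F : normalizerGroup Γ} :
    F ∈ positiveNormalizer Γ ↔ 0 < (linPart F.1).det := by
  rw [← preservesOrientation_iff hdet (f := descend Γ F) (descend_proj F)]
  exact ⟨fun h => h.2, fun h => ⟨descend_mem_isometryGroup F, h⟩⟩

variable (Γ) in
/-- The action of the positive normalizer by orientation-preserving isometries. -/
def positiveDescend : positiveNormalizer Γ →* orientationPreservingIsometryGroup Γ :=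
  (descend Γ).subgroupComap (orientationPreservingIsometryGroup Γ)

lemma positiveDescend_surjective : Function.Surjective (positiveDescend Γ) := by
  rintro ⟨f, hf⟩
  obtain ⟨F, rfl⟩ := exists_descend_eq hf.1
  exact ⟨⟨F, hf⟩, rfl⟩

lemma positiveDescend_eq_one_iff {F : positiveNormalizer Γ} :
    positiveDescend Γ F = 1 ↔ F.1.1 ∈ Γ := by
  rw [← descend_eq_one_iff, Subtype.ext_iff]
  rfl

end Isometries

/-! ### The normalizer of the Hantzsche–Wendt group -/

lemma perm_add_one_of_sign_one : ∀ σ : Equiv.Perm (Fin 3), Equiv.Perm.sign σ = 1 →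
    ∀ i, σ (i + 1) = σ i + 1 := by decide

lemma perm_add_one_of_sign_neg_one : ∀ σ : Equiv.Perm (Fin 3), Equiv.Perm.sign σ = -1 →
    ∀ i, σ (i + 1) = σ i + 2 := by decide

/-- The translation parts of isometries that normalize the Hantzsche–Wendt group: integral vectors
for a rotation `σ` of the coordinates, vectors with all coordinates in `1/2 + ℤ` for a
transposition. Here `m` is twice the translation part. -/
def HalfParity (σ : Equiv.Perm (Fin 3)) (m : Fin 3 → ℤ) : Prop :=
  ∀ i, m i % 2 = if Equiv.Perm.sign σ = 1 then 0 else 1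

/-- `signedPerm` with a half-integral translation part. -/
def halfPerm (σ : Equiv.Perm (Fin 3)) (ε : Fin 3 → ℤˣ) (m : Fin 3 → ℤ) : E3 ≃ᵃⁱ[ℝ] E3 :=
  signedPerm σ ε fun i => (m i : ℝ) / 2

lemma halfPerm_apply (σ : Equiv.Perm (Fin 3)) (ε : Fin 3 → ℤˣ) (m : Fin 3 → ℤ) (x : E3)
    (i : Fin 3) : halfPerm σ ε m x i = ((ε i : ℤ) : ℝ) * x (σ i) + (m i : ℝ) / 2 :=
  signedPerm_apply _ _ _ _ _

lemma halfPerm_inv (σ : Equiv.Perm (Fin 3)) (ε : Fin 3 → ℤˣ) (m : Fin 3 → ℤ) :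
    (halfPerm σ ε m)⁻¹ =
      halfPerm σ⁻¹ (fun i => ε (σ⁻¹ i)) fun i => -(ε (σ⁻¹ i) : ℤ) * m (σ⁻¹ i) := by
  rw [halfPerm, signedPerm_inv, halfPerm]
  congr 1
  funext i
  push_cast
  ring

lemma units_mul_emod_two (u : ℤˣ) (n : ℤ) : ((u : ℤ) * n) % 2 = n % 2 := by
  rcases Int.units_eq_one_or u with h | h <;> rw [h] <;> push_cast <;> omega

lemma HalfParity.inv {σ : Equiv.Perm (Fin 3)} {m : Fin 3 → ℤ} (h : HalfParity σ m)
    (ε : Fin 3 → ℤˣ) : HalfParity σ⁻¹ fun i => -(ε (σ⁻¹ i) : ℤ) * m (σ⁻¹ i) := by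
  intro i
  rw [Equiv.Perm.sign_inv, ← h (σ⁻¹ i)]
  change -((ε (σ⁻¹ i) : ℤˣ) : ℤ) * m (σ⁻¹ i) % 2 = _
  rw [← Units.val_neg, units_mul_emod_two]

/-- Conjugation by a signed permutation of an isometry that acts on the coordinate `σ k`
separately. -/
lemma signedPerm_conj_apply (σ : Equiv.Perm (Fin 3)) (ε : Fin 3 → ℤˣ) (v : Fin 3 → ℝ)
    {γ : E3 ≃ᵃⁱ[ℝ] E3} {k : Fin 3} {s n : ℝ} (h : ∀ x, γ x (σ k) = s * x (σ k) + n) (y : E3) :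
    (signedPerm σ ε v * γ * (signedPerm σ ε v)⁻¹) y k =
      s * y k + (((ε k : ℤ) : ℝ) * n + (1 - s) * v k) := by
  set F := signedPerm σ ε v
  have h1 : F (F⁻¹ y) = y := F.apply_symm_apply y
  have h2 := congrArg (fun z : E3 => z k) h1
  simp only [F] at h2
  rw [signedPerm_apply] at h2
  rw [AffineIsometryEquiv.coe_mul, AffineIsometryEquiv.coe_mul, Function.comp_apply,
    Function.comp_apply, signedPerm_apply, h, ← h2]
  ring

lemma halfPerm_conj_apply (σ : Equiv.Perm (Fin 3)) (ε : Fin 3 → ℤˣ) (m : Fin 3 → ℤ)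
    {γ : E3 ≃ᵃⁱ[ℝ] E3} {k : Fin 3} {s n : ℝ} (h : ∀ x, γ x (σ k) = s * x (σ k) + n) (y : E3) :
    (halfPerm σ ε m * γ * (halfPerm σ ε m)⁻¹) y k =
      s * y k + (((ε k : ℤ) : ℝ) * n + (1 - s) * (m k / 2)) :=
  signedPerm_conj_apply σ ε _ h y

/-- The conjugate of a screw motion is a screw motion. An odd permutation exchanges the two kinds of
reversed coordinates of a screw motion, those with an odd and those with an even translation part,
which is compensated by the odd vector `m`. -/
lemma halfPerm_conj_mem {σ : Equiv.Perm (Fin 3)} {m : Fin 3 → ℤ} (h : HalfParity σ m)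
    (ε : Fin 3 → ℤˣ) {γ : E3 ≃ᵃⁱ[ℝ] E3} (hγ : γ ∈ hantzscheWendtGroup) :
    halfPerm σ ε m * γ * (halfPerm σ ε m)⁻¹ ∈ hantzscheWendtGroup := by
  rcases hantzscheWendtGroup_cases hγ with ⟨n, hn⟩ | ⟨i, n, hn, k0, k1, k2⟩
  · rw [mem_hantzscheWendtGroup_iff]
    refine ⟨fun _ => 1, fun k => 2 * ((ε k : ℤ) * n (σ k)), fun x k => ?_, Or.inl (by simp)⟩
    rw [halfPerm_conj_apply σ ε m (s := 1) (n := 2 * n (σ k)) fun x => by rw [hn, one_mul]]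
    push_cast
    ring
  · have key : ∀ (i' : Fin 3) (n' : Fin 3 → ℤ), n' i' = (ε i' : ℤ) * n (σ i') + m i' →
        n' (i' + 1) = (ε (i' + 1) : ℤ) * n (σ (i' + 1)) + m (i' + 1) →
        n' (i' + 2) = (ε (i' + 2) : ℤ) * n (σ (i' + 2)) →
        (∀ x, γ x (σ i') = -1 * x (σ i') + n (σ i')) →
        (∀ x, γ x (σ (i' + 1)) = -1 * x (σ (i' + 1)) + n (σ (i' + 1))) →
        (∀ x, γ x (σ (i' + 2)) = 1 * x (σ (i' + 2)) + n (σ (i' + 2))) →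
        (n (σ i') + m i') % 2 = 1 → (n (σ (i' + 1)) + m (i' + 1)) % 2 = 0 →
        n (σ (i' + 2)) % 2 = 1 →
        halfPerm σ ε m * γ * (halfPerm σ ε m)⁻¹ ∈ hantzscheWendtGroup := by
      intro i' n' e0 e1 e2 g0 g1 g2 p0 p1 p2
      refine IsScrew.mem (i := i') (n := n') ⟨fun y => ⟨?_, ?_, ?_⟩, ?_, ?_, ?_⟩
      · rw [halfPerm_conj_apply σ ε m g0, e0]
        push_cast
        ring
      · rw [halfPerm_conj_apply σ ε m g1, e1]
        push_cast
        ring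
      · rw [halfPerm_conj_apply σ ε m g2, e2]
        push_cast
        ring
      · rw [e0, Int.add_emod, units_mul_emod_two, ← Int.add_emod, p0]
      · rw [e1, Int.add_emod, units_mul_emod_two, ← Int.add_emod, p1]
      · rw [e2, units_mul_emod_two, p2]
    have key' : ∀ i' : Fin 3, (∀ x, γ x (σ i') = -1 * x (σ i') + n (σ i')) →
        (∀ x, γ x (σ (i' + 1)) = -1 * x (σ (i' + 1)) + n (σ (i' + 1))) →
        (∀ x, γ x (σ (i' + 2)) = 1 * x (σ (i' + 2)) + n (σ (i' + 2))) →
        (n (σ i') + m i') % 2 = 1 → (n (σ (i' + 1)) + m (i' + 1)) % 2 = 0 →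
        n (σ (i' + 2)) % 2 = 1 →
        halfPerm σ ε m * γ * (halfPerm σ ε m)⁻¹ ∈ hantzscheWendtGroup := fun i' =>
      key i' (fun k => if k = i' + 2 then (ε k : ℤ) * n (σ k) else (ε k : ℤ) * n (σ k) + m k)
        (by simp) (by simp [(fin_three_rotate i').2.2.2.2.2.2]) (by simp)
    have g0 : ∀ x, γ x i = -1 * x i + n i := fun x => by rw [(hn x).1]; ring
    have g1 : ∀ x, γ x (i + 1) = -1 * x (i + 1) + n (i + 1) := fun x => by rw [(hn x).2.1]; ring
    have g2 : ∀ x, γ x (i + 2) = 1 * x (i + 2) + n (i + 2) := fun x => by rw [(hn x).2.2]; ring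
    obtain ⟨r1, r2, r3, r4, -⟩ := fin_three_rotate i
    rcases Int.units_eq_one_or (Equiv.Perm.sign σ) with hs | hs
    · have hm : ∀ k, m k % 2 = 0 := fun k => by rw [h k, if_pos hs]
      have hσ := perm_add_one_of_sign_one σ hs
      obtain ⟨i', hi'⟩ := σ.surjective i
      have s1 : σ (i' + 1) = i + 1 := by rw [hσ, hi']
      have s2 : σ (i' + 2) = i + 2 := by rw [← (fin_three_rotate i').1, hσ, s1, r1]
      have m0 := hm i'
      have m1 := hm (i' + 1)
      apply key' i' <;> simp only [hi', s1, s2] <;> first | assumption | omega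
    · have hm : ∀ k, m k % 2 = 1 := fun k => by
        rw [h k, if_neg (by rw [hs]; decide)]
      have hσ := perm_add_one_of_sign_neg_one σ hs
      obtain ⟨i', hi'⟩ := σ.surjective (i + 1)
      have s1 : σ (i' + 1) = i := by rw [hσ, hi', r2]
      have s2 : σ (i' + 2) = i + 2 := by rw [← (fin_three_rotate i').1, hσ, s1]
      have m0 := hm i'
      have m1 := hm (i' + 1)
      apply key' i' <;> simp only [hi', s1, s2] <;> first | assumption | omega

lemma halfPerm_mem_normalizer {σ : Equiv.Perm (Fin 3)} {m : Fin 3 → ℤ} (h : HalfParity σ m)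
    (ε : Fin 3 → ℤˣ) : halfPerm σ ε m ∈ normalizerGroup hantzscheWendtGroup := by
  refine mem_normalizerGroup (fun γ hγ => halfPerm_conj_mem h ε hγ) fun γ hγ => ?_
  have := halfPerm_conj_mem (h.inv ε) (fun i => ε (σ⁻¹ i)) hγ
  rwa [← halfPerm_inv, inv_inv] at this

/-- An integral vector of length one is, up to sign, a standard basis vector. -/
lemma exists_unit_of_sum_sq {a : Fin 3 → ℤ} (h : ∑ i, a i ^ 2 = 1) :
    ∃ (k : Fin 3) (u : ℤˣ), ∀ i, a i = if i = k then (u : ℤ) else 0 := by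
  obtain ⟨k, hk⟩ : ∃ k, a k ≠ 0 := by
    by_contra! h0
    simp [h0] at h
  have h1 := Finset.add_sum_erase Finset.univ (fun i => a i ^ 2) (Finset.mem_univ k)
  rw [h] at h1
  have h2 : 0 ≤ ∑ i ∈ Finset.univ.erase k, a i ^ 2 := Finset.sum_nonneg fun i _ => sq_nonneg _
  have h3 : 0 < a k ^ 2 := by positivity
  have h4 : a k ^ 2 = 1 := by linarith [show 1 ≤ a k ^ 2 from h3]
  have h5 : ∑ i ∈ Finset.univ.erase k, a i ^ 2 = 0 := by linarith [show 1 ≤ a k ^ 2 from h3]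
  rw [Finset.sum_eq_zero_iff_of_nonneg fun i _ => sq_nonneg _] at h5
  obtain ⟨u, hu⟩ := Int.isUnit_iff.mpr (sq_eq_one_iff.mp h4)
  refine ⟨k, u, fun i => ?_⟩
  split_ifs with hi
  · rw [hi, hu]
  · exact pow_eq_zero_iff two_ne_zero |>.mp (h5 i (Finset.mem_erase.mpr ⟨hi, Finset.mem_univ _⟩))

/-- The parities of the translation part of an element of the Hantzsche–Wendt group that reverses
two coordinates. -/
lemma exists_parity_of_reverses {γ : E3 ≃ᵃⁱ[ℝ] E3} (hγ : γ ∈ hantzscheWendtGroup) {i : Fin 3}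
    {a b : ℝ} (ha : ∀ y, γ y i = -1 * y i + a) (hb : ∀ y, γ y (i + 1) = -1 * y (i + 1) + b) :
    ∃ p q : ℤ, a = p ∧ b = q ∧ p % 2 = 1 ∧ q % 2 = 0 := by
  obtain ⟨s, n, hn, hc⟩ := mem_hantzscheWendtGroup_iff.mp hγ
  have key : ∀ (k : Fin 3) (c : ℝ), (∀ y, γ y k = -1 * y k + c) → s k = -1 ∧ c = n k := by
    intro k c hk
    have h0 := hk 0
    have h1 := hk (WithLp.toLp 2 fun _ => 1)
    rw [hn] at h0 h1
    simp only [PiLp.zero_apply, mul_zero, zero_add, mul_one] at h0 h1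
    refine ⟨?_, h0.symm⟩
    have : (s k : ℝ) = -1 := by linarith
    exact_mod_cast this
  obtain ⟨s0, a0⟩ := key i a ha
  obtain ⟨s1, b0⟩ := key (i + 1) b hb
  refine ⟨n i, n (i + 1), a0, b0, ?_⟩
  clear ha hb a0 b0 key hn
  fin_cases i <;> simp_all

/-- The linear part of an isometry in the normalizer permutes the coordinate axes: the conjugate of
the translation by `2 eⱼ` is a translation by an even vector, so the image of `eⱼ` is an integral
unit vector. -/
lemma linPart_single (F : E3 ≃ᵃⁱ[ℝ] E3) (hF : F ∈ normalizerGroup hantzscheWendtGroup)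
    (j : Fin 3) : ∃ (k : Fin 3) (u : ℤˣ),
      linPart F (EuclideanSpace.single j 1) = EuclideanSpace.single k ((u : ℤ) : ℝ) := by
  set w := linPart F (EuclideanSpace.single j 1) with hw
  have hT := evenTranslation_mem (Pi.single j 1)
  set T := translation fun i => 2 * ((Pi.single j 1 : Fin 3 → ℤ) i : ℝ) with hTdef
  have hTx : ∀ x, T x = (2 : ℝ) • EuclideanSpace.single j 1 + x := fun x => by
    ext i
    rw [hTdef, translation_apply]
    by_cases h : i = j
    · subst h
      simp
    · simp [h]
  have hγ : F * T * F⁻¹ ∈ hantzscheWendtGroup := (Subgroup.mem_normalizer_iff.mp hF T).mp hT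
  have hγy : ∀ y, (F * T * F⁻¹) y = y + (2 : ℝ) • w := fun y => by
    have h1 : F (F⁻¹ y) = y := F.apply_symm_apply y
    rw [AffineIsometryEquiv.coe_mul, AffineIsometryEquiv.coe_mul, Function.comp_apply,
      Function.comp_apply, hTx, apply_eq_linPart, map_add, map_smul, add_assoc,
      ← apply_eq_linPart F, h1, add_comm]
  obtain ⟨a, ha⟩ : ∃ a : Fin 3 → ℤ, ∀ k, w k = a k := by
    rcases hantzscheWendtGroup_cases hγ with ⟨n, hn⟩ | ⟨i, n, hn, -⟩
    · refine ⟨n, fun k => ?_⟩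
      have := hn 0 k
      rw [hγy] at this
      simp only [PiLp.add_apply, PiLp.smul_apply, PiLp.zero_apply, smul_eq_mul] at this
      linarith
    · have h0 := (hn 0).1
      have h1 := (hn (WithLp.toLp 2 fun _ => 1)).1
      rw [hγy] at h0 h1
      simp only [PiLp.add_apply, PiLp.smul_apply, PiLp.zero_apply, smul_eq_mul] at h0 h1
      linarith
  have hnorm : ‖w‖ = 1 := by
    have h1 := F.dist_map (EuclideanSpace.single j 1) 0
    rw [apply_eq_linPart F (EuclideanSpace.single j 1), dist_eq_norm, add_sub_cancel_right,
      dist_zero_right] at h1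
    rw [hw, h1]
    simp
  obtain ⟨k, u, hu⟩ := exists_unit_of_sum_sq (a := a) (by
    have h2 := EuclideanSpace.norm_sq_eq w
    rw [hnorm] at h2
    simp only [ha, Real.norm_eq_abs, sq_abs] at h2
    exact_mod_cast (h2.symm.trans (one_pow 2)))
  refine ⟨k, u, ?_⟩
  ext i
  rw [ha, hu]
  by_cases h : i = k
  · subst h
    simp
  · simp [h]

lemma exists_eq_signedPerm {F : E3 ≃ᵃⁱ[ℝ] E3} (hF : F ∈ normalizerGroup hantzscheWendtGroup) :
    ∃ σ ε, F = signedPerm σ ε fun i => F 0 i := by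
  choose τ u hu using linPart_single F hF
  have hinj : Function.Injective (linPart F) := fun x y h => F.injective (by
    rw [apply_eq_linPart F x, apply_eq_linPart F y, h])
  have hτ : Function.Injective τ := by
    intro j j' h
    by_contra hne
    have h1 : linPart F (((u j : ℤ) : ℝ) • EuclideanSpace.single j 1) =
        linPart F (((u j' : ℤ) : ℝ) • EuclideanSpace.single j' 1) := by
      rw [map_smul, map_smul, hu, hu, h]
      ext i
      by_cases hi : i = τ j'
      · subst hi
        simp [unit_sq]
      · simp [hi]
    have h2 := congrArg (fun z : E3 => z j) (hinj h1)
    simp [hne] at h2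
  set e : Equiv.Perm (Fin 3) := Equiv.ofBijective τ (Finite.injective_iff_bijective.mp hτ) with he
  refine ⟨e.symm, fun i => u (e.symm i), isometry_ext fun x i => ?_⟩
  rw [signedPerm_apply, apply_eq_linPart F x, PiLp.add_apply]
  congr 1
  have hx : x = ∑ j, x j • EuclideanSpace.single j (1 : ℝ) := by
    ext k
    simp [Pi.single_apply]
  conv_lhs => rw [hx, map_sum]
  simp only [map_smul, hu]
  rw [WithLp.ofLp_sum, Finset.sum_apply, Finset.sum_eq_single (e.symm i)]
  · have h1 : τ (e.symm i) = i := e.apply_symm_apply i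
    simp [h1, mul_comm]
  · intro j _ hj
    have h1 : i ≠ τ j := fun h => hj (by rw [h]; exact (e.symm_apply_apply j).symm)
    simp [h1]
  · simp

/-- The isometries that normalize the Hantzsche–Wendt group. The translation part is found by
conjugating the screw motions `diamondScrew`, whose reversed coordinates have translation parts of
known parity. -/
lemma exists_eq_halfPerm {F : E3 ≃ᵃⁱ[ℝ] E3} (hF : F ∈ normalizerGroup hantzscheWendtGroup) :
    ∃ σ ε m, HalfParity σ m ∧ F = halfPerm σ ε m := by
  obtain ⟨σ, ε, h⟩ := exists_eq_signedPerm hF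
  have hc : ∀ γ ∈ hantzscheWendtGroup, signedPerm σ ε (fun i => F 0 i) * γ *
      (signedPerm σ ε fun i => F 0 i)⁻¹ ∈ hantzscheWendtGroup := by
    rw [← h]
    exact fun γ => (Subgroup.mem_normalizer_iff.mp hF γ).mp
  have key : ∀ j, ∃ m : ℤ, (m % 2 = if Equiv.Perm.sign σ = 1 then 0 else 1) ∧
      F 0 j = (m : ℝ) / 2 := by
    intro j
    have hγ := hc _ (diamondScrew_mem (σ j))
    have hd : ∀ x, diamondScrew (σ j) x (σ j) = -1 * x (σ j) + 1 := fun x => by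
      rw [(diamondScrew_apply _ x).1, neg_one_mul]
    have hd' : ∀ x, diamondScrew (σ j) x (σ j + 1) = -1 * x (σ j + 1) + 0 := fun x => by
      rw [(diamondScrew_apply _ x).2.1, neg_one_mul, add_zero]
    have hε : ((ε j : ℤˣ) : ℤ) % 2 = 1 := by
      rcases Int.units_eq_one_or (ε j) with h | h <;> rw [h] <;> decide
    obtain ⟨r1, r2, r3, -⟩ := fin_three_rotate j
    obtain ⟨t1, t2, t3, t4, -⟩ := fin_three_rotate (σ j)
    rcases Int.units_eq_one_or (Equiv.Perm.sign σ) with hs | hs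
    · have s1 : σ (j + 1) = σ j + 1 := perm_add_one_of_sign_one σ hs j
      rw [← s1] at hd'
      obtain ⟨p, q, hp, -, hp2, -⟩ := exists_parity_of_reverses hγ
        (signedPerm_conj_apply σ ε _ hd) (signedPerm_conj_apply σ ε _ hd')
      refine ⟨p - ε j, ?_, ?_⟩
      · rw [if_pos hs]
        omega
      · push_cast
        linarith
    · have s1 : σ (j + 2) = σ j + 1 := by
        have h1 := perm_add_one_of_sign_neg_one σ hs j
        have h2 := perm_add_one_of_sign_neg_one σ hs (j + 1)
        rw [r1, h1, t4] at h2
        exact h2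
      rw [← s1] at hd'
      have hγ' := signedPerm_conj_apply σ ε (fun i => F 0 i) (k := j) hd
      obtain ⟨p, q, -, hq, -, hq2⟩ := exists_parity_of_reverses (i := j + 2) hγ
        (signedPerm_conj_apply σ ε _ hd') (b := ((ε j : ℤ) : ℝ) * 1 + (1 - -1) * F 0 j)
        (by rw [r3]; exact hγ')
      refine ⟨q - ε j, ?_, ?_⟩
      · rw [if_neg (by rw [hs]; decide)]
        omega
      · push_cast
        linarith
  choose m hm hm' using key
  refine ⟨σ, ε, m, hm, ?_⟩
  rw [halfPerm]
  simpa only [← hm'] using h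

/-! ### The action of the normalizer on the summands of the gyroid function -/

/-- Twice the `i`-th summand of the gyroid function. -/
def gyroidTerm (i : Fin 3) (x : E3) : ℝ :=
  2 * (Real.sin (Real.pi * x i) * Real.cos (Real.pi * x (i + 1)))

lemma two_mul_gyroid (x : E3) : 2 * gyroid x = ∑ i, gyroidTerm i x := by
  rw [Fin.sum_univ_three]
  change 2 * gyroid x = 2 * (Real.sin (Real.pi * x 0) * Real.cos (Real.pi * x 1)) +
    2 * (Real.sin (Real.pi * x 1) * Real.cos (Real.pi * x 2)) +
    2 * (Real.sin (Real.pi * x 2) * Real.cos (Real.pi * x 0))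
  unfold gyroid
  ring

lemma gyroidTerm_invariant {γ : E3 ≃ᵃⁱ[ℝ] E3} (hγ : γ ∈ hantzscheWendtGroup) (j : Fin 3)
    (x : E3) : gyroidTerm j (γ x) = gyroidTerm j x := by
  rcases hantzscheWendtGroup_cases hγ with ⟨n, hn⟩ | ⟨i, n, hn, k0, k1, k2⟩
  · have h : ∀ j, Real.pi * (x j + 2 * n j) = Real.pi * x j + n j * (2 * Real.pi) := fun j => by
      ring
    simp only [gyroidTerm, hn, h, Real.cos_add_int_mul_two_pi, Real.sin_add_int_mul_two_pi]
  · obtain ⟨h0, h1, h2⟩ := hn x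
    obtain ⟨r1, r2, r3, r4, -⟩ := fin_three_rotate i
    revert j
    refine (forall_rotate_iff i).mpr ⟨?_, ?_, ?_⟩ <;>
    simp only [gyroidTerm, r1, r3, h0, h1, h2, cos_pi_add_intCast, sin_pi_add_intCast,
      Odd.neg_one_zpow (Int.odd_iff.mpr k0), Even.neg_one_zpow (Int.even_iff.mpr k1),
      Odd.neg_one_zpow (Int.odd_iff.mpr k2), mul_neg, Real.cos_neg, Real.sin_neg] <;>
    ring

/-- The sign by which a translation by the integral part of `m / 2` changes the values of
`cos (π t)` and `sin (π t)`. -/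
def halfSign (m : ℤ) : ℤˣ := (m / 2).negOnePow

lemma cos_half_even (u : ℤˣ) (y : ℝ) {m : ℤ} (h : m % 2 = 0) :
    Real.cos (Real.pi * (((u : ℤ) : ℝ) * y + m / 2)) =
      ((halfSign m : ℤ) : ℝ) * Real.cos (Real.pi * y) := by
  have hm : (m : ℝ) / 2 = ((m / 2 : ℤ) : ℝ) := by
    have : m = 2 * (m / 2) := by omega
    rw [div_eq_iff two_ne_zero, mul_comm]
    exact_mod_cast this
  rw [hm, cos_pi_add_intCast, halfSign, Int.cast_negOnePow]
  rcases Int.units_eq_one_or u with rfl | rfl <;> simp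

lemma sin_half_even (u : ℤˣ) (y : ℝ) {m : ℤ} (h : m % 2 = 0) :
    Real.sin (Real.pi * (((u : ℤ) : ℝ) * y + m / 2)) =
      ((u : ℤ) : ℝ) * ((halfSign m : ℤ) : ℝ) * Real.sin (Real.pi * y) := by
  have hm : (m : ℝ) / 2 = ((m / 2 : ℤ) : ℝ) := by
    have : m = 2 * (m / 2) := by omega
    rw [div_eq_iff two_ne_zero, mul_comm]
    exact_mod_cast this
  rw [hm, sin_pi_add_intCast, halfSign, Int.cast_negOnePow]
  rcases Int.units_eq_one_or u with rfl | rfl <;> simp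

lemma half_odd_eq (u : ℤˣ) (y : ℝ) {m : ℤ} (h : m % 2 = 1) :
    Real.pi * (((u : ℤ) : ℝ) * y + m / 2) =
      Real.pi * (((u : ℤ) : ℝ) * y + ((m - 1 : ℤ) : ℝ) / 2) + Real.pi / 2 ∧
      (m - 1) % 2 = 0 ∧ halfSign (m - 1) = halfSign m := by
  refine ⟨?_, by omega, ?_⟩
  · push_cast
    ring
  · unfold halfSign
    congr 1
    omega

lemma cos_half_odd (u : ℤˣ) (y : ℝ) {m : ℤ} (h : m % 2 = 1) :
    Real.cos (Real.pi * (((u : ℤ) : ℝ) * y + m / 2)) =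
      -(((u : ℤ) : ℝ) * ((halfSign m : ℤ) : ℝ) * Real.sin (Real.pi * y)) := by
  obtain ⟨h1, h2, h3⟩ := half_odd_eq u y h
  rw [h1, Real.cos_add_pi_div_two, sin_half_even u y h2, h3]

lemma sin_half_odd (u : ℤˣ) (y : ℝ) {m : ℤ} (h : m % 2 = 1) :
    Real.sin (Real.pi * (((u : ℤ) : ℝ) * y + m / 2)) =
      ((halfSign m : ℤ) : ℝ) * Real.cos (Real.pi * y) := by
  obtain ⟨h1, h2, h3⟩ := half_odd_eq u y h
  rw [h1, Real.sin_add_pi_div_two, cos_half_even u y h2, h3]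

/-- The permutation of the summands of the gyroid function by an isometry with permutation part
`σ`. A transposition exchanges sines and cosines, which shifts the index. -/
def termPerm (σ : Equiv.Perm (Fin 3)) : Equiv.Perm (Fin 3) :=
  if Equiv.Perm.sign σ = 1 then σ else σ * Equiv.addRight 1

/-- The signs of the summands of the gyroid function under `halfPerm σ ε m`. -/
def termSign (σ : Equiv.Perm (Fin 3)) (ε : Fin 3 → ℤˣ) (m : Fin 3 → ℤ) (i : Fin 3) : ℤˣ :=
  (if Equiv.Perm.sign σ = 1 then ε i else -ε (i + 1)) *
    (halfSign (m i) * halfSign (m (i + 1)))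

lemma gyroidTerm_halfPerm {σ : Equiv.Perm (Fin 3)} {m : Fin 3 → ℤ} (h : HalfParity σ m)
    (ε : Fin 3 → ℤˣ) (i : Fin 3) (x : E3) :
    gyroidTerm i (halfPerm σ ε m x) =
      ((termSign σ ε m i : ℤ) : ℝ) * gyroidTerm (termPerm σ i) x := by
  rw [gyroidTerm, halfPerm_apply, halfPerm_apply, gyroidTerm, termSign, termPerm]
  rcases Int.units_eq_one_or (Equiv.Perm.sign σ) with hs | hs
  · have hm : ∀ k, m k % 2 = 0 := fun k => by rw [h k, if_pos hs]
    rw [if_pos hs, if_pos hs, sin_half_even _ _ (hm i), cos_half_even _ _ (hm _),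
      perm_add_one_of_sign_one σ hs]
    push_cast
    ring
  · have hs' : Equiv.Perm.sign σ ≠ 1 := by rw [hs]; decide
    have hm : ∀ k, m k % 2 = 1 := fun k => by rw [h k, if_neg hs']
    have h1 : (σ * Equiv.addRight 1 : Equiv.Perm (Fin 3)) i = σ (i + 1) := rfl
    have h2 : σ (i + 1) + 1 = σ i := by
      rw [perm_add_one_of_sign_neg_one σ hs, (fin_three_rotate _).2.2.1]
    rw [if_neg hs', if_neg hs', sin_half_odd _ _ (hm i), cos_half_odd _ _ (hm _), h1, h2]
    push_cast
    ring

lemma prod_termSign {σ : Equiv.Perm (Fin 3)} {ε : Fin 3 → ℤˣ}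
    (hσ : Equiv.Perm.sign σ * ∏ i, ε i = 1) (m : Fin 3 → ℤ) : ∏ i, termSign σ ε m i = 1 := by
  have hrot : ∀ f : Fin 3 → ℤˣ, ∏ i, f (i + 1) = ∏ i, f i := fun f =>
    Equiv.prod_comp (Equiv.addRight (1 : Fin 3)) f
  unfold termSign
  rw [Finset.prod_mul_distrib, Finset.prod_mul_distrib, hrot (fun i => halfSign (m i)),
    Int.units_mul_self, mul_one]
  rcases Int.units_eq_one_or (Equiv.Perm.sign σ) with hs | hs
  · simp only [hs, if_true]
    rwa [hs, one_mul] at hσ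
  · have hs' : Equiv.Perm.sign σ ≠ 1 := by rw [hs]; decide
    simp only [if_neg hs']
    rw [hrot fun i => -ε i]
    rw [hs] at hσ
    rw [← hσ, Fin.prod_univ_three, Fin.prod_univ_three]
    simp

/-- Half-integral isometries preserving the orientation preserve `schwarzD` up to sign; for odd `m`
the products of the sines and of the cosines are exchanged. -/
lemma schwarzD_halfPerm {σ : Equiv.Perm (Fin 3)} {m : Fin 3 → ℤ} (h : HalfParity σ m)
    {ε : Fin 3 → ℤˣ} (hσ : Equiv.Perm.sign σ * ∏ i, ε i = 1) (x : E3) :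
    schwarzD (halfPerm σ ε m x) = ((∏ i, halfSign (m i) : ℤˣ) : ℤ) * schwarzD x := by
  have hprod : ∀ f : ℝ → ℝ,
      f (x (σ 0)) * f (x (σ 1)) * f (x (σ 2)) = f (x 0) * f (x 1) * f (x 2) := fun f => by
      have := Equiv.prod_comp σ fun i => f (x i)
      rwa [Fin.prod_univ_three, Fin.prod_univ_three] at this
  have hc := hprod fun t => Real.cos (Real.pi * t)
  have hs := hprod fun t => Real.sin (Real.pi * t)
  simp only at hc hs
  have hε : ((Equiv.Perm.sign σ : ℤ) : ℝ) * (((ε 0 : ℤ) : ℝ) * ((ε 1 : ℤ) : ℝ) * ((ε 2 : ℤ) : ℝ))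
      = 1 := by
    rw [Fin.prod_univ_three] at hσ
    have h := congrArg (fun u : ℤˣ => ((u : ℤ) : ℝ)) hσ
    push_cast at h
    exact h
  unfold schwarzD
  simp only [halfPerm_apply, Fin.prod_univ_three, Units.val_mul, Int.cast_mul]
  rw [← hc, ← hs]
  rcases Int.units_eq_one_or (Equiv.Perm.sign σ) with h1 | h1
  · have hm : ∀ k, m k % 2 = 0 := fun k => by rw [h k, if_pos h1]
    rw [h1] at hε
    push_cast at hε
    simp only [sin_half_even _ _ (hm _), cos_half_even _ _ (hm _)]
    linear_combination (((halfSign (m 0) : ℤ) : ℝ) * ((halfSign (m 1) : ℤ) : ℝ) *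
      ((halfSign (m 2) : ℤ) : ℝ) * (Real.sin (Real.pi * x (σ 0)) * Real.sin (Real.pi * x (σ 1)) *
      Real.sin (Real.pi * x (σ 2)))) * hε
  · have hm : ∀ k, m k % 2 = 1 := fun k => by
      rw [h k, if_neg (by rw [h1]; decide)]
    rw [h1] at hε
    push_cast at hε
    simp only [sin_half_odd _ _ (hm _), cos_half_odd _ _ (hm _)]
    linear_combination (((halfSign (m 0) : ℤ) : ℝ) * ((halfSign (m 1) : ℤ) : ℝ) *
      ((halfSign (m 2) : ℤ) : ℝ) * (Real.sin (Real.pi * x (σ 0)) * Real.sin (Real.pi * x (σ 1)) *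
      Real.sin (Real.pi * x (σ 2)))) * hε

/-! ### Sign patterns -/

/-- The triples of signs with product `1`. -/
abbrev SignPattern : Type := {s : Fin 3 → ℤˣ // ∏ i, s i = 1}

/-- The permutation of the sign patterns that permutes the entries by `ρ` and then multiplies them
by the pattern `δ`. -/
def patternPerm (ρ : Equiv.Perm (Fin 3)) (δ : SignPattern) : Equiv.Perm SignPattern where
  toFun s := ⟨fun i => δ.1 i * s.1 (ρ i), by
    rw [Finset.prod_mul_distrib, δ.2, Equiv.prod_comp ρ, s.2, mul_one]⟩
  invFun s := ⟨fun i => δ.1 (ρ⁻¹ i) * s.1 (ρ⁻¹ i), by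
    rw [Finset.prod_mul_distrib, Equiv.prod_comp ρ⁻¹, Equiv.prod_comp ρ⁻¹, δ.2, s.2, mul_one]⟩
  left_inv s := Subtype.ext (funext fun i => by
    have h : ρ (ρ⁻¹ i) = i := ρ.apply_symm_apply i
    simp only [h, ← mul_assoc, Int.units_mul_self, one_mul])
  right_inv s := Subtype.ext (funext fun i => by
    have h : ρ⁻¹ (ρ i) = i := ρ.symm_apply_apply i
    simp only [h, ← mul_assoc, Int.units_mul_self, one_mul])

lemma patternPerm_apply (ρ : Equiv.Perm (Fin 3)) (δ s : SignPattern) (i : Fin 3) :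
    (patternPerm ρ δ s).1 i = δ.1 i * s.1 (ρ i) := rfl

/-- The sign pattern with all entries `1`. -/
def trivialPattern : SignPattern := ⟨fun _ => 1, by simp⟩

lemma exists_pattern_ne : ∀ a b : Fin 3, a ≠ b → ∃ s : SignPattern, s.1 a ≠ s.1 b := by decide

lemma patternPerm_injective {ρ ρ' : Equiv.Perm (Fin 3)} {δ δ' : SignPattern}
    (h : patternPerm ρ δ = patternPerm ρ' δ') : ρ = ρ' ∧ δ = δ' := by
  have h1 : ∀ (s : SignPattern) i, δ.1 i * s.1 (ρ i) = δ'.1 i * s.1 (ρ' i) := fun s i => by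
    rw [← patternPerm_apply, ← patternPerm_apply, h]
  have h2 : δ = δ' := Subtype.ext (funext fun i => by
    simpa [trivialPattern] using h1 trivialPattern i)
  refine ⟨Equiv.ext fun i => ?_, h2⟩
  by_contra hne
  obtain ⟨s, hs⟩ := exists_pattern_ne _ _ hne
  refine hs (mul_left_cancel (a := δ.1 i) ?_)
  rw [h1, h2]

lemma card_signPattern : Fintype.card SignPattern = 4 := by decide

/-- Every permutation of the four sign patterns is of the form `patternPerm ρ δ`. -/
lemma exists_patternPerm_eq (π : Equiv.Perm SignPattern) : ∃ ρ δ, patternPerm ρ δ = π := by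
  have h : Function.Bijective fun p : Equiv.Perm (Fin 3) × SignPattern => patternPerm p.1 p.2 := by
    refine (Fintype.bijective_iff_injective_and_card _).mpr ⟨fun p q hpq => ?_, ?_⟩
    · exact Prod.ext (patternPerm_injective hpq).1 (patternPerm_injective hpq).2
    · rw [Fintype.card_prod, Fintype.card_perm, Fintype.card_perm, card_signPattern]
      rfl
  obtain ⟨p, hp⟩ := h.2 π
  exact ⟨p.1, p.2, hp⟩

lemma patternPerm_mul (ρ ρ' : Equiv.Perm (Fin 3)) :
    patternPerm (ρ' * ρ) trivialPattern =
      patternPerm ρ trivialPattern * patternPerm ρ' trivialPattern := by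
  refine Equiv.ext fun s => Subtype.ext (funext fun i => ?_)
  rw [Equiv.Perm.mul_apply, patternPerm_apply, patternPerm_apply, patternPerm_apply]
  simp [trivialPattern]

/-! ### The orientation-preserving isometries of the Hantzsche–Wendt manifold -/

/-- The isometry `F` permutes by `q.1` the sign patterns that are values of the three summands of
the gyroid function, and multiplies `schwarzD` by `q.2`. -/
def ActsBy (F : E3 ≃ᵃⁱ[ℝ] E3) (q : Equiv.Perm SignPattern × ℤˣ) : Prop :=
  (∀ (s : SignPattern) (x : E3), (∀ i, gyroidTerm i x = ((s.1 i : ℤ) : ℝ)) →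
    ∀ i, gyroidTerm i (F x) = (((q.1 s).1 i : ℤ) : ℝ)) ∧
  ∀ x, schwarzD (F x) = ((q.2 : ℤ) : ℝ) * schwarzD x

/-- A point where the summands of the gyroid function have the given signs. -/
lemma exists_gyroidTerm_eq (s : SignPattern) :
    ∃ x : E3, ∀ i, gyroidTerm i x = ((s.1 i : ℤ) : ℝ) := by
  refine ⟨WithLp.toLp 2 fun i => ((s.1 i : ℤ) : ℝ) * (1 / 4), fun i => ?_⟩
  have hc : ∀ u : ℤˣ, Real.cos (Real.pi * (((u : ℤ) : ℝ) * (1 / 4))) = √2 / 2 := fun u => by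
    rw [← Real.cos_pi_div_four]
    rcases Int.units_eq_one_or u with rfl | rfl
    · congr 1
      push_cast
      ring
    · rw [← Real.cos_neg]
      congr 1
      push_cast
      ring
  have hs : ∀ u : ℤˣ, Real.sin (Real.pi * (((u : ℤ) : ℝ) * (1 / 4))) =
      ((u : ℤ) : ℝ) * (√2 / 2) := fun u => by
    rw [← Real.sin_pi_div_four]
    rcases Int.units_eq_one_or u with rfl | rfl
    · rw [Units.val_one, Int.cast_one, one_mul, one_mul]
      congr 1
      ring
    · rw [Units.val_neg, Units.val_one, Int.cast_neg, Int.cast_one, neg_one_mul, neg_one_mul,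
        ← Real.sin_neg]
      congr 1
      ring
  change 2 * (Real.sin (Real.pi * (((s.1 i : ℤ) : ℝ) * (1 / 4))) *
    Real.cos (Real.pi * (((s.1 (i + 1) : ℤ) : ℝ) * (1 / 4)))) = _
  rw [hc, hs]
  have h2 : √2 * √2 = 2 := Real.mul_self_sqrt zero_le_two
  linear_combination ((s.1 i : ℤ) : ℝ) / 2 * h2

lemma schwarzD_zero : schwarzD 0 = 1 := by simp [schwarzD]

lemma ActsBy.unique {F : E3 ≃ᵃⁱ[ℝ] E3} {q q' : Equiv.Perm SignPattern × ℤˣ} (h : ActsBy F q)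
    (h' : ActsBy F q') : q = q' := by
  refine Prod.ext (Equiv.ext fun s => Subtype.ext (funext fun i => ?_)) ?_
  · obtain ⟨x, hx⟩ := exists_gyroidTerm_eq s
    have h1 := (h.1 s x hx i).symm.trans (h'.1 s x hx i)
    exact Units.ext (by exact_mod_cast h1)
  · have h1 := (h.2 0).symm.trans (h'.2 0)
    rw [schwarzD_zero, mul_one, mul_one] at h1
    exact Units.ext (by exact_mod_cast h1)

lemma ActsBy.mul {F F' : E3 ≃ᵃⁱ[ℝ] E3} {q q' : Equiv.Perm SignPattern × ℤˣ} (h : ActsBy F q)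
    (h' : ActsBy F' q') : ActsBy (F * F') (q * q') := by
  refine ⟨fun s x hx => h.1 _ _ (h'.1 s x hx), fun x => ?_⟩
  rw [AffineIsometryEquiv.coe_mul, Function.comp_apply, h.2, h'.2, Prod.snd_mul]
  push_cast
  ring

lemma actsBy_halfPerm {σ : Equiv.Perm (Fin 3)} {ε : Fin 3 → ℤˣ} {m : Fin 3 → ℤ}
    (h : HalfParity σ m) (hσ : Equiv.Perm.sign σ * ∏ i, ε i = 1) :
    ActsBy (halfPerm σ ε m) (patternPerm (termPerm σ) ⟨termSign σ ε m, prod_termSign hσ m⟩,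
      ∏ i, halfSign (m i)) := by
  refine ⟨fun s x hx i => ?_, schwarzD_halfPerm h hσ⟩
  rw [gyroidTerm_halfPerm h, hx, patternPerm_apply]
  push_cast
  rfl

lemma actsBy_one_of_mem {F : E3 ≃ᵃⁱ[ℝ] E3} (hF : F ∈ hantzscheWendtGroup) : ActsBy F 1 := by
  refine ⟨fun s x hx i => ?_, fun x => ?_⟩
  · rw [gyroidTerm_invariant hF, hx]
    rfl
  · rw [schwarzD_invariant F hF]
    simp

/-- The representation of `F` as a signed permutation of determinant one. -/
lemma exists_eq_halfPerm_of_positive (F : positiveNormalizer hantzscheWendtGroup) :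
    ∃ σ ε m, HalfParity σ m ∧ Equiv.Perm.sign σ * ∏ i, ε i = 1 ∧ F.1.1 = halfPerm σ ε m := by
  obtain ⟨σ, ε, m, hm, h⟩ := exists_eq_halfPerm F.1.2
  refine ⟨σ, ε, m, hm, ?_, h⟩
  have hdet := (mem_positiveNormalizer det_hantzscheWendtGroup).mp F.2
  rw [h, halfPerm, det_linPart_signedPerm] at hdet
  rcases Int.units_eq_one_or (Equiv.Perm.sign σ * ∏ i, ε i) with h1 | h1
  · exact h1
  · rw [h1] at hdet
    norm_num at hdet

lemma exists_positive_eq_halfPerm {σ : Equiv.Perm (Fin 3)} {ε : Fin 3 → ℤˣ} {m : Fin 3 → ℤ}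
    (h : HalfParity σ m) (hσ : Equiv.Perm.sign σ * ∏ i, ε i = 1) :
    ∃ F : positiveNormalizer hantzscheWendtGroup, F.1.1 = halfPerm σ ε m := by
  refine ⟨⟨⟨halfPerm σ ε m, halfPerm_mem_normalizer h ε⟩,
    (mem_positiveNormalizer det_hantzscheWendtGroup).mpr ?_⟩, rfl⟩
  change 0 < (linPart (signedPerm σ ε _)).det
  rw [det_linPart_signedPerm, hσ]
  norm_num

lemma exists_actsBy (F : positiveNormalizer hantzscheWendtGroup) : ∃ q, ActsBy F.1.1 q := by
  obtain ⟨σ, ε, m, hm, hσ, h⟩ := exists_eq_halfPerm_of_positive F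
  exact ⟨_, h ▸ actsBy_halfPerm hm hσ⟩

/-- The action of the positive normalizer on the sign patterns, together with the sign by which
`schwarzD` changes. -/
def normalizerAction :
    positiveNormalizer hantzscheWendtGroup →* Equiv.Perm SignPattern × ℤˣ :=
  MonoidHom.mk' (fun F => (exists_actsBy F).choose) fun F F' =>
    (exists_actsBy (F * F')).choose_spec.unique
      ((exists_actsBy F).choose_spec.mul (exists_actsBy F').choose_spec)

lemma normalizerAction_spec (F : positiveNormalizer hantzscheWendtGroup) :
    ActsBy F.1.1 (normalizerAction F) := (exists_actsBy F).choose_spec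

lemma halfSign_eq_one_iff {m : ℤ} (h : m % 2 = 0) : halfSign m = 1 ↔ m % 4 = 0 := by
  rw [halfSign, Int.negOnePow_eq_one_iff, Int.even_iff]
  omega

lemma halfSign_eq_neg_one_iff {m : ℤ} (h : m % 2 = 0) : halfSign m = -1 ↔ m % 4 = 2 := by
  rw [halfSign, Int.negOnePow_eq_neg_one_iff, Int.odd_iff]
  omega

/-- The kernel of the action is the Hantzsche–Wendt group. -/
lemma normalizerAction_eq_one_iff {F : positiveNormalizer hantzscheWendtGroup} :
    normalizerAction F = 1 ↔ F.1.1 ∈ hantzscheWendtGroup := by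
  refine ⟨fun h => ?_, fun h => (normalizerAction_spec F).unique (actsBy_one_of_mem h)⟩
  obtain ⟨σ, ε, m, hm, hσ, hF⟩ := exists_eq_halfPerm_of_positive F
  have hq := (hF ▸ normalizerAction_spec F).unique (actsBy_halfPerm hm hσ)
  rw [h] at hq
  have hone : (1 : Equiv.Perm SignPattern) = patternPerm 1 trivialPattern :=
    Equiv.ext fun s => Subtype.ext (funext fun i => by
      rw [patternPerm_apply]
      simp [trivialPattern])
  obtain ⟨h1, h2⟩ := patternPerm_injective (hone.symm.trans (congrArg Prod.fst hq))
  have h3 : 1 = ∏ i, halfSign (m i) := congrArg Prod.snd hq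
  have hs : Equiv.Perm.sign σ = 1 := by
    by_contra hs
    rw [termPerm, if_neg hs] at h1
    revert hs h1
    clear * -
    revert σ
    decide
  have hσ1 : σ = 1 := by
    rw [termPerm, if_pos hs] at h1
    exact h1.symm
  subst hσ1
  have hε : ∀ i, ε i = halfSign (m i) * halfSign (m (i + 1)) := by
    intro i
    have h4 : 1 = termSign 1 ε m i := congrFun (congrArg Subtype.val h2) i
    rw [termSign, if_pos hs] at h4
    exact eq_inv_of_mul_eq_one_left h4.symm |>.trans (Int.units_inv_eq_self _)
  have hm2 : ∀ k, m k % 2 = 0 := fun k => by rw [hm k, if_pos hs]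
  rw [hF, mem_hantzscheWendtGroup_iff]
  refine ⟨fun i => ε i, fun i => m i / 2, fun x i => ?_, ?_⟩
  · have : (m i : ℝ) / 2 = ((m i / 2 : ℤ) : ℝ) := by
      have : m i = 2 * (m i / 2) := by have := hm2 i; omega
      rw [div_eq_iff two_ne_zero, mul_comm]
      exact_mod_cast this
    rw [halfPerm_apply, this, Equiv.Perm.one_apply]
  · have m0 := hm2 0
    have m1 := hm2 1
    have m2 := hm2 2
    have e0 : ε 0 = halfSign (m 0) * halfSign (m 1) := hε 0
    have e1 : ε 1 = halfSign (m 1) * halfSign (m 2) := hε 1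
    have e2 : ε 2 = halfSign (m 2) * halfSign (m 0) := hε 2
    rw [Fin.prod_univ_three] at h3
    rcases Int.units_eq_one_or (halfSign (m 0)) with k0 | k0 <;>
    rcases Int.units_eq_one_or (halfSign (m 1)) with k1 | k1 <;>
    rcases Int.units_eq_one_or (halfSign (m 2)) with k2 | k2 <;>
    rw [k0, k1, k2] at h3 <;> (try exact absurd h3 (by decide)) <;>
    rw [k0, k1] at e0 <;> rw [k1, k2] at e1 <;> rw [k2, k0] at e2 <;>
    simp only [halfSign_eq_one_iff, halfSign_eq_neg_one_iff, m0, m1, m2] at k0 k1 k2 <;>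
    simp only [e0, e1, e2] <;> norm_num <;> omega

/-- Preimages are found among the half-integral isometries with constant `m`: `m = 0, 2` for even
and `m = 1, 3` for odd permutations of the terms. -/
lemma normalizerAction_surjective : Function.Surjective normalizerAction := by
  rintro ⟨π, u⟩
  obtain ⟨ρ, δ, rfl⟩ := exists_patternPerm_eq π
  have of_halfPerm : ∀ {σ : Equiv.Perm (Fin 3)} {ε : Fin 3 → ℤˣ} {k : ℤ}
      (_ : HalfParity σ fun _ => k) (_ : Equiv.Perm.sign σ * ∏ i, ε i = 1) (_ : termPerm σ = ρ)
      (_ : ∀ i, termSign σ ε (fun _ => k) i = δ.1 i) (_ : halfSign k = u),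
      ∃ F, normalizerAction F = (patternPerm ρ δ, u) := by
    intro σ ε k hm hσ h1 h2 h3
    obtain ⟨F, hF⟩ := exists_positive_eq_halfPerm hm hσ
    refine ⟨F, (hF ▸ normalizerAction_spec F).unique ?_⟩
    have h4 := actsBy_halfPerm hm hσ
    rwa [h1, show (⟨termSign σ ε fun _ => k, prod_termSign hσ _⟩ : SignPattern) = δ from
      Subtype.ext (funext h2), Fin.prod_univ_three, h3, Int.units_mul_self, one_mul] at h4
  have hδ := δ.2
  have hrot : ∀ i : Fin 3, i + 1 + 2 = i := fun i => (fin_three_rotate i).2.1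
  rcases Int.units_eq_one_or (Equiv.Perm.sign ρ) with hs | hs
  · have hsgn : ∀ k i, termSign ρ δ.1 (fun _ => k) i = δ.1 i := fun k i => by
      rw [termSign, if_pos hs, Int.units_mul_self, mul_one]
    have hp : termPerm ρ = ρ := if_pos hs
    have hσ : Equiv.Perm.sign ρ * ∏ i, δ.1 i = 1 := by rw [hs, hδ, one_mul]
    rcases Int.units_eq_one_or u with rfl | rfl
    · exact of_halfPerm (k := 0) (fun i => by rw [if_pos hs]; rfl) hσ hp (hsgn 0) (by decide)
    · exact of_halfPerm (k := 2) (fun i => by rw [if_pos hs]; rfl) hσ hp (hsgn 2) (by decide)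
  · set σ : Equiv.Perm (Fin 3) := ρ * Equiv.addRight 2 with hσdef
    have hσs : Equiv.Perm.sign σ = -1 := by
      rw [hσdef, map_mul, hs]
      decide
    have hσ1 : Equiv.Perm.sign σ ≠ 1 := by rw [hσs]; decide
    have hp : termPerm σ = ρ := by
      rw [termPerm, if_neg hσ1, hσdef, mul_assoc]
      convert mul_one ρ
      decide
    have hsgn : ∀ k i, termSign σ (fun i => -δ.1 (i + 2)) (fun _ => k) i = δ.1 i := fun k i => by
      rw [termSign, if_neg hσ1, Int.units_mul_self, mul_one, hrot, neg_neg]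
    have hσ : Equiv.Perm.sign σ * ∏ i, -δ.1 (i + 2) = 1 := by
      have hr : ∏ i, -δ.1 (i + 2) = ∏ i, -δ.1 i :=
        Equiv.prod_comp (Equiv.addRight (2 : Fin 3)) fun i => -δ.1 i
      have hδ' := hδ
      rw [Fin.prod_univ_three] at hδ'
      rw [hσs, hr, Fin.prod_univ_three]
      simpa using hδ'
    rcases Int.units_eq_one_or u with rfl | rfl
    · exact of_halfPerm (k := 1) (fun i => by rw [if_neg hσ1]; rfl) hσ hp (hsgn 1) (by decide)
    · exact of_halfPerm (k := 3) (fun i => by rw [if_neg hσ1]; rfl) hσ hp (hsgn 3) (by decide)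

/-- Two surjective homomorphisms with the same kernel have isomorphic images. -/
lemma exists_mulEquiv_of_ker_eq {A B C : Type*} [Group A] [Group B] [Group C] {f : A →* B}
    {g : A →* C} (hf : Function.Surjective f) (hg : Function.Surjective g) (h : f.ker = g.ker) :
    ∃ e : B ≃* C, ∀ a, e (f a) = g a := by
  refine ⟨(QuotientGroup.quotientKerEquivOfSurjective f hf).symm.trans
    ((QuotientGroup.quotientMulEquivOfEq h).trans
      (QuotientGroup.quotientKerEquivOfSurjective g hg)), fun a => ?_⟩
  have h1 : (QuotientGroup.quotientKerEquivOfSurjective f hf).symm (f a) = (a : A ⧸ f.ker) := by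
    rw [MulEquiv.symm_apply_eq]
    rfl
  rw [MulEquiv.trans_apply, h1]
  rfl

/-- The orientation-preserving isometries of the Hantzsche–Wendt manifold permute the four sign
patterns; together with the sign by which they change `schwarzD` this is an isomorphism. -/
lemma exists_isometryAction :
    ∃ e : orientationPreservingIsometryGroup hantzscheWendtGroup ≃* Equiv.Perm SignPattern × ℤˣ,
      ∀ F, e (positiveDescend hantzscheWendtGroup F) = normalizerAction F := by
  refine exists_mulEquiv_of_ker_eq positiveDescend_surjective normalizerAction_surjective ?_
  ext F
  rw [MonoidHom.mem_ker, MonoidHom.mem_ker, positiveDescend_eq_one_iff,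
    normalizerAction_eq_one_iff]

lemma nonempty_mulEquiv_perm_prod : Nonempty
    (orientationPreservingIsometryGroup hantzscheWendtGroup ≃*
      Equiv.Perm (Fin 4) × Multiplicative (ZMod 2)) := by
  obtain ⟨e, -⟩ := exists_isometryAction
  have e1 : SignPattern ≃ Fin 4 := Fintype.equivFinOfCardEq card_signPattern
  have : Fact (Nat.Prime 2) := ⟨Nat.prime_two⟩
  have e2 : ℤˣ ≃* Multiplicative (ZMod 2) := mulEquivOfPrimeCardEq (p := 2)
    (by rw [Nat.card_eq_fintype_card]; decide) (by rw [Nat.card_eq_fintype_card]; decide)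
  exact ⟨e.trans (e1.permCongrHom.prodCongr e2)⟩

lemma card_orientationPreservingIsometryGroup :
    Nat.card (orientationPreservingIsometryGroup hantzscheWendtGroup) = 48 := by
  obtain ⟨e⟩ := nonempty_mulEquiv_perm_prod
  rw [Nat.card_congr e.toEquiv, Nat.card_eq_fintype_card, Fintype.card_prod, Fintype.card_perm,
    Fintype.card_fin]
  decide

/-! ### The two types of the Hantzsche–Wendt manifold -/

lemma orientable_hantzscheWendt : Orientable HantzscheWendt :=
  ⟨_, isOrientation_one _ det_hantzscheWendtGroup⟩

theorem isInterchangingType24_hantzscheWendt :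
    IsInterchangingType24 (orientationPreservingIsometryGroup hantzscheWendtGroup) 3 := by
  have hm : HalfParity 1 fun _ => 2 := fun i => by simp
  have hσ : Equiv.Perm.sign (1 : Equiv.Perm (Fin 3)) * ∏ i : Fin 3, (1 : ℤˣ) = 1 := by simp
  obtain ⟨T, hT⟩ := exists_positive_eq_halfPerm hm (ε := fun _ => 1) hσ
  have hneg : ∀ x, schwarzD (T.1.1 x) = -schwarzD x := fun x => by
    rw [hT, schwarzD_halfPerm hm hσ]
    simp [halfSign]
  refine ⟨by norm_num, orientable_hantzscheWendt, ⟨_, _, isHeegaardSplitting_of_function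
    contDiff_schwarzD schwarzD_invariant schwarzD_regular
    (diamondCell.isHandlebody (by norm_num) contDiff_schwarzD.continuous schwarzD_invariant) hneg,
    fun f hf => ?_, ⟨_, T.2, interchanges_descend hneg⟩, fun f hf _ => hf.2⟩,
    card_orientationPreservingIsometryGroup⟩
  obtain ⟨F, hF⟩ := positiveDescend_surjective ⟨f, hf⟩
  have hf' : f = descend hantzscheWendtGroup F.1 := congrArg Subtype.val hF.symm
  have hx := (normalizerAction_spec F).2
  rw [hf']
  rcases Int.units_eq_one_or (normalizerAction F).2 with h | h <;> rw [h] at hx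
  · exact Or.inl (preserves_descend fun x => by simpa using hx x)
  · exact Or.inr (interchanges_descend fun x => by simpa using hx x)

/-- The product of the symmetries of the triangle and the group of order two, as permutations of
the sign patterns by permutations of the entries. -/
def patternHom : Equiv.Perm (Fin 3) × ℤˣ →* Equiv.Perm SignPattern × ℤˣ where
  toFun p := (patternPerm p.1⁻¹ trivialPattern, p.2)
  map_one' := Prod.ext (Equiv.ext fun s => Subtype.ext (funext fun i => by
    simp [patternPerm_apply, trivialPattern])) rfl
  map_mul' p q := by
    rw [Prod.fst_mul, mul_inv_rev, patternPerm_mul]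
    rfl

lemma patternHom_injective : Function.Injective patternHom := by
  intro p q h
  exact Prod.ext (inv_injective (patternPerm_injective (congrArg Prod.fst h)).1)
    (congrArg Prod.snd h :)

/-- The hexagon group as the product of the triangle group and the group of order two. -/
def dihedralFun : DihedralGroup 6 → Equiv.Perm (Fin 3) × ℤˣ
  | .r i => (finRotate 3 ^ i.val, (-1) ^ i.val)
  | .sr i => (Equiv.swap 0 1 * finRotate 3 ^ i.val, (-1) ^ i.val)

lemma dihedralFun_mul : ∀ a b, dihedralFun (a * b) = dihedralFun a * dihedralFun b := by
  decide

lemma dihedralFun_injective : Function.Injective dihedralFun := by decide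

/-- The dihedral group acts by the permutations of the sign patterns that only permute the entries.
Such an isometry permutes the terms of the gyroid function without changing signs, so it preserves
both sides of the gyroid; these are interchanged by `x ↦ -x`, which reverses the orientation. -/
lemma exists_isType12 : ∃ G : Subgroup (Diffeo HantzscheWendt),
    IsType12 G 2 ∧ Nonempty (G ≃* DihedralGroup 6) := by
  obtain ⟨e, he⟩ := exists_isometryAction
  set j : DihedralGroup 6 →* orientationPreservingIsometryGroup hantzscheWendtGroup :=
    e.symm.toMonoidHom.comp (patternHom.comp (MonoidHom.mk' dihedralFun dihedralFun_mul)) with hj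
  set φ := (orientationPreservingIsometryGroup hantzscheWendtGroup).subtype.comp j with hφ
  have hinj : Function.Injective φ := Subtype.val_injective.comp
    (e.symm.injective.comp (patternHom_injective.comp dihedralFun_injective))
  have hm : HalfParity 1 fun _ => 0 := fun i => by simp
  have hN : ∀ x, gyroid (halfPerm 1 (fun _ => -1) (fun _ => 0) x) = -gyroid x := fun x => by
    simp [gyroid, halfPerm_apply]
    ring
  refine ⟨φ.range, ⟨by norm_num, orientable_hantzscheWendt, ?_, ⟨_, _,
    isHeegaardSplitting_of_function (F := ⟨_, halfPerm_mem_normalizer hm _⟩)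
      contDiff_gyroid gyroid_invariant gyroid_regular
      (gyroidCell.isHandlebody (by norm_num) contDiff_gyroid.continuous gyroid_invariant) hN, ?_⟩,
    ?_⟩, ⟨(MonoidHom.ofInjective hinj).symm⟩⟩
  · rintro _ ⟨d, rfl⟩
    exact (j d).2.2
  · rintro _ ⟨d, rfl⟩
    obtain ⟨F, hF⟩ := positiveDescend_surjective (j d)
    have hd : φ d = descend hantzscheWendtGroup F.1 := congrArg Subtype.val hF.symm
    rw [hd]
    have h1 : normalizerAction F = patternHom (dihedralFun d) := by
      rw [← he, hF]
      exact e.apply_symm_apply _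
    obtain ⟨σ, ε, m, hm, hσ, h2⟩ := exists_eq_halfPerm_of_positive F
    have h3 := (h2 ▸ normalizerAction_spec F).unique (actsBy_halfPerm hm hσ)
    rw [h1] at h3
    have h4 := (patternPerm_injective (congrArg Prod.fst h3)).2
    refine preserves_descend fun x => ?_
    have h5 : 2 * gyroid (F.1.1 x) = 2 * gyroid x := by
      rw [two_mul_gyroid, two_mul_gyroid, h2,
        ← Equiv.sum_comp (termPerm σ) fun i => gyroidTerm i x]
      refine Finset.sum_congr rfl fun i _ => ?_
      have h6 : 1 = termSign σ ε m i := congrFun (congrArg Subtype.val h4) i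
      rw [gyroidTerm_halfPerm hm, ← h6]
      simp
    linarith
  · rw [← Nat.card_congr (MonoidHom.ofInjective hinj).toEquiv, DihedralGroup.nat_card]

end

end Heegaard

theorem corollary2p6 :
    -- the 3-torus
    ((∃ G : Subgroup (Heegaard.Diffeo Heegaard.ThreeTorus), Heegaard.IsType48 G 3) ∧
      Heegaard.IsHeegaardGenus Heegaard.ThreeTorus 3) ∧
    -- the Hantzsche-Wendt manifold
    (Heegaard.IsInterchangingType24
        (Heegaard.orientationPreservingIsometryGroup Heegaard.hantzscheWendtGroup) 3 ∧
      Nonempty (Heegaard.orientationPreservingIsometryGroup Heegaard.hantzscheWendtGroup ≃*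
        Equiv.Perm (Fin 4) × Multiplicative (ZMod 2)) ∧
      ∃ G : Subgroup (Heegaard.Diffeo Heegaard.HantzscheWendt),
        Heegaard.IsType12 G 2 ∧ Nonempty (G ≃* DihedralGroup 6)) :=
  ⟨⟨⟨_, Heegaard.isType48_torusGroup⟩, Heegaard.isHeegaardGenus_threeTorus⟩,
    Heegaard.isInterchangingType24_hantzscheWendt, Heegaard.nonempty_mulEquiv_perm_prod,
    Heegaard.exists_isType12⟩
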